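/- **Setting.** Let $\mathbb H$ be the quaternions with units $e_0=1,e_1,e_2,e_3$, $\mathbb S=\{J:\operatorname{Re}J=0,|J|=1\}$, $\mathbb C_J=\mathbb R+J\mathbb R$, and for $\omega\in(0,\pi)$ let $S_\omega=\{s\in\mathbb H\setminus\{0\}:|\operatorname{Arg}s|<\omega\}$. A function $f$ on $S_\theta$ is *left slice hyperholomorphic* ($f\in\mathcal{SH}_L(S_\theta)$) if $f(x+Jy)=a(x,y)+J\,b(x,y)$ for all $J\in\mathbb S$, with $C^1$ functions $a,b$ with values in $\mathbb H$, $a$ even and $b$ odd in $y$, and $a_x=b_y$, $a_y=-b_x$; it is *intrinsic* if $a,b$ can be taken real valued. For $\alpha,\beta\in\mathbb R$, $\Psi_L^{\alpha,\beta}(S_\theta)$ (resp. $\Psi^{\alpha,\beta}(S_\theta)$) is the set of left slice hyperholomorphic (resp. intrinsic) $f$ on $S_\theta$ such that for some $\delta>0$, $C\ge0$: $|f(s)|\le C|s|^{\alpha-1+\delta}$ for $|s|\le1$ and $|f(s)|\le C|s|^{\beta-1-\delta}$ for $|s|\ge1$. $\mathcal F_L(S_\theta)$ is the set of $f\in\mathcal{SH}_L(S_\theta)$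 with $|f(s)|\le C(|s|^k+|s|^{-k})$ on $S_\theta$ for some $k>0$, $C\ge 0$. Let $V$ be a two-sided quaternionic Banach space ($\|qv\|=|q|\|v\|=\|vq\|$). A right linear operator $T$ in $V$ with two-sided linear domain has components $T_i=\frac{e_i}4\big(e_iTe_i-\sum_{j\ne i}e_jTe_j\big)$, so $T=\sum_i e_iT_i$; put $\overline T=T_0-e_1T_1-e_2T_2-e_3T_3$ on $\operatorname{dom}T$ and $|T|^2=\sum_iT_i^2$ on $\{v\in\operatorname{dom}T: T_iv\in\operatorname{dom}T\ \forall i\}$. $T$ is in $\mathcal{KC}(V)$ if it is closed and $T_iT_jv=T_jT_iv$ for all $i,j$ and $v\in\operatorname{dom}|T|^2$. $T$, together with a dense two-sided linear subspace $D\subseteq\operatorname{dom}|T|^2$, is *of type $(\alpha,\beta,\omega)$* if * $T,\overline T\in\mathcal{KC}(V)$; $T_iv\in D$ for all $i$ and all $v\in D$ with $|T|^2v\in\operatorname{dom}T$; and for every $s\in\mathbb H$ the operator $Q_{c,s}(T)=s^2-2sT_0+|T|^2$ with domain $D$ is closed; * every $s\in\mathbb H$ for which $Q_{c,s}(T):D\to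 V$ is not bijective lies in $\overline{S_\omega}$; * for every $\varphi\in(\omega,\pi)$ there is $C_\varphi\ge0$ such that $S_L^{-1}(s,T):=(s-\overline T)Q_{c,s}^{-1}(T)$ satisfies, for $s\in\mathbb H\setminus(S_\varphi\cup\{0\})$, $\|S_L^{-1}(s,T)\|\le C_\varphi|s|^{-\alpha}$ if $|s|\le1$ and $\|S_L^{-1}(s,T)\|\le C_\varphi|s|^{-\beta}$ if $|s|\ge1$. Put $P_2^L(s,T)=2S_L^{-1}(s,T)\big(S_L^{-1}(s,T)+S_L^{-1}(s,\overline T)\big)$ and $F_L(s,T)=-4S_L^{-1}(s,T)Q_{c,s}^{-1}(T)$. For $J\in\mathbb S$, $\varphi\in(\omega,\theta)$, the integral of $K(s)\,ds_J\,g(s)$ along $\partial(S_\varphi\cap\mathbb C_J)$ is $\int_{\mathbb R}K(\gamma(t))\frac{\gamma'(t)}Jg(\gamma(t))\,dt$ with $\gamma(t)=-te^{J\varphi}$ for $t<0$ and $\gamma(t)=te^{-J\varphi}$ for $t>0$. Whenever these integrals converge absolutely in operator norm, define $$g(T)=\tfrac1{2\pi}\!\int S_L^{-1}(s,T)ds_Jg(s),\quad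 \mathcal Dg(T)=\tfrac{-1}{\pi}\!\int Q_{c,s}^{-1}(T)ds_Jg(s),$$ $$\overline{\mathcal D}g(T)=\tfrac1{2\pi}\!\int P_2^L(s,T)ds_Jg(s),\quad \Delta g(T)=\tfrac1{2\pi}\!\int F_L(s,T)ds_Jg(s),$$ and $g(\overline T)$ in the same way with $\overline T$ in place of $T$. These are all *defined* for $g$ (along $(\varphi,J)$) if the integrals for $g(T),g(\overline T),\mathcal Dg(T),\overline{\mathcal D}g(T),\Delta g(T)$ converge absolutely. A *regularizer* of $f\in\mathcal F_L(S_\theta)$ (along $(\varphi,J)$) is an $e\in\Psi^{3\alpha,3\beta}(S_\theta)$ with $ef\in\Psi_L^{3\alpha,3\beta}(S_\theta)$ such that these operators are defined for $e$ and for $ef$ and $e(T)$, $e(\overline T)$ are injective. From a regularizer one forms the (in general unbounded) operators $$f(T):=e(T)^{-1}(ef)(T),\qquad \mathcal Df(T):=\big(e(T)e(\overline T)\big)^{-1}\Big(e(T)\mathcal D(ef)(T)-\mathcal De(T)(ef)(T)\Big),$$ $$\overline{\mathcal D}f(T):=\big(e(T)^2e(\overline T)\big)^{-1}\Big(e(T)e(\overline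 T)\overline{\mathcal D}(ef)(T)-e(\overline T)\overline{\mathcal D}e(T)(ef)(T)+e(T)\mathcal De(T)(ef)(\overline T)-e(\overline T)\mathcal De(T)(ef)(T)\Big),$$ $$\Delta f(T):=\big(e(T)^2e(\overline T)\big)^{-1}\Big(e(T)e(\overline T)\Delta(ef)(T)-e(\overline T)\Delta e(T)(ef)(T)+e(T)\mathcal De(T)\mathcal D(ef)(T)-(\mathcal De(T))^2(ef)(T)\Big).$$ **Theorem.** Let $\alpha\ge\frac13$, $\beta\in(0,\frac13]$, $\omega\in(0,\pi)$, let $T$ (with $D$) be of type $(\alpha,\beta,\omega)$ with $T,\overline T$ injective, and let $\theta\in(\omega,\pi)$ and $f\in\mathcal F_L(S_\theta)$. Then: 1. There is $N\in\mathbb N$ such that for every $n\ge N$ the function $e(s)=s^n(1+s)^{-2n}$ is a regularizer of $f$ along every $(\varphi,J)$, $\varphi\in(\omega,\theta)$, $J\in\mathbb S$; in particular regularizers exist. 2. For every $g\in\Psi_L^{3\alpha,\beta}(S_\theta)$ and every $(\varphi,J)$, all the operators $g(T),g(\overline T),\mathcal Dg(T),\overline{\mathcal D}g(T),\Delta g(T)$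 are defined. 3. None of the four $H^\infty$-functional calculi $f(T)$, $\mathcal Df(T)$, $\overline{\mathcal D}f(T)$, $\Delta f(T)$ depends on the choice of the regularizer: if $e_1$ is a regularizer of $f$ along $(\varphi_1,J_1)$ and $e_2$ one along $(\varphi_2,J_2)$, the resulting operators are equal, including their domains. -/

import Mathlib

open Quaternion MeasureTheory Set

set_option linter.unusedSectionVars false

noncomputable section

namespace QuatCalculus

/-! ### Quaternions, sectors, slice hyperholomorphic functions -/

/-- The units `e₀ = 1, e₁, e₂, e₃`. -/
def unit : Fin 4 → ℍ[ℝ] := ![1, ⟨0, 1, 0, 0⟩, ⟨0, 0, 1, 0⟩, ⟨0, 0, 0, 1⟩]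

/-- The sphere of imaginary units. -/
def imUnits : Set ℍ[ℝ] := {J | J.re = 0 ∧ ‖J‖ = 1}

/-- `|Arg s| ∈ [0, π]`: the argument of `s = x + J y` with `y = |Im s| ≥ 0`. -/
def absArg (s : ℍ[ℝ]) : ℝ := Complex.arg ⟨s.re, ‖s.im‖⟩

/-- The open sector `S_ω`. -/
def sector (ω : ℝ) : Set ℍ[ℝ] := {s | s ≠ 0 ∧ absArg s < ω}

/-- The set of `(x, y) ∈ ℝ²` with `x + 𝕊 y ⊆ U`. -/
def reduced (U : Set ℍ[ℝ]) : Set (ℝ × ℝ) :=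
  {p | ∀ J ∈ imUnits, (p.1 : ℍ[ℝ]) + p.2 • J ∈ U}

/-- `a, b` are the components of a slice hyperholomorphic function on `U`:
continuously differentiable, even respectively odd in `y`, and satisfying
the Cauchy-Riemann equations. -/
structure IsHolomorphicPair (U : Set ℍ[ℝ]) (a b : ℝ × ℝ → ℍ[ℝ]) : Prop where
  contDiff_fst : ContDiffOn ℝ 1 a (reduced U)
  contDiff_snd : ContDiffOn ℝ 1 b (reduced U)
  even : ∀ p ∈ reduced U, a (p.1, -p.2) = a p
  odd : ∀ p ∈ reduced U, b (p.1, -p.2) = -b p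
  cr_fst : ∀ p ∈ reduced U, fderiv ℝ a p (1, 0) = fderiv ℝ b p (0, 1)
  cr_snd : ∀ p ∈ reduced U, fderiv ℝ a p (0, 1) = -fderiv ℝ b p (1, 0)

/-- Left slice hyperholomorphic functions on `U`. -/
def SHL (U : Set ℍ[ℝ]) (f : ℍ[ℝ] → ℍ[ℝ]) : Prop :=
  ∃ a b : ℝ × ℝ → ℍ[ℝ], IsHolomorphicPair U a b ∧
    ∀ p ∈ reduced U, ∀ J ∈ imUnits, f ((p.1 : ℍ[ℝ]) + p.2 • J) = a p + J * b p

/-- Intrinsic functions on `U`: the components are real valued. -/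
def Intrinsic (U : Set ℍ[ℝ]) (f : ℍ[ℝ] → ℍ[ℝ]) : Prop :=
  ∃ a b : ℝ × ℝ → ℍ[ℝ], IsHolomorphicPair U a b ∧
    (∀ p ∈ reduced U, (a p).im = 0 ∧ (b p).im = 0) ∧
    ∀ p ∈ reduced U, ∀ J ∈ imUnits, f ((p.1 : ℍ[ℝ]) + p.2 • J) = a p + J * b p

/-- `r ^ a` for `r ≤ 1` and `r ^ b` for `r ≥ 1`. -/
def twoPow (a b r : ℝ) : ℝ := if r ≤ 1 then r ^ a else r ^ b

/-- The decay condition in the spaces `Ψ^{α,β}`. -/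
def Decays (α β θ : ℝ) (f : ℍ[ℝ] → ℍ[ℝ]) : Prop :=
  ∃ δ > 0, ∃ C ≥ 0, ∀ s ∈ sector θ, ‖f s‖ ≤ C * twoPow (α - 1 + δ) (β - 1 - δ) ‖s‖

/-- The space `Ψ_L^{α,β}(S_θ)`. -/
def PsiL (α β θ : ℝ) (f : ℍ[ℝ] → ℍ[ℝ]) : Prop := SHL (sector θ) f ∧ Decays α β θ f

/-- The space `Ψ^{α,β}(S_θ)`. -/
def Psi (α β θ : ℝ) (f : ℍ[ℝ] → ℍ[ℝ]) : Prop := Intrinsic (sector θ) f ∧ Decays α β θ f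

/-- The space `F_L(S_θ)` of left slice hyperholomorphic functions of polynomial growth. -/
def PolyGrowthL (θ : ℝ) (f : ℍ[ℝ] → ℍ[ℝ]) : Prop :=
  SHL (sector θ) f ∧ ∃ k > (0 : ℝ), ∃ C ≥ 0, ∀ s ∈ sector θ, ‖f s‖ ≤ C * (‖s‖ ^ k + 1 / ‖s‖ ^ k)

section Operators

/- `V` is a two-sided quaternionic Banach space: a bimodule over the real algebra of the
quaternions, with `‖q v‖ = |q| ‖v‖ = ‖v q‖`. Right multiplication is the action of the opposite
ring. -/
variable {V : Type*} [NormedAddCommGroup V] [NormedSpace ℝ V] [CompleteSpace V]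
  [Module ℍ[ℝ] V] [Module ℍ[ℝ]ᵐᵒᵖ V] [SMulCommClass ℍ[ℝ] ℍ[ℝ]ᵐᵒᵖ V]
  [IsScalarTower ℝ ℍ[ℝ] V] [IsScalarTower ℝ ℍ[ℝ]ᵐᵒᵖ V]
  [NormSMulClass ℍ[ℝ] V] [NormSMulClass ℍ[ℝ]ᵐᵒᵖ V]

/-! ### Right linear operators and their components -/

/-- Left multiplication by a quaternion, as a right linear map. -/
def leftMul (q : ℍ[ℝ]) : V →ₗ[ℍ[ℝ]ᵐᵒᵖ] V where
  toFun v := q • v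
  map_add' := smul_add q
  map_smul' r v := smul_comm q r v

/-- Left multiplication by a quaternion, as a bounded operator. -/
def leftMulL (q : ℍ[ℝ]) : V →L[ℝ] V :=
  LinearMap.mkContinuous
    { toFun := fun v => q • v
      map_add' := smul_add q
      map_smul' := fun r v => smul_comm q r v } ‖q‖ (fun v => (norm_smul q v).le)

variable (V) in
/-- A right linear operator in `V` whose domain is a two-sided linear subspace. -/
structure RightOp where
  /-- the operator, linear with respect to right multiplication -/
  toPMap : V →ₗ.[ℍ[ℝ]ᵐᵒᵖ] V
  smul_mem : ∀ (q : ℍ[ℝ]) (v : V), v ∈ toPMap.domain → q • v ∈ toPMap.domain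

namespace RightOp

/-- The domain. -/
def dom (T : RightOp V) : Submodule ℍ[ℝ]ᵐᵒᵖ V := T.toPMap.domain

open Classical in
/-- The value `T v` for `v ∈ dom T` (and `0` for other `v`). -/
def app (T : RightOp V) (v : V) : V :=
  if h : v ∈ T.toPMap.domain then T.toPMap ⟨v, h⟩ else 0

/-- The operator `q T p`, that is `v ↦ q T(p v)`, on `dom T`. -/
def sandwich (T : RightOp V) (q p : ℍ[ℝ]) : T.dom →ₗ[ℍ[ℝ]ᵐᵒᵖ] V :=
  leftMul q ∘ₗ T.toPMap.toFun ∘ₗ (leftMul p).restrict (fun v hv => T.smul_mem p v hv)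

/-- The component `T_i = (e_i / 4) (e_i T e_i - ∑_{j ≠ i} e_j T e_j)`, as a map on `dom T`. -/
def componentMap (T : RightOp V) (i : Fin 4) : T.dom →ₗ[ℍ[ℝ]ᵐᵒᵖ] V :=
  leftMul ((1 / 4 : ℝ) • unit i) ∘ₗ (T.sandwich (unit i) (unit i) -
    ∑ j ∈ Finset.univ.erase i, T.sandwich (unit j) (unit j))

/-- The component `T_i` as an operator, so that `T = T_0 + e_1 T_1 + e_2 T_2 + e_3 T_3` with
two-sided linear `T_i` on `dom T`. -/
def component (T : RightOp V) (i : Fin 4) : RightOp V where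
  toPMap := ⟨T.dom, T.componentMap i⟩
  smul_mem := T.smul_mem

/-- The conjugate operator `T_0 - e_1 T_1 - e_2 T_2 - e_3 T_3` on `dom T`. -/
def conj (T : RightOp V) : RightOp V where
  toPMap := ⟨T.dom, T.componentMap 0 - leftMul (unit 1) ∘ₗ T.componentMap 1
    - leftMul (unit 2) ∘ₗ T.componentMap 2 - leftMul (unit 3) ∘ₗ T.componentMap 3⟩
  smul_mem := T.smul_mem

/-- The domain of `|T|² = T_0² + T_1² + T_2² + T_3²`. -/
def domModSq (T : RightOp V) : Set V :=
  {v | v ∈ T.dom ∧ ∀ i, (T.component i).app v ∈ T.dom}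

/-- The operator `|T|²` on `domModSq T`. -/
def modSq (T : RightOp V) (v : V) : V := ∑ i, (T.component i).app ((T.component i).app v)

/-- Injectivity (on the domain). -/
def Inj (T : RightOp V) : Prop := ∀ v ∈ T.dom, T.app v = 0 → v = 0

/-- Closed operators with commuting components. -/
structure IsKC (T : RightOp V) : Prop where
  closed : IsClosed (T.toPMap.graph : Set (V × V))
  comm : ∀ v ∈ T.domModSq, ∀ i j,
    (T.component i).app ((T.component j).app v) = (T.component j).app ((T.component i).app v)

/-- `Q_{c,s}(T) v = s² v - 2 s T_0 v + |T|² v`; its domain is a subspace `D` of `domModSq T`. -/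
def Q (T : RightOp V) (s : ℍ[ℝ]) (v : V) : V :=
  s ^ 2 • v - (2 * s) • (T.component 0).app v + T.modSq v

/-- The conditions on the domain `D` of the operators `Q_{c,s}(T)`. -/
structure IsAdmissible (T : RightOp V) (D : Submodule ℍ[ℝ]ᵐᵒᵖ V) : Prop where
  smul_mem : ∀ (q : ℍ[ℝ]) (v : V), v ∈ D → q • v ∈ D
  le : (D : Set V) ⊆ T.domModSq
  dense : Dense (D : Set V)
  component_mem : ∀ v ∈ D, T.modSq v ∈ T.dom → ∀ i, (T.component i).app v ∈ D
  closed : ∀ s : ℍ[ℝ], IsClosed {p : V × V | p.1 ∈ D ∧ p.2 = T.Q s p.1}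

/-! ### Spectrum and resolvents -/

/-- The `F`-resolvent set. -/
def resolventSet (T : RightOp V) (D : Submodule ℍ[ℝ]ᵐᵒᵖ V) : Set ℍ[ℝ] :=
  {s | BijOn (T.Q s) D univ}

/-- The `F`-spectrum. -/
def spectrum (T : RightOp V) (D : Submodule ℍ[ℝ]ᵐᵒᵖ V) : Set ℍ[ℝ] := (T.resolventSet D)ᶜ

/-- The inverse `Q_{c,s}^{-1}(T)`, as a function. -/
def QinvFun (T : RightOp V) (D : Submodule ℍ[ℝ]ᵐᵒᵖ V) (s : ℍ[ℝ]) : V → V :=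
  Function.invFunOn (T.Q s) D

open Classical in
/-- A function `V → V` that is a bounded linear operator, regarded as such (otherwise `0`). -/
def toBounded (F : V → V) : V →L[ℝ] V :=
  if h : ∃ A : V →L[ℝ] V, ⇑A = F then h.choose else 0

/-- The bounded operator `Q_{c,s}^{-1}(T)`. -/
def Qinv (T : RightOp V) (D : Submodule ℍ[ℝ]ᵐᵒᵖ V) (s : ℍ[ℝ]) : V →L[ℝ] V :=
  toBounded (T.QinvFun D s)

/-- The left `S`-resolvent `S_L^{-1}(s,T) = s Q_{c,s}^{-1}(T) - conj(T) Q_{c,s}^{-1}(T)`. -/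
def SL (T : RightOp V) (D : Submodule ℍ[ℝ]ᵐᵒᵖ V) (s : ℍ[ℝ]) : V →L[ℝ] V :=
  toBounded (fun v => s • T.QinvFun D s v - T.conj.app (T.QinvFun D s v))

/-- The left `P₂`-resolvent. -/
def P2L (T : RightOp V) (D : Submodule ℍ[ℝ]ᵐᵒᵖ V) (s : ℍ[ℝ]) : V →L[ℝ] V :=
  (2 : ℝ) • (T.SL D s * (T.SL D s + T.conj.SL D s))

/-- The left `F`-resolvent. -/
def FL (T : RightOp V) (D : Submodule ℍ[ℝ]ᵐᵒᵖ V) (s : ℍ[ℝ]) : V →L[ℝ] V :=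
  (-4 : ℝ) • (T.SL D s * T.Qinv D s)

/-! The values of `Qinv` and `SL` are not junk: on the resolvent set the underlying functions are
bounded operators, by the closed graph theorem. -/

theorem app_of_mem (T : RightOp V) {v : V} (h : v ∈ T.dom) : T.app v = T.toPMap ⟨v, h⟩ :=
  dif_pos h

theorem app_add (T : RightOp V) {v w : V} (hv : v ∈ T.dom) (hw : w ∈ T.dom) :
    T.app (v + w) = T.app v + T.app w := by
  rw [app_of_mem T hv, app_of_mem T hw, app_of_mem T (add_mem hv hw), ← LinearPMap.map_add]; rfl

theorem app_smul (T : RightOp V) (r : ℍ[ℝ]ᵐᵒᵖ) {v : V} (hv : v ∈ T.dom) :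
    T.app (r • v) = r • T.app v := by
  rw [app_of_mem T hv, app_of_mem T (T.dom.smul_mem r hv), ← LinearPMap.map_smul]; rfl

theorem modSq_add (T : RightOp V) {v w : V} (hv : v ∈ T.domModSq) (hw : w ∈ T.domModSq) :
    T.modSq (v + w) = T.modSq v + T.modSq w := by
  simp only [modSq, ← Finset.sum_add_distrib]
  refine Finset.sum_congr rfl fun i _ => ?_
  rw [app_add (T.component i) hv.1 hw.1, app_add (T.component i) (hv.2 i) (hw.2 i)]

theorem modSq_smul (T : RightOp V) (r : ℍ[ℝ]ᵐᵒᵖ) {v : V} (hv : v ∈ T.domModSq) :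
    T.modSq (r • v) = r • T.modSq v := by
  simp only [modSq, Finset.smul_sum]
  refine Finset.sum_congr rfl fun i _ => ?_
  rw [app_smul (T.component i) r hv.1, app_smul (T.component i) r (hv.2 i)]

theorem Q_add (T : RightOp V) (s : ℍ[ℝ]) {v w : V} (hv : v ∈ T.domModSq) (hw : w ∈ T.domModSq) :
    T.Q s (v + w) = T.Q s v + T.Q s w := by
  simp only [Q, modSq_add T hv hw, app_add (T.component 0) hv.1 hw.1, smul_add]
  abel

theorem Q_smul (T : RightOp V) (s : ℍ[ℝ]) (r : ℍ[ℝ]ᵐᵒᵖ) {v : V} (hv : v ∈ T.domModSq) :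
    T.Q s (r • v) = r • T.Q s v := by
  simp only [Q, modSq_smul T r hv, app_smul (T.component 0) r hv.1, smul_add, smul_sub,
    smul_comm (_ : ℍ[ℝ]) r]

theorem coe_toBounded {F : V → V} (h : ∃ A : V →L[ℝ] V, ⇑A = F) : ⇑(toBounded F) = F := by
  rw [toBounded, dif_pos h]; exact h.choose_spec

theorem real_smul_eq (r : ℝ) (v : V) : r • v = (r • (1 : ℍ[ℝ]ᵐᵒᵖ)) • v := by
  rw [smul_assoc, one_smul]

section

variable {T : RightOp V} {D : Submodule ℍ[ℝ]ᵐᵒᵖ V} {s : ℍ[ℝ]}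

theorem QinvFun_mem (hs : s ∈ T.resolventSet D) (v : V) : T.QinvFun D s v ∈ D :=
  Function.invFunOn_mem (hs.surjOn (mem_univ v))

theorem Q_QinvFun (hs : s ∈ T.resolventSet D) (v : V) : T.Q s (T.QinvFun D s v) = v :=
  Function.invFunOn_eq (hs.surjOn (mem_univ v))

theorem QinvFun_eq_iff (hs : s ∈ T.resolventSet D) (v w : V) :
    w = T.QinvFun D s v ↔ w ∈ D ∧ v = T.Q s w := by
  constructor
  · rintro rfl
    exact ⟨QinvFun_mem hs v, (Q_QinvFun hs v).symm⟩
  · rintro ⟨hw, h⟩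
    exact hs.injOn hw (QinvFun_mem hs v) (by rw [Q_QinvFun hs, h])

/-- `Q_{c,s}^{-1}(T)` is a bounded operator for `s` in the resolvent set. -/
theorem coe_Qinv (hD : T.IsAdmissible D) (hs : s ∈ T.resolventSet D) :
    ⇑(T.Qinv D s) = T.QinvFun D s := by
  refine coe_toBounded ?_
  let L : V →ₗ[ℝ] V :=
    { toFun := T.QinvFun D s
      map_add' := fun v w => by
        refine ((QinvFun_eq_iff hs _ _).2 ⟨add_mem (QinvFun_mem hs v) (QinvFun_mem hs w), ?_⟩).symm
        rw [Q_add T s (hD.le (QinvFun_mem hs v)) (hD.le (QinvFun_mem hs w)),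
          Q_QinvFun hs, Q_QinvFun hs]
      map_smul' := fun r v => by
        refine ((QinvFun_eq_iff hs _ _).2 ⟨?_, ?_⟩).symm
        · rw [RingHom.id_apply, real_smul_eq]; exact D.smul_mem _ (QinvFun_mem hs v)
        · rw [RingHom.id_apply, real_smul_eq r (T.QinvFun D s v),
            Q_smul T s _ (hD.le (QinvFun_mem hs v)), Q_QinvFun hs, ← real_smul_eq] }
  have hg : IsClosed (L.graph : Set (V × V)) := by
    have := (hD.closed s).preimage continuous_swap
    convert! this using 1
    ext ⟨v, w⟩
    exact QinvFun_eq_iff hs v w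
  exact ⟨ContinuousLinearMap.ofIsClosedGraph hg, rfl⟩

/-- `S_L^{-1}(s,T)` is a bounded operator for `s` in the resolvent set. -/
theorem coe_SL (hT : T.conj.IsKC) (hD : T.IsAdmissible D) (hs : s ∈ T.resolventSet D) :
    ⇑(T.SL D s) = fun v => s • T.QinvFun D s v - T.conj.app (T.QinvFun D s v) := by
  refine coe_toBounded ?_
  have hm : ∀ v, T.QinvFun D s v ∈ T.conj.dom := fun v => (hD.le (QinvFun_mem hs v)).1
  have hQ := coe_Qinv hD hs
  let L : V →ₗ[ℝ] V :=
    { toFun := fun v => T.conj.app (T.Qinv D s v)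
      map_add' := fun v w => by
        rw [map_add, app_add] <;> (rw [hQ]; exact hm _)
      map_smul' := fun r v => by
        rw [map_smul, real_smul_eq, app_smul, ← real_smul_eq, RingHom.id_apply]
        rw [hQ]; exact hm _ }
  have hg : IsClosed (L.graph : Set (V × V)) := by
    have := hT.closed.preimage
      (f := fun p : V × V => (T.Qinv D s p.1, p.2)) (by fun_prop)
    convert! this using 1
    ext ⟨v, w⟩
    have hv : T.Qinv D s v ∈ T.conj.dom := by rw [hQ]; exact hm v
    simp only [SetLike.mem_coe, LinearMap.mem_graph_iff, mem_preimage, LinearPMap.mem_graph_iff]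
    change w = T.conj.app (T.Qinv D s v) ↔ _
    rw [app_of_mem _ hv]
    constructor
    · rintro rfl
      exact ⟨⟨_, hv⟩, rfl, rfl⟩
    · rintro ⟨y, hy, hy'⟩
      rw [← hy']
      congr 1
      exact Subtype.ext hy
  refine ⟨leftMulL s ∘L T.Qinv D s - ContinuousLinearMap.ofIsClosedGraph hg, ?_⟩
  funext v
  change s • T.Qinv D s v - T.conj.app (T.Qinv D s v) = _
  rw [hQ]

end

/-- Operators (together with the domain `D`) of type `(α, β, ω)`. -/
structure IsOfType (T : RightOp V) (D : Submodule ℍ[ℝ]ᵐᵒᵖ V) (α β ω : ℝ) : Prop where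
  isKC : T.IsKC
  conj_isKC : T.conj.IsKC
  admissible : T.IsAdmissible D
  spectrum_subset : T.spectrum D ⊆ closure (sector ω)
  norm_le : ∀ φ ∈ Ioo ω Real.pi, ∃ C ≥ 0, ∀ s ∉ sector φ, s ≠ 0 →
    ‖T.SL D s‖ ≤ C * twoPow (-α) (-β) ‖s‖

end RightOp

/-! ### The functional calculi for decaying functions -/

/-- `e^{J φ} = cos φ + J sin φ`. -/
def expJ (J : ℍ[ℝ]) (φ : ℝ) : ℍ[ℝ] := (Real.cos φ : ℍ[ℝ]) + Real.sin φ • J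

/-- The path along the boundary of `S_φ ∩ ℂ_J`: `-t e^{Jφ}` for `t < 0`, `t e^{-Jφ}` for `t > 0`. -/
def path (φ : ℝ) (J : ℍ[ℝ]) (t : ℝ) : ℍ[ℝ] :=
  if t < 0 then (-t) • expJ J φ else t • expJ J (-φ)

/-- The derivative of `path` (for `t ≠ 0`). -/
def pathDeriv (φ : ℝ) (J : ℍ[ℝ]) (t : ℝ) : ℍ[ℝ] :=
  if t < 0 then -expJ J φ else expJ J (-φ)

/-- The integrand `K(γ(t)) (γ'(t) / J) f(γ(t))`; the product of an operator with a quaternion `q`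
on its right is the operator `v ↦ K (q v)`. -/
def integrand (K : ℍ[ℝ] → V →L[ℝ] V) (φ : ℝ) (J : ℍ[ℝ]) (f : ℍ[ℝ] → ℍ[ℝ]) (t : ℝ) : V →L[ℝ] V :=
  K (path φ J t) * leftMulL (pathDeriv φ J t * J⁻¹ * f (path φ J t))

/-- Absolute convergence of the integral of `K(s) ds_J f(s)` along the boundary of `S_φ ∩ ℂ_J`. -/
def Converges (K : ℍ[ℝ] → V →L[ℝ] V) (φ : ℝ) (J : ℍ[ℝ]) (f : ℍ[ℝ] → ℍ[ℝ]) : Prop :=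
  Integrable (integrand K φ J f) volume

/-- The integral of `K(s) ds_J f(s)` along the boundary of `S_φ ∩ ℂ_J`. -/
def pathIntegral (K : ℍ[ℝ] → V →L[ℝ] V) (φ : ℝ) (J : ℍ[ℝ]) (f : ℍ[ℝ] → ℍ[ℝ]) : V →L[ℝ] V :=
  ∫ t : ℝ, integrand K φ J f t

namespace RightOp

/-- `f(T)`, the `S`-functional calculus. -/
def calcS (T : RightOp V) (D : Submodule ℍ[ℝ]ᵐᵒᵖ V) (φ : ℝ) (J : ℍ[ℝ]) (f : ℍ[ℝ] → ℍ[ℝ]) :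
    V →L[ℝ] V := (1 / (2 * Real.pi)) • pathIntegral (T.SL D) φ J f

/-- `𝒟f(T)`, the `Q`-functional calculus. -/
def calcQ (T : RightOp V) (D : Submodule ℍ[ℝ]ᵐᵒᵖ V) (φ : ℝ) (J : ℍ[ℝ]) (f : ℍ[ℝ] → ℍ[ℝ]) :
    V →L[ℝ] V := (-1 / Real.pi) • pathIntegral (T.Qinv D) φ J f

/-- The `P₂`-functional calculus (of the conjugate Cauchy-Fueter derivative of `f`). -/
def calcP (T : RightOp V) (D : Submodule ℍ[ℝ]ᵐᵒᵖ V) (φ : ℝ) (J : ℍ[ℝ]) (f : ℍ[ℝ] → ℍ[ℝ]) :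
    V →L[ℝ] V := (1 / (2 * Real.pi)) • pathIntegral (T.P2L D) φ J f

/-- `Δf(T)`, the `F`-functional calculus. -/
def calcF (T : RightOp V) (D : Submodule ℍ[ℝ]ᵐᵒᵖ V) (φ : ℝ) (J : ℍ[ℝ]) (f : ℍ[ℝ] → ℍ[ℝ]) :
    V →L[ℝ] V := (1 / (2 * Real.pi)) • pathIntegral (T.FL D) φ J f

/-- The integrals of the four functional calculi of `f` for `T`, and of the `S`-functional calculus
of `f` for the conjugate of `T`, converge absolutely. -/
structure CalcDefined (T : RightOp V) (D : Submodule ℍ[ℝ]ᵐᵒᵖ V) (φ : ℝ) (J : ℍ[ℝ])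
    (f : ℍ[ℝ] → ℍ[ℝ]) : Prop where
  convS : Converges (T.SL D) φ J f
  convS_conj : Converges (T.conj.SL D) φ J f
  convQ : Converges (T.Qinv D) φ J f
  convP : Converges (T.P2L D) φ J f
  convF : Converges (T.FL D) φ J f

end RightOp

/-! ### The `H^∞`-functional calculi -/

/-- The unbounded operator `A⁻¹ B`, for bounded `A`, `B` with `A` injective: its graph consists of
all `(v, w)` with `A w = B v`. -/
def invMul (A B : V →L[ℝ] V) : V →ₗ.[ℝ] V :=
  (LinearMap.ker ((A : V →ₗ[ℝ] V) ∘ₗ LinearMap.snd ℝ V V -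
    (B : V →ₗ[ℝ] V) ∘ₗ LinearMap.fst ℝ V V)).toLinearPMap

namespace RightOp

/-- `e` is a regularizer of `f` (with the integrals taken along the boundary of `S_φ ∩ ℂ_J`). -/
structure IsRegularizer (T : RightOp V) (D : Submodule ℍ[ℝ]ᵐᵒᵖ V) (α β θ φ : ℝ) (J : ℍ[ℝ])
    (f e : ℍ[ℝ] → ℍ[ℝ]) : Prop where
  psi : Psi (3 * α) (3 * β) θ e
  psi_mul : PsiL (3 * α) (3 * β) θ (e * f)
  defined : T.CalcDefined D φ J e
  defined_mul : T.CalcDefined D φ J (e * f)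
  inj : Function.Injective (T.calcS D φ J e)
  inj_conj : Function.Injective (T.conj.calcS D φ J e)

variable (T : RightOp V) (D : Submodule ℍ[ℝ]ᵐᵒᵖ V) (φ : ℝ) (J : ℍ[ℝ]) (f e : ℍ[ℝ] → ℍ[ℝ])

/- Products of bounded operators are compositions. -/

/-- The `S`-functional calculus of `f`, built from the regularizer `e`. -/
def hinfS : V →ₗ.[ℝ] V := invMul (T.calcS D φ J e) (T.calcS D φ J (e * f))

/-- The `Q`-functional calculus of `f`, built from the regularizer `e`. -/
def hinfQ : V →ₗ.[ℝ] V :=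
  invMul (T.calcS D φ J e * T.conj.calcS D φ J e)
    (T.calcS D φ J e * T.calcQ D φ J (e * f) - T.calcQ D φ J e * T.calcS D φ J (e * f))

/-- The `P₂`-functional calculus of `f`, built from the regularizer `e`. -/
def hinfP : V →ₗ.[ℝ] V :=
  invMul (T.calcS D φ J e ^ 2 * T.conj.calcS D φ J e)
    (T.calcS D φ J e * T.conj.calcS D φ J e * T.calcP D φ J (e * f)
      - T.conj.calcS D φ J e * T.calcP D φ J e * T.calcS D φ J (e * f)
      + T.calcS D φ J e * T.calcQ D φ J e * T.conj.calcS D φ J (e * f)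
      - T.conj.calcS D φ J e * T.calcQ D φ J e * T.calcS D φ J (e * f))

/-- The `F`-functional calculus of `f`, built from the regularizer `e`. -/
def hinfF : V →ₗ.[ℝ] V :=
  invMul (T.calcS D φ J e ^ 2 * T.conj.calcS D φ J e)
    (T.calcS D φ J e * T.conj.calcS D φ J e * T.calcF D φ J (e * f)
      - T.conj.calcS D φ J e * T.calcF D φ J e * T.calcS D φ J (e * f)
      + T.calcS D φ J e * T.calcQ D φ J e * T.calcQ D φ J (e * f)
      - T.calcQ D φ J e ^ 2 * T.calcS D φ J (e * f))

end RightOp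

end Operators

end QuatCalculus

end

noncomputable section

namespace QuatCalculus

/-! ### Contour shifting in horizontal strips -/

section Strip

open Complex Filter Topology

variable {M : Type*} [NormedAddCommGroup M] [NormedSpace ℂ M]

theorem integrable_exp_neg_mul_abs {δ : ℝ} (hδ : 0 < δ) :
    Integrable (fun x : ℝ => Real.exp (-δ * |x|)) := by
  have h1 : IntegrableOn (fun x : ℝ => Real.exp (-δ * |x|)) (Ioi 0) :=
    (exp_neg_integrableOn_Ioi 0 hδ).congr_fun
      (fun x hx => by simp only [abs_of_pos (mem_Ioi.1 hx)]) measurableSet_Ioi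
  have h2 : IntegrableOn (fun x : ℝ => Real.exp (-δ * |x|)) (Iic 0) :=
    (integrableOn_exp_mul_Iic hδ 0).congr_fun
      (fun x hx => by simp only [abs_of_nonpos (mem_Iic.1 hx), neg_mul_neg]) measurableSet_Iic
  rw [← integrableOn_univ, ← Iic_union_Ioi (a := (0 : ℝ))]
  exact h2.union h1

theorem exists_bound_strip {G : ℂ → M} {a b : ℝ}
    (hd : DifferentiableOn ℂ G {z | z.im ∈ Icc a b}) {δ C R : ℝ}
    (hb : ∀ z : ℂ, z.im ∈ Icc a b → R ≤ |z.re| → ‖G z‖ ≤ C * Real.exp (-δ * |z.re|)) :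
    ∃ C', ∀ z : ℂ, z.im ∈ Icc a b → ‖G z‖ ≤ C' * Real.exp (-δ * |z.re|) := by
  have hK : IsCompact (Icc (-R) R ×ℂ Icc a b) := isCompact_Icc.reProdIm isCompact_Icc
  have hc : ContinuousOn (fun z => ‖G z‖ * Real.exp (δ * |z.re|)) (Icc (-R) R ×ℂ Icc a b) :=
    ((hd.continuousOn.mono fun z hz => hz.2).norm).mul (by fun_prop)
  obtain ⟨C₁, hC₁⟩ := hK.exists_bound_of_continuousOn hc
  refine ⟨max C C₁, fun z hz => ?_⟩
  rcases le_or_gt R |z.re| with h | h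
  · exact (hb z hz h).trans (by gcongr; exact le_max_left _ _)
  · have := hC₁ z ⟨abs_le.1 h.le, hz⟩
    rw [Real.norm_of_nonneg (by positivity)] at this
    calc ‖G z‖ = ‖G z‖ * Real.exp (δ * |z.re|) * Real.exp (-δ * |z.re|) := by
          rw [mul_assoc, ← Real.exp_add]; simp
      _ ≤ _ := by gcongr; exact this.trans (le_max_right _ _)

theorem integrable_strip {G : ℂ → M} {a b : ℝ}
    (hd : DifferentiableOn ℂ G {z | z.im ∈ Icc a b}) {δ C : ℝ} (hδ : 0 < δ)
    (hb : ∀ z : ℂ, z.im ∈ Icc a b → ‖G z‖ ≤ C * Real.exp (-δ * |z.re|))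
    {y : ℝ} (hy : y ∈ Icc a b) : Integrable (fun x : ℝ => G (x + y * I)) := by
  have hm : ∀ x : ℝ, ((x : ℂ) + y * I) ∈ {z : ℂ | z.im ∈ Icc a b} := fun x => by simpa using hy
  refine Integrable.mono' ((integrable_exp_neg_mul_abs hδ).const_mul C) ?_ (.of_forall fun x => ?_)
  · exact (hd.continuousOn.comp_continuous (by fun_prop) hm).aestronglyMeasurable
  · simpa using hb _ (hm x)

/-- The integral of a decaying holomorphic function along a horizontal line does not change when
the line is moved. -/
theorem integral_strip [CompleteSpace M] {G : ℂ → M} {a b : ℝ} (R : ℝ) (hab : a ≤ b)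
    (hd : DifferentiableOn ℂ G {z | z.im ∈ Icc a b}) {δ C : ℝ} (hδ : 0 < δ)
    (hb : ∀ z : ℂ, z.im ∈ Icc a b → R ≤ |z.re| → ‖G z‖ ≤ C * Real.exp (-δ * |z.re|)) :
    ∫ x : ℝ, G (x + a * I) = ∫ x : ℝ, G (x + b * I) := by
  obtain ⟨C, hb⟩ := exists_bound_strip hd hb
  have hrect : ∀ R : ℝ, (∫ x : ℝ in -R..R, G (x + a * I)) - (∫ x : ℝ in -R..R, G (x + b * I)) =
      I • (∫ y : ℝ in a..b, G (((-R : ℝ) : ℂ) + y * I)) -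
        I • (∫ y : ℝ in a..b, G ((R : ℂ) + y * I)) := by
    intro R
    have := integral_boundary_rect_eq_zero_of_differentiableOn G ⟨-R, a⟩ ⟨R, b⟩
      (hd.mono fun z hz => by have := hz.2; rwa [uIcc_of_le hab] at this)
    simp only at this
    rw [← sub_eq_zero, ← this]
    abel
  have hv : ∀ s : ℝ, s = 1 ∨ s = -1 → Tendsto (fun R : ℝ =>
      I • ∫ y : ℝ in a..b, G (((s * R : ℝ) : ℂ) + y * I)) atTop (𝓝 0) := by
    intro s hs
    refine squeeze_zero_norm' (a := fun R => C * Real.exp (-δ * R) * |b - a|) ?_ ?_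
    · filter_upwards [eventually_ge_atTop 0] with R hR
      rw [norm_smul, norm_I, one_mul]
      refine intervalIntegral.norm_integral_le_of_norm_le_const fun y hy => ?_
      rw [uIoc_of_le hab] at hy
      have := hb (((s * R : ℝ) : ℂ) + y * I) (by simpa using ⟨hy.1.le, hy.2⟩)
      have h2 : |s * R| = R := by
        rw [abs_mul, abs_of_nonneg hR]; rcases hs with rfl | rfl <;> simp
      simpa [h2, -ofReal_mul] using this
    · have : Tendsto (fun R : ℝ => Real.exp (-δ * R)) atTop (𝓝 0) :=
        Real.tendsto_exp_atBot.comp (tendsto_id.const_mul_atTop_of_neg (by linarith))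
      simpa using (this.const_mul C).mul_const |b - a|
  have hlim : ∀ y ∈ Icc a b, Tendsto (fun R : ℝ => ∫ x : ℝ in -R..R, G (x + y * I)) atTop
      (𝓝 (∫ x : ℝ, G (x + y * I))) := fun y hy =>
    intervalIntegral_tendsto_integral (integrable_strip hd hδ hb hy) tendsto_neg_atTop_atBot
      tendsto_id
  have h1 := (hlim a ⟨le_rfl, hab⟩).sub (hlim b ⟨hab, le_rfl⟩)
  have h2 := (hv (-1) (.inr rfl)).sub (hv 1 (.inl rfl))
  simp only [hrect] at h1
  simp only [neg_mul, one_mul, sub_zero] at h2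
  exact sub_eq_zero.1 (tendsto_nhds_unique h1 h2)

theorem norm_sinh_ge (z : ℂ) : |Real.sinh z.re| ≤ ‖sinh z‖ := by
  have h : sinh z = (Real.sinh z.re * Real.cos z.im : ℝ) + (Real.cosh z.re * Real.sin z.im : ℝ) * I := by
    conv_lhs => rw [← re_add_im z]
    rw [sinh_add, sinh_mul_I, cosh_mul_I]
    push_cast
    ring
  rw [h, norm_add_mul_I]
  refine Real.abs_le_sqrt ?_
  have h1 := Real.cosh_sq z.re
  have h2 := Real.sin_sq_add_cos_sq z.im
  nlinarith [sq_nonneg (Real.sin z.im), sq_nonneg (Real.sinh z.re)]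

theorem inv_sinh_bound {x : ℝ} (hx : 1 ≤ |x|) : |Real.sinh x|⁻¹ ≤ 4 * Real.exp (-1 * |x|) := by
  have h : Real.sinh |x| = |Real.sinh x| := by rw [Real.abs_sinh]
  have h2 : Real.exp |x| / 4 ≤ |Real.sinh x| := by
    rw [← h, Real.sinh_eq]
    have h3 : Real.exp (-|x|) ≤ 1 := Real.exp_le_one_iff.2 (by simp)
    have h4 : 2 ≤ Real.exp |x| := by linarith [Real.add_one_le_exp |x|]
    linarith
  calc |Real.sinh x|⁻¹ ≤ (Real.exp |x| / 4)⁻¹ := by gcongr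
    _ = _ := by rw [neg_one_mul, Real.exp_neg]; field_simp

theorem sinh_ne_zero_of_im {z : ℂ} (h : z.im ∈ Ioo 0 Real.pi) : sinh z ≠ 0 := by
  intro h0
  have h1 : sin (z * I) = 0 := by rw [sin_mul_I, h0, zero_mul]
  obtain ⟨k, hk⟩ := sin_eq_zero_iff.1 h1
  have h2 := congrArg re hk
  simp at h2
  have h3 : (-1 : ℝ) < k := by
    by_contra! h5
    nlinarith [h.1, h.2, Real.pi_pos]
  have h4 : (k : ℝ) < 0 := by
    by_contra! h5
    nlinarith [h.1, h.2, Real.pi_pos]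
  norm_cast at h3 h4
  have : (-1 : ℤ) < k := by exact_mod_cast h3
  omega

theorem integral_inv_cosh : ∫ x : ℝ, (Real.cosh x)⁻¹ = Real.pi := by
  have hd : ∀ x : ℝ, HasDerivAt (fun x => 2 * Real.arctan (Real.exp x)) (Real.cosh x)⁻¹ x := by
    intro x
    convert! ((Real.hasDerivAt_arctan _).comp x (Real.hasDerivAt_exp x)).const_mul 2 using 1
    rw [Real.cosh_eq, Real.exp_neg]
    have := Real.exp_pos x
    field_simp
    ring
  have hi : Integrable (fun x : ℝ => (Real.cosh x)⁻¹) := by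
    refine Integrable.mono' ((integrable_exp_neg_mul_abs one_pos).const_mul 2) ?_ ?_
    · exact (Real.continuous_cosh.inv₀ fun x => (Real.cosh_pos x).ne').aestronglyMeasurable
    · refine .of_forall fun x => ?_
      rw [Real.norm_of_nonneg (inv_nonneg.2 (Real.cosh_pos x).le), ← Real.cosh_abs]
      calc (Real.cosh |x|)⁻¹ ≤ (Real.exp |x| / 2)⁻¹ := by
            gcongr
            rw [Real.cosh_eq]
            linarith [Real.exp_pos (-|x|)]
        _ = _ := by rw [neg_one_mul, Real.exp_neg]; field_simp
  rw [integral_of_hasDerivAt_of_tendsto hd hi (m := 0) (n := Real.pi), sub_zero]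
  · have := ((Real.continuous_arctan.tendsto 0).comp Real.tendsto_exp_atBot).const_mul 2
    simpa using this
  · have := ((tendsto_nhds_of_tendsto_nhdsWithin Real.tendsto_arctan_atTop).comp
      Real.tendsto_exp_atTop).const_mul 2
    rwa [mul_div_cancel₀ _ two_ne_zero] at this

theorem integral_inv_sinh {y : ℝ} (hy : y ∈ Ioo 0 Real.pi) :
    ∫ x : ℝ, (sinh (x + y * I))⁻¹ = -(Real.pi * I) := by
  have key : ∀ a b : ℝ, a ≤ b → a ∈ Ioo 0 Real.pi → b ∈ Ioo 0 Real.pi →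
      ∫ x : ℝ, (sinh (x + a * I))⁻¹ = ∫ x : ℝ, (sinh (x + b * I))⁻¹ := by
    intro a b hab ha hb
    refine integral_strip (G := fun z => (sinh z)⁻¹) (δ := 1) (C := 4) 1 hab ?_ one_pos ?_
    · intro z hz
      exact (differentiable_sinh z |>.inv
        (sinh_ne_zero_of_im ⟨ha.1.trans_le hz.1, hz.2.trans_lt hb.2⟩)).differentiableWithinAt
    · intro z _ hz
      rw [norm_inv]
      refine le_trans ?_ (inv_sinh_bound hz)
      have : 0 < |Real.sinh z.re| := abs_pos.2 (by rw [Ne, Real.sinh_eq_zero]; rintro h; simp [h] at hz; linarith)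
      gcongr
      exact norm_sinh_ge z
  have hpi : Real.pi / 2 ∈ Ioo 0 Real.pi := ⟨by positivity, by linarith [Real.pi_pos]⟩
  have h2 : ∫ x : ℝ, (sinh (x + (Real.pi / 2 : ℝ) * I))⁻¹ = -(Real.pi * I) := by
    have : ∀ x : ℝ, (sinh (x + (Real.pi / 2 : ℝ) * I))⁻¹ = -I * (((Real.cosh x)⁻¹ : ℝ) : ℂ) := by
      intro x
      rw [sinh_add, cosh_mul_I, sinh_mul_I, ← ofReal_cos, ← ofReal_sin]
      simp
    simp_rw [this]
    rw [integral_const_mul, integral_complex_ofReal, integral_inv_cosh]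
    ring
  rcases le_total y (Real.pi / 2) with h | h
  · rw [key y _ h hy hpi, h2]
  · rw [← key _ y h hpi hy, h2]

/-- The residue of `1 / sinh` at `0`, as a difference of integrals along horizontal lines. -/
theorem integral_inv_sinh_neg {y : ℝ} (hy : y ∈ Ioo (-Real.pi) 0) :
    ∫ x : ℝ, (sinh (x + y * I))⁻¹ = Real.pi * I := by
  have h := integral_inv_sinh (y := -y) ⟨by linarith [hy.2], by linarith [hy.1]⟩
  rw [← integral_neg_eq_self] at h
  have : ∀ x : ℝ, (sinh (((-x : ℝ) : ℂ) + ((-y : ℝ) : ℂ) * I))⁻¹ = -(sinh (x + y * I))⁻¹ := by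
    intro x
    rw [← inv_neg, ← sinh_neg]
    congr 2
    push_cast
    ring
  simp_rw [this, integral_neg, neg_inj] at h
  exact h

theorem integrable_inv_sinh {y : ℝ} (hy : y ∈ Ioo 0 Real.pi) :
    Integrable fun x : ℝ => (sinh (x + y * I))⁻¹ := by
  by_contra h
  have := integral_inv_sinh hy
  rw [integral_undef h] at this
  simp [Real.pi_ne_zero] at this

theorem integrable_inv_sinh_neg {y : ℝ} (hy : y ∈ Ioo (-Real.pi) 0) :
    Integrable fun x : ℝ => (sinh (x + y * I))⁻¹ := by
  by_contra h
  have := integral_inv_sinh_neg hy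
  rw [integral_undef h] at this
  simp [Real.pi_ne_zero] at this

end Strip

/-! ### Integrals along the boundary of a planar sector -/

section Contour

open Complex Filter Topology

/-- The path along the boundary of the planar sector of half-angle `φ`. -/
def ray (φ t : ℝ) : ℂ := if t < 0 then (-t) • exp (φ * I) else t • exp (((-φ : ℝ) : ℂ) * I)

/-- The derivative of `ray`, divided by `I`. -/
def rayWeight (φ t : ℝ) : ℂ := (if t < 0 then -exp (φ * I) else exp (((-φ : ℝ) : ℂ) * I)) * I⁻¹

theorem ray_of_neg {φ t : ℝ} (ht : t < 0) : ray φ t = (-t) • exp (φ * I) := if_pos ht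

theorem ray_of_pos {φ t : ℝ} (ht : 0 < t) : ray φ t = t • exp (((-φ : ℝ) : ℂ) * I) :=
  if_neg ht.not_gt

@[simp] theorem norm_ray (φ t : ℝ) : ‖ray φ t‖ = |t| := by
  unfold ray
  split_ifs with h <;> rw [norm_smul, norm_exp_ofReal_mul_I, mul_one] <;> simp

@[simp] theorem norm_rayWeight (φ t : ℝ) : ‖rayWeight φ t‖ = 1 := by
  unfold rayWeight
  split_ifs with h <;> rw [norm_mul] <;> simp [-ofReal_neg, norm_exp_ofReal_mul_I]

theorem ray_ne_zero {φ t : ℝ} (ht : t ≠ 0) : ray φ t ≠ 0 := by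
  rw [← norm_pos_iff, norm_ray]; exact abs_pos.2 ht

theorem arg_smul_exp {r y : ℝ} (hr : 0 < r) (hy : y ∈ Ioc (-Real.pi) Real.pi) :
    arg (r • exp (y * I)) = y := by
  rw [real_smul, arg_real_mul _ hr, arg_exp_mul_I, toIocMod_eq_self]
  convert! hy using 1
  ring_nf

theorem abs_arg_ray {φ t : ℝ} (hφ : φ ∈ Ioo 0 Real.pi) (ht : t ≠ 0) : |arg (ray φ t)| = φ := by
  rcases lt_or_gt_of_ne ht with h | h
  · rw [ray_of_neg h, arg_smul_exp (by linarith) ⟨by linarith [hφ.1, Real.pi_pos], hφ.2.le⟩,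
      abs_of_pos hφ.1]
  · rw [ray_of_pos h, arg_smul_exp h ⟨by linarith [hφ.2], by linarith [hφ.1, Real.pi_pos]⟩,
      abs_neg, abs_of_pos hφ.1]

theorem ray_neg (φ t : ℝ) : ray φ (-t) = (starRingEnd ℂ) (ray φ t) := by
  rcases lt_trichotomy t 0 with h | rfl | h
  · rw [ray_of_neg h, ray_of_pos (by linarith)]
    simp [← exp_conj]
  · simp [ray]
  · rw [ray_of_pos h, ray_of_neg (by linarith)]
    simp [← exp_conj]

theorem rayWeight_neg {φ t : ℝ} (ht : t ≠ 0) :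
    rayWeight φ (-t) = (starRingEnd ℂ) (rayWeight φ t) := by
  unfold rayWeight
  rcases lt_or_gt_of_ne ht with h | h
  · rw [if_neg (by linarith), if_pos h]
    simp [← exp_conj]
  · rw [if_pos (by linarith), if_neg (by linarith)]
    simp [← exp_conj]

theorem continuous_ray (φ : ℝ) : Continuous (ray φ) := by
  have : ray φ = fun t => if 0 ≤ t then t • exp (((-φ : ℝ) : ℂ) * I) else (-t) • exp (φ * I) := by
    funext t
    unfold ray
    split_ifs with h1 h2 h2
    · linarith
    · rfl
    · rfl
    · linarith
  rw [this]
  exact Continuous.if_le (by fun_prop) (by fun_prop) continuous_const continuous_id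
    fun t ht => by simp [← ht]

theorem measurable_rayWeight (φ : ℝ) : Measurable (rayWeight φ) :=
  (Measurable.ite measurableSet_Iio measurable_const measurable_const).mul_const _

theorem continuous_twoPow_norm {a b : ℝ} : ContinuousOn (fun z : ℂ => twoPow a b ‖z‖) {0}ᶜ := by
  have h : ∀ z : ℂ, z ∈ ({0}ᶜ : Set ℂ) → ‖z‖ ≠ 0 := fun z hz => norm_ne_zero_iff.2 hz
  unfold twoPow
  refine ContinuousOn.if (p := fun z : ℂ => ‖z‖ ≤ 1) ?_ ?_ ?_
  · rintro z ⟨_, hz⟩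
    have : ‖z‖ = 1 := frontier_le_subset_eq continuous_norm continuous_const hz
    simp [this]
  · exact (continuous_norm.continuousOn.rpow_const fun z hz => .inl (h z hz.1))
  · exact (continuous_norm.continuousOn.rpow_const fun z hz => .inl (h z hz.1))

theorem twoPow_nonneg {a b r : ℝ} (hr : 0 ≤ r) : 0 ≤ twoPow a b r := by
  unfold twoPow; split_ifs <;> positivity

theorem twoPow_mul {a b c d r : ℝ} (hr : 0 < r) :
    twoPow a b r * twoPow c d r = twoPow (a + c) (b + d) r := by
  unfold twoPow; split_ifs <;> rw [Real.rpow_add hr]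

theorem twoPow_le_twoPow {a b c d r : ℝ} (hr : 0 < r) (h1 : c ≤ a) (h2 : b ≤ d) :
    twoPow a b r ≤ twoPow c d r := by
  unfold twoPow
  split_ifs with h
  · exact Real.rpow_le_rpow_of_exponent_ge hr h h1
  · exact Real.rpow_le_rpow_of_exponent_le (not_le.1 h).le h2

theorem twoPow_exp_mul (δ x : ℝ) :
    twoPow (-1 + δ) (-1 - δ) (Real.exp x) * Real.exp x = Real.exp (-δ * |x|) := by
  unfold twoPow
  split_ifs with h
  · rw [abs_of_nonpos (by simpa using h), ← Real.exp_mul, ← Real.exp_add]; ring_nf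
  · rw [abs_of_pos (by simpa using h), ← Real.exp_mul, ← Real.exp_add]; ring_nf

theorem integrable_twoPow {δ : ℝ} (hδ : 0 < δ) :
    Integrable fun t : ℝ => twoPow (-1 + δ) (-1 - δ) |t| := by
  have h1 : IntegrableOn (fun t : ℝ => twoPow (-1 + δ) (-1 - δ) |t|) (Ioi 0) := by
    rw [← Ioc_union_Ioi_eq_Ioi zero_le_one]
    refine IntegrableOn.union ?_ ?_
    · refine IntegrableOn.congr_fun (f := fun t : ℝ => t ^ (-1 + δ)) ?_ ?_ measurableSet_Ioc
      · rw [← intervalIntegrable_iff_integrableOn_Ioc_of_le zero_le_one]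
        exact intervalIntegral.intervalIntegrable_rpow' (by linarith)
      · intro t ht
        simp [twoPow, abs_of_pos ht.1, ht.2]
    · refine IntegrableOn.congr_fun (f := fun t : ℝ => t ^ (-1 - δ)) ?_ ?_ measurableSet_Ioi
      · exact integrableOn_Ioi_rpow_of_lt (by linarith) one_pos
      · intro t ht
        have ht := mem_Ioi.1 ht
        simp [twoPow, abs_of_pos (one_pos.trans ht), ht]
  have h2 : IntegrableOn (fun t : ℝ => twoPow (-1 + δ) (-1 - δ) |t|) (Iio 0) := by
    have h3 : IntegrableOn (fun t : ℝ => twoPow (-1 + δ) (-1 - δ) |t|) (Ioi (-0)) := by simpa using h1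
    simpa using h3.comp_neg_Iio
  rw [← integrableOn_univ, ← Iic_union_Ioi (a := (0 : ℝ)), integrableOn_union,
    integrableOn_Iic_iff_integrableOn_Iio]
  exact ⟨h2, h1⟩

variable {M : Type*} [NormedAddCommGroup M] [NormedSpace ℂ M]

/-- The integral of `F(s) ds / i` along the boundary of the planar sector of half-angle `φ`. -/
def cint (φ : ℝ) (F : ℂ → M) : M := ∫ t : ℝ, rayWeight φ t • F (ray φ t)

/-- Absolute convergence of `cint`. -/
def CInt (φ : ℝ) (F : ℂ → M) : Prop := Integrable fun t : ℝ => rayWeight φ t • F (ray φ t)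

theorem CInt.add {φ : ℝ} {F G : ℂ → M} (hF : CInt φ F) (hG : CInt φ G) :
    CInt φ (fun z => F z + G z) := by
  simp only [CInt, smul_add]; exact Integrable.add hF hG

theorem CInt.sub {φ : ℝ} {F G : ℂ → M} (hF : CInt φ F) (hG : CInt φ G) :
    CInt φ (fun z => F z - G z) := by
  simp only [CInt, smul_sub]; exact Integrable.sub hF hG

theorem cint_add {φ : ℝ} {F G : ℂ → M} (hF : CInt φ F) (hG : CInt φ G) :
    cint φ (fun z => F z + G z) = cint φ F + cint φ G := by
  simp only [cint, smul_add]; exact integral_add hF hG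

theorem cint_sub {φ : ℝ} {F G : ℂ → M} (hF : CInt φ F) (hG : CInt φ G) :
    cint φ (fun z => F z - G z) = cint φ F - cint φ G := by
  simp only [cint, smul_sub]; exact integral_sub hF hG

theorem cint_smul (φ : ℝ) (c : ℂ) (F : ℂ → M) : cint φ (fun z => c • F z) = c • cint φ F := by
  simp only [cint, smul_comm _ c]; exact integral_smul _ _

theorem CInt.smul {φ : ℝ} {F : ℂ → M} (hF : CInt φ F) (c : ℂ) : CInt φ (fun z => c • F z) := by
  simp only [CInt, smul_comm _ c]; exact Integrable.smul c hF

theorem ae_ne_zero_real : ∀ᵐ t : ℝ, t ≠ 0 := by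
  simp [ae_iff]

theorem cint_congr {φ : ℝ} {F G : ℂ → M} (h : ∀ t ≠ 0, F (ray φ t) = G (ray φ t)) :
    cint φ F = cint φ G :=
  integral_congr_ae (ae_ne_zero_real.mono fun t ht => by simp only [h t ht])

theorem CInt.congr {φ : ℝ} {F G : ℂ → M} (hF : CInt φ F) (h : ∀ t ≠ 0, F (ray φ t) = G (ray φ t)) :
    CInt φ G :=
  Integrable.congr hF (ae_ne_zero_real.mono fun t ht => by simp only [h t ht])

theorem ContinuousLinearMap.cint_comp [CompleteSpace M] {N : Type*} [NormedAddCommGroup N]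
    [NormedSpace ℂ N] [CompleteSpace N] (A : M →L[ℂ] N) {φ : ℝ} {F : ℂ → M} (hF : CInt φ F) :
    cint φ (fun z => A (F z)) = A (cint φ F) := by
  simp only [cint, ← map_smul]; exact A.integral_comp_comm hF

theorem CInt.clm_comp {N : Type*} [NormedAddCommGroup N]
    [NormedSpace ℂ N] (A : M →L[ℂ] N) {φ : ℝ} {F : ℂ → M} (hF : CInt φ F) :
    CInt φ (fun z => A (F z)) := by
  simpa only [CInt, ← map_smul] using A.integrable_comp hF

theorem aestronglyMeasurable_comp_ray {N : Type*} [TopologicalSpace N]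
    [TopologicalSpace.PseudoMetrizableSpace N] {φ : ℝ} {F : ℂ → N} {U : Set ℂ}
    (hF : ContinuousOn F U) (hU : ∀ t ≠ 0, ray φ t ∈ U) :
    AEStronglyMeasurable (fun t => F (ray φ t)) volume := by
  have h : ContinuousOn (fun t => F (ray φ t)) {0}ᶜ :=
    hF.comp (continuous_ray φ).continuousOn fun t ht => hU t ht
  have := h.aestronglyMeasurable (μ := volume) (measurableSet_singleton 0).compl
  rwa [Measure.restrict_eq_self_of_ae_mem (s := ({0}ᶜ : Set ℝ)) ae_ne_zero_real] at this

/-- A function that decays at `0` and `∞` faster than `1 / |z|`. -/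
def Tame (U : Set ℂ) (F : ℂ → M) : Prop :=
  ∃ δ > 0, ∃ C ≥ 0, ∀ z ∈ U, ‖F z‖ ≤ C * twoPow (-1 + δ) (-1 - δ) ‖z‖

theorem Tame.cInt {φ : ℝ} {F : ℂ → M} {U : Set ℂ} (hF : ContinuousOn F U) (hb : Tame U F)
    (hU : ∀ t ≠ 0, ray φ t ∈ U) : CInt φ F := by
  obtain ⟨δ, hδ, C, -, hb⟩ := hb
  refine Integrable.mono' ((integrable_twoPow hδ).const_mul C) ?_ ?_
  · exact (measurable_rayWeight φ).aestronglyMeasurable.smul (aestronglyMeasurable_comp_ray hF hU)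
  · refine ae_ne_zero_real.mono fun t ht => ?_
    rw [norm_smul, norm_rayWeight, one_mul]
    simpa using hb _ (hU t ht)

/-- The integrand in logarithmic coordinates. -/
def logPull (F : ℂ → M) (z : ℂ) : M := exp z • F (exp z)

theorem setIntegral_Ioi_exp (f : ℝ → M) :
    ∫ t in Ioi (0 : ℝ), f t = ∫ x : ℝ, Real.exp x • f (Real.exp x) := by
  have := integral_image_eq_integral_abs_deriv_smul (s := univ) MeasurableSet.univ
    (fun x _ => (Real.hasDerivAt_exp x).hasDerivWithinAt) Real.exp_injective.injOn f
  rw [image_univ, Real.range_exp] at this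
  simpa [abs_of_pos (Real.exp_pos _)] using this

theorem cint_eq {φ : ℝ} {F : ℂ → M} (hF : CInt φ F) :
    cint φ F = I⁻¹ • ((∫ x : ℝ, logPull F (x + ((-φ : ℝ) : ℂ) * I)) -
      ∫ x : ℝ, logPull F (x + φ * I)) := by
  have h1 : ∫ t in Ioi (0 : ℝ), rayWeight φ t • F (ray φ t) =
      I⁻¹ • ∫ x : ℝ, logPull F (x + ((-φ : ℝ) : ℂ) * I) := by
    rw [setIntegral_Ioi_exp, ← integral_smul]
    congr 1
    funext x
    rw [ray_of_pos (Real.exp_pos x), rayWeight, if_neg (Real.exp_pos x).not_gt, logPull, exp_add,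
      ← ofReal_exp, ← real_smul, ← Complex.coe_smul, smul_smul, smul_smul]
    congr 1
    rw [real_smul]
    ring
  have h2 : ∫ t in Iic (0 : ℝ), rayWeight φ t • F (ray φ t) =
      -(I⁻¹ • ∫ x : ℝ, logPull F (x + φ * I)) := by
    have := integral_comp_neg_Iic (0 : ℝ) fun t => rayWeight φ (-t) • F (ray φ (-t))
    simp only [neg_neg, neg_zero] at this
    rw [this, setIntegral_Ioi_exp, ← integral_smul, ← integral_neg]
    congr 1
    funext x
    have hx : -Real.exp x < 0 := by linarith [Real.exp_pos x]
    rw [ray_of_neg hx, rayWeight, if_pos hx, logPull, exp_add, neg_neg,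
      ← ofReal_exp, ← real_smul, ← Complex.coe_smul, smul_smul, smul_smul, ← neg_smul]
    congr 1
    rw [real_smul]
    ring
  rw [cint, ← setIntegral_univ, ← Iic_union_Ioi (a := (0 : ℝ)),
    setIntegral_union (Iic_disjoint_Ioi le_rfl) measurableSet_Ioi hF.integrableOn hF.integrableOn,
    h1, h2, smul_sub]
  abel

theorem arg_exp_of_mem {z : ℂ} (hz : z.im ∈ Ioc (-Real.pi) Real.pi) : arg (exp z) = z.im := by
  rw [← log_im, log_exp hz.1 hz.2]

theorem norm_logPull_le {F : ℂ → M} {z : ℂ} {δ C : ℝ}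
    (h : ‖F (exp z)‖ ≤ C * twoPow (-1 + δ) (-1 - δ) ‖exp z‖) :
    ‖logPull F z‖ ≤ C * Real.exp (-δ * |z.re|) := by
  rw [logPull, norm_smul, ← twoPow_exp_mul, ← Complex.norm_exp]
  calc _ ≤ ‖exp z‖ * (C * twoPow (-1 + δ) (-1 - δ) ‖exp z‖) := by gcongr
    _ = _ := by ring

theorem DifferentiableOn.logPull {F : ℂ → M} {U : Set ℂ} (hF : DifferentiableOn ℂ F U) {W : Set ℂ}
    (hW : MapsTo exp W U) : DifferentiableOn ℂ (logPull F) W :=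
  differentiable_exp.differentiableOn.smul (hF.comp differentiable_exp.differentiableOn hW)

variable [CompleteSpace M]

/-- Cauchy's theorem in a sector. -/
theorem cint_eq_zero {φ : ℝ} (hφ : φ ∈ Ioo 0 Real.pi) {F : ℂ → M}
    (hd : DifferentiableOn ℂ F {z | z ≠ 0 ∧ |arg z| ≤ φ}) (hb : Tame {z | z ≠ 0 ∧ |arg z| ≤ φ} F) :
    cint φ F = 0 := by
  have hr : ∀ t ≠ 0, ray φ t ∈ {z | z ≠ 0 ∧ |arg z| ≤ φ} := fun t ht =>
    ⟨ray_ne_zero ht, (abs_arg_ray hφ ht).le⟩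
  have hm : MapsTo exp {z | z.im ∈ Icc (-φ) φ} {z | z ≠ 0 ∧ |arg z| ≤ φ} := fun z hz =>
    ⟨exp_ne_zero z, by
      rw [arg_exp_of_mem ⟨by linarith [hz.1, hφ.2], by linarith [hz.2, hφ.2]⟩]
      exact abs_le.2 hz⟩
  rw [cint_eq (hb.cInt hd.continuousOn hr)]
  obtain ⟨δ, hδ, C, -, hb⟩ := hb
  rw [integral_strip 0 (by linarith [hφ.1]) (DifferentiableOn.logPull hd hm) hδ
    (fun z hz _ => norm_logPull_le (hb _ (hm hz))), sub_self, smul_zero]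

/-- The contour can be moved within a region of holomorphy. -/
theorem cint_eq_cint {φ ψ : ℝ} (hφ : φ ∈ Ioo 0 Real.pi) (hψ : ψ ∈ Ioo 0 Real.pi) {F : ℂ → M}
    {U : Set ℂ} (hd : DifferentiableOn ℂ F U) (hb : Tame U F)
    (hU : ∀ z : ℂ, z ≠ 0 → min φ ψ ≤ |arg z| → |arg z| ≤ max φ ψ → z ∈ U) :
    cint φ F = cint ψ F := by
  wlog h : φ ≤ ψ generalizing φ ψ
  · exact (this hψ hφ (by rwa [min_comm, max_comm]) (by linarith)).symm
  rw [min_eq_left h, max_eq_right h] at hU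
  have hr : ∀ χ ∈ Icc φ ψ, ∀ t ≠ 0, ray χ t ∈ U := fun χ hχ t ht => by
    have := abs_arg_ray (φ := χ) ⟨hφ.1.trans_le hχ.1, hχ.2.trans_lt hψ.2⟩ ht
    exact hU _ (ray_ne_zero ht) (by rw [this]; exact hχ.1) (by rw [this]; exact hχ.2)
  have hm : MapsTo exp {z | z.im ∈ Icc φ ψ} U := fun z hz => by
    have := arg_exp_of_mem (z := z) ⟨by linarith [hz.1, hφ.1, Real.pi_pos], by linarith [hz.2, hψ.2]⟩
    refine hU _ (exp_ne_zero z) ?_ ?_ <;> rw [this, abs_of_pos (hφ.1.trans_le hz.1)]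
    exacts [hz.1, hz.2]
  have hm' : MapsTo exp {z | z.im ∈ Icc (-ψ) (-φ)} U := fun z hz => by
    have := arg_exp_of_mem (z := z) ⟨by linarith [hz.1, hψ.2], by linarith [hz.2, hφ.1, Real.pi_pos]⟩
    refine hU _ (exp_ne_zero z) ?_ ?_ <;> rw [this, abs_of_neg (by linarith [hz.2, hφ.1])]
    exacts [by linarith [hz.2], by linarith [hz.1]]
  rw [cint_eq (hb.cInt hd.continuousOn (hr φ ⟨le_rfl, h⟩)),
    cint_eq (hb.cInt hd.continuousOn (hr ψ ⟨h, le_rfl⟩))]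
  obtain ⟨δ, hδ, C, -, hb⟩ := hb
  rw [integral_strip 0 h (DifferentiableOn.logPull hd hm) hδ
    (fun z hz _ => norm_logPull_le (hb _ (hm hz))),
    integral_strip 0 (neg_le_neg h) (DifferentiableOn.logPull hd hm') hδ
    (fun z hz _ => norm_logPull_le (hb _ (hm' hz)))]

theorem le_abs_arg_iff {φ : ℝ} (hφ : φ ∈ Icc 0 Real.pi) {z : ℂ} (hz : z ≠ 0) :
    φ ≤ |arg z| ↔ z.re ≤ Real.cos φ * ‖z‖ := by
  have h1 : 0 < ‖z‖ := norm_pos_iff.2 hz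
  rw [← div_le_iff₀ h1, ← cos_arg hz, ← Real.cos_abs (arg z)]
  exact (Real.strictAntiOn_cos.le_iff_ge ⟨abs_nonneg _, abs_arg_le_pi z⟩ hφ).symm

/-- Cauchy's theorem in the complement of a sector. The decay is only required for large and
for small arguments. -/
theorem cint_eq_zero_of_outer {φ : ℝ} (hφ : φ ∈ Ioo 0 Real.pi) {F : ℂ → M} (hF : CInt φ F)
    (hd : DifferentiableOn ℂ F {z | z ≠ 0 ∧ φ ≤ |arg z|}) {δ C : ℝ} (hδ : 0 < δ)
    (hb : ∀ z : ℂ, z ≠ 0 → φ ≤ |arg z| → 1 ≤ |Real.log ‖z‖| →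
      ‖F z‖ ≤ C * twoPow (-1 + δ) (-1 - δ) ‖z‖) :
    cint φ F = 0 := by
  have hm : MapsTo exp {z | z.im ∈ Icc φ (2 * Real.pi - φ)} {z | z ≠ 0 ∧ φ ≤ |arg z|} := by
    intro z hz
    refine ⟨exp_ne_zero z, ?_⟩
    rw [le_abs_arg_iff ⟨hφ.1.le, hφ.2.le⟩ (exp_ne_zero z), exp_re, Complex.norm_exp, mul_comm]
    gcongr
    rcases le_total z.im Real.pi with h | h
    · exact Real.cos_le_cos_of_nonneg_of_le_pi hφ.1.le h hz.1
    · rw [← Real.cos_two_pi_sub]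
      exact Real.cos_le_cos_of_nonneg_of_le_pi hφ.1.le (by linarith) (by linarith [hz.2])
  have h2 : ∫ x : ℝ, logPull F (x + ((-φ : ℝ) : ℂ) * I) =
      ∫ x : ℝ, logPull F (x + ((2 * Real.pi - φ : ℝ) : ℂ) * I) := by
    congr 1
    funext x
    have : exp (x + ((2 * Real.pi - φ : ℝ) : ℂ) * I) = exp (x + ((-φ : ℝ) : ℂ) * I) := by
      rw [← exp_periodic (x + ((-φ : ℝ) : ℂ) * I)]
      push_cast
      ring_nf
    rw [logPull, logPull, this]
  rw [cint_eq hF, h2, integral_strip 1 (by linarith [hφ.2]) (DifferentiableOn.logPull hd hm) hδ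
    (fun z hz h1 => norm_logPull_le (hb _ (hm hz).1 (hm hz).2 (by rwa [Complex.norm_exp, Real.log_exp]))),
    sub_self, smul_zero]

end Contour

/-! ### Cauchy's integral formula in a sector and a product rule -/

section CauchyFormula

open Complex Filter Topology

/-- The open planar sector of half-angle `θ`. -/
def csector (θ : ℝ) : Set ℂ := {z | z ≠ 0 ∧ |arg z| < θ}

/-- The functions with values in `ℂ` that are holomorphic on a sector and decay at `0` and `∞`. -/
structure IsCDecaying (θ : ℝ) (k : ℂ → ℂ) : Prop where
  diff : DifferentiableOn ℂ k (csector θ)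
  decay : ∃ δ > 0, ∃ C ≥ 0, ∀ z ∈ csector θ, ‖k z‖ ≤ C * twoPow δ (-δ) ‖z‖

theorem exists_dist_ge {a b : ℝ} (ha : 0 ≤ a) (hab : a < b) (hb : b ≤ Real.pi) :
    ∃ c > 0, ∀ s p : ℂ, s ≠ 0 → p ≠ 0 → |arg s| ≤ a → b ≤ |arg p| →
      c * ‖s‖ ≤ ‖p - s‖ ∧ c * ‖p‖ ≤ ‖p - s‖ := by
  set C := max (Real.cos (b - a)) 0 with hC
  have hC1 : C < 1 := by
    refine max_lt ?_ one_pos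
    rw [← Real.cos_zero]
    exact Real.cos_lt_cos_of_nonneg_of_le_pi le_rfl (by linarith) (by linarith)
  refine ⟨Real.sqrt (1 - C), Real.sqrt_pos.2 (by linarith), fun s p hs hp h1 h2 => ?_⟩
  have h3 : Real.cos (arg p - arg s) ≤ C := by
    refine le_trans ?_ (le_max_left _ _)
    rw [← Real.cos_abs (arg p - arg s)]
    have h4 : b - a ≤ |arg p - arg s| := by
      have := abs_sub_abs_le_abs_sub (arg p) (arg s); linarith
    have h5 : |arg p - arg s| ≤ Real.pi + a := by
      have := abs_sub (arg p) (arg s); linarith [abs_arg_le_pi p]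
    rcases le_total |arg p - arg s| Real.pi with h | h
    · exact Real.cos_le_cos_of_nonneg_of_le_pi (by linarith) h h4
    · rw [← Real.cos_two_pi_sub]
      exact Real.cos_le_cos_of_nonneg_of_le_pi (by linarith) (by linarith) (by linarith)
  have h6 : ‖p - s‖ ^ 2 = ‖p‖ ^ 2 + ‖s‖ ^ 2 - 2 * (‖p‖ * ‖s‖ * Real.cos (arg p - arg s)) := by
    rw [Real.cos_sub]
    have e1 := norm_mul_cos_arg p
    have e2 := norm_mul_cos_arg s
    have e3 := norm_mul_sin_arg p
    have e4 := norm_mul_sin_arg s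
    have : ‖p‖ * ‖s‖ * (Real.cos (arg p) * Real.cos (arg s) + Real.sin (arg p) * Real.sin (arg s)) =
        p.re * s.re + p.im * s.im := by rw [← e1, ← e2, ← e3, ← e4]; ring
    rw [this, ← normSq_eq_norm_sq, ← normSq_eq_norm_sq, ← normSq_eq_norm_sq, normSq_apply,
      normSq_apply, normSq_apply, sub_re, sub_im]
    ring
  have h7 : ‖p‖ * ‖s‖ * Real.cos (arg p - arg s) ≤ ‖p‖ * ‖s‖ * C := by gcongr
  have h8 : 0 ≤ C := le_max_right _ _
  constructor
  · refine (sq_le_sq₀ (by positivity) (norm_nonneg _)).1 ?_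
    rw [mul_pow, Real.sq_sqrt (by linarith)]
    nlinarith [mul_nonneg h8 (sq_nonneg (‖p‖ - ‖s‖)), mul_nonneg (sub_nonneg.2 hC1.le) (sq_nonneg ‖p‖)]
  · refine (sq_le_sq₀ (by positivity) (norm_nonneg _)).1 ?_
    rw [mul_pow, Real.sq_sqrt (by linarith)]
    nlinarith [mul_nonneg h8 (sq_nonneg (‖p‖ - ‖s‖)), mul_nonneg (sub_nonneg.2 hC1.le) (sq_nonneg ‖s‖)]

theorem twoPow_exp (δ x : ℝ) : twoPow δ (-δ) (Real.exp x) = Real.exp (-δ * |x|) := by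
  have := twoPow_exp_mul δ x
  rw [← this]
  have h : Real.exp x = twoPow 1 1 (Real.exp x) := by simp [twoPow]
  nth_rw 3 [h]
  rw [twoPow_mul (Real.exp_pos x)]
  ring_nf

theorem twoPow_div (δ : ℝ) {r : ℝ} (hr : 0 < r) :
    twoPow δ (-δ) r / r = twoPow (-1 + δ) (-1 - δ) r := by
  have h : twoPow 1 1 r = r := by simp [twoPow]
  rw [div_eq_iff hr.ne']
  nth_rw 3 [← h]
  rw [twoPow_mul hr]
  ring_nf

theorem twoPow_le_one {a b r : ℝ} (hr : 0 < r) (ha : 0 ≤ a) (hb : b ≤ 0) : twoPow a b r ≤ 1 := by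
  simpa [twoPow] using twoPow_le_twoPow hr ha hb

theorem IsCDecaying.bounded {θ : ℝ} {k : ℂ → ℂ} (hk : IsCDecaying θ k) :
    ∃ C ≥ 0, ∀ z ∈ csector θ, ‖k z‖ ≤ C := by
  obtain ⟨δ, hδ, C, hC, hb⟩ := hk.decay
  refine ⟨C, hC, fun z hz => (hb z hz).trans ?_⟩
  exact mul_le_of_le_one_right hC (twoPow_le_one (norm_pos_iff.2 hz.1) hδ.le (by linarith))

theorem IsCDecaying.tame_div {θ : ℝ} {k : ℂ → ℂ} (hk : IsCDecaying θ k) {U : Set ℂ}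
    (hU : U ⊆ csector θ) {d : ℂ → ℂ} {c : ℝ} (hc : 0 < c) (hd : ∀ z ∈ U, c * ‖z‖ ≤ ‖d z‖) :
    Tame U (fun z => k z / d z) := by
  obtain ⟨δ, hδ, C, hC, hb⟩ := hk.decay
  refine ⟨δ, hδ, C / c, by positivity, fun z hz => ?_⟩
  have hz0 : 0 < ‖z‖ := norm_pos_iff.2 (hU hz).1
  rw [← twoPow_div δ hz0, norm_div]
  calc _ ≤ (C * twoPow δ (-δ) ‖z‖) / (c * ‖z‖) := by
        gcongr
        · exact mul_nonneg hC (twoPow_nonneg hz0.le)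
        · exact hb z (hU hz)
        · exact hd z hz
    _ = _ := by field_simp

theorem norm_inv_one_sub_exp_le {u : ℂ} (hu : 1 ≤ |u.re|) : ‖(1 - exp u)⁻¹‖ ≤ 2 := by
  have h1 : |1 - Real.exp u.re| ≤ ‖1 - exp u‖ := by
    rw [← Complex.norm_exp]
    simpa using abs_norm_sub_norm_le 1 (exp u)
  have h2 : (1 : ℝ) / 2 ≤ |1 - Real.exp u.re| := by
    rcases le_abs'.1 hu with h | h
    · have h3 : Real.exp u.re ≤ Real.exp (-1) := Real.exp_le_exp.2 h
      have h4 : Real.exp (-1) ≤ 1 / 2 := by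
        rw [Real.exp_neg, inv_eq_one_div]
        have := Real.add_one_le_exp (1 : ℝ)
        exact one_div_le_one_div_of_le two_pos (by linarith)
      rw [abs_of_nonneg] <;> linarith
    · have := Real.add_one_le_exp u.re
      rw [abs_of_nonpos] <;> linarith
  rw [norm_inv]
  calc _ ≤ (1 / 2 : ℝ)⁻¹ := by gcongr; exact h2.trans h1
    _ = 2 := by norm_num

theorem one_sub_exp_ne_zero {u : ℂ} (hu : u ≠ 0) (h : |u.im| < 2 * Real.pi) : 1 - exp u ≠ 0 := by
  intro h0
  obtain ⟨n, hn⟩ := exp_eq_one_iff.1 (sub_eq_zero.1 h0).symm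
  have h1 : u.im = n * (2 * Real.pi) := by rw [hn]; simp
  have hn0 : n ≠ 0 := by rintro rfl; simp at hn; exact hu hn
  have h2 : (1 : ℝ) ≤ |(n : ℝ)| := by exact_mod_cast Int.one_le_abs hn0
  rw [h1, abs_mul, abs_of_pos (by positivity : (0 : ℝ) < 2 * Real.pi)] at h
  nlinarith [Real.pi_pos]

theorem exp_neg_half_div (u : ℂ) : exp (-u / 2) / (1 - exp (-u)) = (2 * sinh (u / 2))⁻¹ := by
  have h : (2 * sinh (u / 2)) = (1 - exp (-u)) * exp (u / 2) := by
    rw [two_sinh, sub_mul, one_mul, ← exp_add]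
    ring_nf
  rw [h, mul_inv, div_eq_inv_mul, ← exp_neg]
  ring_nf

theorem integral_half_inv_sinh (w : ℂ) (y : ℝ) :
    ∫ x : ℝ, (2 * sinh ((x + y * I - w) / 2))⁻¹ =
      ∫ x : ℝ, (sinh (x + (((y - w.im) / 2 : ℝ) : ℂ) * I))⁻¹ := by
  have h : ∀ x : ℝ, (2 * sinh ((x + y * I - w) / 2))⁻¹ =
      (fun x : ℝ => (2 : ℂ)⁻¹ * (sinh (((x / 2 : ℝ) : ℂ) + (((y - w.im) / 2 : ℝ) : ℂ) * I))⁻¹)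
        (x - w.re) := by
    intro x
    simp only [mul_inv]
    congr 3
    apply Complex.ext <;> simp
  simp_rw [h]
  rw [integral_sub_right_eq_self (fun x : ℝ => (2 : ℂ)⁻¹ *
    (sinh (((x / 2 : ℝ) : ℂ) + (((y - w.im) / 2 : ℝ) : ℂ) * I))⁻¹) w.re, integral_const_mul,
    Measure.integral_comp_div (fun x : ℝ => (sinh ((x : ℂ) + (((y - w.im) / 2 : ℝ) : ℂ) * I))⁻¹) 2]
  simp

theorem csector_ray {φ θ : ℝ} (hφ : φ ∈ Ioo 0 Real.pi) (h : φ < θ) {t : ℝ} (ht : t ≠ 0) :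
    ray φ t ∈ csector θ := ⟨ray_ne_zero ht, by rwa [abs_arg_ray hφ ht]⟩

theorem IsCDecaying.cInt_div_sub {θ ψ : ℝ} {k : ℂ → ℂ} (hk : IsCDecaying θ k)
    (hψ : ψ ∈ Ioo 0 Real.pi) (hψθ : ψ < θ) {s : ℂ} (hs : s ≠ 0) (hsψ : |arg s| < ψ) :
    CInt ψ (fun p => k p / (p - s)) := by
  obtain ⟨c, hc, hdist⟩ := exists_dist_ge (abs_nonneg _) hsψ hψ.2.le
  have hU : {p : ℂ | p ≠ 0 ∧ |arg p| = ψ} ⊆ csector θ := fun p hp => ⟨hp.1, hp.2.trans_lt hψθ⟩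
  refine Tame.cInt (U := {p : ℂ | p ≠ 0 ∧ |arg p| = ψ}) ?_ (hk.tame_div hU hc ?_) ?_
  · refine (hk.diff.continuousOn.mono hU).div (by fun_prop) ?_
    rintro p hp h
    rw [sub_eq_zero.1 h] at hp
    exact hsψ.ne hp.2
  · exact fun p hp => (hdist s p hs hp.1 le_rfl hp.2.ge).2
  · exact fun t ht => ⟨ray_ne_zero ht, abs_arg_ray hψ ht⟩

/-- Cauchy's integral formula in a sector. -/
theorem IsCDecaying.cauchy_formula {θ ψ : ℝ} {k : ℂ → ℂ} (hk : IsCDecaying θ k)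
    (hψ : ψ ∈ Ioo 0 Real.pi) (hψθ : ψ < θ) (hθ : θ ≤ Real.pi) {s : ℂ} (hs : s ≠ 0)
    (hsψ : |arg s| < ψ) :
    cint ψ (fun p => k p / (p - s)) = 2 * Real.pi * k s := by
  set w := log s with hw
  have hws : exp w = s := exp_log hs
  have hwim : |w.im| < ψ := by rwa [hw, log_im]
  have hmaps : MapsTo exp {z | z.im ∈ Ioo (-θ) θ} (csector θ) := fun z hz =>
    ⟨exp_ne_zero z, by
      rw [arg_exp_of_mem ⟨by linarith [hz.1], by linarith [hz.2]⟩]; exact abs_lt.2 hz⟩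
  let N : ℂ → ℂ := fun z => k (exp z) - k s * exp (-(z - w) / 2)
  let d : ℂ → ℂ := fun z => 1 - exp (-(z - w))
  let G : ℂ → ℂ := fun z => dslope N w z / dslope d w z
  have hopen : IsOpen {z : ℂ | z.im ∈ Ioo (-θ) θ} := isOpen_Ioo.preimage Complex.continuous_im
  have hwmem : {z : ℂ | z.im ∈ Ioo (-θ) θ} ∈ 𝓝 w :=
    hopen.mem_nhds ⟨by linarith [neg_abs_le w.im], by linarith [le_abs_self w.im]⟩
  have hsub : {z : ℂ | z.im ∈ Icc (-ψ) ψ} ⊆ {z | z.im ∈ Ioo (-θ) θ} := fun z hz =>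
    ⟨by linarith [hz.1], by linarith [hz.2]⟩
  have hN : DifferentiableOn ℂ N {z | z.im ∈ Ioo (-θ) θ} :=
    (hk.diff.comp differentiable_exp.differentiableOn hmaps).sub (by fun_prop)
  have hd : Differentiable ℂ d := by fun_prop
  have hd0 : d w = 0 := by simp [d]
  have hN0 : N w = 0 := by simp [N, hws]
  have hdne : ∀ z : ℂ, z.im ∈ Icc (-ψ) ψ → z ≠ w → d z ≠ 0 := by
    intro z hz hzw
    refine one_sub_exp_ne_zero (neg_ne_zero.2 (sub_ne_zero.2 hzw)) ?_
    rw [neg_im, abs_neg, sub_im, abs_lt]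
    constructor <;> linarith [hz.1, hz.2, neg_abs_le w.im, le_abs_self w.im, hψ.2]
  have hG : ∀ z : ℂ, z ≠ w → G z = k (exp z) / d z - k s * (2 * sinh ((z - w) / 2))⁻¹ := by
    intro z hz
    have hz' := sub_ne_zero.2 hz
    simp only [G, dslope_of_ne _ hz, slope_def_field, hN0, hd0, sub_zero]
    rw [div_div_div_cancel_right₀ hz', ← exp_neg_half_div]
    simp only [N, d, sub_div, mul_div_assoc]
  have hGd : DifferentiableOn ℂ G {z | z.im ∈ Icc (-ψ) ψ} := by
    refine DifferentiableOn.div (((differentiableOn_dslope hwmem).2 hN).mono hsub)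
      (((differentiableOn_dslope univ_mem).2 hd.differentiableOn).mono (subset_univ _)) ?_
    intro z hz
    rcases eq_or_ne z w with rfl | hzw
    · rw [dslope_same]
      have : HasDerivAt d 1 w := by
        have := ((((hasDerivAt_id w).sub_const w).neg).cexp).const_sub 1
        simpa [d] using! this
      rw [this.deriv]
      exact one_ne_zero
    · rw [dslope_of_ne _ hzw, slope_def_field, hd0, sub_zero]
      exact div_ne_zero (hdne z hz hzw) (sub_ne_zero.2 hzw)
  obtain ⟨δ, hδ, C, hC, hb⟩ := hk.decay
  have hGb : ∀ z : ℂ, z.im ∈ Icc (-ψ) ψ → |w.re| + 2 ≤ |z.re| →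
      ‖G z‖ ≤ (2 * C + ‖k s‖ * (2 * Real.exp (|w.re| / 2))) *
        Real.exp (-(min δ (1 / 2)) * |z.re|) := by
    intro z hz hR
    have hre : |z.re| - |w.re| ≤ |(z - w).re| := by
      rw [sub_re]; exact abs_sub_abs_le_abs_sub _ _
    rw [hG z (by rintro rfl; linarith)]
    have e1 : ‖k (exp z) / d z‖ ≤ 2 * C * Real.exp (-(min δ (1 / 2)) * |z.re|) := by
      rw [div_eq_mul_inv, norm_mul]
      have h1 := hb _ (hmaps (hsub hz))
      rw [Complex.norm_exp, twoPow_exp] at h1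
      have h2 : ‖(d z)⁻¹‖ ≤ 2 := norm_inv_one_sub_exp_le (by rw [neg_re, abs_neg]; linarith)
      have h3 : Real.exp (-δ * |z.re|) ≤ Real.exp (-(min δ (1 / 2)) * |z.re|) := by
        gcongr; exact min_le_left _ _
      calc _ ≤ (C * Real.exp (-δ * |z.re|)) * 2 := by gcongr
        _ ≤ (C * Real.exp (-(min δ (1 / 2)) * |z.re|)) * 2 := by gcongr
        _ = _ := by ring
    have e2 : ‖(2 * sinh ((z - w) / 2))⁻¹‖ ≤
        (2 * Real.exp (|w.re| / 2)) * Real.exp (-(min δ (1 / 2)) * |z.re|) := by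
      have h0 : ((z - w) / 2).re = (z - w).re / 2 := by simp
      have h1 : 1 ≤ |((z - w) / 2).re| := by
        rw [h0, abs_div, abs_two]; linarith
      have h2 := inv_sinh_bound h1
      have h3 : 0 < |Real.sinh ((z - w) / 2).re| := by
        rw [abs_pos, Ne, Real.sinh_eq_zero]
        intro h; rw [h] at h1; simp at h1; linarith
      have h4 : ‖(sinh ((z - w) / 2))⁻¹‖ ≤ 4 * Real.exp (-1 * |((z - w) / 2).re|) := by
        rw [norm_inv]
        refine le_trans ?_ h2
        gcongr
        exact norm_sinh_ge _
      rw [mul_inv, norm_mul, norm_inv, Complex.norm_ofNat]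
      calc _ ≤ (2 : ℝ)⁻¹ * (4 * Real.exp (-1 * |((z - w) / 2).re|)) := by gcongr
        _ = 2 * Real.exp (-1 * |((z - w) / 2).re|) := by ring
        _ ≤ 2 * (Real.exp (|w.re| / 2) * Real.exp (-(min δ (1 / 2)) * |z.re|)) := by
            rw [← Real.exp_add, h0, abs_div, abs_two]
            gcongr
            nlinarith [min_le_right δ (1 / 2), abs_nonneg z.re]
        _ = _ := by ring
    calc _ ≤ ‖k (exp z) / d z‖ + ‖k s * (2 * sinh ((z - w) / 2))⁻¹‖ := norm_sub_le _ _
      _ ≤ 2 * C * Real.exp (-(min δ (1 / 2)) * |z.re|) + ‖k s‖ *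
          ((2 * Real.exp (|w.re| / 2)) * Real.exp (-(min δ (1 / 2)) * |z.re|)) := by
          rw [norm_mul]; gcongr
      _ = _ := by ring
  have hδ' : 0 < min δ (1 / 2) := lt_min hδ (by norm_num)
  have hψψ : -ψ ≤ ψ := by linarith [hψ.1]
  have hstrip := integral_strip _ hψψ hGd hδ' hGb
  obtain ⟨C', hGb'⟩ := exists_bound_strip hGd hGb
  have hline : ∀ y : ℝ, |y| = ψ → Integrable (fun x : ℝ =>
      (sinh (x + (((y - w.im) / 2 : ℝ) : ℂ) * I))⁻¹) →
      ∫ x : ℝ, logPull (fun p => k p / (p - s)) (x + y * I) =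
      (∫ x : ℝ, G (x + y * I)) + k s * ∫ x : ℝ, (sinh (x + (((y - w.im) / 2 : ℝ) : ℂ) * I))⁻¹ := by
    intro y hy hint
    have hym : y ∈ Icc (-ψ) ψ := abs_le.1 hy.le
    rw [← integral_half_inv_sinh, ← integral_const_mul, ← integral_add]
    · congr 1
      funext x
      have hzw : (x : ℂ) + y * I ≠ w := by
        rintro h
        rw [← h] at hwim
        simp at hwim
        exact hwim.ne hy
      rw [hG _ hzw, sub_add_cancel, logPull, smul_eq_mul]
      have : exp (x + y * I) - s = exp (x + y * I) * d (x + y * I) := by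
        simp only [d]
        rw [mul_sub, ← exp_add, mul_one, ← hws]
        ring_nf
      rw [this, ← mul_div_assoc, mul_div_mul_left _ _ (exp_ne_zero _)]
    · exact integrable_strip hGd hδ' hGb' hym
    · refine Integrable.const_mul ?_ _
      have h := ((hint.comp_div (two_ne_zero)).comp_sub_right w.re).const_mul (2 : ℂ)⁻¹
      refine h.congr (.of_forall fun x => ?_)
      simp only [mul_inv]
      congr 3
      apply Complex.ext <;> simp
  have hy1 : (ψ - w.im) / 2 ∈ Ioo 0 Real.pi :=
    ⟨by linarith [le_abs_self w.im], by linarith [neg_abs_le w.im, hψ.2]⟩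
  have hy2 : (-ψ - w.im) / 2 ∈ Ioo (-Real.pi) 0 :=
    ⟨by linarith [le_abs_self w.im, hψ.2], by linarith [neg_abs_le w.im]⟩
  rw [cint_eq (hk.cInt_div_sub hψ hψθ hs hsψ),
    hline (-ψ) (by rw [abs_neg, abs_of_pos hψ.1]) (integrable_inv_sinh_neg hy2),
    hline ψ (abs_of_pos hψ.1) (integrable_inv_sinh hy1),
    integral_inv_sinh hy1, integral_inv_sinh_neg hy2, hstrip, smul_eq_mul]
  field_simp
  ring

end CauchyFormula

/-! ### The functional calculus of a pair of commuting resolvents -/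

section ResolventPair

open Complex Filter Topology

variable {M : Type*} [NormedAddCommGroup M] [NormedSpace ℂ M] [CompleteSpace M]

theorem IsCDecaying.cint_div_sub_eq_zero {θ φ : ℝ} {h : ℂ → ℂ} (hh : IsCDecaying θ h)
    (hφ : φ ∈ Ioo 0 Real.pi) (hφθ : φ < θ) {p : ℂ} (hp : p ≠ 0) (hpφ : φ < |arg p|) :
    cint φ (fun s => h s / (p - s)) = 0 := by
  obtain ⟨c, hc, hdist⟩ := exists_dist_ge hφ.1.le hpφ (abs_arg_le_pi p)
  have hU : {z : ℂ | z ≠ 0 ∧ |arg z| ≤ φ} ⊆ csector θ := fun z hz => ⟨hz.1, hz.2.trans_lt hφθ⟩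
  refine cint_eq_zero hφ ?_ (hh.tame_div hU hc fun z hz => (hdist z p hz.1 hp hz.2 le_rfl).1)
  refine (hh.diff.mono hU).div (by fun_prop) fun z hz h0 => ?_
  rw [← sub_eq_zero.1 h0] at hz
  exact hpφ.not_ge hz.2

theorem IsCDecaying.integrable_ray_div {θ φ : ℝ} {h : ℂ → ℂ} (hh : IsCDecaying θ h)
    (hφ : φ ∈ Ioo 0 Real.pi) (hφθ : φ < θ) :
    Integrable fun t : ℝ => rayWeight φ t * (h (ray φ t) / t) := by
  have hU : {z : ℂ | z ≠ 0 ∧ |arg z| = φ} ⊆ csector θ := fun z hz => ⟨hz.1, hz.2.trans_lt hφθ⟩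
  have hr : ∀ t ≠ 0, ray φ t ∈ {z : ℂ | z ≠ 0 ∧ |arg z| = φ} := fun t ht =>
    ⟨ray_ne_zero ht, abs_arg_ray hφ ht⟩
  obtain ⟨δ, hδ, C, hC, hb⟩ := hh.decay
  refine Integrable.mono' ((integrable_twoPow hδ).const_mul C) ?_ ?_
  · refine (measurable_rayWeight φ).aestronglyMeasurable.mul ?_
    simp only [div_eq_mul_inv]
    exact (aestronglyMeasurable_comp_ray (hh.diff.continuousOn.mono hU) hr).mul
      (measurable_ofReal.inv.aestronglyMeasurable)
  · refine ae_ne_zero_real.mono fun t ht => ?_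
    have h1 : 0 < |t| := abs_pos.2 ht
    rw [norm_mul, norm_rayWeight, one_mul, norm_div, norm_real, Real.norm_eq_abs,
      ← twoPow_div δ h1, ← mul_div_assoc]
    gcongr
    simpa using hb _ (hU (hr t ht))

/-- The interchange of two contour integrals behind the product rules. -/
theorem cint_cint_quotient {θ φ ψ : ℝ} {h k : ℂ → ℂ} {K : ℂ → M} (hh : IsCDecaying θ h)
    (hk : IsCDecaying θ k) (hφ : 0 < φ) (hφψ : φ < ψ) (hψθ : ψ < θ) (hθ : θ ≤ Real.pi)
    (hhK : CInt φ fun s => h s • K s) (hkK : CInt ψ fun p => k p • K p) :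
    cint φ (fun s => h s • cint ψ (fun p => (p - s)⁻¹ • k p • (K s - K p))) =
      (2 * Real.pi : ℂ) • cint φ (fun s => (k s * h s) • K s) := by
  have hφ' : φ ∈ Ioo 0 Real.pi := ⟨hφ, by linarith⟩
  have hψ' : ψ ∈ Ioo 0 Real.pi := ⟨by linarith, by linarith⟩
  obtain ⟨c, hc, hdist⟩ := exists_dist_ge hφ.le hφψ hψ'.2.le
  have hd : ∀ t τ : ℝ, c * |t| ≤ ‖ray ψ τ - ray φ t‖ ∧ c * |τ| ≤ ‖ray ψ τ - ray φ t‖ := by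
    intro t τ
    rcases eq_or_ne t 0 with rfl | ht
    · have : c * |τ| ≤ |τ| := by
        refine mul_le_of_le_one_left (abs_nonneg _) ?_
        have h0 : Tendsto (fun r : ℝ => ‖ray ψ 1 - ray φ r‖) (𝓝[>] 0) (𝓝 ‖ray ψ 1 - ray φ 0‖) :=
          ((continuous_const.sub (continuous_ray φ)).norm.tendsto 0).mono_left inf_le_left
        have h1 := ge_of_tendsto h0 (b := c) (by
          filter_upwards [self_mem_nhdsWithin] with r hr
          have := (hdist (ray φ r) (ray ψ 1) (ray_ne_zero (ne_of_gt hr)) (ray_ne_zero one_ne_zero)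
            (abs_arg_ray hφ' (ne_of_gt hr)).le (abs_arg_ray hψ' one_ne_zero).ge).2
          simpa using this)
        have h2 : ray φ 0 = 0 := by simp [ray]
        rw [h2, sub_zero, norm_ray, abs_one] at h1
        linarith
      have h2 : ray φ 0 = 0 := by simp [ray]
      rw [h2, sub_zero, norm_ray, abs_zero, mul_zero]
      exact ⟨abs_nonneg _, this⟩
    rcases eq_or_ne τ 0 with rfl | hτ
    · have : c * |t| ≤ |t| := by
        refine mul_le_of_le_one_left (abs_nonneg _) ?_
        have h0 : Tendsto (fun r : ℝ => ‖ray ψ r - ray φ 1‖) (𝓝[>] 0) (𝓝 ‖ray ψ 0 - ray φ 1‖) :=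
          (((continuous_ray ψ).sub continuous_const).norm.tendsto 0).mono_left inf_le_left
        have h1 := ge_of_tendsto h0 (b := c) (by
          filter_upwards [self_mem_nhdsWithin] with r hr
          have := (hdist (ray φ 1) (ray ψ r) (ray_ne_zero one_ne_zero) (ray_ne_zero (ne_of_gt hr))
            (abs_arg_ray hφ' one_ne_zero).le (abs_arg_ray hψ' (ne_of_gt hr)).ge).1
          simpa using this)
        have h2 : ray ψ 0 = 0 := by simp [ray]
        rw [h2, zero_sub, norm_neg, norm_ray, abs_one] at h1
        exact h1
      have h2 : ray ψ 0 = 0 := by simp [ray]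
      rw [h2, zero_sub, norm_neg, norm_ray, abs_zero, mul_zero]
      exact ⟨this, abs_nonneg _⟩
    simpa using hdist (ray φ t) (ray ψ τ) (ray_ne_zero ht) (ray_ne_zero hτ)
      (abs_arg_ray hφ' ht).le (abs_arg_ray hψ' hτ).ge
  -- the second half of the inner integral
  let B : ℂ → M := fun s => cint ψ fun p => (p - s)⁻¹ • k p • K p
  have hB : ∀ t ≠ 0, CInt ψ fun p => (p - ray φ t)⁻¹ • k p • K p := by
    intro t ht
    have := Integrable.bdd_smul hkK (c * |t|)⁻¹
      (φ := fun τ : ℝ => (ray ψ τ - ray φ t)⁻¹) ?_ (.of_forall fun τ => ?_)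
    · exact Integrable.congr this (.of_forall fun τ => smul_comm _ _ _)
    · exact ((((continuous_ray ψ).sub continuous_const).measurable).inv).aestronglyMeasurable
    · rw [norm_inv]
      have := abs_pos.2 ht
      exact inv_anti₀ (by positivity) (hd t τ).1
  have hinner : ∀ t ≠ 0, cint ψ (fun p => (p - ray φ t)⁻¹ • k p • (K (ray φ t) - K p)) =
      (2 * Real.pi * k (ray φ t)) • K (ray φ t) - B (ray φ t) := by
    intro t ht
    have harg := abs_arg_ray hφ' ht
    have h1 := hk.cInt_div_sub hψ' hψθ (ray_ne_zero ht) (harg.trans_lt hφψ)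
    have h2 : CInt ψ fun p => (k p / (p - ray φ t)) • K (ray φ t) := by
      have := h1.smul_const (K (ray φ t))
      simpa only [CInt, smul_assoc] using this
    rw [← hk.cauchy_formula hψ' hψθ hθ (ray_ne_zero ht) (harg.trans_lt hφψ)]
    have h3 : cint ψ (fun p => k p / (p - ray φ t)) • K (ray φ t) =
        cint ψ fun p => (k p / (p - ray φ t)) • K (ray φ t) := by
      simp only [cint]
      rw [← integral_smul_const]
      simp only [smul_assoc]
    rw [h3, ← cint_sub h2 (hB t ht)]
    refine cint_congr fun τ _ => ?_
    rw [smul_sub, smul_sub, smul_smul, div_eq_inv_mul]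
  -- the double integral
  have hF : Integrable (Function.uncurry fun t τ : ℝ => (rayWeight φ t * h (ray φ t)) •
      (rayWeight ψ τ • (ray ψ τ - ray φ t)⁻¹ • k (ray ψ τ) • K (ray ψ τ)))
      (volume.prod volume) := by
    have h1 := (hh.integrable_ray_div hφ' (by linarith)).smul_prod hkK
    have h2 := Integrable.bdd_smul h1 c⁻¹
      (φ := fun x : ℝ × ℝ => (x.1 : ℂ) * (ray ψ x.2 - ray φ x.1)⁻¹) ?_ (.of_forall fun x => ?_)
    · refine h2.congr ?_
      have hne : ∀ᵐ x : ℝ × ℝ ∂(volume.prod volume), x.1 ≠ 0 :=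
        Measure.quasiMeasurePreserving_fst.ae ae_ne_zero_real
      refine hne.mono fun x hx => ?_
      have hx' : (x.1 : ℂ) ≠ 0 := ofReal_ne_zero.2 hx
      simp only [Function.uncurry, smul_smul, Pi.smul_apply']
      congr 1
      field_simp
    · refine Measurable.aestronglyMeasurable ?_
      have m1 := (continuous_ray ψ).measurable
      have m2 := (continuous_ray φ).measurable
      exact (measurable_ofReal.comp measurable_fst).mul
        (((m1.comp measurable_snd).sub (m2.comp measurable_fst)).inv)
    · rcases eq_or_ne x.1 0 with h0 | h0
      · simp [h0, hc.le]
      have hx := abs_pos.2 h0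
      rw [norm_mul, norm_inv, norm_real, Real.norm_eq_abs]
      calc _ ≤ |x.1| * (c * |x.1|)⁻¹ := by gcongr; exact (hd x.1 x.2).1
        _ = _ := by field_simp
  have hBint : CInt φ fun s => h s • B s := by
    refine hF.integral_prod_left.congr (.of_forall fun t => ?_)
    simp only [Function.uncurry, B, cint]
    rw [integral_smul, mul_smul]
  have hBzero : cint φ (fun s => h s • B s) = 0 := by
    have e1 : cint φ (fun s => h s • B s) = ∫ t : ℝ, ∫ τ : ℝ, (rayWeight φ t * h (ray φ t)) •
      (rayWeight ψ τ • (ray ψ τ - ray φ t)⁻¹ • k (ray ψ τ) • K (ray ψ τ)) := by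
      simp only [cint, B]
      congr 1
      funext t
      rw [integral_smul, mul_smul]
    rw [e1, integral_integral_swap hF]
    refine integral_eq_zero_of_ae (ae_ne_zero_real.mono fun τ hτ => ?_)
    have harg := abs_arg_ray hψ' hτ
    have e2 := hh.cint_div_sub_eq_zero hφ' (by linarith) (ray_ne_zero hτ) (harg.symm ▸ hφψ)
    have e3 : ∀ t : ℝ, (rayWeight φ t * h (ray φ t)) •
        (rayWeight ψ τ • (ray ψ τ - ray φ t)⁻¹ • k (ray ψ τ) • K (ray ψ τ)) =
        (rayWeight φ t • (h (ray φ t) / (ray ψ τ - ray φ t))) •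
          (rayWeight ψ τ • k (ray ψ τ) • K (ray ψ τ)) := by
      intro t
      simp only [smul_smul, smul_eq_mul]
      congr 1
      field_simp
    simp only [e3]
    rw [integral_smul_const]
    simp only [cint] at e2
    rw [e2, zero_smul, Pi.zero_apply]
  obtain ⟨Ck, -, hCk⟩ := hk.bounded
  have hkhK : CInt φ fun s => (k s * h s) • K s := by
    have hU : ∀ t ≠ 0, ray φ t ∈ csector θ := fun t ht => csector_ray hφ' (by linarith) ht
    have := Integrable.bdd_smul hhK Ck (aestronglyMeasurable_comp_ray hk.diff.continuousOn hU)
      (ae_ne_zero_real.mono fun t ht => hCk _ (hU t ht))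
    exact Integrable.congr this (.of_forall fun t => by
      simp only [Pi.smul_apply', smul_smul, mul_left_comm])
  calc _ = cint φ (fun s => (2 * Real.pi : ℂ) • (k s * h s) • K s - h s • B s) := by
        refine cint_congr fun t ht => ?_
        rw [hinner t ht, smul_sub, smul_smul, smul_smul]
        congr 2
        ring
    _ = _ := by rw [cint_sub (hkhK.smul _) hBint, hBzero, sub_zero, cint_smul]

end ResolventPair

section ResolventPair

open Complex Filter Topology

/-- The complement of the closed planar sector of half-angle `ω`. -/
def coSector (ω : ℝ) : Set ℂ := {z | z ≠ 0 ∧ ω < |arg z|}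

theorem lt_abs_arg_iff {φ : ℝ} (hφ : φ ∈ Icc 0 Real.pi) {z : ℂ} (hz : z ≠ 0) :
    φ < |arg z| ↔ z.re < Real.cos φ * ‖z‖ := by
  have h1 : 0 < ‖z‖ := norm_pos_iff.2 hz
  rw [← div_lt_iff₀ h1, ← cos_arg hz, ← Real.cos_abs (arg z)]
  exact (Real.strictAntiOn_cos.lt_iff_gt ⟨abs_nonneg _, abs_arg_le_pi z⟩ hφ).symm

theorem isOpen_coSector {ω : ℝ} (hω : ω ∈ Icc 0 Real.pi) : IsOpen (coSector ω) := by
  have : coSector ω = {z : ℂ | z ≠ 0} ∩ {z | z.re < Real.cos ω * ‖z‖} := by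
    ext z
    exact and_congr_right fun hz => lt_abs_arg_iff hω hz
  rw [this]
  exact isOpen_ne.inter (isOpen_lt Complex.continuous_re (by fun_prop))

variable {M : Type*} [NormedAddCommGroup M] [NormedSpace ℂ M]
variable {N : Type*} [NormedAddCommGroup N] [NormedSpace ℂ N]

/-- A power bound that is uniform outside of all larger sectors. -/
def PowBound (ω a b : ℝ) (W : ℂ → N) : Prop :=
  ∀ φ ∈ Ioo ω Real.pi, ∃ C ≥ 0, ∀ z : ℂ, z ≠ 0 → φ ≤ |arg z| → ‖W z‖ ≤ C * twoPow a b ‖z‖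

theorem PowBound.mono {ω a b c d : ℝ} {W : ℂ → N} (h : PowBound ω a b W) (h1 : c ≤ a)
    (h2 : b ≤ d) : PowBound ω c d W := by
  intro φ hφ
  obtain ⟨C, hC, hb⟩ := h φ hφ
  exact ⟨C, hC, fun z hz hz' => (hb z hz hz').trans
    (mul_le_mul_of_nonneg_left (twoPow_le_twoPow (norm_pos_iff.2 hz) h1 h2) hC)⟩

theorem PowBound.mul {A : Type*} [NormedRing A] {ω a b c d : ℝ} {W X : ℂ → A}
    (h : PowBound ω a b W) (h' : PowBound ω c d X) :
    PowBound ω (a + c) (b + d) (fun z => W z * X z) := by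
  intro φ hφ
  obtain ⟨C, hC, hb⟩ := h φ hφ
  obtain ⟨C', hC', hb'⟩ := h' φ hφ
  refine ⟨C * C', by positivity, fun z hz hz' => (norm_mul_le _ _).trans ?_⟩
  rw [← twoPow_mul (norm_pos_iff.2 hz)]
  calc _ ≤ (C * twoPow a b ‖z‖) * (C' * twoPow c d ‖z‖) := by
        gcongr
        · exact mul_nonneg hC (twoPow_nonneg (norm_nonneg _))
        · exact hb z hz hz'
        · exact hb' z hz hz'
    _ = _ := by ring

/-- Holomorphic kernels whose products with functions in `Ψ^{3α,β}` are integrable. -/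
structure IsKernel (α β ω : ℝ) (W : ℂ → N) : Prop where
  diff : DifferentiableOn ℂ W (coSector ω)
  bound : PowBound ω (-(3 * α)) (-β) W

/-- The space `Ψ^{3α,β}` of a planar sector. -/
structure IsCGood (α β θ : ℝ) (k : ℂ → ℂ) : Prop where
  diff : DifferentiableOn ℂ k (csector θ)
  decay : ∃ δ > 0, ∃ C ≥ 0, ∀ z ∈ csector θ, ‖k z‖ ≤ C * twoPow (3 * α - 1 + δ) (β - 1 - δ) ‖z‖

theorem IsCGood.isCDecaying {α β θ : ℝ} {k : ℂ → ℂ} (hk : IsCGood α β θ k) (hα : 1 / 3 ≤ α)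
    (hβ : β ≤ 1) : IsCDecaying θ k := by
  obtain ⟨δ, hδ, C, hC, hb⟩ := hk.decay
  exact ⟨hk.diff, δ, hδ, C, hC, fun z hz => (hb z hz).trans (mul_le_mul_of_nonneg_left
    (twoPow_le_twoPow (norm_pos_iff.2 hz.1) (by linarith) (by linarith)) hC)⟩

theorem IsCGood.tame_smul {α β θ ω φ : ℝ} {k : ℂ → ℂ} {W : ℂ → N} (hk : IsCGood α β θ k)
    (hW : IsKernel α β ω W) (hφ : φ ∈ Ioo ω Real.pi) :
    Tame (csector θ ∩ {z | φ ≤ |arg z|}) (fun z => k z • W z) := by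
  obtain ⟨δ, hδ, C, hC, hb⟩ := hk.decay
  obtain ⟨C', hC', hb'⟩ := hW.bound φ hφ
  refine ⟨δ, hδ, C * C', by positivity, fun z hz => ?_⟩
  have hz0 := norm_pos_iff.2 hz.1.1
  have e : twoPow (-1 + δ) (-1 - δ) ‖z‖ =
      twoPow (3 * α - 1 + δ) (β - 1 - δ) ‖z‖ * twoPow (-(3 * α)) (-β) ‖z‖ := by
    rw [twoPow_mul hz0]; ring_nf
  rw [norm_smul, e]
  calc _ ≤ (C * twoPow (3 * α - 1 + δ) (β - 1 - δ) ‖z‖) * (C' * twoPow (-(3 * α)) (-β) ‖z‖) := by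
        gcongr
        · exact mul_nonneg hC (twoPow_nonneg (norm_nonneg _))
        · exact hb z hz.1
        · exact hb' z hz.1.1 hz.2
    _ = _ := by ring

theorem IsCGood.diff_smul {α β θ ω φ : ℝ} {k : ℂ → ℂ} {W : ℂ → N} (hk : IsCGood α β θ k)
    (hW : IsKernel α β ω W) (hφ : ω < φ) :
    DifferentiableOn ℂ (fun z => k z • W z) (csector θ ∩ {z | φ ≤ |arg z|}) :=
  (hk.diff.mono inter_subset_left).smul
    (hW.diff.mono fun _ hz => ⟨hz.1.1, hφ.trans_le hz.2⟩)

theorem IsCGood.cInt {α β θ ω φ : ℝ} {k : ℂ → ℂ} {W : ℂ → N} (hk : IsCGood α β θ k)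
    (hW : IsKernel α β ω W) (hω : 0 ≤ ω) (hθ : θ ≤ Real.pi) (hφ : φ ∈ Ioo ω θ) :
    CInt φ (fun z => k z • W z) := by
  have hφ' : φ ∈ Ioo 0 Real.pi := ⟨hω.trans_lt hφ.1, hφ.2.trans_le hθ⟩
  refine (hk.tame_smul hW ⟨hφ.1, hφ'.2⟩).cInt (hk.diff_smul hW hφ.1).continuousOn fun t ht => ?_
  exact ⟨csector_ray hφ' hφ.2 ht, (abs_arg_ray hφ' ht).ge⟩

theorem IsCGood.cint_eq_cint [CompleteSpace N] {α β θ ω φ ψ : ℝ} {k : ℂ → ℂ} {W : ℂ → N}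
    (hk : IsCGood α β θ k) (hW : IsKernel α β ω W) (hω : 0 ≤ ω) (hθ : θ ≤ Real.pi)
    (hφ : φ ∈ Ioo ω θ) (hψ : ψ ∈ Ioo ω θ) :
    cint φ (fun z => k z • W z) = cint ψ (fun z => k z • W z) := by
  have hmin : min φ ψ ∈ Ioo ω Real.pi := ⟨lt_min hφ.1 hψ.1, (min_le_left _ _).trans_lt (hφ.2.trans_le hθ)⟩
  exact QuatCalculus.cint_eq_cint ⟨hω.trans_lt hφ.1, hφ.2.trans_le hθ⟩
    ⟨hω.trans_lt hψ.1, hψ.2.trans_le hθ⟩ (hk.diff_smul hW hmin.1) (hk.tame_smul hW hmin)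
    fun z hz h1 h2 => ⟨⟨hz, h2.trans_lt (max_lt hφ.2 hψ.2)⟩, h1⟩

/-- Two commuting (pseudo-)resolvents outside of a sector, with power bounds. -/
structure IsResolventPair (α β ω : ℝ) (R S : ℂ → M →L[ℂ] M) : Prop where
  res_fst : ∀ s ∈ coSector ω, ∀ p ∈ coSector ω, R s - R p = (p - s) • (R s * R p)
  res_snd : ∀ s ∈ coSector ω, ∀ p ∈ coSector ω, S s - S p = (p - s) • (S s * S p)
  comm : ∀ s ∈ coSector ω, ∀ p ∈ coSector ω, R s * S p = S p * R s
  bound_fst : PowBound ω (-α) (-β) R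
  bound_snd : PowBound ω (-α) (-β) S

theorem differentiableOn_of_resolvent {A : Type*} [NormedRing A] [NormedAlgebra ℂ A]
    {a b ω : ℝ} (hω : ω ∈ Ico 0 Real.pi) {R : ℂ → A}
    (hR : ∀ s ∈ coSector ω, ∀ p ∈ coSector ω, R s - R p = (p - s) • (R s * R p))
    (hb : PowBound ω a b R) : DifferentiableOn ℂ R (coSector ω) := by
  intro s hs
  have hΩ := (isOpen_coSector ⟨hω.1, hω.2.le⟩).mem_nhds hs
  obtain ⟨φ, hφ1, hφ2⟩ := exists_between hs.2
  have hφπ : φ < Real.pi := hφ2.trans_le (abs_arg_le_pi s)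
  obtain ⟨C, hC, hb⟩ := hb φ ⟨hφ1, hφπ⟩
  have hφΩ : coSector φ ∈ 𝓝 s :=
    (isOpen_coSector ⟨hω.1.trans hφ1.le, hφπ.le⟩).mem_nhds ⟨hs.1, hφ2⟩
  have hcont : ContinuousAt R s := by
    have h0 : Tendsto (fun z => ‖z - s‖ * ((C * twoPow a b ‖z‖) * ‖R s‖)) (𝓝 s) (𝓝 0) := by
      have h1 : ContinuousAt (fun z : ℂ => twoPow a b ‖z‖) s :=
        continuous_twoPow_norm.continuousAt (isOpen_compl_singleton.mem_nhds hs.1)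
      have h2 : ContinuousAt (fun z => ‖z - s‖ * ((C * twoPow a b ‖z‖) * ‖R s‖)) s := by fun_prop
      simpa [ContinuousAt] using h2
    rw [ContinuousAt, tendsto_iff_norm_sub_tendsto_zero]
    refine squeeze_zero' (.of_forall fun _ => norm_nonneg _) ?_ h0
    filter_upwards [hΩ, hφΩ] with z hz hz'
    rw [hR z hz s hs, norm_smul, norm_sub_rev]
    gcongr
    refine (norm_mul_le _ _).trans ?_
    gcongr
    exact hb z hz.1 hz'.2.le
  have : HasDerivAt R (-(R s * R s)) s := by
    rw [hasDerivAt_iff_tendsto_slope]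
    have h1 : Tendsto (fun z => -(R z * R s)) (𝓝[≠] s) (𝓝 (-(R s * R s))) :=
      ((hcont.mul continuousAt_const).neg).mono_left inf_le_left
    refine h1.congr' ?_
    filter_upwards [self_mem_nhdsWithin, nhdsWithin_le_nhds hΩ] with z hz hz'
    rw [slope_def_module, hR z hz' s hs, smul_smul, ← neg_sub z s, mul_neg,
      inv_mul_cancel₀ (sub_ne_zero.2 hz), neg_one_smul]
  exact this.differentiableAt.differentiableWithinAt

/-- The product rule for integrals of kernels, in terms of a factorization of the difference
quotient of the kernel `W`. -/
theorem sum_cint_cint [CompleteSpace M] {ι : Type*} [Fintype ι] {A B : ι → ℂ → M →L[ℂ] M}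
    {W : ℂ → M →L[ℂ] M} {x : M} {h k : ℂ → ℂ} {θ ω φ ψ : ℝ} (hh : IsCDecaying θ h)
    (hk : IsCDecaying θ k) (hω : 0 ≤ ω) (hφ : ω < φ) (hφψ : φ < ψ) (hψθ : ψ < θ)
    (hθ : θ ≤ Real.pi) (hA : ∀ i, CInt ψ fun p => k p • A i p) (hB : ∀ i, CInt φ fun s => h s • B i s x)
    (hWk : CInt ψ fun p => k p • W p) (hWh : CInt φ fun s => h s • W s x)
    (hid : ∀ s ∈ coSector ω, ∀ p ∈ coSector ω, p ≠ s →
      ∑ i, A i p (B i s x) = (p - s)⁻¹ • (W s x - W p x)) :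
    ∑ i, cint ψ (fun p => k p • A i p) (cint φ fun s => h s • B i s x) =
      (2 * Real.pi : ℂ) • cint φ (fun s => (k s * h s) • W s x) := by
  have hφ' : φ ∈ Ioo 0 Real.pi := ⟨by linarith, by linarith⟩
  have hψ' : ψ ∈ Ioo 0 Real.pi := ⟨by linarith, by linarith⟩
  have hAx : ∀ i (y : M), CInt ψ fun p => k p • A i p y := fun i y =>
    (hA i).clm_comp (ContinuousLinearMap.apply ℂ M y)
  have hAy : ∀ i (y : M), cint ψ (fun p => k p • A i p) y = cint ψ fun p => k p • A i p y :=
    fun i y => (ContinuousLinearMap.cint_comp (ContinuousLinearMap.apply ℂ M y) (hA i)).symm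
  have hWk' : CInt ψ fun p => k p • W p x := hWk.clm_comp (ContinuousLinearMap.apply ℂ M x)
  rw [← cint_cint_quotient hh hk hφ'.1 hφψ hψθ hθ hWh hWk']
  have h1 : ∀ i, CInt φ fun s => h s • cint ψ (fun p => k p • A i p (B i s x)) := fun i => by
    refine CInt.congr ((hB i).clm_comp (cint ψ fun p => k p • A i p)) fun t _ => ?_
    rw [map_smul, hAy]
  calc _ = ∑ i, cint φ fun s => h s • cint ψ (fun p => k p • A i p (B i s x)) := by
        refine Finset.sum_congr rfl fun i _ => ?_
        rw [← ContinuousLinearMap.cint_comp _ (hB i)]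
        refine cint_congr fun t _ => ?_
        rw [map_smul, hAy]
    _ = cint φ fun s => ∑ i, h s • cint ψ (fun p => k p • A i p (B i s x)) := by
        simp only [cint, Finset.smul_sum]
        exact (integral_finsetSum _ fun i _ => h1 i).symm
    _ = _ := by
        refine cint_congr fun t ht => ?_
        rw [← Finset.smul_sum]
        congr 1
        have : ∑ i, cint ψ (fun p => k p • A i p (B i (ray φ t) x)) =
            cint ψ fun p => ∑ i, k p • A i p (B i (ray φ t) x) := by
          simp only [cint, Finset.smul_sum]
          exact (integral_finsetSum _ fun i _ => hAx i _).symm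
        rw [this]
        refine cint_congr fun τ hτ => ?_
        have hs : ray φ t ∈ coSector ω := ⟨ray_ne_zero ht, by rwa [abs_arg_ray hφ' ht]⟩
        have hp : ray ψ τ ∈ coSector ω := ⟨ray_ne_zero hτ, by rw [abs_arg_ray hψ' hτ]; linarith⟩
        have hne : ray ψ τ ≠ ray φ t := by
          intro h0
          have := abs_arg_ray hψ' hτ
          rw [h0, abs_arg_ray hφ' ht] at this
          exact hφψ.ne this
        rw [← Finset.smul_sum, hid _ hs _ hp hne]
        simp only [smul_sub, smul_smul]
        congr 2 <;> ring

namespace IsResolventPair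

variable {α β ω : ℝ} {R S : ℂ → M →L[ℂ] M}

theorem symm (h : IsResolventPair α β ω R S) : IsResolventPair α β ω S R :=
  ⟨h.res_snd, h.res_fst, fun s hs p hp => (h.comm p hp s hs).symm, h.bound_snd, h.bound_fst⟩

theorem mul_eq (h : IsResolventPair α β ω R S) {s p : ℂ} (hs : s ∈ coSector ω)
    (hp : p ∈ coSector ω) (hne : p ≠ s) : R p * R s = (p - s)⁻¹ • (R s - R p) := by
  have h1 := h.res_fst p hp s hs
  rw [← neg_sub (R p), h1, ← neg_sub p s, neg_smul, neg_neg, smul_smul,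
    inv_mul_cancel₀ (sub_ne_zero.2 hne), one_smul]

theorem comm_self (h : IsResolventPair α β ω R S) {s p : ℂ} (hs : s ∈ coSector ω)
    (hp : p ∈ coSector ω) : R p * R s = R s * R p := by
  rcases eq_or_ne p s with rfl | hne
  · rfl
  rw [h.mul_eq hs hp hne, h.mul_eq hp hs hne.symm, ← neg_sub p s, inv_neg, neg_smul, ← smul_neg,
    neg_sub]

section Kernels

variable (hω : ω ∈ Ico 0 Real.pi) (hα : 0 ≤ α) (hβ : 0 ≤ β)
include hω hα hβ

theorem kernel_fst (h : IsResolventPair α β ω R S) : IsKernel α β ω R :=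
  ⟨differentiableOn_of_resolvent hω h.res_fst h.bound_fst,
    h.bound_fst.mono (by linarith) le_rfl⟩

theorem kernel_mul (h : IsResolventPair α β ω R S) : IsKernel α β ω (fun z => R z * S z) :=
  ⟨(h.kernel_fst hω hα hβ).diff.mul (h.symm.kernel_fst hω hα hβ).diff,
    (h.bound_fst.mul h.bound_snd).mono (by linarith) (by linarith)⟩

theorem kernel_sq (h : IsResolventPair α β ω R S) : IsKernel α β ω (fun z => R z * R z) :=
  ⟨(h.kernel_fst hω hα hβ).diff.mul (h.kernel_fst hω hα hβ).diff,
    (h.bound_fst.mul h.bound_fst).mono (by linarith) (by linarith)⟩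

theorem kernel_sq_mul (h : IsResolventPair α β ω R S) :
    IsKernel α β ω (fun z => R z * (R z * S z)) :=
  ⟨(h.kernel_fst hω hα hβ).diff.mul (h.kernel_mul hω hα hβ).diff,
    (h.bound_fst.mul (h.bound_fst.mul h.bound_snd)).mono (by linarith) (by linarith)⟩

end Kernels

end IsResolventPair

end ResolventPair

section ResolventPair

open Complex Filter Topology

theorem comm_resolvent_identities {A : Type*} [CommRing A] [Algebra ℂ A] {a : ℂ} {R R' S S' : A}
    (h1 : R * R' = a • (R' - R)) (h2 : S * S' = a • (S' - S)) :
    (R * S) * R' + S * (R' * S') = a • (R' * S' - R * S) ∧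
    R * (R' * (R' * S')) + (R * S) * (R' * S') + (R * (R * S)) * R' =
      a • (R' * (R' * S') - R * (R * S)) ∧
    R * (R' * R') + (R * R) * R' = a • (R' * R' - R * R) ∧
    (R - S) * (R' * S') = (R * S) * (R' - S') := by
  simp only [Algebra.smul_def] at *
  refine ⟨?_, ?_, ?_, ?_⟩
  · linear_combination S * h1 + R' * h2
  · linear_combination (R' * S') * h1 + (R * R') * h2 + (R * S) * h1
  · linear_combination (R' + R) * h1
  · linear_combination (S' - S) * h1 + (R - R') * h2

theorem resolvent_identities {A : Type*} [Ring A] [Algebra ℂ A] {a : ℂ} {R R' S S' : A}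
    (h1 : R * R' = a • (R' - R)) (h2 : S * S' = a • (S' - S))
    (c1 : R * R' = R' * R) (c2 : S * S' = S' * S) (c3 : R * S = S * R) (c4 : R * S' = S' * R)
    (c5 : R' * S = S * R') (c6 : R' * S' = S' * R') :
    (R * S) * R' + S * (R' * S') = a • (R' * S' - R * S) ∧
    R * (R' * (R' * S')) + (R * S) * (R' * S') + (R * (R * S)) * R' =
      a • (R' * (R' * S') - R * (R * S)) ∧
    R * (R' * R') + (R * R) * R' = a • (R' * R' - R * R) ∧
    (R - S) * (R' * S') = (R * S) * (R' - S') := by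
  have hc : ∀ x ∈ ({R, R', S, S'} : Set A), ∀ y ∈ ({R, R', S, S'} : Set A), x * y = y * x := by
    rintro x (rfl | rfl | rfl | rfl) y (rfl | rfl | rfl | rfl) <;>
      first | rfl | assumption | (symm; assumption)
  let Z := Algebra.adjoin ℂ ({R, R', S, S'} : Set A)
  have : IsMulCommutative Z := Algebra.isMulCommutative_adjoin ℂ hc
  let : CommRing Z := { Subalgebra.toRing Z with mul_comm := fun x y => this.is_comm.comm x y }
  have hm : ∀ x ∈ ({R, R', S, S'} : Set A), x ∈ Z := fun x hx => Algebra.subset_adjoin hx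
  let r : Z := ⟨R, hm R (by simp)⟩
  let r' : Z := ⟨R', hm R' (by simp)⟩
  let s : Z := ⟨S, hm S (by simp)⟩
  let s' : Z := ⟨S', hm S' (by simp)⟩
  obtain ⟨e1, e2, e3, e4⟩ := comm_resolvent_identities (a := a) (R := r) (R' := r') (S := s)
    (S' := s') (Subtype.ext h1) (Subtype.ext h2)
  exact ⟨congrArg Subtype.val e1, congrArg Subtype.val e2, congrArg Subtype.val e3,
    congrArg Subtype.val e4⟩

variable {M : Type*} [NormedAddCommGroup M] [NormedSpace ℂ M] [CompleteSpace M]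

/-- The operator `(2π)⁻¹ ∫ k(s) W(s) ds / i`. -/
def opCalc (W : ℂ → M →L[ℂ] M) (φ : ℝ) (k : ℂ → ℂ) : M →L[ℂ] M :=
  (2 * Real.pi : ℂ)⁻¹ • cint φ (fun z => k z • W z)

namespace IsResolventPair

variable {α β ω θ φ χ : ℝ} {R S : ℂ → M →L[ℂ] M} {k h : ℂ → ℂ} {x : M}

theorem identities (H : IsResolventPair α β ω R S) {s p : ℂ} (hs : s ∈ coSector ω)
    (hp : p ∈ coSector ω) (hne : p ≠ s) :
    (R p * S p) * R s + S p * (R s * S s) = (p - s)⁻¹ • (R s * S s - R p * S p) ∧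
    R p * (R s * (R s * S s)) + (R p * S p) * (R s * S s) + (R p * (R p * S p)) * R s =
      (p - s)⁻¹ • (R s * (R s * S s) - R p * (R p * S p)) ∧
    R p * (R s * R s) + (R p * R p) * R s = (p - s)⁻¹ • (R s * R s - R p * R p) ∧
    (R p - S p) * (R s * S s) = (R p * S p) * (R s - S s) :=
  resolvent_identities (H.mul_eq hs hp hne) (H.symm.mul_eq hs hp hne) (H.comm_self hs hp)
    (H.symm.comm_self hs hp) (H.comm p hp p hp) (H.comm p hp s hs) (H.comm s hs p hp)
    (H.comm s hs s hs)

theorem opCalc_eq {W : ℂ → M →L[ℂ] M} (hW : IsKernel α β ω W) (hk : IsCGood α β θ k)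
    (hω : 0 ≤ ω) (hθ : θ ≤ Real.pi) (hφ : φ ∈ Ioo ω θ) (hχ : χ ∈ Ioo ω θ) :
    opCalc W φ k = opCalc W χ k := by
  rw [opCalc, opCalc, hk.cint_eq_cint hW hω hθ hφ hχ]

/-- The product rule for kernels, for operators given by integrals along arbitrary contours. -/
theorem sum_opCalc {ι : Type*} [Fintype ι] {A B : ι → ℂ → M →L[ℂ] M} {W : ℂ → M →L[ℂ] M}
    (hα : 1 / 3 ≤ α) (hβ : β ≤ 1) (hω : 0 ≤ ω) (hθ : θ ≤ Real.pi) (hφ : φ ∈ Ioo ω θ)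
    (hχ : χ ∈ Ioo ω θ) (hk : IsCGood α β θ k) (hh : IsCDecaying θ h)
    (hA : ∀ i, IsKernel α β ω (A i)) (hW : IsKernel α β ω W)
    (hB : ∀ i, CInt φ fun s => h s • B i s x) (hWh : CInt φ fun s => h s • W s x)
    (hid : ∀ s ∈ coSector ω, ∀ p ∈ coSector ω, p ≠ s →
      ∑ i, A i p * B i s = (p - s)⁻¹ • (W s - W p)) :
    ∑ i, opCalc (A i) χ k (cint φ fun s => h s • B i s x) =
      cint φ (fun s => (k s * h s) • W s x) := by
  obtain ⟨ψ, hψ1, hψ2⟩ := exists_between hφ.2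
  have hψ : ψ ∈ Ioo ω θ := ⟨hφ.1.trans hψ1, hψ2⟩
  have key := sum_cint_cint hh (hk.isCDecaying hα hβ) hω hφ.1 hψ1 hψ2 hθ
    (fun i => hk.cInt (hA i) hω hθ hψ) hB (hk.cInt hW hω hθ hψ) hWh fun s hs p hp hne => by
      have := congrArg (fun X : M →L[ℂ] M => X x) (hid s hs p hp hne)
      simpa using this
  have hpi : (2 * Real.pi : ℂ) ≠ 0 := by exact_mod_cast (by positivity : (2 * Real.pi) ≠ 0)
  rw [← inv_smul_smul₀ hpi (cint φ fun s => (k s * h s) • W s x), ← key, Finset.smul_sum]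
  refine Finset.sum_congr rfl fun i _ => ?_
  rw [opCalc_eq (hA i) hk hω hθ hχ hψ, opCalc, _root_.smul_apply]

variable (H : IsResolventPair α β ω R S) (hα : 1 / 3 ≤ α) (hβ : β ∈ Icc (0 : ℝ) 1)
  (hω : ω ∈ Ico 0 Real.pi) (hθ : θ ≤ Real.pi) (hφ : φ ∈ Ioo ω θ) (hχ : χ ∈ Ioo ω θ)
  (hk : IsCGood α β θ k) (hh : IsCDecaying θ h)
include H hα hβ hω hθ hφ hχ hk hh

theorem opCalc_cint_fst (h1 : CInt φ fun s => h s • R s x) :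
    opCalc R χ k (cint φ fun s => h s • R s x) = cint φ (fun s => (k s * h s) • R s x) := by
  have hα' : 0 ≤ α := by linarith
  have := sum_opCalc (ι := Unit) (A := fun _ => R) (B := fun _ => R) hα hβ.2 hω.1 hθ hφ hχ hk hh
    (fun _ => H.kernel_fst hω hα' hβ.1) (H.kernel_fst hω hα' hβ.1) (fun _ => h1) h1
    fun s hs p hp hne => by simpa using H.mul_eq hs hp hne
  simpa using this

theorem opCalc_cint_mul (h1 : CInt φ fun s => h s • R s x)
    (h2 : CInt φ fun s => h s • (R s * S s) x) :
    opCalc (fun z => R z * S z) χ k (cint φ fun s => h s • R s x) +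
      opCalc S χ k (cint φ fun s => h s • (R s * S s) x) =
      cint φ (fun s => (k s * h s) • (R s * S s) x) := by
  have hα' : 0 ≤ α := by linarith
  have := sum_opCalc (ι := Fin 2) (A := ![fun z => R z * S z, S])
    (B := ![R, fun z => R z * S z]) (W := fun z => R z * S z) (x := x) hα hβ.2 hω.1 hθ hφ hχ hk hh
    (by simpa [Fin.forall_fin_two] using
      ⟨H.kernel_mul hω hα' hβ.1, H.symm.kernel_fst hω hα' hβ.1⟩)
    (H.kernel_mul hω hα' hβ.1) (by simpa [Fin.forall_fin_two] using ⟨h1, h2⟩) h2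
    fun s hs p hp hne => by simpa using (H.identities hs hp hne).1
  simpa using this

theorem opCalc_cint_sq_mul (h1 : CInt φ fun s => h s • R s x)
    (h2 : CInt φ fun s => h s • (R s * S s) x)
    (h3 : CInt φ fun s => h s • (R s * (R s * S s)) x) :
    opCalc R χ k (cint φ fun s => h s • (R s * (R s * S s)) x) +
      opCalc (fun z => R z * S z) χ k (cint φ fun s => h s • (R s * S s) x) +
      opCalc (fun z => R z * (R z * S z)) χ k (cint φ fun s => h s • R s x) =
      cint φ (fun s => (k s * h s) • (R s * (R s * S s)) x) := by
  have hα' : 0 ≤ α := by linarith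
  have := sum_opCalc (ι := Fin 3)
    (A := ![R, fun z => R z * S z, fun z => R z * (R z * S z)])
    (B := ![fun z => R z * (R z * S z), fun z => R z * S z, R])
    (W := fun z => R z * (R z * S z)) (x := x) hα hβ.2 hω.1 hθ hφ hχ hk hh
    (by intro i; fin_cases i; exacts
      [H.kernel_fst hω hα' hβ.1, H.kernel_mul hω hα' hβ.1, H.kernel_sq_mul hω hα' hβ.1])
    (H.kernel_sq_mul hω hα' hβ.1) (by intro i; fin_cases i; exacts [h3, h2, h1]) h3
    fun s hs p hp hne => by
      simpa [Fin.sum_univ_three] using (H.identities hs hp hne).2.1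
  simpa [Fin.sum_univ_three] using this

theorem opCalc_cint_sq (h1 : CInt φ fun s => h s • R s x)
    (h2 : CInt φ fun s => h s • (R s * R s) x) :
    opCalc R χ k (cint φ fun s => h s • (R s * R s) x) +
      opCalc (fun z => R z * R z) χ k (cint φ fun s => h s • R s x) =
      cint φ (fun s => (k s * h s) • (R s * R s) x) := by
  have hα' : 0 ≤ α := by linarith
  have := sum_opCalc (ι := Fin 2) (A := ![R, fun z => R z * R z])
    (B := ![fun z => R z * R z, R]) (W := fun z => R z * R z) (x := x) hα hβ.2 hω.1 hθ hφ hχ hk hh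
    (by simpa [Fin.forall_fin_two] using
      ⟨H.kernel_fst hω hα' hβ.1, H.kernel_sq hω hα' hβ.1⟩)
    (H.kernel_sq hω hα' hβ.1) (by simpa [Fin.forall_fin_two] using ⟨h2, h1⟩) h2
    fun s hs p hp hne => by simpa using (H.identities hs hp hne).2.2.1
  simpa using this

omit hα hh in
theorem opCalc_sub_cint (hα : 0 ≤ α) (h1 : CInt φ fun s => h s • R s x)
    (h2 : CInt φ fun s => h s • S s x) (h3 : CInt φ fun s => h s • (R s * S s) x) :
    (opCalc R χ k - opCalc S χ k) (cint φ fun s => h s • (R s * S s) x) =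
      opCalc (fun z => R z * S z) χ k
        ((cint φ fun s => h s • R s x) - cint φ fun s => h s • S s x) := by
  have hR := hk.cInt (H.kernel_fst hω hα hβ.1) hω.1 hθ hχ
  have hS := hk.cInt (H.symm.kernel_fst hω hα hβ.1) hω.1 hθ hχ
  have hRS := hk.cInt (H.kernel_mul hω hα hβ.1) hω.1 hθ hχ
  have happ : ∀ {W : ℂ → M →L[ℂ] M} (_ : CInt χ fun z => k z • W z) (y : M),
      cint χ (fun z => k z • W z) y = cint χ fun z => k z • W z y := fun hW y =>
    (ContinuousLinearMap.cint_comp (ContinuousLinearMap.apply ℂ M y) hW).symm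
  have happ' : ∀ {W : ℂ → M →L[ℂ] M} (_ : CInt χ fun z => k z • W z) (y : M),
      CInt χ fun z => k z • W z y := fun hW y => hW.clm_comp (ContinuousLinearMap.apply ℂ M y)
  rw [opCalc, opCalc, opCalc, ← smul_sub, _root_.smul_apply,
    _root_.smul_apply, ← cint_sub h1 h2, ← ContinuousLinearMap.cint_comp _ h3,
    ← ContinuousLinearMap.cint_comp _ (h1.sub h2)]
  congr 1
  refine cint_congr fun t ht => ?_
  rw [← smul_sub, map_smul, map_smul]
  congr 1
  rw [_root_.sub_apply, happ hR, happ hS, happ hRS,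
    ← cint_sub (happ' hR _) (happ' hS _)]
  refine cint_congr fun τ hτ => ?_
  rw [← smul_sub]
  congr 1
  have hφ' : φ ∈ Ioo 0 Real.pi := ⟨hω.1.trans_lt hφ.1, hφ.2.trans_le hθ⟩
  have hχ' : χ ∈ Ioo 0 Real.pi := ⟨hω.1.trans_lt hχ.1, hχ.2.trans_le hθ⟩
  have hs : ray φ t ∈ coSector ω := ⟨ray_ne_zero ht, by rw [abs_arg_ray hφ' ht]; exact hφ.1⟩
  have hp : ray χ τ ∈ coSector ω := ⟨ray_ne_zero hτ, by rw [abs_arg_ray hχ' hτ]; exact hχ.1⟩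
  have key : (R (ray χ τ) - S (ray χ τ)) * (R (ray φ t) * S (ray φ t)) =
      (R (ray χ τ) * S (ray χ τ)) * (R (ray φ t) - S (ray φ t)) := by
    rcases eq_or_ne (ray χ τ) (ray φ t) with h0 | h0
    · rw [h0]
      have hc := H.comm _ hs _ hs
      generalize R (ray φ t) = r at *
      generalize S (ray φ t) = q at *
      rw [sub_mul, mul_sub, mul_assoc r q r, ← hc, mul_assoc, ← mul_assoc q r q, ← hc]
      simp only [mul_assoc]
    · exact (H.identities hs hp h0).2.2.2
  exact congrArg (fun X : M →L[ℂ] M => X x) key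

end IsResolventPair

end ResolventPair

section Residue

open Complex Filter Topology

theorem logPull_inv_sub_inv {z : ℂ} (hz : |z.im| ∈ Ioo 0 Real.pi) :
    logPull (fun s => (s - 1)⁻¹ - (1 + s)⁻¹) z = (sinh z)⁻¹ := by
  have h : sinh z ≠ 0 := by
    rcases abs_cases z.im with ⟨h, -⟩ | ⟨h, -⟩
    · exact sinh_ne_zero_of_im (h ▸ hz)
    · have := sinh_ne_zero_of_im (z := -z) (by rw [neg_im, ← h]; exact hz)
      rwa [sinh_neg, neg_ne_zero] at this
  have e1 := exp_ne_zero z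
  have e2 : (exp z - 1) * (1 + exp z) = 2 * sinh z * exp z := by
    have e0 : exp (-z) * exp z = 1 := by rw [← exp_add]; simp
    rw [two_sinh]; linear_combination e0
  have e3 : (exp z - 1) * (1 + exp z) ≠ 0 := by rw [e2]; exact mul_ne_zero (mul_ne_zero two_ne_zero h) e1
  have h2 := left_ne_zero_of_mul e3
  have h3 := right_ne_zero_of_mul e3
  rw [logPull, smul_eq_mul, inv_sub_inv h2 h3, e2]
  field_simp
  ring

theorem norm_mul_bounds {φ : ℝ} (hφ : φ ∈ Ioo 0 Real.pi) :
    ∃ c > 0, ∀ z : ℂ, z ≠ 0 → |arg z| ≤ φ → c ≤ ‖1 + z‖ ∧ c * ‖z‖ ≤ ‖1 + z‖ := by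
  obtain ⟨c, hc, h⟩ := exists_dist_ge hφ.1.le hφ.2 le_rfl
  refine ⟨c, hc, fun z hz hz' => ?_⟩
  have := h z (-1) hz (by norm_num) hz' (by simp [abs_of_pos Real.pi_pos])
  have e : ‖-1 - z‖ = ‖1 + z‖ := by rw [← norm_neg]; ring_nf
  rw [e] at this
  exact ⟨by simpa using this.2, this.1⟩

theorem norm_sub_one_bounds {φ : ℝ} (hφ : φ ∈ Ioo 0 Real.pi) :
    ∃ c > 0, ∀ z : ℂ, z ≠ 0 → φ ≤ |arg z| → c ≤ ‖z - 1‖ ∧ c * ‖z‖ ≤ ‖z - 1‖ := by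
  obtain ⟨c, hc, h⟩ := exists_dist_ge le_rfl hφ.1 hφ.2.le
  refine ⟨c, hc, fun z hz hz' => ?_⟩
  simpa using h 1 z one_ne_zero hz (by simp) hz'

theorem inv_mul_inv_le_twoPow {a b c d r : ℝ} (hc : 0 < c) (hd : 0 < d) (hr : 0 < r)
    (h1 : c ≤ a) (h2 : c * r ≤ a) (h3 : d ≤ b) (h4 : d * r ≤ b) :
    a⁻¹ * b⁻¹ ≤ (c * d)⁻¹ * twoPow 0 (-2) r := by
  have hb : 0 < b := hd.trans_le h3
  have ha : 0 < a := hc.trans_le h1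
  unfold twoPow
  split_ifs with h
  · rw [Real.rpow_zero, mul_one, mul_inv]
    gcongr
  · have : r ^ (-2 : ℝ) = r⁻¹ * r⁻¹ := by
      rw [Real.rpow_neg hr.le, Real.rpow_two, sq, mul_inv]
    rw [this]
    calc a⁻¹ * b⁻¹ ≤ (c * r)⁻¹ * (d * r)⁻¹ := by gcongr
      _ = _ := by simp only [mul_inv]; ring

theorem differentiableOn_inv_sub_one {φ : ℝ} (hφ : 0 < φ) :
    DifferentiableOn ℂ (fun z : ℂ => (z - 1)⁻¹) {z | z ≠ 0 ∧ φ ≤ |arg z|} := by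
  refine DifferentiableOn.inv (by fun_prop) fun z hz h0 => ?_
  have := hz.2
  rw [sub_eq_zero.1 h0, arg_one, abs_zero] at this
  linarith

theorem one_add_ne_zero_of_arg {φ : ℝ} (hφ : φ < Real.pi) {z : ℂ} (hz : |arg z| ≤ φ) :
    1 + z ≠ 0 := by
  intro h
  rw [← neg_eq_iff_add_eq_zero.2 h, arg_neg_one, abs_of_pos Real.pi_pos] at hz
  linarith

theorem tame_inv_sub_inv {φ : ℝ} (hφ : φ ∈ Ioo 0 Real.pi) :
    Tame {z | z ≠ 0 ∧ |arg z| = φ} (fun z => (z - 1)⁻¹ - (1 + z)⁻¹) := by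
  obtain ⟨c, hc, h⟩ := norm_mul_bounds hφ
  obtain ⟨d, hd, h'⟩ := norm_sub_one_bounds hφ
  refine ⟨1, one_pos, 2 * (c * d)⁻¹, by positivity, fun z hz => ?_⟩
  obtain ⟨h1, h2⟩ := h z hz.1 hz.2.le
  obtain ⟨h3, h4⟩ := h' z hz.1 hz.2.ge
  have e1 : 1 + z ≠ 0 := norm_pos_iff.1 (hc.trans_le h1)
  have e2 : z - 1 ≠ 0 := norm_pos_iff.1 (hd.trans_le h3)
  have e3 : (z - 1)⁻¹ - (1 + z)⁻¹ = 2 * ((1 + z)⁻¹ * (z - 1)⁻¹) := by field_simp; ring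
  show ‖(z - 1)⁻¹ - (1 + z)⁻¹‖ ≤ _
  rw [e3, norm_mul, norm_mul, norm_inv, norm_inv, Complex.norm_ofNat]
  have := inv_mul_inv_le_twoPow hc hd (norm_pos_iff.2 hz.1) h1 h2 h3 h4
  rw [show (-1 + 1 : ℝ) = 0 by norm_num, show (-1 - 1 : ℝ) = -2 by norm_num]
  linarith

theorem continuousOn_inv_sub_inv {φ : ℝ} (hφ : φ ∈ Ioo 0 Real.pi) :
    ContinuousOn (fun z : ℂ => (z - 1)⁻¹ - (1 + z)⁻¹) {z | z ≠ 0 ∧ |arg z| = φ} := by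
  refine ((differentiableOn_inv_sub_one hφ.1).continuousOn.mono fun z hz => ⟨hz.1, hz.2.ge⟩).sub ?_
  exact ContinuousOn.inv₀ (by fun_prop) fun z hz => one_add_ne_zero_of_arg hφ.2 hz.2.le

theorem cInt_inv_sub_inv {φ : ℝ} (hφ : φ ∈ Ioo 0 Real.pi) :
    CInt φ (fun z => (z - 1)⁻¹ - (1 + z)⁻¹) :=
  (tame_inv_sub_inv hφ).cInt (continuousOn_inv_sub_inv hφ)
    fun _ ht => ⟨ray_ne_zero ht, abs_arg_ray hφ ht⟩

theorem cint_inv_sub_inv {φ : ℝ} (hφ : φ ∈ Ioo 0 Real.pi) :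
    cint φ (fun z => (z - 1)⁻¹ - (1 + z)⁻¹) = 2 * Real.pi := by
  have h1 : ∀ x : ℝ, logPull (fun z => (z - 1)⁻¹ - (1 + z)⁻¹) (x + ((-φ : ℝ) : ℂ) * I) =
      (sinh (x + ((-φ : ℝ) : ℂ) * I))⁻¹ := fun x => logPull_inv_sub_inv <| by
    simpa [abs_of_pos hφ.1] using hφ
  have h2 : ∀ x : ℝ, logPull (fun z => (z - 1)⁻¹ - (1 + z)⁻¹) (x + φ * I) =
      (sinh (x + φ * I))⁻¹ := fun x => logPull_inv_sub_inv <| by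
    simpa [abs_of_pos hφ.1] using hφ
  rw [cint_eq (cInt_inv_sub_inv hφ)]
  simp only [h1, h2]
  rw [integral_inv_sinh hφ, integral_inv_sinh_neg ⟨by linarith [hφ.2], by linarith [hφ.1]⟩,
    smul_eq_mul]
  field_simp
  ring

variable {M : Type*} [NormedAddCommGroup M] [NormedSpace ℂ M] [CompleteSpace M]

/-- The function `s ^ n (1 + s) ^ (-2 n)`. -/
def stdReg (n : ℕ) (z : ℂ) : ℂ := z ^ n * ((1 + z) ^ (2 * n))⁻¹

theorem stdReg_eq (n : ℕ) {z : ℂ} (hz : 1 + z ≠ 0) :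
    stdReg n z = (1 + z)⁻¹ ^ n * (1 - (1 + z)⁻¹) ^ n := by
  have : 1 - (1 + z)⁻¹ = z * (1 + z)⁻¹ := by field_simp; ring
  rw [this, stdReg, mul_pow, pow_mul', sq, mul_inv, inv_pow]
  ring

namespace IsResolventPair

variable {α β ω : ℝ} {R S : ℂ → M →L[ℂ] M}

theorem neg_one_mem (hω : ω < Real.pi) : (-1 : ℂ) ∈ coSector ω :=
  ⟨by norm_num, by rwa [arg_neg_one, abs_of_pos Real.pi_pos]⟩

theorem neg_resolvent_mul (H : IsResolventPair α β ω R S) (hω : ω < Real.pi) {s : ℂ}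
    (hs : s ∈ coSector ω) (hs1 : 1 + s ≠ 0) :
    -R (-1) * R s = (1 + s)⁻¹ • R s + (1 + s)⁻¹ • -R (-1) := by
  have h1 := H.res_fst _ hs _ (neg_one_mem hω)
  have h2 : (-1 - s) = -(1 + s) := by ring
  rw [← smul_add, ← sub_eq_add_neg, h1, h2, neg_smul, smul_neg, smul_smul, inv_mul_cancel₀ hs1,
    one_smul, neg_mul, H.comm_self hs (neg_one_mem hω)]

/-- The polar part of `H R(s)` for powers of the resolvent at `-1`. -/
theorem exists_polar_part (H : IsResolventPair α β ω R S) (hω : ω < Real.pi) (m n : ℕ) :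
    ∃ c : ℂ → M →L[ℂ] M, Differentiable ℂ c ∧ ∀ s ∈ coSector ω, 1 + s ≠ 0 →
      ((1 + R (-1)) ^ n * ((-R (-1)) ^ m * -R (-1))) * R s =
        ((1 + s)⁻¹ * ((1 + s)⁻¹ ^ m * (1 - (1 + s)⁻¹) ^ n)) • R s +
        (1 + s)⁻¹ • ((1 + R (-1)) ^ n * ((-R (-1)) ^ m * -R (-1))) +
        ((1 + s)⁻¹ ^ 2) • c (1 + s)⁻¹ := by
  have step : ∀ {g : ℂ → ℂ} {c : ℂ → M →L[ℂ] M} {X : M →L[ℂ] M} {s : ℂ}, s ∈ coSector ω →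
      1 + s ≠ 0 → X * R s = ((1 + s)⁻¹ * g (1 + s)⁻¹) • R s + (1 + s)⁻¹ • X +
        ((1 + s)⁻¹ ^ 2) • c (1 + s)⁻¹ →
      (-R (-1) * X) * R s = ((1 + s)⁻¹ * ((1 + s)⁻¹ * g (1 + s)⁻¹)) • R s +
        (1 + s)⁻¹ • (-R (-1) * X) +
        ((1 + s)⁻¹ ^ 2) • (g (1 + s)⁻¹ • -R (-1) + -R (-1) * c (1 + s)⁻¹) := by
    intro g c X s hs hs1 h
    rw [mul_assoc, h, mul_add, mul_add, mul_smul_comm, mul_smul_comm, mul_smul_comm,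
      H.neg_resolvent_mul hω hs hs1]
    module
  induction n with
  | zero =>
    induction m with
    | zero =>
      refine ⟨fun _ => 0, differentiable_const _, fun s hs hs1 => ?_⟩
      simpa using H.neg_resolvent_mul hω hs hs1
    | succ m ih =>
      obtain ⟨c, hc, h⟩ := ih
      refine ⟨fun r => (r ^ m * (1 - r) ^ 0) • -R (-1) + -R (-1) * c r, by fun_prop, fun s hs hs1 => ?_⟩
      have := step (g := fun r => r ^ m * (1 - r) ^ 0) (c := c) hs hs1 (h s hs hs1)
      simp only [pow_zero, one_mul, mul_one] at this ⊢
      rw [pow_succ' (-R (-1)), pow_succ' (1 + s)⁻¹, mul_assoc (-R (-1))]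
      exact this
  | succ n ih =>
    obtain ⟨c, hc, h⟩ := ih
    refine ⟨fun r => c r - ((r ^ m * (1 - r) ^ n) • -R (-1) + -R (-1) * c r), by fun_prop,
      fun s hs hs1 => ?_⟩
    have := step (g := fun r => r ^ m * (1 - r) ^ n) (c := c) hs hs1 (h s hs hs1)
    have e : (1 + R (-1)) ^ (n + 1) * ((-R (-1)) ^ m * -R (-1)) =
        (1 + R (-1)) ^ n * ((-R (-1)) ^ m * -R (-1)) -
          -R (-1) * ((1 + R (-1)) ^ n * ((-R (-1)) ^ m * -R (-1))) := by
      rw [pow_succ']; noncomm_ring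
    rw [e, sub_mul, this, h s hs hs1]
    module

theorem opCalc_stdReg {θ φ : ℝ} (H : IsResolventPair α β ω R S) (hα : 0 ≤ α)
    (hβ : β ∈ Ioc (0 : ℝ) 1) (hω : ω ∈ Ico 0 Real.pi) (hθ : θ ≤ Real.pi) (hφ : φ ∈ Ioo ω θ)
    {n : ℕ} (hn : 1 ≤ n) (hnα : 3 * α ≤ n) (hk : IsCGood α β θ (stdReg n)) :
    opCalc R φ (stdReg n) = (1 + R (-1)) ^ n * (-R (-1)) ^ n := by
  obtain ⟨n, rfl⟩ : ∃ m, n = m + 1 := ⟨n - 1, by omega⟩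
  have hφ' : φ ∈ Ioo 0 Real.pi := ⟨hω.1.trans_lt hφ.1, hφ.2.trans_le hθ⟩
  obtain ⟨c, hc, hpolar⟩ := H.exists_polar_part hω.2 n (n + 1)
  rw [pow_succ (-R (-1))]
  set X := (1 + R (-1)) ^ (n + 1) * ((-R (-1)) ^ n * -R (-1)) with hX
  have hdec : ∀ s ∈ coSector ω, 1 + s ≠ 0 → stdReg (n + 1) s • R s =
      (X * R s - (s - 1)⁻¹ • X) + ((s - 1)⁻¹ - (1 + s)⁻¹) • X -
        ((1 + s)⁻¹ ^ 2) • c (1 + s)⁻¹ := by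
    intro s hs hs1
    rw [hpolar s hs hs1, stdReg_eq _ hs1, pow_succ' (1 + s)⁻¹ n]
    module
  have hRk := H.kernel_fst hω hα hβ.1.le
  have c1 : CInt φ fun z => stdReg (n + 1) z • R z := hk.cInt hRk hω.1 hθ hφ
  have c2 : CInt φ fun z : ℂ => ((z - 1)⁻¹ - (1 + z)⁻¹) • X := by
    have := (cInt_inv_sub_inv hφ').smul_const X
    simpa only [CInt, smul_assoc] using this
  have i2 : cint φ (fun z : ℂ => ((z - 1)⁻¹ - (1 + z)⁻¹) • X) = (2 * Real.pi : ℂ) • X := by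
    rw [← cint_inv_sub_inv hφ']
    have e : ∀ t : ℝ, rayWeight φ t • ((ray φ t - 1)⁻¹ - (1 + ray φ t)⁻¹) • X =
        (rayWeight φ t • ((ray φ t - 1)⁻¹ - (1 + ray φ t)⁻¹)) • X :=
      fun t => (smul_assoc _ _ _).symm
    simp only [cint, e]
    exact integral_smul_const _ _
  -- the polar part
  have hcb : ∀ K : ℝ, ∃ C ≥ 0, ∀ r : ℂ, ‖r‖ ≤ K → ‖c r‖ ≤ C := by
    intro K
    obtain ⟨C, hC⟩ := (isCompact_closedBall (0 : ℂ) K).exists_bound_of_continuousOn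
      hc.continuous.continuousOn
    exact ⟨max C 0, le_max_right _ _, fun r hr => (hC r (by simpa using hr)).trans (le_max_left _ _)⟩
  have hone : ∀ δ ≤ (1 : ℝ), ∀ r > 0, twoPow 0 (-2) r ≤ twoPow (-1 + δ) (-1 - δ) r :=
    fun δ hδ r hr => twoPow_le_twoPow hr (by linarith) (by linarith)
  obtain ⟨a, ha, hab⟩ := norm_mul_bounds hφ'
  obtain ⟨Ca, hCa, hca⟩ := hcb a⁻¹
  have d3 : DifferentiableOn ℂ (fun z : ℂ => ((1 + z)⁻¹ ^ 2) • c (1 + z)⁻¹)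
      {z | z ≠ 0 ∧ |arg z| ≤ φ} := by
    have : DifferentiableOn ℂ (fun z : ℂ => (1 + z)⁻¹) {z | z ≠ 0 ∧ |arg z| ≤ φ} :=
      DifferentiableOn.inv (by fun_prop) fun z hz => one_add_ne_zero_of_arg hφ'.2 hz.2
    exact (this.pow 2).smul (hc.comp_differentiableOn this)
  have t3 : Tame {z | z ≠ 0 ∧ |arg z| ≤ φ} (fun z : ℂ => ((1 + z)⁻¹ ^ 2) • c (1 + z)⁻¹) := by
    refine ⟨1, one_pos, (a * a)⁻¹ * Ca, by positivity, fun z hz => ?_⟩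
    obtain ⟨h1, h2⟩ := hab z hz.1 hz.2
    have hz0 := norm_pos_iff.2 hz.1
    have h3 := inv_mul_inv_le_twoPow ha ha hz0 h1 h2 h1 h2
    have h4 : ‖c (1 + z)⁻¹‖ ≤ Ca := hca _ (by rw [norm_inv]; gcongr)
    rw [norm_smul, norm_pow, norm_inv, sq]
    calc _ ≤ ((a * a)⁻¹ * twoPow 0 (-2) ‖z‖) * Ca := by
          gcongr
          exact mul_nonneg (by positivity) (twoPow_nonneg hz0.le)
      _ ≤ ((a * a)⁻¹ * twoPow (-1 + 1) (-1 - 1) ‖z‖) * Ca := by gcongr; exact hone 1 le_rfl _ hz0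
      _ = _ := by ring
  have i3 := cint_eq_zero hφ' d3 t3
  have c3 : CInt φ (fun z : ℂ => ((1 + z)⁻¹ ^ 2) • c (1 + z)⁻¹) :=
    t3.cInt d3.continuousOn fun t ht => ⟨ray_ne_zero ht, (abs_arg_ray hφ' ht).le⟩
  have hray : ∀ t ≠ 0, ray φ t ∈ coSector ω ∧ 1 + ray φ t ≠ 0 := fun t ht =>
    ⟨⟨ray_ne_zero ht, by rw [abs_arg_ray hφ' ht]; exact hφ.1⟩,
      one_add_ne_zero_of_arg hφ'.2 (abs_arg_ray hφ' ht).le⟩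
  -- the part that is holomorphic outside of the sector
  have c4 : CInt φ fun z => X * R z - (z - 1)⁻¹ • X := by
    refine ((c1.sub c2).add c3).congr fun t ht => ?_
    rw [hdec _ (hray t ht).1 (hray t ht).2]
    module
  have d4 : DifferentiableOn ℂ (fun z => X * R z - (z - 1)⁻¹ • X) {z | z ≠ 0 ∧ φ ≤ |arg z|} :=
    ((hRk.diff.mono fun z hz => ⟨hz.1, hφ.1.trans_le hz.2⟩).const_mul X).sub
      ((differentiableOn_inv_sub_one hφ'.1).smul_const X)
  obtain ⟨CR, hCR, hR⟩ := H.bound_fst φ ⟨hφ.1, hφ'.2⟩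
  obtain ⟨b, hb, hbb⟩ := norm_sub_one_bounds hφ'
  obtain ⟨C2, hC2, hc2⟩ := hcb 2
  have i4 : cint φ (fun z => X * R z - (z - 1)⁻¹ • X) = 0 := by
    refine cint_eq_zero_of_outer (δ := β)
      (C := (2 ^ (2 * (n + 1))) * CR + 2 * ((1 / 2) * b)⁻¹ * ‖X‖ + ((1 / 2 : ℝ) * (1 / 2))⁻¹ * C2)
      hφ' c4 d4 hβ.1 fun z hz hz' hlog => ?_
    have hz0 := norm_pos_iff.2 hz
    have hfar : 1 / 2 ≤ ‖1 + z‖ ∧ 1 / 2 * ‖z‖ ≤ ‖1 + z‖ := by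
      have he : (2 : ℝ) ≤ Real.exp 1 := by linarith [Real.add_one_le_exp (1 : ℝ)]
      rcases le_abs'.1 hlog with h | h
      · have h1 : ‖z‖ ≤ 1 / 2 := by
          rw [← Real.exp_log hz0]
          calc _ ≤ Real.exp (-1) := Real.exp_le_exp.2 h
            _ = (Real.exp 1)⁻¹ := Real.exp_neg 1
            _ ≤ 2⁻¹ := by gcongr
            _ = _ := by norm_num
        have h2 := norm_sub_norm_le (1 : ℂ) (-z)
        rw [norm_neg, sub_neg_eq_add, norm_one] at h2
        constructor <;> linarith
      · have h1 : 2 ≤ ‖z‖ := by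
          rw [← Real.exp_log hz0]
          exact he.trans (Real.exp_le_exp.2 h)
        have h2 := norm_sub_norm_le z (-1)
        rw [norm_neg, sub_neg_eq_add, norm_one, add_comm z] at h2
        constructor <;> linarith
    have hs1 : 1 + z ≠ 0 := norm_pos_iff.1 (lt_of_lt_of_le (by norm_num) hfar.1)
    have e1 : X * R z - (z - 1)⁻¹ • X = stdReg (n + 1) z • R z +
        (-(2 * ((1 + z)⁻¹ * (z - 1)⁻¹))) • X + ((1 + z)⁻¹ ^ 2) • c (1 + z)⁻¹ := by
      rw [hdec z ⟨hz, hφ.1.trans_le hz'⟩ hs1]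
      obtain ⟨h3, h4⟩ := hbb z hz hz'
      have e2 : z - 1 ≠ 0 := norm_pos_iff.1 (hb.trans_le h3)
      have e3 : (z - 1)⁻¹ - (1 + z)⁻¹ = 2 * ((1 + z)⁻¹ * (z - 1)⁻¹) := by field_simp; ring
      rw [e3]
      module
    have b1 : ‖stdReg (n + 1) z • R z‖ ≤
        (2 ^ (2 * (n + 1))) * CR * twoPow (-1 + β) (-1 - β) ‖z‖ := by
      have h5 : ‖stdReg (n + 1) z‖ ≤ 2 ^ (2 * (n + 1)) *
          twoPow ((n + 1 : ℕ) : ℝ) (-((n + 1 : ℕ) : ℝ)) ‖z‖ := by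
        rw [stdReg, norm_mul, norm_inv, norm_pow, norm_pow]
        unfold twoPow
        split_ifs with h
        · rw [Real.rpow_natCast, mul_comm]
          gcongr
          rw [← inv_pow]
          gcongr
          calc ‖1 + z‖⁻¹ ≤ (1 / 2 : ℝ)⁻¹ := by gcongr; exact hfar.1
            _ = 2 := by norm_num
        · rw [Real.rpow_neg hz0.le, Real.rpow_natCast]
          calc _ ≤ ‖z‖ ^ (n + 1) * ((1 / 2 * ‖z‖) ^ (2 * (n + 1)))⁻¹ := by gcongr; exact hfar.2
            _ = _ := by
                rw [mul_pow, mul_inv, ← inv_pow, pow_mul' ‖z‖, sq]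
                field_simp
      have h6 : twoPow ((n + 1 : ℕ) : ℝ) (-((n + 1 : ℕ) : ℝ)) ‖z‖ * twoPow (-α) (-β) ‖z‖ ≤
          twoPow (-1 + β) (-1 - β) ‖z‖ := by
        rw [twoPow_mul hz0]
        have hn1 : (1 : ℝ) ≤ ((n + 1 : ℕ) : ℝ) := by exact_mod_cast hn
        refine twoPow_le_twoPow hz0 ?_ ?_ <;> linarith [hβ.2]
      rw [norm_smul]
      calc _ ≤ (2 ^ (2 * (n + 1)) * twoPow ((n + 1 : ℕ) : ℝ) (-((n + 1 : ℕ) : ℝ)) ‖z‖) *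
            (CR * twoPow (-α) (-β) ‖z‖) := by
            gcongr
            · exact mul_nonneg (by positivity) (twoPow_nonneg hz0.le)
            · exact hR z hz hz'
        _ = 2 ^ (2 * (n + 1)) * CR * (twoPow ((n + 1 : ℕ) : ℝ) (-((n + 1 : ℕ) : ℝ)) ‖z‖ *
            twoPow (-α) (-β) ‖z‖) := by ring
        _ ≤ _ := by gcongr
    have b2 : ‖(-(2 * ((1 + z)⁻¹ * (z - 1)⁻¹))) • X‖ ≤
        2 * ((1 / 2) * b)⁻¹ * ‖X‖ * twoPow (-1 + β) (-1 - β) ‖z‖ := by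
      obtain ⟨h3, h4⟩ := hbb z hz hz'
      have h5 := (inv_mul_inv_le_twoPow (by norm_num) hb hz0 hfar.1 hfar.2 h3 h4).trans
        (mul_le_mul_of_nonneg_left (hone β hβ.2 _ hz0) (by positivity))
      rw [norm_smul, norm_neg, norm_mul, norm_mul, norm_inv, norm_inv, Complex.norm_ofNat]
      calc _ ≤ 2 * ((1 / 2 * b)⁻¹ * twoPow (-1 + β) (-1 - β) ‖z‖) * ‖X‖ := by gcongr
        _ = _ := by ring
    have b3 : ‖((1 + z)⁻¹ ^ 2) • c (1 + z)⁻¹‖ ≤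
        ((1 / 2 : ℝ) * (1 / 2))⁻¹ * C2 * twoPow (-1 + β) (-1 - β) ‖z‖ := by
      have h5 := (inv_mul_inv_le_twoPow (by norm_num) (by norm_num) hz0 hfar.1 hfar.2 hfar.1
        hfar.2).trans (mul_le_mul_of_nonneg_left (hone β hβ.2 _ hz0) (by positivity))
      have h4 : ‖c (1 + z)⁻¹‖ ≤ C2 := hc2 _ (by
        rw [norm_inv]
        calc ‖1 + z‖⁻¹ ≤ (1 / 2 : ℝ)⁻¹ := by gcongr; exact hfar.1
            _ = 2 := by norm_num)
      rw [norm_smul, norm_pow, norm_inv, sq]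
      calc _ ≤ (((1 / 2 : ℝ) * (1 / 2))⁻¹ * twoPow (-1 + β) (-1 - β) ‖z‖) * C2 := by
            gcongr
            exact mul_nonneg (by norm_num) (twoPow_nonneg hz0.le)
        _ = _ := by ring
    rw [e1, add_mul, add_mul]
    exact (norm_add₃_le).trans (by gcongr)
  have hpi : (2 * Real.pi : ℂ) ≠ 0 := by exact_mod_cast (by positivity : (2 * Real.pi) ≠ 0)
  have htot : cint φ (fun z => stdReg (n + 1) z • R z) = (2 * Real.pi : ℂ) • X := by
    calc _ = cint φ (fun z => ((X * R z - (z - 1)⁻¹ • X) + ((z - 1)⁻¹ - (1 + z)⁻¹) • X) -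
          ((1 + z)⁻¹ ^ 2) • c (1 + z)⁻¹) :=
          cint_congr fun t ht => hdec _ (hray t ht).1 (hray t ht).2
      _ = _ := by rw [cint_sub (c4.add c2) c3, cint_add c4 c2, i2, i3, i4, zero_add, sub_zero]
  rw [opCalc, htot, inv_smul_smul₀ hpi]

end IsResolventPair

end Residue

section Components

variable {V : Type*} [NormedAddCommGroup V] [NormedSpace ℝ V] [CompleteSpace V]
  [Module ℍ[ℝ] V] [Module ℍ[ℝ]ᵐᵒᵖ V] [SMulCommClass ℍ[ℝ] ℍ[ℝ]ᵐᵒᵖ V]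
  [IsScalarTower ℝ ℍ[ℝ] V] [IsScalarTower ℝ ℍ[ℝ]ᵐᵒᵖ V]
  [NormSMulClass ℍ[ℝ] V] [NormSMulClass ℍ[ℝ]ᵐᵒᵖ V]

theorem unit_zero : unit 0 = 1 := rfl

theorem unit_apply : ((unit 1).re = 0 ∧ (unit 1).imI = 1 ∧ (unit 1).imJ = 0 ∧ (unit 1).imK = 0) ∧
    ((unit 2).re = 0 ∧ (unit 2).imI = 0 ∧ (unit 2).imJ = 1 ∧ (unit 2).imK = 0) ∧
    ((unit 3).re = 0 ∧ (unit 3).imI = 0 ∧ (unit 3).imJ = 0 ∧ (unit 3).imK = 1) :=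
  ⟨⟨rfl, rfl, rfl, rfl⟩, ⟨rfl, rfl, rfl, rfl⟩, ⟨rfl, rfl, rfl, rfl⟩⟩

namespace RightOp

variable (T : RightOp V)

theorem ext_toPMap {T S : RightOp V} (h : T.toPMap = S.toPMap) : T = S := by
  obtain ⟨a, _⟩ := T
  obtain ⟨b, _⟩ := S
  cases h
  rfl

theorem app_real_smul (r : ℝ) {v : V} (hv : v ∈ T.dom) : T.app (r • v) = r • T.app v := by
  rw [real_smul_eq, app_smul T _ hv, ← real_smul_eq]

theorem real_smul_mem (r : ℝ) {v : V} (hv : v ∈ T.dom) : r • v ∈ T.dom := by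
  rw [real_smul_eq]; exact T.dom.smul_mem _ hv

theorem app_zero : T.app 0 = 0 := by
  have := T.app_real_smul 0 T.dom.zero_mem
  rwa [zero_smul, zero_smul] at this

theorem app_neg (v : V) : T.app (-v) = -T.app v := by
  by_cases hv : v ∈ T.dom
  · have := T.app_real_smul (-1) hv
    rwa [neg_one_smul, neg_one_smul] at this
  · have hv' : -v ∉ T.dom := fun h => hv (by simpa using neg_mem h)
    have e : ∀ w ∉ T.dom, T.app w = 0 := fun w hw => dif_neg hw
    rw [e _ hv, e _ hv', neg_zero]

theorem app_sub {v w : V} (hv : v ∈ T.dom) (hw : w ∈ T.dom) :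
    T.app (v - w) = T.app v - T.app w := by
  rw [sub_eq_add_neg, app_add T hv (neg_mem hw), app_neg, ← sub_eq_add_neg]

theorem app_sum {ι : Type*} (s : Finset ι) (x : ι → V) (hx : ∀ i, x i ∈ T.dom) :
    T.app (∑ i ∈ s, x i) = ∑ i ∈ s, T.app (x i) := by
  classical
  induction s using Finset.induction_on with
  | empty => simpa using T.app_zero
  | insert i s hi ih =>
    rw [Finset.sum_insert hi, Finset.sum_insert hi, app_add T (hx i) (sum_mem fun j _ => hx j), ih]

theorem component_app (i : Fin 4) {v : V} (hv : v ∈ T.dom) :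
    (T.component i).app v = ((1 / 4 : ℝ) • unit i) • (unit i • T.app (unit i • v) -
      ∑ j ∈ Finset.univ.erase i, unit j • T.app (unit j • v)) := by
  have h : ∀ q p : ℍ[ℝ], T.sandwich q p ⟨v, hv⟩ = q • T.app (p • v) := fun q p => by
    rw [app_of_mem T (T.smul_mem p v hv)]; rfl
  rw [app_of_mem (T.component i) hv]
  change T.componentMap i ⟨v, hv⟩ = _
  simp only [componentMap, LinearMap.comp_apply, LinearMap.sub_apply, LinearMap.sum_apply, h]
  rfl

theorem smul_eq_sum (q : ℍ[ℝ]) (v : V) :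
    q • v = q.re • unit 0 • v + q.imI • unit 1 • v + q.imJ • unit 2 • v + q.imK • unit 3 • v := by
  simp only [← smul_assoc, ← add_smul]
  congr 1
  ext <;> simp [unit_zero, unit_apply]

theorem app_quat_smul {v : V} (hv : v ∈ T.dom) (q : ℍ[ℝ]) :
    T.app (q • v) = ∑ i, (unit i * q) • (T.component i).app v := by
  have h := fun i => T.smul_mem (unit i) v hv
  have h' := fun (r : ℝ) i => T.real_smul_mem r (h i)
  have e : T.app (q • v) = q.re • T.app (unit 0 • v) + q.imI • T.app (unit 1 • v) +
      q.imJ • T.app (unit 2 • v) + q.imK • T.app (unit 3 • v) := by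
    rw [smul_eq_sum, app_add T (add_mem (add_mem (h' _ 0) (h' _ 1)) (h' _ 2)) (h' _ 3),
      app_add T (add_mem (h' _ 0) (h' _ 1)) (h' _ 2), app_add T (h' _ 0) (h' _ 1),
      app_real_smul T _ (h 0), app_real_smul T _ (h 1), app_real_smul T _ (h 2),
      app_real_smul T _ (h 3)]
  rw [e]
  simp only [T.component_app _ hv]
  generalize hw : (fun i => T.app (unit i • v)) = w
  have hw' : ∀ i, T.app (unit i • v) = w i := fun i => congrFun hw i
  simp only [hw', Fin.sum_univ_four, Finset.sum_erase_eq_sub (Finset.mem_univ _)]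
  match_scalars <;> ext <;> simp [unit_zero, unit_apply] <;> ring

theorem component_app_eq {v : V} (hv : v ∈ T.dom) (x : Fin 4 → V)
    (h : ∀ j, T.app (unit j • v) = ∑ i, (unit i * unit j) • x i) (i : Fin 4) :
    (T.component i).app v = x i := by
  rw [T.component_app i hv]
  simp only [h, Fin.sum_univ_four, Finset.sum_erase_eq_sub (Finset.mem_univ _)]
  obtain rfl | rfl | rfl | rfl : i = 0 ∨ i = 1 ∨ i = 2 ∨ i = 3 := by fin_cases i <;> simp
  all_goals match_scalars
  all_goals ext <;> simp [unit_zero, unit_apply] <;> ring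

theorem component_app_of_notMem {v : V} (hv : v ∉ T.dom) (i : Fin 4) :
    (T.component i).app v = 0 := dif_neg hv

theorem app_eq_sum {v : V} (hv : v ∈ T.dom) : T.app v = ∑ i, unit i • (T.component i).app v := by
  simpa using T.app_quat_smul hv 1

theorem component_quat_smul (q : ℍ[ℝ]) {v : V} (hv : v ∈ T.dom) (i : Fin 4) :
    (T.component i).app (q • v) = q • (T.component i).app v := by
  refine T.component_app_eq (T.smul_mem q v hv) (fun i => q • (T.component i).app v) (fun j => ?_) i
  rw [smul_smul, T.app_quat_smul hv]
  simp only [smul_smul, mul_assoc]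

theorem conj_app {v : V} (hv : v ∈ T.dom) : T.conj.app v = (T.component 0).app v -
    unit 1 • (T.component 1).app v - unit 2 • (T.component 2).app v -
    unit 3 • (T.component 3).app v := by
  rw [app_of_mem T.conj hv, app_of_mem (T.component 0) hv, app_of_mem (T.component 1) hv,
    app_of_mem (T.component 2) hv, app_of_mem (T.component 3) hv]
  rfl

theorem conj_app_eq {v : V} (hv : v ∈ T.dom) :
    T.conj.app v = (2 : ℝ) • (T.component 0).app v - T.app v := by
  rw [T.conj_app hv, T.app_eq_sum hv, Fin.sum_univ_four, unit_zero, one_smul, two_smul]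
  abel

/-- The signs of the components of the conjugate operator. -/
def conjSign : Fin 4 → ℝ := ![1, -1, -1, -1]

theorem conj_component (i : Fin 4) (v : V) :
    (T.conj.component i).app v = conjSign i • (T.component i).app v := by
  by_cases hv : v ∈ T.dom
  · refine T.conj.component_app_eq hv (fun i => conjSign i • (T.component i).app v) (fun j => ?_) i
    rw [T.conj_app (T.smul_mem _ v hv)]
    simp only [T.component_quat_smul _ hv, Fin.sum_univ_four, smul_smul, unit_zero, one_mul]
    simp only [conjSign, Matrix.cons_val_zero, Matrix.cons_val_one, Matrix.cons_val, one_smul,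
      neg_smul, smul_neg]
    abel
  · rw [T.component_app_of_notMem hv, T.conj.component_app_of_notMem hv, smul_zero]

theorem conj_component_zero (v : V) : (T.conj.component 0).app v = (T.component 0).app v := by
  rw [conj_component]; exact one_smul ℝ _

theorem component_app_mul_self (r : ℝ) (i : Fin 4) (v : V) :
    (T.component i).app (r • v) = r • (T.component i).app v := by
  rcases eq_or_ne r 0 with rfl | hr
  · rw [zero_smul, zero_smul, app_zero]
  by_cases hv : v ∈ T.dom
  · exact (T.component i).app_real_smul r hv
  · rw [T.component_app_of_notMem hv, T.component_app_of_notMem, smul_zero]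
    intro h
    refine hv ?_
    have := T.real_smul_mem r⁻¹ h
    rwa [smul_smul, inv_mul_cancel₀ hr, one_smul] at this

theorem conjSign_mul_self (i : Fin 4) : conjSign i * conjSign i = 1 := by
  fin_cases i <;> norm_num [conjSign]

theorem conj_modSq : T.conj.modSq = T.modSq := by
  funext v
  refine Finset.sum_congr rfl fun i _ => ?_
  rw [conj_component, conj_component, component_app_mul_self, smul_smul, conjSign_mul_self, one_smul]

theorem conj_Q (s : ℍ[ℝ]) : T.conj.Q s = T.Q s := by
  funext v
  rw [Q, Q, conj_modSq, conj_component_zero]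

theorem conj_domModSq : T.conj.domModSq = T.domModSq := by
  ext v
  refine and_congr Iff.rfl (forall_congr' fun i => ?_)
  rw [conj_component]
  constructor
  · intro h
    have := T.real_smul_mem (conjSign i) h
    rwa [smul_smul, conjSign_mul_self, one_smul] at this
  · exact T.real_smul_mem _

theorem conj_conj : T.conj.conj = T := by
  have h : T.conj.conj.toPMap = T.toPMap := by
    refine LinearPMap.ext rfl fun v hv hv' => ?_
    have e1 : T.conj.conj.app v = T.conj.conj.toPMap ⟨v, hv⟩ := app_of_mem _ hv
    have e2 : T.app v = T.toPMap ⟨v, hv'⟩ := app_of_mem _ hv'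
    rw [← e1, ← e2, T.conj.conj_app_eq hv', T.conj_app_eq hv', conj_component_zero]
    abel
  exact ext_toPMap h

theorem app_conj_app (hT : T.IsKC) {v : V} (hv : v ∈ T.domModSq) :
    T.app (T.conj.app v) = T.modSq v := by
  have hc := hT.comm v hv
  have h1 := fun i j => T.component_quat_smul (unit i) (hv.2 i) j
  have h2 : ∀ i, unit i • (T.component i).app v ∈ T.dom := fun i => T.smul_mem _ _ (hv.2 i)
  have h3 : ∀ i, (T.component i).app (T.conj.app v) =
      (T.component i).app ((T.component 0).app v) - unit 1 • (T.component i).app ((T.component 1).app v) -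
      unit 2 • (T.component i).app ((T.component 2).app v) -
      unit 3 • (T.component i).app ((T.component 3).app v) := fun i => by
    rw [T.conj_app hv.1, (T.component i).app_sub (sub_mem (sub_mem (hv.2 0) (h2 1)) (h2 2)) (h2 3),
      (T.component i).app_sub (sub_mem (hv.2 0) (h2 1)) (h2 2),
      (T.component i).app_sub (hv.2 0) (h2 1), h1, h1, h1]
  have hm : T.conj.app v ∈ T.dom := by
    rw [T.conj_app hv.1]
    exact sub_mem (sub_mem (sub_mem (hv.2 0) (h2 1)) (h2 2)) (h2 3)
  rw [T.app_eq_sum hm, modSq]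
  simp only [Fin.sum_univ_four, h3]
  rw [hc 1 0, hc 2 0, hc 3 0, hc 2 1, hc 3 1, hc 3 2]
  match_scalars <;> ext <;> simp [unit_zero, unit_apply]

theorem conj_app_mem {v : V} (hv : v ∈ T.domModSq) : T.conj.app v ∈ T.dom := by
  have h2 : ∀ i, unit i • (T.component i).app v ∈ T.dom := fun i => T.smul_mem _ _ (hv.2 i)
  rw [T.conj_app hv.1]
  exact sub_mem (sub_mem (sub_mem (hv.2 0) (h2 1)) (h2 2)) (h2 3)

end RightOp

end Components

section Resolvents

variable {V : Type*} [NormedAddCommGroup V] [NormedSpace ℝ V] [CompleteSpace V]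
  [Module ℍ[ℝ] V] [Module ℍ[ℝ]ᵐᵒᵖ V] [SMulCommClass ℍ[ℝ] ℍ[ℝ]ᵐᵒᵖ V]
  [IsScalarTower ℝ ℍ[ℝ] V] [IsScalarTower ℝ ℍ[ℝ]ᵐᵒᵖ V]
  [NormSMulClass ℍ[ℝ] V] [NormSMulClass ℍ[ℝ]ᵐᵒᵖ V]

theorem unit_one_mem : unit 1 ∈ imUnits := by
  refine ⟨rfl, ?_⟩
  have h := Quaternion.normSq_eq_norm_mul_self (unit 1)
  rw [Quaternion.normSq_def'] at h
  simp only [unit_apply] at h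
  norm_num at h
  nlinarith [norm_nonneg (unit 1)]

/-- Embedding of the complex plane, with imaginary unit `J`. -/
def emb (J : ℍ[ℝ]) (z : ℂ) : ℍ[ℝ] := (z.re : ℍ[ℝ]) + z.im • J

theorem imUnits_mul_self {J : ℍ[ℝ]} (hJ : J ∈ imUnits) : J * J = -1 := by
  have h1 : ‖J‖ * ‖J‖ = 1 := by rw [hJ.2, one_mul]
  have h2 : star J = -J := by ext <;> simp [hJ.1]
  have h3 := Quaternion.self_mul_star J
  rw [h2, Quaternion.normSq_eq_norm_mul_self, h1, mul_neg, neg_eq_iff_eq_neg] at h3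
  simpa using h3

theorem neg_mem_imUnits {J : ℍ[ℝ]} (hJ : J ∈ imUnits) : -J ∈ imUnits :=
  ⟨by simp [hJ.1], by rw [norm_neg]; exact hJ.2⟩

theorem emb_smul (J : ℍ[ℝ]) (z : ℂ) (v : V) : emb J z • v = z.re • v + z.im • J • v := by
  rw [emb, add_smul, smul_assoc]
  exact congrArg (· + _) (algebraMap_smul ℍ[ℝ] z.re v)

namespace RightOp

variable {T : RightOp V} {D : Submodule ℍ[ℝ]ᵐᵒᵖ V} {s : ℍ[ℝ]}

theorem IsAdmissible.conj (hD : T.IsAdmissible D) : T.conj.IsAdmissible D where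
  smul_mem := hD.smul_mem
  le := by rw [conj_domModSq]; exact hD.le
  dense := hD.dense
  component_mem v hv h i := by
    rw [conj_component, real_smul_eq]
    rw [conj_modSq] at h
    exact D.smul_mem _ (hD.component_mem v hv h i)
  closed := by simp only [conj_Q]; exact hD.closed

theorem conj_resolventSet : T.conj.resolventSet D = T.resolventSet D := by
  simp only [resolventSet, conj_Q]

theorem conj_Qinv : T.conj.Qinv D = T.Qinv D := by
  funext s
  simp only [Qinv, QinvFun, conj_Q]

theorem modSq_quat_smul (q : ℍ[ℝ]) {v : V} (hv : v ∈ T.domModSq) :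
    T.modSq (q • v) = q • T.modSq v := by
  simp only [modSq, Finset.smul_sum]
  refine Finset.sum_congr rfl fun i _ => ?_
  rw [component_quat_smul T q hv.1, component_quat_smul T q (hv.2 i)]

theorem Q_quat_smul (q : ℍ[ℝ]) {v : V} (hv : v ∈ T.domModSq) :
    T.Q s (q • v) = s ^ 2 • q • v - (2 * s) • q • (T.component 0).app v + q • T.modSq v := by
  rw [Q, modSq_quat_smul q hv, component_quat_smul T q hv.1]

theorem Q_quat_smul_of_mul_eq {q p : ℍ[ℝ]} (h : p * q = q * s) {v : V} (hv : v ∈ T.domModSq) :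
    T.Q p (q • v) = q • T.Q s v := by
  have h2 : p ^ 2 * q = q * s ^ 2 := by rw [sq, sq, mul_assoc, h, ← mul_assoc, h, mul_assoc]
  have h3 : 2 * p * q = q * (2 * s) := by rw [two_mul, two_mul, add_mul, mul_add, h]
  rw [Q_quat_smul q hv, Q, smul_add, smul_sub, smul_smul, smul_smul, smul_smul, smul_smul, h2, h3]

theorem mem_resolventSet_of_mul_eq (hD : T.IsAdmissible D) {q p : ℍ[ℝ]} (hq : q ≠ 0)
    (h : p * q = q * s) (hs : s ∈ T.resolventSet D) : p ∈ T.resolventSet D := by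
  have h' : s * q⁻¹ = q⁻¹ * p := by
    rw [eq_inv_mul_iff_mul_eq₀ hq, ← mul_assoc, ← h, mul_inv_cancel_right₀ hq]
  refine ⟨fun _ _ => mem_univ _, fun v hv w hw hvw => ?_, fun w _ => ?_⟩
  · have := hs.injOn (hD.smul_mem q⁻¹ v hv) (hD.smul_mem q⁻¹ w hw) (by
      rw [Q_quat_smul_of_mul_eq h' (hD.le hv), Q_quat_smul_of_mul_eq h' (hD.le hw), hvw])
    exact smul_right_injective V (inv_ne_zero hq) this
  · obtain ⟨v, hv, hv'⟩ := hs.surjOn (mem_univ (q⁻¹ • w))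
    refine ⟨q • v, hD.smul_mem q v hv, ?_⟩
    rw [Q_quat_smul_of_mul_eq h (hD.le hv), hv', smul_smul, mul_inv_cancel₀ hq, one_smul]

theorem Qinv_mem (hD : T.IsAdmissible D) (hs : s ∈ T.resolventSet D) (v : V) :
    T.Qinv D s v ∈ D := by rw [coe_Qinv hD hs]; exact QinvFun_mem hs v

theorem Q_Qinv (hD : T.IsAdmissible D) (hs : s ∈ T.resolventSet D) (v : V) :
    T.Q s (T.Qinv D s v) = v := by rw [coe_Qinv hD hs]; exact Q_QinvFun hs v

theorem Qinv_eq (hD : T.IsAdmissible D) (hs : s ∈ T.resolventSet D) {v w : V} (hw : w ∈ D)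
    (h : T.Q s w = v) : T.Qinv D s v = w :=
  hs.injOn (Qinv_mem hD hs v) hw (by rw [Q_Qinv hD hs, h])

theorem Qinv_mem_dom (hD : T.IsAdmissible D) (hs : s ∈ T.resolventSet D) (v : V) :
    T.Qinv D s v ∈ T.dom := (hD.le (Qinv_mem hD hs v)).1

theorem Qinv_quat_smul (hD : T.IsAdmissible D) (hs : s ∈ T.resolventSet D) {q p : ℍ[ℝ]}
    (hq : q ≠ 0) (h : p * q = q * s) (v : V) : T.Qinv D p (q • v) = q • T.Qinv D s v := by
  refine Qinv_eq hD (mem_resolventSet_of_mul_eq hD hq h hs) (hD.smul_mem q _ (Qinv_mem hD hs v)) ?_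
  rw [Q_quat_smul_of_mul_eq h (hD.le (Qinv_mem hD hs v)), Q_Qinv hD hs]

theorem Qinv_comm_smul (hD : T.IsAdmissible D) (hs : s ∈ T.resolventSet D) {q : ℍ[ℝ]}
    (h : s * q = q * s) (v : V) : T.Qinv D s (q • v) = q • T.Qinv D s v := by
  rcases eq_or_ne q 0 with rfl | hq
  · simp
  · exact Qinv_quat_smul hD hs hq h v

theorem SL_apply (hT : T.conj.IsKC) (hD : T.IsAdmissible D) (hs : s ∈ T.resolventSet D) (v : V) :
    T.SL D s v = s • T.Qinv D s v - T.conj.app (T.Qinv D s v) := by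
  rw [coe_SL hT hD hs, coe_Qinv hD hs]

theorem component_mem_domModSq (hD : T.IsAdmissible D) (hs : s ∈ T.resolventSet D) {v : V}
    (hv : v ∈ T.dom) (i : Fin 4) : (T.component i).app (T.Qinv D s v) ∈ D := by
  set w := T.Qinv D s v with hw
  have hwD : w ∈ D := Qinv_mem hD hs v
  have hwm := hD.le hwD
  have h := Q_Qinv hD hs v
  rw [← hw, Q] at h
  refine hD.component_mem w hwD ?_ i
  rw [← sub_eq_iff_eq_add'.2 h.symm]
  exact sub_mem hv (sub_mem (T.smul_mem _ _ hwm.1) (T.smul_mem _ _ (hwm.2 0)))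

/-- The operators `Q_{c,s}^{-1}(T)` commute with the components. -/
theorem Qinv_component (hT : T.IsKC) (hD : T.IsAdmissible D) (hs : s ∈ T.resolventSet D) {v : V}
    (hv : v ∈ T.dom) (i : Fin 4) :
    T.Qinv D s ((T.component i).app v) = (T.component i).app (T.Qinv D s v) := by
  set w := T.Qinv D s v with hw
  have hwD : w ∈ D := Qinv_mem hD hs v
  have hwm := hD.le hwD
  have hi := fun j => component_mem_domModSq hD hs hv j
  simp only [← hw] at hi
  have him := fun j => hD.le (hi j)
  refine Qinv_eq hD hs (hi i) ?_
  have hm : T.modSq w ∈ T.dom := sum_mem fun j _ => (him j).2 j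
  have e1 : T.modSq ((T.component i).app w) = (T.component i).app (T.modSq w) := by
    rw [modSq, modSq, (T.component i).app_sum _ _ fun j => (him j).2 j]
    refine Finset.sum_congr rfl fun j _ => ?_
    rw [hT.comm w hwm j i, hT.comm _ (him j) j i]
  have e2 := Q_Qinv hD hs v
  rw [← hw, Q] at e2
  rw [Q, e1, hT.comm w hwm 0 i, ← e2, app_add (T.component i)
    (sub_mem (T.smul_mem _ _ hwm.1) (T.smul_mem _ _ (hwm.2 0))) hm,
    app_sub (T.component i) (T.smul_mem _ _ hwm.1) (T.smul_mem _ _ (hwm.2 0)),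
    component_quat_smul T _ hwm.1, component_quat_smul T _ (hwm.2 0)]

theorem neg_one_comm (q : ℍ[ℝ]) : (-1 : ℍ[ℝ]) * q = q * (-1) := by simp

/-- `Q_{c,-1}^{-1}(T)` commutes with `T`. -/
theorem Qinv_neg_one_app (hT : T.IsKC) (hD : T.IsAdmissible D) (h1 : -1 ∈ T.resolventSet D) {v : V}
    (hv : v ∈ T.dom) : T.Qinv D (-1) (T.app v) = T.app (T.Qinv D (-1) v) := by
  rw [T.app_eq_sum hv, T.app_eq_sum (Qinv_mem_dom hD h1 v), map_sum]
  refine Finset.sum_congr rfl fun i _ => ?_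
  rw [Qinv_comm_smul hD h1 (neg_one_comm _), Qinv_component hT hD h1 hv]

/-- Uniqueness for the resolvent equation `(z - T) (x + i y) = w₀ + i w₁`. -/
theorem resolvent_unique (hT : T.IsKC) (hTc : T.conj.IsKC) (hD : T.IsAdmissible D)
    (h1 : -1 ∈ T.resolventSet D) {z : ℂ} (hz : ∀ J ∈ imUnits, emb J z ∈ T.resolventSet D)
    {x y : V} (hx : x ∈ T.dom) (hy : y ∈ T.dom) (e1 : T.app x = z.re • x - z.im • y)
    (e2 : T.app y = z.im • x + z.re • y) : x = 0 ∧ y = 0 := by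
  set B := T.Qinv D (-1) with hB
  have hBD : ∀ v, B v ∈ D := Qinv_mem hD h1
  have hBm : ∀ v, B v ∈ T.domModSq := fun v => hD.le (hBD v)
  have f1 : T.app (B x) = z.re • B x - z.im • B y := by
    rw [← Qinv_neg_one_app hT hD h1 hx, ← hB, e1]; simp
  have f2 : T.app (B y) = z.im • B x + z.re • B y := by
    rw [← Qinv_neg_one_app hT hD h1 hy, ← hB, e2]; simp
  have hmod : ∀ v ∈ T.domModSq, T.conj.app (T.app v) = T.modSq v := fun v hv => by
    have := T.conj.app_conj_app hTc (v := v) (by rwa [conj_domModSq])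
    rwa [conj_conj, conj_modSq] at this
  have hr := fun (r : ℝ) v => T.real_smul_mem r (hBm v).1
  have g1 : T.modSq (B x) = z.re • T.conj.app (B x) - z.im • T.conj.app (B y) := by
    rw [← hmod _ (hBm x), f1, T.conj.app_sub (hr _ x) (hr _ y), T.conj.app_real_smul _ (hBm x).1,
      T.conj.app_real_smul _ (hBm y).1]
  have g2 : T.modSq (B y) = z.im • T.conj.app (B x) + z.re • T.conj.app (B y) := by
    rw [← hmod _ (hBm y), f2, app_add T.conj (hr _ x) (hr _ y), T.conj.app_real_smul _ (hBm x).1,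
      T.conj.app_real_smul _ (hBm y).1]
  rw [T.conj_app_eq (hBm x).1, T.conj_app_eq (hBm y).1, f1, f2] at g1 g2
  have key : ∀ J ∈ imUnits, B x + J • B y = 0 := by
    intro J hJ
    have hJD : J • B y ∈ D := hD.smul_mem J _ (hBD y)
    refine (hz J hJ).injOn (add_mem (hBD x) hJD) D.zero_mem ?_
    have h0 : T.Q (emb J z) 0 = 0 := by
      have := T.Q_smul (emb J z) 0 (hBm x)
      rwa [zero_smul, zero_smul] at this
    have hJJ : ∀ v : V, J • J • v = -v := fun v => by
      rw [smul_smul, imUnits_mul_self hJ, neg_smul, one_smul]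
    have hJr : ∀ (r : ℝ) (v : V), J • r • v = r • J • v := fun r v => smul_comm J r v
    rw [h0, T.Q_add _ (hBm x) (hD.le hJD), Q_quat_smul J (hBm y), Q, g1, g2, sq, mul_smul, mul_smul,
      mul_smul, mul_smul]
    simp only [two_smul, emb_smul, smul_add, smul_sub, hJJ, hJr, smul_neg]
    generalize J • B x = a
    generalize J • B y = b
    generalize J • (T.component 0).app (B x) = c
    generalize J • (T.component 0).app (B y) = d
    module
  obtain ⟨J, hJ⟩ : ∃ J, J ∈ imUnits := ⟨unit 1, unit_one_mem⟩
  have k1 := key J hJ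
  have k2 := key (-J) (neg_mem_imUnits hJ)
  rw [neg_smul] at k2
  have hx0 : B x = 0 := by
    have : (2 : ℝ) • B x = 0 := by rw [two_smul, ← add_zero (0 : V)]; nth_rw 1 [← k1]; rw [← k2]; abel
    simpa using this
  have hJ0 : J ≠ 0 := by rintro rfl; simpa using hJ.2
  have hy0 : B y = 0 := by
    rw [hx0, zero_add] at k1
    exact (smul_eq_zero.1 k1).resolve_left hJ0
  have hinj : ∀ v, B v = 0 → v = 0 := fun v hv => by
    have e := Q_Qinv hD h1 v
    have h0 := T.Q_smul (-1) 0 (hBm v)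
    rw [zero_smul, zero_smul] at h0
    rwa [← hB, hv, h0, eq_comm] at e
  exact ⟨hinj x hx0, hinj y hy0⟩

end RightOp

end Resolvents

section Sectors

theorem norm_sq_eq_re_sq_add (s : ℍ[ℝ]) : ‖s‖ ^ 2 = s.re ^ 2 + ‖s.im‖ ^ 2 := by
  rw [sq ‖s‖, sq ‖s.im‖, ← Quaternion.normSq_eq_norm_mul_self, ← Quaternion.normSq_eq_norm_mul_self,
    Quaternion.normSq_def', Quaternion.normSq_def']
  simp
  ring

theorem norm_mk_re_norm_im (s : ℍ[ℝ]) : ‖(⟨s.re, ‖s.im‖⟩ : ℂ)‖ = ‖s‖ := by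
  rw [← sq_eq_sq₀ (norm_nonneg _) (norm_nonneg _), norm_sq_eq_re_sq_add, Complex.sq_norm,
    Complex.normSq_mk]
  ring

theorem absArg_mem (s : ℍ[ℝ]) : absArg s ∈ Icc 0 Real.pi :=
  ⟨Complex.arg_nonneg_iff.2 (norm_nonneg _), Complex.arg_le_pi _⟩

theorem cos_absArg {s : ℍ[ℝ]} (hs : s ≠ 0) : Real.cos (absArg s) = s.re / ‖s‖ := by
  rw [absArg, Complex.cos_arg, norm_mk_re_norm_im]
  rw [← norm_ne_zero_iff, norm_mk_re_norm_im]
  exact norm_ne_zero_iff.2 hs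

theorem absArg_eq_abs_arg {s : ℍ[ℝ]} {z : ℂ} (h1 : s.re = z.re) (h2 : ‖s‖ = ‖z‖) :
    absArg s = |Complex.arg z| := by
  rcases eq_or_ne z 0 with rfl | hz
  · rw [norm_zero, norm_eq_zero] at h2
    have : (⟨0, 0⟩ : ℂ) = 0 := rfl
    simp [absArg, h2, this]
  · have hs : s ≠ 0 := by rw [← norm_ne_zero_iff, h2, norm_ne_zero_iff]; exact hz
    refine Real.injOn_cos (absArg_mem s) ⟨abs_nonneg _, Complex.abs_arg_le_pi z⟩ ?_
    rw [cos_absArg hs, Real.cos_abs, Complex.cos_arg hz, h1, h2]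

theorem absArg_eq_absArg {s p : ℍ[ℝ]} (h1 : s.re = p.re) (h2 : ‖s‖ = ‖p‖) :
    absArg s = absArg p := by
  rw [absArg_eq_abs_arg (s := s) (z := ⟨p.re, ‖p.im‖⟩) h1 (h2.trans (norm_mk_re_norm_im p).symm)]
  exact abs_of_nonneg (absArg_mem p).1

theorem norm_emb {J : ℍ[ℝ]} (hJ : J ∈ imUnits) (z : ℂ) : ‖emb J z‖ = ‖z‖ := by
  have h1 : (emb J z).re = z.re := by simp [emb, hJ.1]
  have h2 : (emb J z).im = z.im • J := by
    ext <;> simp [emb, hJ.1]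
  rw [← sq_eq_sq₀ (norm_nonneg _) (norm_nonneg _), norm_sq_eq_re_sq_add, h1, h2, norm_smul, hJ.2,
    Complex.sq_norm, Complex.normSq_apply, Real.norm_eq_abs, mul_one, sq_abs]
  ring

theorem emb_re {J : ℍ[ℝ]} (hJ : J ∈ imUnits) (z : ℂ) : (emb J z).re = z.re := by
  simp [emb, hJ.1]

theorem absArg_emb {J : ℍ[ℝ]} (hJ : J ∈ imUnits) (z : ℂ) : absArg (emb J z) = |Complex.arg z| :=
  absArg_eq_abs_arg (emb_re hJ z) (norm_emb hJ z)

theorem emb_ne_zero {J : ℍ[ℝ]} (hJ : J ∈ imUnits) {z : ℂ} : emb J z ≠ 0 ↔ z ≠ 0 := by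
  rw [← norm_ne_zero_iff, norm_emb hJ, norm_ne_zero_iff]

theorem emb_mem_sector {J : ℍ[ℝ]} (hJ : J ∈ imUnits) {z : ℂ} {θ : ℝ} :
    emb J z ∈ sector θ ↔ z ∈ csector θ := by
  rw [sector, csector, Set.mem_ofPred, Set.mem_ofPred, emb_ne_zero hJ, absArg_emb hJ]

theorem emb_add (J : ℍ[ℝ]) (z w : ℂ) : emb J (z + w) = emb J z + emb J w := by
  rw [emb, emb, emb, Complex.add_re, Complex.add_im, add_smul, Quaternion.coe_add]
  abel

theorem emb_mul {J : ℍ[ℝ]} (hJ : J ∈ imUnits) (z w : ℂ) : emb J (z * w) = emb J z * emb J w := by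
  have h := imUnits_mul_self hJ
  simp only [emb, Complex.mul_re, Complex.mul_im, add_mul, mul_add, smul_mul_smul_comm, h,
    Quaternion.coe_mul_eq_smul, Quaternion.mul_coe_eq_smul]
  ext <;> simp [hJ.1] <;> ring

theorem emb_one (J : ℍ[ℝ]) : emb J 1 = 1 := by simp [emb]

theorem emb_I (J : ℍ[ℝ]) : emb J Complex.I = J := by simp [emb]

theorem emb_comm (J : ℍ[ℝ]) (z : ℂ) : emb J z * J = J * emb J z := by
  rw [emb, add_mul, mul_add, smul_mul_assoc, mul_smul_comm, Quaternion.coe_commutes]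

theorem emb_zero (J : ℍ[ℝ]) : emb J 0 = 0 := by simp [emb]

theorem closure_sector_subset {ω : ℝ} (hω : ω ∈ Ioo 0 Real.pi) :
    closure (sector ω) ⊆ {s | Real.cos ω * ‖s‖ ≤ s.re} := by
  refine closure_minimal (fun s hs => ?_) (isClosed_le (by fun_prop) Quaternion.continuous_re)
  have h := Real.strictAntiOn_cos (absArg_mem s) (Ioo_subset_Icc_self hω) hs.2
  rw [cos_absArg hs.1, lt_div_iff₀ (norm_pos_iff.2 hs.1)] at h
  exact h.le

end Sectors

section Pairs

variable {V : Type*} [NormedAddCommGroup V] [NormedSpace ℝ V] [CompleteSpace V]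
  [Module ℍ[ℝ] V] [Module ℍ[ℝ]ᵐᵒᵖ V] [SMulCommClass ℍ[ℝ] ℍ[ℝ]ᵐᵒᵖ V]
  [IsScalarTower ℝ ℍ[ℝ] V] [IsScalarTower ℝ ℍ[ℝ]ᵐᵒᵖ V]
  [NormSMulClass ℍ[ℝ] V] [NormSMulClass ℍ[ℝ]ᵐᵒᵖ V]

@[simp] theorem leftMulL_apply (q : ℍ[ℝ]) (v : V) : leftMulL q v = q • v := rfl

theorem leftMulL_mul (p q : ℍ[ℝ]) : (leftMulL (p * q) : V →L[ℝ] V) = leftMulL p * leftMulL q := by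
  ext v; exact mul_smul p q v

theorem leftMulL_one : (leftMulL 1 : V →L[ℝ] V) = 1 := by
  ext v; exact one_smul _ v

theorem leftMulL_add (p q : ℍ[ℝ]) : (leftMulL (p + q) : V →L[ℝ] V) = leftMulL p + leftMulL q := by
  ext v; exact add_smul p q v

theorem leftMulL_smul (r : ℝ) (q : ℍ[ℝ]) : (leftMulL (r • q) : V →L[ℝ] V) = r • leftMulL q := by
  ext v; exact smul_assoc r q v

theorem norm_leftMulL_le (q : ℍ[ℝ]) : ‖(leftMulL q : V →L[ℝ] V)‖ ≤ ‖q‖ :=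
  ContinuousLinearMap.opNorm_le_bound _ (norm_nonneg _) fun v => (norm_smul q v).le

/-- `‖A q‖ = ‖A‖ |q|`. -/
theorem norm_mul_leftMulL (A : V →L[ℝ] V) (q : ℍ[ℝ]) : ‖A * leftMulL q‖ = ‖A‖ * ‖q‖ := by
  have h : ∀ (A : V →L[ℝ] V) q, ‖A * leftMulL q‖ ≤ ‖A‖ * ‖q‖ := fun A q =>
    (norm_mul_le _ _).trans (mul_le_mul_of_nonneg_left (norm_leftMulL_le q) (norm_nonneg _))
  refine le_antisymm (h A q) ?_
  rcases eq_or_ne q 0 with rfl | hq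
  · rw [norm_zero, mul_zero]; exact norm_nonneg _
  · have := h (A * leftMulL q) q⁻¹
    rw [mul_assoc, ← leftMulL_mul, mul_inv_cancel₀ hq, leftMulL_one, mul_one, norm_inv] at this
    rwa [le_mul_inv_iff₀ (norm_pos_iff.2 hq)] at this

namespace RightOp

variable {T : RightOp V} {D : Submodule ℍ[ℝ]ᵐᵒᵖ V} {s : ℍ[ℝ]}

theorem SL_mem (hT : T.conj.IsKC) (hD : T.IsAdmissible D) (hs : s ∈ T.resolventSet D) (v : V) :
    T.SL D s v ∈ T.dom := by
  rw [SL_apply hT hD hs]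
  have h := hD.le (Qinv_mem hD hs v)
  exact sub_mem (T.smul_mem _ _ h.1) (T.conj_app_mem h)

/-- The left resolvent equation. -/
theorem app_SL (hT : T.IsKC) (hTc : T.conj.IsKC) (hD : T.IsAdmissible D)
    (hs : s ∈ T.resolventSet D) (v : V) : T.app (T.SL D s v) = T.SL D s (s • v) - v := by
  have h := hD.le (Qinv_mem hD hs v)
  have hs' := T.smul_mem s _ h.1
  rw [SL_apply hTc hD hs, SL_apply hTc hD hs, Qinv_comm_smul hD hs rfl,
    T.app_sub hs' (T.conj_app_mem h), T.app_conj_app hT h, T.conj_app_eq hs',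
    T.component_quat_smul s h.1, eq_sub_iff_add_eq]
  nth_rw 3 [← Q_Qinv hD hs v]
  rw [Q, mul_smul, two_smul ℍ[ℝ], two_smul ℝ, sq, mul_smul]
  abel

/-- The components `a`, `b` of the resolvent `S_L^{-1}(x + J y, T) = a + b J`. -/
def fstR (T : RightOp V) (D : Submodule ℍ[ℝ]ᵐᵒᵖ V) (J : ℍ[ℝ]) (z : ℂ) : V →L[ℝ] V :=
  (1 / 2 : ℝ) • (T.SL D (emb J z) + T.SL D (emb (-J) z))

/-- The second component of the resolvent. -/
def sndR (T : RightOp V) (D : Submodule ℍ[ℝ]ᵐᵒᵖ V) (J : ℍ[ℝ]) (z : ℂ) : V →L[ℝ] V :=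
  (1 / 2 : ℝ) • (T.SL D (emb (-J) z) - T.SL D (emb J z)) * leftMulL J

theorem fstR_apply (J : ℍ[ℝ]) (z : ℂ) (v : V) : T.fstR D J z v =
    (1 / 2 : ℝ) • (T.SL D (emb J z) v + T.SL D (emb (-J) z) v) := rfl

theorem sndR_apply (J : ℍ[ℝ]) (z : ℂ) (v : V) : T.sndR D J z v =
    (1 / 2 : ℝ) • (T.SL D (emb (-J) z) (J • v) - T.SL D (emb J z) (J • v)) := rfl

/-- The points of the plane that give points of the resolvent set. -/
def regular (T : RightOp V) (D : Submodule ℍ[ℝ]ᵐᵒᵖ V) : Set ℂ :=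
  {z | ∀ J ∈ imUnits, emb J z ∈ T.resolventSet D}

theorem conj_regular : T.conj.regular D = T.regular D := by
  simp only [regular, conj_resolventSet]

/-- The conditions on `T` and `D` that do not involve norms. -/
structure IsGood (T : RightOp V) (D : Submodule ℍ[ℝ]ᵐᵒᵖ V) : Prop where
  isKC : T.IsKC
  conj_isKC : T.conj.IsKC
  admissible : T.IsAdmissible D
  neg_one_mem : -1 ∈ T.resolventSet D

theorem IsGood.conj (h : T.IsGood D) : T.conj.IsGood D :=
  ⟨h.conj_isKC, by rw [conj_conj]; exact h.isKC, h.admissible.conj,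
    by rw [conj_resolventSet]; exact h.neg_one_mem⟩

section

variable (h : T.IsGood D) {z : ℂ} (hz : z ∈ T.regular D) {J : ℍ[ℝ]} (hJ : J ∈ imUnits)
include h hz hJ

theorem fstR_mem (v : V) : T.fstR D J z v ∈ T.dom :=
  T.real_smul_mem _ (add_mem (SL_mem h.conj_isKC h.admissible (hz J hJ) _)
    (SL_mem h.conj_isKC h.admissible (hz (-J) (neg_mem_imUnits hJ)) _))

theorem sndR_mem (v : V) : T.sndR D J z v ∈ T.dom :=
  T.real_smul_mem _ (sub_mem (SL_mem h.conj_isKC h.admissible (hz (-J) (neg_mem_imUnits hJ)) _)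
    (SL_mem h.conj_isKC h.admissible (hz J hJ) _))

theorem app_fstR_sndR (v : V) :
    T.app (T.fstR D J z v) = z.re • T.fstR D J z v - z.im • T.sndR D J z v - v ∧
    T.app (T.sndR D J z v) = z.im • T.fstR D J z v + z.re • T.sndR D J z v := by
  have m1 := fun v => SL_mem h.conj_isKC h.admissible (hz J hJ) v
  have m2 := fun v => SL_mem h.conj_isKC h.admissible (hz (-J) (neg_mem_imUnits hJ)) v
  have a1 := fun v => app_SL h.isKC h.conj_isKC h.admissible (hz J hJ) v
  have a2 := fun v => app_SL h.isKC h.conj_isKC h.admissible (hz (-J) (neg_mem_imUnits hJ)) v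
  have hJJ : ∀ v : V, J • J • v = -v := fun v => by
    rw [smul_smul, imUnits_mul_self hJ, neg_smul, one_smul]
  rw [fstR_apply, sndR_apply, T.app_real_smul _ (add_mem (m1 _) (m2 _)),
    T.app_real_smul _ (sub_mem (m2 _) (m1 _)), app_add T (m1 _) (m2 _), T.app_sub (m2 _) (m1 _),
    a1, a2, a1, a2]
  simp only [emb_smul, neg_smul, hJJ, map_add, map_smul, map_neg, smul_neg]
  generalize J • v = w
  constructor <;> module

theorem SL_eq (v : V) : T.SL D (emb J z) v = T.fstR D J z v + T.sndR D J z (J • v) := by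
  have hJJ : J • J • v = -v := by
    rw [smul_smul, imUnits_mul_self hJ, neg_smul, one_smul]
  rw [fstR_apply, sndR_apply, hJJ, map_neg, map_neg]
  module

/-- The components of the resolvent are determined by the resolvent equation. -/
theorem eq_fstR_sndR {v x y : V} (hx : x ∈ T.dom) (hy : y ∈ T.dom)
    (e1 : T.app x = z.re • x - z.im • y - v) (e2 : T.app y = z.im • x + z.re • y) :
    x = T.fstR D J z v ∧ y = T.sndR D J z v := by
  have m1 := fstR_mem h hz hJ v
  have m2 := sndR_mem h hz hJ v
  obtain ⟨a1, a2⟩ := app_fstR_sndR h hz hJ v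
  have := resolvent_unique h.isKC h.conj_isKC h.admissible h.neg_one_mem hz
    (sub_mem hx m1) (sub_mem hy m2) (by rw [T.app_sub hx m1, e1, a1]; module)
    (by rw [T.app_sub hy m2, e2, a2]; module)
  exact ⟨sub_eq_zero.1 this.1, sub_eq_zero.1 this.2⟩

/-- Uniqueness for the inhomogeneous complex resolvent equation. -/
theorem eq_resolvent {v w x y : V} (hx : x ∈ T.dom) (hy : y ∈ T.dom)
    (e1 : T.app x = z.re • x - z.im • y - v) (e2 : T.app y = z.im • x + z.re • y - w) :
    x = T.fstR D J z v - T.sndR D J z w ∧ y = T.fstR D J z w + T.sndR D J z v := by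
  have m1 := fstR_mem h hz hJ
  have m2 := sndR_mem h hz hJ
  have a := app_fstR_sndR h hz hJ
  have hm1 := sub_mem (m1 v) (m2 w)
  have hm2 := add_mem (m1 w) (m2 v)
  have := resolvent_unique h.isKC h.conj_isKC h.admissible h.neg_one_mem hz
    (sub_mem hx hm1) (sub_mem hy hm2)
    (by rw [T.app_sub hx hm1, e1, T.app_sub (m1 v) (m2 w), (a v).1, (a w).2]; module)
    (by rw [T.app_sub hy hm2, e2, app_add T (m1 w) (m2 v), (a v).2, (a w).1]; module)
  exact ⟨sub_eq_zero.1 this.1, sub_eq_zero.1 this.2⟩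

end

theorem fstR_sndR_eq (h : T.IsGood D) {z : ℂ} (hz : z ∈ T.regular D) {J K : ℍ[ℝ]}
    (hJ : J ∈ imUnits) (hK : K ∈ imUnits) :
    T.fstR D J z = T.fstR D K z ∧ T.sndR D J z = T.sndR D K z := by
  have := fun v => eq_fstR_sndR h hz hK (fstR_mem h hz hJ v) (sndR_mem h hz hJ v)
    (app_fstR_sndR h hz hJ v).1 (app_fstR_sndR h hz hJ v).2
  exact ⟨ContinuousLinearMap.ext fun v => (this v).1, ContinuousLinearMap.ext fun v => (this v).2⟩

end RightOp

end Pairs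

section Commuting

variable {V : Type*} [NormedAddCommGroup V] [NormedSpace ℝ V] [CompleteSpace V]
  [Module ℍ[ℝ] V] [Module ℍ[ℝ]ᵐᵒᵖ V] [SMulCommClass ℍ[ℝ] ℍ[ℝ]ᵐᵒᵖ V]
  [IsScalarTower ℝ ℍ[ℝ] V] [IsScalarTower ℝ ℍ[ℝ]ᵐᵒᵖ V]
  [NormSMulClass ℍ[ℝ] V] [NormSMulClass ℍ[ℝ]ᵐᵒᵖ V]

namespace RightOp

variable {T : RightOp V} {D : Submodule ℍ[ℝ]ᵐᵒᵖ V} {s : ℍ[ℝ]}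

/-- The bounded operator `B` commutes with `T`. -/
def Commutes (T : RightOp V) (B : V →L[ℝ] V) : Prop :=
  ∀ v ∈ T.dom, B v ∈ T.dom ∧ T.app (B v) = B (T.app v)

theorem mem_domModSq (h : T.IsGood D) (hs : s ∈ T.resolventSet D) (v : V) :
    T.Qinv D s v ∈ T.domModSq := h.admissible.le (Qinv_mem h.admissible hs v)

theorem component_conj_app (hT : T.IsKC) {v : V} (hv : v ∈ T.domModSq) :
    (T.component 0).app (T.conj.app v) = T.conj.app ((T.component 0).app v) := by
  have h1 := fun i => T.component_quat_smul (unit i) (hv.2 i) 0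
  have h2 : ∀ i, unit i • (T.component i).app v ∈ T.dom := fun i => T.smul_mem _ _ (hv.2 i)
  rw [T.conj_app hv.1, T.conj_app (hv.2 0),
    (T.component 0).app_sub (sub_mem (sub_mem (hv.2 0) (h2 1)) (h2 2)) (h2 3),
    (T.component 0).app_sub (sub_mem (hv.2 0) (h2 1)) (h2 2),
    (T.component 0).app_sub (hv.2 0) (h2 1), h1, h1, h1, hT.comm v hv 0 1, hT.comm v hv 0 2,
    hT.comm v hv 0 3]

theorem commutes_SL (h : T.IsGood D) (hs : s ∈ T.resolventSet D) :
    (T.component 0).Commutes (T.SL D s) := by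
  intro v hv
  have hm := mem_domModSq h hs v
  refine ⟨SL_mem h.conj_isKC h.admissible hs v, ?_⟩
  rw [SL_apply h.conj_isKC h.admissible hs, SL_apply h.conj_isKC h.admissible hs,
    (T.component 0).app_sub (T.smul_mem _ _ hm.1) (T.conj_app_mem hm),
    Qinv_component h.isKC h.admissible hs hv, component_conj_app h.isKC hm,
    T.component_quat_smul _ hm.1]

theorem commutes_zero_fstR_sndR (h : T.IsGood D) {z : ℂ} (hz : z ∈ T.regular D) {J : ℍ[ℝ]}
    (hJ : J ∈ imUnits) : (T.component 0).Commutes (T.fstR D J z) ∧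
      (T.component 0).Commutes (T.sndR D J z) := by
  have c1 := commutes_SL h (hz J hJ)
  have c2 := commutes_SL h (hz (-J) (neg_mem_imUnits hJ))
  constructor
  · intro v hv
    have e1 := c1 v hv
    have e2 := c2 v hv
    refine ⟨fstR_mem h hz hJ v, ?_⟩
    rw [fstR_apply, fstR_apply, (T.component 0).app_real_smul _ (add_mem e1.1 e2.1),
      app_add (T.component 0) e1.1 e2.1, e1.2, e2.2]
  · intro v hv
    have hv' := T.smul_mem J v hv
    have e1 := c1 _ hv'
    have e2 := c2 _ hv'
    refine ⟨sndR_mem h hz hJ v, ?_⟩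
    rw [sndR_apply, sndR_apply, (T.component 0).app_real_smul _ (sub_mem e2.1 e1.1),
      (T.component 0).app_sub e2.1 e1.1, e1.2, e2.2, T.component_quat_smul _ hv]

theorem commutes_fstR_sndR (h : T.IsGood D) {z : ℂ} (hz : z ∈ T.regular D) {J : ℍ[ℝ]}
    (hJ : J ∈ imUnits) : T.Commutes (T.fstR D J z) ∧ T.Commutes (T.sndR D J z) := by
  have key : ∀ v ∈ T.dom,
      T.fstR D J z (T.app v) = z.re • T.fstR D J z v - z.im • T.sndR D J z v - v ∧
      T.sndR D J z (T.app v) = z.im • T.fstR D J z v + z.re • T.sndR D J z v := by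
    intro v hv
    have m1 := fstR_mem h hz hJ
    have m2 := sndR_mem h hz hJ
    have a := app_fstR_sndR h hz hJ
    have r1 := fun (r : ℝ) v => T.real_smul_mem r (m1 v)
    have r2 := fun (r : ℝ) v => T.real_smul_mem r (m2 v)
    have n1 := sub_mem (sub_mem (r1 z.re v) (r2 z.im v)) hv
    have n2 := add_mem (r1 z.im v) (r2 z.re v)
    have e := eq_fstR_sndR h hz hJ (v := T.app v) n1 n2
      (by
        rw [T.app_sub (sub_mem (r1 _ v) (r2 _ v)) hv, T.app_sub (r1 _ v) (r2 _ v),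
          T.app_real_smul _ (m1 v), T.app_real_smul _ (m2 v), (a v).1, (a v).2])
      (by
        rw [app_add T (r1 _ v) (r2 _ v), T.app_real_smul _ (m1 v), T.app_real_smul _ (m2 v),
          (a v).1, (a v).2])
    exact ⟨e.1.symm, e.2.symm⟩
  constructor
  · intro v hv
    exact ⟨fstR_mem h hz hJ v, by rw [(app_fstR_sndR h hz hJ v).1, (key v hv).1]⟩
  · intro v hv
    exact ⟨sndR_mem h hz hJ v, by rw [(app_fstR_sndR h hz hJ v).2, (key v hv).2]⟩

theorem app_eq_conj {v : V} (hv : v ∈ T.dom) :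
    T.app v = (2 : ℝ) • (T.component 0).app v - T.conj.app v := by
  rw [T.conj_app_eq hv]; abel

theorem Commutes.of_conj {B : V →L[ℝ] V} (h0 : (T.component 0).Commutes B)
    (h : T.conj.Commutes B) : T.Commutes B := by
  intro v hv
  refine ⟨(h v hv).1, ?_⟩
  rw [app_eq_conj hv, app_eq_conj (T := T) (h v hv).1, (h0 v hv).2, (h v hv).2, map_sub, map_smul]

theorem commutes_conj_fstR_sndR (h : T.IsGood D) {z : ℂ} (hz : z ∈ T.regular D) {J : ℍ[ℝ]}
    (hJ : J ∈ imUnits) : T.Commutes (T.conj.fstR D J z) ∧ T.Commutes (T.conj.sndR D J z) := by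
  have hz' : z ∈ T.conj.regular D := by rwa [conj_regular]
  have h1 := commutes_fstR_sndR h.conj hz' hJ
  have h2 := commutes_zero_fstR_sndR h.conj hz' hJ
  have e : ∀ {B}, (T.conj.component 0).Commutes B → (T.component 0).Commutes B := fun hB v hv => by
    have := hB v hv
    rwa [conj_component_zero, conj_component_zero] at this
  exact ⟨.of_conj (e h2.1) h1.1, .of_conj (e h2.2) h1.2⟩

/-- An operator that commutes with `T` commutes with the components of the resolvent. -/
theorem Commutes.comm (h : T.IsGood D) {z : ℂ} (hz : z ∈ T.regular D) {J : ℍ[ℝ]}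
    (hJ : J ∈ imUnits) {B : V →L[ℝ] V} (hB : T.Commutes B) :
    Commute B (T.fstR D J z) ∧ Commute B (T.sndR D J z) := by
  have key := fun v => eq_fstR_sndR h hz hJ (v := B v)
    (hB _ (fstR_mem h hz hJ v)).1 (hB _ (sndR_mem h hz hJ v)).1
    (by rw [(hB _ (fstR_mem h hz hJ v)).2, (app_fstR_sndR h hz hJ v).1]; simp)
    (by rw [(hB _ (sndR_mem h hz hJ v)).2, (app_fstR_sndR h hz hJ v).2]; simp)
  exact ⟨ContinuousLinearMap.ext fun v => (key v).1, ContinuousLinearMap.ext fun v => (key v).2⟩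

/-- The resolvent identity, in terms of components. -/
theorem fstR_sndR_sub (h : T.IsGood D) {z w : ℂ} (hz : z ∈ T.regular D) (hw : w ∈ T.regular D)
    {J : ℍ[ℝ]} (hJ : J ∈ imUnits) (v : V) :
    T.fstR D J z v - T.fstR D J w v =
      (w - z).re • (T.fstR D J z (T.fstR D J w v) - T.sndR D J z (T.sndR D J w v)) -
      (w - z).im • (T.fstR D J z (T.sndR D J w v) + T.sndR D J z (T.fstR D J w v)) ∧
    T.sndR D J z v - T.sndR D J w v =
      (w - z).re • (T.fstR D J z (T.sndR D J w v) + T.sndR D J z (T.fstR D J w v)) +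
      (w - z).im • (T.fstR D J z (T.fstR D J w v) - T.sndR D J z (T.sndR D J w v)) := by
  have m1 := sub_mem (fstR_mem h hz hJ v) (fstR_mem h hw hJ v)
  have m2 := sub_mem (sndR_mem h hz hJ v) (sndR_mem h hw hJ v)
  have a := app_fstR_sndR h hz hJ v
  have b := app_fstR_sndR h hw hJ v
  have := eq_resolvent h hz hJ m1 m2
    (v := (w - z).re • T.fstR D J w v - (w - z).im • T.sndR D J w v)
    (w := (w - z).re • T.sndR D J w v + (w - z).im • T.fstR D J w v)
    (by
      rw [T.app_sub (fstR_mem h hz hJ v) (fstR_mem h hw hJ v), a.1, b.1, Complex.sub_re,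
        Complex.sub_im]
      module)
    (by
      rw [T.app_sub (sndR_mem h hz hJ v) (sndR_mem h hw hJ v), a.2, b.2, Complex.sub_re,
        Complex.sub_im]
      module)
  simp only [map_sub, map_add, map_smul] at this
  rw [this.1, this.2]
  constructor <;> module

/-- `(z - T)⁻¹ (z - conj T)⁻¹ = Q_{c,s}^{-1}(T)`. -/
theorem Qinv_eq_components (h : T.IsGood D) {z : ℂ} (hz : z ∈ T.regular D) {J : ℍ[ℝ]}
    (hJ : J ∈ imUnits) (v : V) :
    T.Qinv D (emb J z) v = (T.conj.fstR D J z (T.fstR D J z v) - T.conj.sndR D J z (T.sndR D J z v)) +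
      (T.conj.fstR D J z (T.sndR D J z (J • v)) + T.conj.sndR D J z (T.fstR D J z (J • v))) := by
  have hz' : z ∈ T.conj.regular D := by rwa [conj_regular]
  have hJ' := neg_mem_imUnits hJ
  have hD := h.admissible
  have hJJ : ∀ v : V, J • J • v = -v := fun v => by
    rw [smul_smul, imUnits_mul_self hJ, neg_smul, one_smul]
  set A := T.Qinv D (emb J z) with hA
  set B := T.Qinv D (emb (-J) z) with hB
  have mA : ∀ v, A v ∈ T.dom := Qinv_mem_dom hD (hz J hJ)
  have mB : ∀ v, B v ∈ T.dom := Qinv_mem_dom hD (hz _ hJ')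
  have cA : ∀ v, A (J • v) = J • A v := Qinv_comm_smul hD (hz J hJ) (emb_comm J z)
  have cB : ∀ v, B (J • v) = J • B v := Qinv_comm_smul hD (hz _ hJ') (by simpa using emb_comm (-J) z)
  have eA : ∀ v, T.conj.app (A v) = emb J z • A v - T.SL D (emb J z) v := fun v => by
    rw [SL_apply h.conj_isKC hD (hz J hJ), sub_sub_cancel]
  have eB : ∀ v, T.conj.app (B v) = emb (-J) z • B v - T.SL D (emb (-J) z) v := fun v => by
    rw [SL_apply h.conj_isKC hD (hz _ hJ'), sub_sub_cancel]
  have key : ∀ v, (1 / 2 : ℝ) • (A v + B v) = _ ∧ (1 / 2 : ℝ) • (B (J • v) - A (J • v)) = _ :=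
    fun v => eq_resolvent h.conj hz' hJ (v := T.fstR D J z v) (w := T.sndR D J z v)
      (x := (1 / 2 : ℝ) • (A v + B v)) (y := (1 / 2 : ℝ) • (B (J • v) - A (J • v)))
      (T.real_smul_mem _ (add_mem (mA _) (mB _))) (T.real_smul_mem _ (sub_mem (mB _) (mA _)))
      (by
        rw [T.conj.app_real_smul _ (add_mem (mA _) (mB _)), app_add T.conj (mA _) (mB _), eA, eB,
          fstR_apply, cA, cB]
        simp only [emb_smul, neg_smul, smul_neg]
        generalize J • A v = a
        generalize J • B v = b
        module)
      (by
        rw [T.conj.app_real_smul _ (sub_mem (mB _) (mA _)), T.conj.app_sub (mB _) (mA _), eA, eB,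
          sndR_apply, cA, cB]
        simp only [emb_smul, neg_smul, hJJ, smul_neg]
        generalize J • A v = a
        generalize J • B v = b
        module)
  have k2 := (key (J • v)).2
  rw [hJJ, map_neg, map_neg] at k2
  rw [← (key v).1, ← k2]
  module

theorem SL_add_conj_SL (h : T.IsGood D) (hs : s ∈ T.resolventSet D) (v : V) :
    T.SL D s v + T.conj.SL D s v =
      (2 : ℝ) • (s • T.Qinv D s v - (T.component 0).app (T.Qinv D s v)) := by
  have hm := mem_domModSq h hs v
  rw [SL_apply h.conj_isKC h.admissible hs, SL_apply (by rw [conj_conj]; exact h.isKC)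
    h.admissible.conj (by rwa [conj_resolventSet]), conj_conj, conj_Qinv, T.conj_app_eq hm.1]
  generalize s • T.Qinv D s v = w
  module

theorem SL_add_conj_SL_smul (h : T.IsGood D) (hs : s ∈ T.resolventSet D) {q : ℍ[ℝ]}
    (hq : s * q = q * s) (v : V) :
    T.SL D s (q • v) + T.conj.SL D s (q • v) = q • (T.SL D s v + T.conj.SL D s v) := by
  rw [SL_add_conj_SL h hs, SL_add_conj_SL h hs, Qinv_comm_smul h.admissible hs hq,
    T.component_quat_smul _ (mem_domModSq h hs v).1, smul_comm q (2 : ℝ), smul_sub q, smul_smul s, smul_smul q s, hq]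

end RightOp

end Commuting

section OfType

variable {V : Type*} [NormedAddCommGroup V] [NormedSpace ℝ V] [CompleteSpace V]
  [Module ℍ[ℝ] V] [Module ℍ[ℝ]ᵐᵒᵖ V] [SMulCommClass ℍ[ℝ] ℍ[ℝ]ᵐᵒᵖ V]
  [IsScalarTower ℝ ℍ[ℝ] V] [IsScalarTower ℝ ℍ[ℝ]ᵐᵒᵖ V]
  [NormSMulClass ℍ[ℝ] V] [NormSMulClass ℍ[ℝ]ᵐᵒᵖ V]

theorem norm_unit (i : Fin 4) : ‖unit i‖ = 1 := by
  have h := Quaternion.normSq_eq_norm_mul_self (unit i)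
  rw [Quaternion.normSq_def'] at h
  have h' : ‖unit i‖ * ‖unit i‖ = 1 := by
    rw [← h]
    obtain rfl | rfl | rfl | rfl : i = 0 ∨ i = 1 ∨ i = 2 ∨ i = 3 := by fin_cases i <;> simp
    all_goals simp [unit_zero, unit_apply]
  nlinarith [norm_nonneg (unit i)]

theorem star_unit_mul (i : Fin 4) : star (unit i) * unit i = 1 := by
  rw [Quaternion.star_mul_self, Quaternion.normSq_eq_norm_mul_self, norm_unit, one_mul]
  rfl

theorem unit_mul_star (i : Fin 4) : unit i * star (unit i) = 1 := by
  rw [Quaternion.self_mul_star, Quaternion.normSq_eq_norm_mul_self, norm_unit, one_mul]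
  rfl

namespace RightOp

variable {T : RightOp V} {D : Submodule ℍ[ℝ]ᵐᵒᵖ V} {s : ℍ[ℝ]} {α β ω : ℝ}

theorem IsOfType.mem_resolventSet (hT : T.IsOfType D α β ω) (hω : ω ∈ Ioo 0 Real.pi) (hs : s ≠ 0)
    (h : ω < absArg s) : s ∈ T.resolventSet D := by
  by_contra h0
  have h1 := closure_sector_subset hω (hT.spectrum_subset h0)
  have h2 := Real.strictAntiOn_cos (Ioo_subset_Icc_self hω) (absArg_mem s) h
  rw [cos_absArg hs, div_lt_iff₀ (norm_pos_iff.2 hs)] at h2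
  exact absurd h1 (not_le.2 h2)

theorem IsOfType.coSector_subset (hT : T.IsOfType D α β ω) (hω : ω ∈ Ioo 0 Real.pi) :
    coSector ω ⊆ T.regular D := fun z hz J hJ =>
  hT.mem_resolventSet hω ((emb_ne_zero hJ).2 hz.1) (by rw [absArg_emb hJ]; exact hz.2)

theorem IsOfType.isGood (hT : T.IsOfType D α β ω) (hω : ω ∈ Ioo 0 Real.pi) : T.IsGood D where
  isKC := hT.isKC
  conj_isKC := hT.conj_isKC
  admissible := hT.admissible
  neg_one_mem := by
    have h := hT.coSector_subset hω (IsResolventPair.neg_one_mem hω.2) _ unit_one_mem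
    simpa [emb] using h

/-- The sum of the resolvents of `T` and its conjugate is a mean of resolvents of `T`. -/
theorem SL_add_conj_SL_eq_mean (h : T.IsGood D) (hs : s ∈ T.resolventSet D) (v : V) :
    T.SL D s v + T.conj.SL D s v = (1 / 2 : ℝ) • ∑ i, unit i •
      T.SL D (star (unit i) * s * unit i) (star (unit i) • v) := by
  have hm := mem_domModSq h hs v
  have e : ∀ i, T.SL D (star (unit i) * s * unit i) (star (unit i) • v) =
      star (unit i) • s • T.Qinv D s v - T.conj.app (star (unit i) • T.Qinv D s v) := by
    intro i
    have hq : star (unit i) ≠ 0 := fun h0 => by simpa [h0] using star_unit_mul i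
    have hp : star (unit i) * s * unit i * star (unit i) = star (unit i) * s := by
      rw [mul_assoc, unit_mul_star, mul_one]
    rw [SL_apply h.conj_isKC h.admissible (mem_resolventSet_of_mul_eq h.admissible hq hp hs),
      Qinv_quat_smul h.admissible hs hq hp, smul_smul, hp, mul_smul]
  suffices h4 : ∑ i, unit i • T.SL D (star (unit i) * s * unit i) (star (unit i) • v) =
      (4 : ℝ) • (s • T.Qinv D s v - (T.component 0).app (T.Qinv D s v)) by
    rw [SL_add_conj_SL h hs, h4, smul_smul]
    norm_num
  simp only [e, smul_sub, smul_smul, unit_mul_star, ← mul_assoc, one_mul]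
  have e2 : ∀ q : ℍ[ℝ], T.conj.app (q • T.Qinv D s v) = q • (T.component 0).app (T.Qinv D s v) -
    (unit 1 * q) • (T.component 1).app (T.Qinv D s v) -
    (unit 2 * q) • (T.component 2).app (T.Qinv D s v) -
    (unit 3 * q) • (T.component 3).app (T.Qinv D s v) := fun q => by
    rw [T.conj_app (T.smul_mem q _ hm.1)]
    simp only [T.component_quat_smul q hm.1, smul_smul]
  simp only [e2, Fin.sum_univ_four]
  generalize s • T.Qinv D s v = w
  match_scalars <;> ext <;> simp [unit_zero, unit_apply] <;> ring

theorem absArg_star_mul_mul (i : Fin 4) (s : ℍ[ℝ]) :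
    ‖star (unit i) * s * unit i‖ = ‖s‖ ∧ absArg (star (unit i) * s * unit i) = absArg s := by
  have h : ‖star (unit i) * s * unit i‖ = ‖s‖ := by
    rw [norm_mul, norm_mul, norm_star, norm_unit, one_mul, mul_one]
  refine ⟨h, absArg_eq_absArg ?_ h⟩
  obtain rfl | rfl | rfl | rfl : i = 0 ∨ i = 1 ∨ i = 2 ∨ i = 3 := by fin_cases i <;> simp
  all_goals simp [unit_zero, unit_apply]

theorem IsOfType.conj (hT : T.IsOfType D α β ω) (hω : ω ∈ Ioo 0 Real.pi) :
    T.conj.IsOfType D α β ω where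
  isKC := hT.conj_isKC
  conj_isKC := by rw [conj_conj]; exact hT.isKC
  admissible := hT.admissible.conj
  spectrum_subset := by
    rw [spectrum, conj_resolventSet]; exact hT.spectrum_subset
  norm_le φ hφ := by
    obtain ⟨C, hC, hb⟩ := hT.norm_le φ hφ
    refine ⟨3 * C, by positivity, fun s hs hs0 => ?_⟩
    have hφs : φ ≤ absArg s := not_lt.1 fun h => hs ⟨hs0, h⟩
    have hres := hT.mem_resolventSet hω hs0 (hφ.1.trans_le hφs)
    have key : T.conj.SL D s = (1 / 2 : ℝ) • ∑ i, leftMulL (unit i) *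
        T.SL D (star (unit i) * s * unit i) * leftMulL (star (unit i)) - T.SL D s := by
      ext v
      have := SL_add_conj_SL_eq_mean (hT.isGood hω) hres v
      rw [_root_.sub_apply, _root_.smul_apply, _root_.sum_apply, eq_sub_iff_add_eq']
      exact this
    have hi : ∀ i, ‖leftMulL (unit i) * T.SL D (star (unit i) * s * unit i) *
        leftMulL (star (unit i))‖ ≤ C * twoPow (-α) (-β) ‖s‖ := by
      intro i
      obtain ⟨h1, h2⟩ := absArg_star_mul_mul i s
      have h3 := hb (star (unit i) * s * unit i) (fun h => hs ⟨hs0, by rw [← h2]; exact h.2⟩) (by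
        rwa [← norm_ne_zero_iff, h1, norm_ne_zero_iff])
      rw [norm_mul_leftMulL, norm_star, norm_unit, mul_one]
      refine (norm_mul_le _ _).trans ?_
      rw [h1] at h3
      have h4 := norm_leftMulL_le (V := V) (unit i)
      rw [norm_unit] at h4
      exact (mul_le_of_le_one_left (norm_nonneg _) h4).trans h3
    have hsum := (norm_sum_le Finset.univ fun i => leftMulL (unit i) *
        T.SL D (star (unit i) * s * unit i) * leftMulL (star (unit i))).trans
        (Finset.sum_le_sum fun i _ => hi i)
    rw [Finset.sum_const, Finset.card_univ, Fintype.card_fin, nsmul_eq_mul] at hsum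
    rw [key]
    refine (norm_sub_le _ _).trans ?_
    rw [norm_smul]
    have := hb s hs hs0
    norm_num at hsum ⊢
    linarith

theorem IsOfType.powBound (hT : T.IsOfType D α β ω) {J : ℍ[ℝ]} (hJ : J ∈ imUnits) :
    PowBound ω (-α) (-β) (T.fstR D J) ∧ PowBound ω (-α) (-β) (T.sndR D J) := by
  have h : ∀ φ ∈ Ioo ω Real.pi, ∃ C ≥ 0, ∀ z : ℂ, z ≠ 0 → φ ≤ |Complex.arg z| → ∀ J ∈ imUnits,
      ‖T.SL D (emb J z)‖ ≤ C * twoPow (-α) (-β) ‖z‖ := by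
    intro φ hφ
    obtain ⟨C, hC, hb⟩ := hT.norm_le φ hφ
    refine ⟨C, hC, fun z hz hz' J hJ => ?_⟩
    have := hb (emb J z) (fun h => not_lt.2 hz' ((absArg_emb hJ z).symm.trans_lt h.2))
      ((emb_ne_zero hJ).2 hz)
    rwa [norm_emb hJ] at this
  constructor
  · intro φ hφ
    obtain ⟨C, hC, hb⟩ := h φ hφ
    refine ⟨C, hC, fun z hz hz' => ?_⟩
    have h1 := hb z hz hz' J hJ
    have h2 := hb z hz hz' (-J) (neg_mem_imUnits hJ)
    rw [fstR, norm_smul]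
    have h3 := norm_add_le (T.SL D (emb J z)) (T.SL D (emb (-J) z))
    norm_num
    linarith
  · intro φ hφ
    obtain ⟨C, hC, hb⟩ := h φ hφ
    refine ⟨C, hC, fun z hz hz' => ?_⟩
    have h1 := hb z hz hz' J hJ
    have h2 := hb z hz hz' (-J) (neg_mem_imUnits hJ)
    rw [sndR, norm_mul_leftMulL, hJ.2, mul_one, norm_smul]
    have h3 := norm_sub_le (T.SL D (emb (-J) z)) (T.SL D (emb J z))
    norm_num
    linarith

end RightOp

end OfType

section SliceSpace

variable (V : Type*) [NormedAddCommGroup V] [NormedSpace ℝ V] [CompleteSpace V]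
  [Module ℍ[ℝ] V] [Module ℍ[ℝ]ᵐᵒᵖ V] [SMulCommClass ℍ[ℝ] ℍ[ℝ]ᵐᵒᵖ V]
  [IsScalarTower ℝ ℍ[ℝ] V] [IsScalarTower ℝ ℍ[ℝ]ᵐᵒᵖ V]
  [NormSMulClass ℍ[ℝ] V] [NormSMulClass ℍ[ℝ]ᵐᵒᵖ V]

/-- The bounded operators on `V`, regarded as a complex Banach space with `z A = A (x + J y)`. -/
def SliceSpace (_ : imUnits) : Type _ := V →L[ℝ] V

variable {V} (J : imUnits)

instance : NormedAddCommGroup (SliceSpace V J) := inferInstanceAs (NormedAddCommGroup (V →L[ℝ] V))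

instance : CompleteSpace (SliceSpace V J) := inferInstanceAs (CompleteSpace (V →L[ℝ] V))

theorem leftMulL_zero : (leftMulL 0 : V →L[ℝ] V) = 0 := by
  ext v; exact zero_smul _ v

/-- The bounded operator given by an element of the complex space. -/
def ofSlice (Y : SliceSpace V J) : V →L[ℝ] V := Y

theorem mul_emb_one (A : V →L[ℝ] V) : A * leftMulL (emb J 1) = A := by
  rw [emb_one, leftMulL_one, mul_one]

theorem mul_emb_mul (z w : ℂ) (A : V →L[ℝ] V) :
    A * leftMulL (emb J (z * w)) = A * leftMulL (emb J w) * leftMulL (emb J z) := by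
  rw [mul_comm, emb_mul J.2, leftMulL_mul, mul_assoc]

theorem mul_emb_add (z w : ℂ) (A : V →L[ℝ] V) :
    A * leftMulL (emb J (z + w)) = A * leftMulL (emb J z) + A * leftMulL (emb J w) := by
  rw [emb_add, leftMulL_add, mul_add]

theorem mul_emb_zero (A : V →L[ℝ] V) : A * leftMulL (emb J 0) = 0 := by
  rw [emb_zero, leftMulL_zero, mul_zero]

theorem norm_mul_emb (z : ℂ) (A : V →L[ℝ] V) : ‖A * leftMulL (emb J z)‖ = ‖z‖ * ‖A‖ := by
  rw [norm_mul_leftMulL, norm_emb J.2, mul_comm]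

theorem mul_emb_ofReal (r : ℝ) (A : V →L[ℝ] V) : A * leftMulL (emb J (r : ℂ)) = r • A := by
  have : emb J (r : ℂ) = r • 1 := by
    rw [emb, Complex.ofReal_re, Complex.ofReal_im, zero_smul, add_zero,
      ← Algebra.algebraMap_eq_smul_one]
    rfl
  rw [this, leftMulL_smul, leftMulL_one, mul_smul_comm, mul_one]

instance : SMul ℂ (SliceSpace V J) where
  smul z Y := (ofSlice J Y * leftMulL (emb J z) : V →L[ℝ] V)

instance : NormedSpace ℂ (SliceSpace V J) where
  one_smul Y := mul_emb_one J (ofSlice J Y)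
  mul_smul z w Y := mul_emb_mul J z w (ofSlice J Y)
  smul_zero z := zero_mul (leftMulL (emb J z) : V →L[ℝ] V)
  smul_add z X Y := add_mul (ofSlice J X) (ofSlice J Y) (leftMulL (emb J z))
  add_smul z w Y := mul_emb_add J z w (ofSlice J Y)
  zero_smul Y := mul_emb_zero J (ofSlice J Y)
  norm_smul_le z Y := (norm_mul_emb J z (ofSlice J Y)).le

/-- The identification of the bounded operators with the complex space. -/
def toSlice : (V →L[ℝ] V) ≃ₗᵢ[ℝ] SliceSpace V J where
  toFun A := A
  invFun Y := Y
  map_add' _ _ := rfl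
  map_smul' r A := (mul_emb_ofReal J r A).symm
  left_inv _ := rfl
  right_inv _ := rfl
  norm_map' _ := rfl

theorem smul_toSlice (z : ℂ) (A : V →L[ℝ] V) :
    z • toSlice J A = toSlice J (A * leftMulL (emb J z)) := rfl

/-- The operator `Y ↦ A Y + B Y J`. -/
def sliceOp (A B : V →L[ℝ] V) : SliceSpace V J →L[ℂ] SliceSpace V J :=
  LinearMap.mkContinuous
    { toFun := fun Y => toSlice J (A * (toSlice J).symm Y + B * (toSlice J).symm Y * leftMulL J)
      map_add' := fun X Y => by simp only [map_add, mul_add, add_mul]; abel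
      map_smul' := fun z Y => by
        obtain ⟨Y, rfl⟩ := (toSlice J).surjective Y
        simp only [smul_toSlice, LinearIsometryEquiv.symm_apply_apply, RingHom.id_apply, add_mul,
          mul_assoc, ← leftMulL_mul, emb_comm] }
    (‖A‖ + ‖B‖) fun Y => by
      obtain ⟨Y, rfl⟩ := (toSlice J).surjective Y
      rw [LinearMap.coe_mk, AddHom.coe_mk, LinearIsometryEquiv.symm_apply_apply,
        LinearIsometryEquiv.norm_map, LinearIsometryEquiv.norm_map, add_mul]
      refine (norm_add_le _ _).trans (add_le_add (norm_mul_le _ _) ?_)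
      rw [norm_mul_leftMulL, J.2.2, mul_one]
      exact norm_mul_le _ _

variable {J}

theorem sliceOp_apply (A B Y : V →L[ℝ] V) :
    sliceOp J A B (toSlice J Y) = toSlice J (A * Y + B * Y * leftMulL J) := rfl

theorem norm_sliceOp_le (A B : V →L[ℝ] V) : ‖sliceOp J A B‖ ≤ ‖A‖ + ‖B‖ :=
  LinearMap.mkContinuous_norm_le _ (by positivity) _

theorem sliceOp_ext {F G : SliceSpace V J →L[ℂ] SliceSpace V J}
    (h : ∀ Y : V →L[ℝ] V, F (toSlice J Y) = G (toSlice J Y)) : F = G :=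
  ContinuousLinearMap.ext fun Y => by
    obtain ⟨Y, rfl⟩ := (toSlice J).surjective Y
    exact h Y

theorem leftMulL_mul_self : (leftMulL (J : ℍ[ℝ]) * leftMulL (J : ℍ[ℝ]) : V →L[ℝ] V) = -1 := by
  rw [← leftMulL_mul, imUnits_mul_self J.2]
  ext v
  simp

theorem sliceOp_mul (A B A' B' : V →L[ℝ] V) : sliceOp J A B * sliceOp J A' B' =
    sliceOp J (A * A' - B * B') (A * B' + B * A') := by
  refine sliceOp_ext fun Y => ?_
  change sliceOp J A B (sliceOp J A' B' _) = _
  rw [sliceOp_apply, sliceOp_apply, sliceOp_apply]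
  congr 1
  have h : B * (A' * Y + B' * Y * leftMulL (J : ℍ[ℝ])) * leftMulL (J : ℍ[ℝ]) =
      B * A' * Y * leftMulL (J : ℍ[ℝ]) - B * B' * Y := by
    rw [mul_add, add_mul, mul_assoc B (B' * Y * _), mul_assoc (B' * Y), leftMulL_mul_self]
    noncomm_ring
  rw [h]
  noncomm_ring

theorem sliceOp_add (A B A' B' : V →L[ℝ] V) :
    sliceOp J A B + sliceOp J A' B' = sliceOp J (A + A') (B + B') := by
  refine sliceOp_ext fun Y => ?_
  rw [_root_.add_apply, sliceOp_apply, sliceOp_apply, sliceOp_apply, ← map_add]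
  congr 1
  noncomm_ring

theorem sliceOp_sub (A B A' B' : V →L[ℝ] V) :
    sliceOp J A B - sliceOp J A' B' = sliceOp J (A - A') (B - B') := by
  refine sliceOp_ext fun Y => ?_
  rw [_root_.sub_apply, sliceOp_apply, sliceOp_apply, sliceOp_apply, ← map_sub]
  congr 1
  noncomm_ring

theorem smul_sliceOp (z : ℂ) (A B : V →L[ℝ] V) :
    z • sliceOp J A B = sliceOp J (z.re • A - z.im • B) (z.re • B + z.im • A) := by
  refine sliceOp_ext fun Y => ?_
  rw [_root_.smul_apply, sliceOp_apply, sliceOp_apply, smul_toSlice]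
  congr 1
  have h1 : (leftMulL (emb J z) : V →L[ℝ] V) = z.re • 1 + z.im • leftMulL (J : ℍ[ℝ]) := by
    ext v; exact emb_smul _ z v
  have h2 : ∀ X : V →L[ℝ] V, X * leftMulL (J : ℍ[ℝ]) * leftMulL (J : ℍ[ℝ]) = -X := fun X => by
    rw [mul_assoc, leftMulL_mul_self, mul_neg_one]
  simp only [h1, mul_add, add_mul, mul_smul_comm, smul_mul_assoc, mul_one, sub_mul, h2]
  module

end SliceSpace

section SliceResolvent

variable {V : Type*} [NormedAddCommGroup V] [NormedSpace ℝ V] [CompleteSpace V]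
  [Module ℍ[ℝ] V] [Module ℍ[ℝ]ᵐᵒᵖ V] [SMulCommClass ℍ[ℝ] ℍ[ℝ]ᵐᵒᵖ V]
  [IsScalarTower ℝ ℍ[ℝ] V] [IsScalarTower ℝ ℍ[ℝ]ᵐᵒᵖ V]
  [NormSMulClass ℍ[ℝ] V] [NormSMulClass ℍ[ℝ]ᵐᵒᵖ V]

theorem emb_conj (J : ℍ[ℝ]) (z : ℂ) : emb J ((starRingEnd ℂ) z) = emb (-J) z := by
  simp [emb]

/-- Two functions with values in an algebra of operators, even and odd under conjugation. -/
structure IsEvenOdd (ω : ℝ) (Z : Subalgebra ℝ (V →L[ℝ] V)) (a b : ℂ → V →L[ℝ] V) : Prop where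
  even : ∀ z ∈ coSector ω, a ((starRingEnd ℂ) z) = a z
  odd : ∀ z ∈ coSector ω, b ((starRingEnd ℂ) z) = -b z
  fst_mem : ∀ z ∈ coSector ω, a z ∈ Z
  snd_mem : ∀ z ∈ coSector ω, b z ∈ Z

theorem IsEvenOdd.mul {ω : ℝ} {Z : Subalgebra ℝ (V →L[ℝ] V)} {a b a' b' : ℂ → V →L[ℝ] V}
    (h : IsEvenOdd ω Z a b) (h' : IsEvenOdd ω Z a' b') :
    IsEvenOdd ω Z (fun z => a z * a' z - b z * b' z) (fun z => a z * b' z + b z * a' z) where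
  even z hz := by simp only [h.even z hz, h.odd z hz, h'.even z hz, h'.odd z hz, neg_mul_neg]
  odd z hz := by
    simp only [h.even z hz, h.odd z hz, h'.even z hz, h'.odd z hz, mul_neg, neg_mul]
    abel
  fst_mem z hz := sub_mem (mul_mem (h.fst_mem z hz) (h'.fst_mem z hz))
    (mul_mem (h.snd_mem z hz) (h'.snd_mem z hz))
  snd_mem z hz := add_mem (mul_mem (h.fst_mem z hz) (h'.snd_mem z hz))
    (mul_mem (h.snd_mem z hz) (h'.fst_mem z hz))

namespace RightOp

variable (T : RightOp V) (D : Submodule ℍ[ℝ]ᵐᵒᵖ V)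

/-- The first component of the resolvent. -/
def resA (z : ℂ) : V →L[ℝ] V := T.fstR D (unit 1) z

/-- The second component of the resolvent. -/
def resB (z : ℂ) : V →L[ℝ] V := T.sndR D (unit 1) z

/-- The components of the resolvents of `T` and its conjugate. -/
def resSet (ω : ℝ) : Set (V →L[ℝ] V) :=
  {B | ∃ z ∈ coSector ω, B = T.resA D z ∨ B = T.resB D z ∨
    B = T.conj.resA D z ∨ B = T.conj.resB D z}

/-- The double commutant of the components of the resolvents. -/
def calcAlg (ω : ℝ) : Subalgebra ℝ (V →L[ℝ] V) :=
  Subalgebra.centralizer ℝ (Set.centralizer (T.resSet D ω))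

/-- The resolvent of `T` as an operator on the slice space. -/
def sliceR (J : imUnits) (z : ℂ) : SliceSpace V J →L[ℂ] SliceSpace V J :=
  sliceOp J (T.resA D z) (T.resB D z)

variable {T D} {α β ω : ℝ}

theorem isEvenOdd_res : IsEvenOdd ω (T.calcAlg D ω) (T.resA D) (T.resB D) where
  even z _ := by
    rw [resA, resA, fstR, fstR, emb_conj, emb_conj, neg_neg, add_comm]
  odd z _ := by
    rw [resB, resB, sndR, sndR, emb_conj, emb_conj, neg_neg, ← neg_mul, ← smul_neg, neg_sub]
  fst_mem z hz := Set.subset_centralizer_centralizer ⟨z, hz, .inl rfl⟩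
  snd_mem z hz := Set.subset_centralizer_centralizer ⟨z, hz, .inr (.inl rfl)⟩

theorem isEvenOdd_conj_res : IsEvenOdd ω (T.calcAlg D ω) (T.conj.resA D) (T.conj.resB D) where
  even z hz := isEvenOdd_res.even z hz
  odd z hz := isEvenOdd_res.odd z hz
  fst_mem z hz := Set.subset_centralizer_centralizer ⟨z, hz, .inr (.inr (.inl rfl))⟩
  snd_mem z hz := Set.subset_centralizer_centralizer ⟨z, hz, .inr (.inr (.inr rfl))⟩

theorem comm_resSet (h : T.IsGood D) (hω : coSector ω ⊆ T.regular D) {A B : V →L[ℝ] V}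
    (hA : A ∈ T.resSet D ω) (hB : B ∈ T.resSet D ω) : A * B = B * A := by
  have hω' : coSector ω ⊆ T.conj.regular D := by rwa [conj_regular]
  have key : ∀ A ∈ T.resSet D ω, T.Commutes A := by
    rintro A ⟨z, hz, rfl | rfl | rfl | rfl⟩
    exacts [(commutes_fstR_sndR h (hω hz) unit_one_mem).1,
      (commutes_fstR_sndR h (hω hz) unit_one_mem).2,
      (commutes_conj_fstR_sndR h (hω hz) unit_one_mem).1,
      (commutes_conj_fstR_sndR h (hω hz) unit_one_mem).2]
  have key' : ∀ A ∈ T.resSet D ω, T.conj.Commutes A := by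
    rintro A ⟨z, hz, rfl | rfl | rfl | rfl⟩
    · have := commutes_conj_fstR_sndR h.conj (hω' hz) unit_one_mem
      rw [conj_conj] at this
      exact this.1
    · have := commutes_conj_fstR_sndR h.conj (hω' hz) unit_one_mem
      rw [conj_conj] at this
      exact this.2
    · exact (commutes_fstR_sndR h.conj (hω' hz) unit_one_mem).1
    · exact (commutes_fstR_sndR h.conj (hω' hz) unit_one_mem).2
  obtain ⟨z, hz, rfl | rfl | rfl | rfl⟩ := hB
  exacts [((key A hA).comm h (hω hz) unit_one_mem).1, ((key A hA).comm h (hω hz) unit_one_mem).2,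
    ((key' A hA).comm h.conj (hω' hz) unit_one_mem).1,
    ((key' A hA).comm h.conj (hω' hz) unit_one_mem).2]

theorem calcAlg_comm (h : T.IsGood D) (hω : coSector ω ⊆ T.regular D) {A B : V →L[ℝ] V}
    (hA : A ∈ T.calcAlg D ω) (hB : B ∈ T.calcAlg D ω) : A * B = B * A := by
  have h1 : T.resSet D ω ⊆ Set.centralizer (T.resSet D ω) := fun A hA B hB =>
    comm_resSet h hω hB hA
  exact (hA B (Set.centralizer_subset h1 hB)).symm

theorem IsOfType.isResolventPair (hT : T.IsOfType D α β ω) (hω : ω ∈ Ioo 0 Real.pi)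
    (J : imUnits) : IsResolventPair α β ω (T.sliceR D J) (T.conj.sliceR D J) := by
  have hg := hT.isGood hω
  have hreg := hT.coSector_subset hω
  have hreg' : coSector ω ⊆ T.conj.regular D := by rwa [conj_regular]
  have res : ∀ {S : RightOp V}, S.IsGood D → coSector ω ⊆ S.regular D →
      ∀ s ∈ coSector ω, ∀ p ∈ coSector ω,
        S.sliceR D J s - S.sliceR D J p = (p - s) • (S.sliceR D J s * S.sliceR D J p) := by
    intro S hg hreg s hs p hp
    rw [sliceR, sliceR, sliceOp_mul, sliceOp_sub, smul_sliceOp]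
    have := fstR_sndR_sub hg (hreg hs) (hreg hp) unit_one_mem
    congr 1
    · ext v; exact (this v).1
    · ext v; exact (this v).2
  have bound : ∀ {S : RightOp V}, S.IsOfType D α β ω → PowBound ω (-α) (-β) (S.sliceR D J) := by
    intro S hS φ hφ
    obtain ⟨C, hC, h1⟩ := (hS.powBound unit_one_mem).1 φ hφ
    obtain ⟨C', hC', h2⟩ := (hS.powBound unit_one_mem).2 φ hφ
    refine ⟨C + C', by positivity, fun z hz hz' => (norm_sliceOp_le _ _).trans ?_⟩
    rw [add_mul]
    exact add_le_add (h1 z hz hz') (h2 z hz hz')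
  refine ⟨res hg hreg, res hg.conj hreg', fun s hs p hp => ?_, bound hT, bound (hT.conj hω)⟩
  have e := isEvenOdd_res (T := T) (D := D) (ω := ω)
  have e' := isEvenOdd_conj_res (T := T) (D := D) (ω := ω)
  have c := fun {A B : V →L[ℝ] V} (hA : A ∈ T.calcAlg D ω) (hB : B ∈ T.calcAlg D ω) =>
    calcAlg_comm hg hreg hA hB
  rw [sliceR, sliceR, sliceOp_mul, sliceOp_mul, c (e.fst_mem s hs) (e'.fst_mem p hp),
    c (e.snd_mem s hs) (e'.snd_mem p hp), c (e.fst_mem s hs) (e'.snd_mem p hp),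
    c (e.snd_mem s hs) (e'.fst_mem p hp), add_comm]

section

variable (hg : T.IsGood D) (hreg : coSector ω ⊆ T.regular D) {z : ℂ} (hz : z ∈ coSector ω)
  (J : imUnits)
include hg hreg hz

theorem resA_eq : T.resA D z = T.fstR D J z :=
  (fstR_sndR_eq hg (hreg hz) unit_one_mem J.2).1

theorem resB_eq : T.resB D z = T.sndR D J z :=
  (fstR_sndR_eq hg (hreg hz) unit_one_mem J.2).2

theorem sliceR_one : T.sliceR D J z (toSlice J 1) = toSlice J (T.SL D (emb J z)) := by
  rw [sliceR, sliceOp_apply]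
  congr 1
  ext v
  rw [SL_eq hg (hreg hz) J.2, resA_eq hg hreg hz J, resB_eq hg hreg hz J]
  rfl

theorem sliceR_mul_one : T.sliceR D J z (T.conj.sliceR D J z (toSlice J 1)) =
    toSlice J (T.Qinv D (emb J z)) := by
  have e := isEvenOdd_res (T := T) (D := D) (ω := ω)
  have e' := isEvenOdd_conj_res (T := T) (D := D) (ω := ω)
  have c := fun {A B : V →L[ℝ] V} (hA : A ∈ T.calcAlg D ω) (hB : B ∈ T.calcAlg D ω) =>
    calcAlg_comm hg hreg hA hB
  have hreg' : coSector ω ⊆ T.conj.regular D := by rwa [conj_regular]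
  change (T.sliceR D J z * T.conj.sliceR D J z) _ = _
  rw [sliceR, sliceR, sliceOp_mul, sliceOp_apply, c (e.fst_mem z hz) (e'.fst_mem z hz),
    c (e.snd_mem z hz) (e'.snd_mem z hz), c (e.fst_mem z hz) (e'.snd_mem z hz),
    c (e.snd_mem z hz) (e'.fst_mem z hz), resA_eq hg hreg hz J, resB_eq hg hreg hz J,
    resA_eq hg.conj hreg' hz J, resB_eq hg.conj hreg' hz J]
  congr 1
  ext v
  rw [Qinv_eq_components hg (hreg hz) J.2, add_comm (T.conj.fstR D J z (T.sndR D J z _))]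
  rfl

theorem sliceR_toSlice {A : V →L[ℝ] V} (hA : A * leftMulL (J : ℍ[ℝ]) = leftMulL (J : ℍ[ℝ]) * A) :
    T.sliceR D J z (toSlice J A) = toSlice J (T.SL D (emb J z) * A) := by
  have h1 := sliceR_one hg hreg hz J
  rw [sliceR, sliceOp_apply] at h1 ⊢
  have h2 := (toSlice J).injective h1
  rw [← h2, add_mul, mul_one, mul_one, mul_assoc, hA, mul_assoc]

theorem sliceR_sq_mul_one :
    T.sliceR D J z (T.sliceR D J z (T.conj.sliceR D J z (toSlice J 1))) =
      toSlice J (T.SL D (emb J z) * T.Qinv D (emb J z)) := by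
  rw [sliceR_mul_one hg hreg hz]
  refine sliceR_toSlice hg hreg hz J ?_
  ext v
  exact Qinv_comm_smul hg.admissible (hreg hz J J.2) (emb_comm J z) v

theorem sliceR_sq_one : T.sliceR D J z (T.sliceR D J z (toSlice J 1)) =
    toSlice J (T.SL D (emb J z) * (T.SL D (emb J z) + T.conj.SL D (emb J z)) -
      T.Qinv D (emb J z)) := by
  have hreg' : coSector ω ⊆ T.conj.regular D := by rwa [conj_regular]
  rw [map_sub, ← sliceR_mul_one hg hreg hz, eq_sub_iff_add_eq, ← map_add,
    sliceR_one hg hreg hz J, sliceR_one hg.conj hreg' hz J, ← map_add]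
  refine sliceR_toSlice hg hreg hz J ?_
  ext v
  exact SL_add_conj_SL_smul hg (hreg hz J J.2) (emb_comm J z) v

end

end RightOp

end SliceResolvent

section Pairing

variable {V : Type*} [NormedAddCommGroup V] [NormedSpace ℝ V] [CompleteSpace V]
  [Module ℍ[ℝ] V] [Module ℍ[ℝ]ᵐᵒᵖ V] [SMulCommClass ℍ[ℝ] ℍ[ℝ]ᵐᵒᵖ V]
  [IsScalarTower ℝ ℍ[ℝ] V] [IsScalarTower ℝ ℍ[ℝ]ᵐᵒᵖ V]
  [NormSMulClass ℍ[ℝ] V] [NormSMulClass ℍ[ℝ]ᵐᵒᵖ V]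

/-- Operator valued kernels `K(x + J y) = a + b J`, with `a`, `b` even and odd. -/
structure IsSliceKernel (α β ω : ℝ) (Z : Subalgebra ℝ (V →L[ℝ] V)) (K : ℍ[ℝ] → V →L[ℝ] V)
    (a b : ℂ → V →L[ℝ] V) : Prop where
  evenOdd : IsEvenOdd ω Z a b
  kernel : ∀ J : imUnits, IsKernel α β ω (fun z => sliceOp J (a z) (b z))
  apply : ∀ (J : imUnits), ∀ z ∈ coSector ω,
    sliceOp J (a z) (b z) (toSlice J 1) = toSlice J (K (emb J z))

/-- The integral of `k(s) K(s)`, for real components `a`, `b` of the kernel `K`. -/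
def pairInt (φ : ℝ) (k : ℂ → ℂ) (a b : ℂ → V →L[ℝ] V) : V →L[ℝ] V :=
  ∫ t : ℝ, ((rayWeight φ t * k (ray φ t)).re • a (ray φ t) -
    (rayWeight φ t * k (ray φ t)).im • b (ray φ t))

/-- Functions that commute with complex conjugation. -/
def IsConjSymm (θ : ℝ) (k : ℂ → ℂ) : Prop :=
  ∀ z ∈ csector θ, k ((starRingEnd ℂ) z) = (starRingEnd ℂ) (k z)

theorem integrable_sum {E ι : Type*} [NormedAddCommGroup E] [Fintype ι] {F : ι → ℝ → E}
    (h : ∀ j, Integrable (F j)) : Integrable fun t => ∑ j, F j t :=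
  integrable_finsetSum _ fun j _ => h j

theorem integral_eq_zero_of_odd {E : Type*} [NormedAddCommGroup E] [NormedSpace ℝ E] {f : ℝ → E}
    (h : ∀ t ≠ 0, f (-t) = -f t) : ∫ t, f t = 0 := by
  have h1 : ∫ t, f t = -∫ t, f t := by
    rw [← integral_neg, ← integral_neg_eq_self f]
    refine integral_congr_ae ?_
    filter_upwards [ae_ne_zero_real] with t ht using h t ht
  have h2 : (2 : ℝ) • ∫ t, f t = 0 := by
    rw [two_smul]; nth_rw 1 [h1]; exact neg_add_cancel _
  simpa using h2

section

variable {ω θ φ : ℝ} {Z : Subalgebra ℝ (V →L[ℝ] V)} {a b : ℂ → V →L[ℝ] V} {k : ℂ → ℂ}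

theorem integrable_toSlice_symm {J : imUnits} {f : ℝ → SliceSpace V J} (hf : Integrable f) :
    Integrable fun t => (toSlice J).symm (f t) :=
  ((toSlice J).symm.toContinuousLinearEquiv.toContinuousLinearMap).integrable_comp hf

theorem integral_toSlice {J : imUnits} (f : ℝ → V →L[ℝ] V) :
    ∫ t, toSlice J (f t) = toSlice J (∫ t, f t) :=
  (toSlice J).toContinuousLinearEquiv.integral_comp_comm f

theorem integral_toSlice_symm {J : imUnits} (f : ℝ → SliceSpace V J) :
    ∫ t, (toSlice J).symm (f t) = (toSlice J).symm (∫ t, f t) :=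
  (toSlice J).symm.toContinuousLinearEquiv.integral_comp_comm f

theorem pairing (hab : IsEvenOdd ω Z a b) (hk : IsConjSymm θ k) (hω : 0 ≤ ω) (hθ : θ ≤ Real.pi)
    (hφ : φ ∈ Ioo ω θ) {J : imUnits}
    (h : CInt φ fun z => k z • sliceOp J (a z) (b z) (toSlice J 1)) :
    Integrable (fun t : ℝ => (rayWeight φ t * k (ray φ t)).re • a (ray φ t) -
      (rayWeight φ t * k (ray φ t)).im • b (ray φ t)) ∧
    ∀ Y, cint φ (fun z => k z • sliceOp J (a z) (b z) (toSlice J Y)) =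
      toSlice J (pairInt φ k a b * Y) := by
  have hφ' : φ ∈ Ioo 0 Real.pi := ⟨hω.trans_lt hφ.1, hφ.2.trans_le hθ⟩
  have hco : ∀ t ≠ 0, ray φ t ∈ coSector ω := fun t ht =>
    ⟨ray_ne_zero ht, by rw [abs_arg_ray hφ' ht]; exact hφ.1⟩
  set F : ℝ → V →L[ℝ] V := fun t => (rayWeight φ t * k (ray φ t)).re • a (ray φ t) -
      (rayWeight φ t * k (ray φ t)).im • b (ray φ t) with hF
  set G : ℝ → V →L[ℝ] V := fun t => (rayWeight φ t * k (ray φ t)).re • b (ray φ t) +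
      (rayWeight φ t * k (ray φ t)).im • a (ray φ t) with hG
  have hsplit : ∀ (Y : V →L[ℝ] V) t,
      rayWeight φ t • k (ray φ t) • sliceOp J (a (ray φ t)) (b (ray φ t)) (toSlice J Y) =
        toSlice J (F t * Y + G t * Y * leftMulL (J : ℍ[ℝ])) := fun Y t => by
    rw [smul_smul, ← _root_.smul_apply, smul_sliceOp, sliceOp_apply]
  have hw : ∀ t ≠ 0, rayWeight φ (-t) * k (ray φ (-t)) =
      (starRingEnd ℂ) (rayWeight φ t * k (ray φ t)) := fun t ht => by
    rw [rayWeight_neg ht, ray_neg, hk _ (csector_ray hφ' hφ.2 ht), map_mul]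
  have hFe : ∀ t ≠ 0, F (-t) = F t := fun t ht => by
    simp only [hF, hw t ht]
    simp only [ray_neg, hab.even _ (hco t ht), hab.odd _ (hco t ht), Complex.conj_re,
      Complex.conj_im, neg_smul, smul_neg, neg_neg]
  have hGo : ∀ t ≠ 0, G (-t) = -G t := fun t ht => by
    simp only [hG, hw t ht]
    simp only [ray_neg, hab.even _ (hco t ht), hab.odd _ (hco t ht), Complex.conj_re,
      Complex.conj_im, neg_smul, smul_neg, neg_add]
  have hΦ : Integrable fun t => F t + G t * leftMulL (J : ℍ[ℝ]) := by
    refine (integrable_toSlice_symm h).congr (.of_forall fun t => ?_)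
    simp only [hsplit, mul_one, LinearIsometryEquiv.symm_apply_apply]
  have hFi : Integrable F := by
    refine ((hΦ.add hΦ.comp_neg).smul (1 / 2 : ℝ)).congr ?_
    filter_upwards [ae_ne_zero_real] with t ht
    simp only [Pi.smul_apply, Pi.add_apply, hFe t ht, hGo t ht, neg_mul]
    module
  have hGi : Integrable G := by
    have h1 : Integrable fun t => G t * leftMulL (J : ℍ[ℝ]) :=
      (hΦ.sub hFi).congr (.of_forall fun t => add_sub_cancel_left _ _)
    refine (h1.mul_const (-leftMulL (J : ℍ[ℝ]))).congr (.of_forall fun t => ?_)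
    simp only [mul_neg, mul_assoc, leftMulL_mul_self, neg_neg, mul_one]
  refine ⟨hFi, fun Y => ?_⟩
  have h0 : ∫ t, G t * Y * leftMulL (J : ℍ[ℝ]) = 0 := integral_eq_zero_of_odd fun t ht => by
    rw [hGo t ht, neg_mul, neg_mul]
  simp only [cint, hsplit]
  rw [integral_toSlice, integral_add (hFi.mul_const Y) ((hGi.mul_const Y).mul_const _), h0, add_zero]
  congr 1
  exact integral_mul_const_of_integrable hFi

theorem pairInt_mem (hab : IsEvenOdd ω Z a b) (hω : 0 ≤ ω) (hφ : φ ∈ Ioo ω Real.pi)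
    {S : Set (V →L[ℝ] V)} (hZ : Z = Subalgebra.centralizer ℝ S) : pairInt φ k a b ∈ Z := by
  have hφ' : φ ∈ Ioo 0 Real.pi := ⟨hω.trans_lt hφ.1, hφ.2⟩
  have hco : ∀ t ≠ 0, ray φ t ∈ coSector ω := fun t ht =>
    ⟨ray_ne_zero ht, by rw [abs_arg_ray hφ' ht]; exact hφ.1⟩
  by_cases h : Integrable (fun t : ℝ => (rayWeight φ t * k (ray φ t)).re • a (ray φ t) -
      (rayWeight φ t * k (ray φ t)).im • b (ray φ t))
  · rw [hZ, Subalgebra.mem_centralizer_iff]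
    intro c hc
    rw [pairInt, ← integral_mul_const_of_integrable h, ← integral_const_mul_of_integrable h]
    refine integral_congr_ae ?_
    filter_upwards [ae_ne_zero_real] with t ht
    have hm := sub_mem (Z.smul_mem (hab.fst_mem _ (hco t ht)) (rayWeight φ t * k (ray φ t)).re)
      (Z.smul_mem (hab.snd_mem _ (hco t ht)) (rayWeight φ t * k (ray φ t)).im)
    rw [hZ, Subalgebra.mem_centralizer_iff] at hm
    exact hm c hc
  · rw [pairInt, integral_undef h]
    exact zero_mem _

end

end Pairing

section Paths

variable {V : Type*} [NormedAddCommGroup V] [NormedSpace ℝ V] [CompleteSpace V]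
  [Module ℍ[ℝ] V] [Module ℍ[ℝ]ᵐᵒᵖ V] [SMulCommClass ℍ[ℝ] ℍ[ℝ]ᵐᵒᵖ V]
  [IsScalarTower ℝ ℍ[ℝ] V] [IsScalarTower ℝ ℍ[ℝ]ᵐᵒᵖ V]
  [NormSMulClass ℍ[ℝ] V] [NormSMulClass ℍ[ℝ]ᵐᵒᵖ V]

theorem emb_real_smul (J : ℍ[ℝ]) (r : ℝ) (z : ℂ) : emb J (r • z) = r • emb J z := by
  simp [emb, smul_smul, Quaternion.coe_mul_eq_smul]

theorem emb_neg (J : ℍ[ℝ]) (z : ℂ) : emb J (-z) = -emb J z := by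
  have := emb_real_smul J (-1) z
  rwa [neg_one_smul, neg_one_smul] at this

theorem emb_exp (J : ℍ[ℝ]) (φ : ℝ) : emb J (Complex.exp (φ * Complex.I)) = expJ J φ := by
  rw [emb, expJ, Complex.exp_ofReal_mul_I_re, Complex.exp_ofReal_mul_I_im]

theorem path_eq (φ : ℝ) (J : ℍ[ℝ]) (t : ℝ) : path φ J t = emb J (ray φ t) := by
  unfold path ray
  split_ifs <;> rw [emb_real_smul, emb_exp]

theorem pathDeriv_eq {J : ℍ[ℝ]} (hJ : J ∈ imUnits) (φ t : ℝ) :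
    pathDeriv φ J t * J⁻¹ = emb J (rayWeight φ t) := by
  have h : J⁻¹ = emb J Complex.I⁻¹ := by
    rw [Complex.inv_I, emb_neg, emb_I]
    refine inv_eq_of_mul_eq_one_right ?_
    rw [mul_neg, imUnits_mul_self hJ, neg_neg]
  rw [rayWeight, emb_mul hJ, h, pathDeriv]
  split_ifs
  · rw [emb_neg, emb_exp]
  · rw [emb_exp]

/-- The coordinate of the projection of a quaternion to the plane `ℝ + J ℝ`. -/
def sliceCoord (J : ℍ[ℝ]) : ℍ[ℝ] →ₗ[ℝ] ℂ where
  toFun q := ⟨q.re, -(J * q).re⟩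
  map_add' p q := by apply Complex.ext <;> simp [mul_add]; ring
  map_smul' r q := by apply Complex.ext <;> simp; ring

theorem sliceCoord_emb_mul {J : ℍ[ℝ]} (hJ : J ∈ imUnits) (z : ℂ) (q : ℍ[ℝ]) :
    sliceCoord J (emb J z * q) = z * sliceCoord J q := by
  have h : J * (emb J z * q) = z.re • (J * q) - z.im • q := by
    rw [← mul_assoc, ← emb_comm, emb, add_mul, smul_mul_assoc, imUnits_mul_self hJ, add_mul,
      mul_assoc, Quaternion.coe_mul_eq_smul]
    simp [sub_eq_add_neg]
  have h' : emb J z * q = z.re • q + z.im • (J * q) := by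
    rw [emb, add_mul, Quaternion.coe_mul_eq_smul, smul_mul_assoc]
  apply Complex.ext
  · simp only [sliceCoord, LinearMap.coe_mk, AddHom.coe_mk, Complex.mul_re, h', Quaternion.re_add,
      Quaternion.re_smul, smul_eq_mul]
    ring
  · simp only [sliceCoord, LinearMap.coe_mk, AddHom.coe_mk, Complex.mul_im, h, Quaternion.re_sub,
      Quaternion.re_smul, smul_eq_mul]
    ring

theorem abs_re_le_norm (q : ℍ[ℝ]) : |q.re| ≤ ‖q‖ := by
  rw [← abs_norm, ← sq_le_sq, norm_sq_eq_re_sq_add]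
  nlinarith [sq_nonneg ‖q.im‖]

theorem norm_sliceCoord_le {J : ℍ[ℝ]} (hJ : J ∈ imUnits) (q : ℍ[ℝ]) :
    ‖sliceCoord J q‖ ≤ 2 * ‖q‖ := by
  refine (Complex.norm_le_abs_re_add_abs_im _).trans ?_
  have h1 := abs_re_le_norm q
  have h2 := abs_re_le_norm (J * q)
  rw [norm_mul, hJ.2, one_mul] at h2
  simp only [sliceCoord, LinearMap.coe_mk, AddHom.coe_mk, abs_neg]
  linarith

theorem sum_re_smul (p : ℍ[ℝ]) : ∑ j, (p * star (unit j)).re • unit j = p := by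
  rw [Fin.sum_univ_four]
  ext <;> simp [unit_zero, unit_apply]

theorem sum_sliceCoord {J : ℍ[ℝ]} (hJ : J ∈ imUnits) (q : ℍ[ℝ]) :
    ∑ j, emb J ((1 / 2 : ℝ) • sliceCoord J (q * star (unit j))) * unit j = q := by
  have h : ∀ j, emb J ((1 / 2 : ℝ) • sliceCoord J (q * star (unit j))) * unit j =
      (1 / 2 : ℝ) • ((q * star (unit j)).re • unit j) -
        (1 / 2 : ℝ) • (J * ((J * q * star (unit j)).re • unit j)) := fun j => by
    rw [emb_real_smul, smul_mul_assoc, emb, add_mul, Quaternion.coe_mul_eq_smul, smul_mul_assoc]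
    simp only [sliceCoord, LinearMap.coe_mk, AddHom.coe_mk, neg_smul, mul_smul_comm, mul_assoc,
      smul_add, smul_neg, sub_eq_add_neg]
  simp only [h, Finset.sum_sub_distrib, ← Finset.smul_sum, ← Finset.mul_sum, sum_re_smul]
  rw [← mul_assoc, imUnits_mul_self hJ, neg_one_mul, smul_neg, sub_neg_eq_add, ← add_smul]
  norm_num

/-- The components of a function on the plane `ℝ + J ℝ`. -/
def sliceComp (J : ℍ[ℝ]) (h : ℍ[ℝ] → ℍ[ℝ]) (j : Fin 4) (z : ℂ) : ℂ :=
  (1 / 2 : ℝ) • sliceCoord J (h (emb J z) * star (unit j))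

theorem norm_sliceComp_le {J : ℍ[ℝ]} (hJ : J ∈ imUnits) (h : ℍ[ℝ] → ℍ[ℝ]) (j : Fin 4) (z : ℂ) :
    ‖sliceComp J h j z‖ ≤ ‖h (emb J z)‖ := by
  rw [sliceComp, norm_smul]
  have := norm_sliceCoord_le hJ (h (emb J z) * star (unit j))
  rw [norm_mul, norm_star, norm_unit, mul_one] at this
  norm_num
  linarith

theorem sum_sliceComp {J : ℍ[ℝ]} (hJ : J ∈ imUnits) (h : ℍ[ℝ] → ℍ[ℝ]) (z : ℂ) :
    h (emb J z) = ∑ j, emb J (sliceComp J h j z) * unit j :=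
  (sum_sliceCoord hJ _).symm

section

variable {α β ω θ φ : ℝ} {Z : Subalgebra ℝ (V →L[ℝ] V)} {K : ℍ[ℝ] → V →L[ℝ] V}
  {a b : ℂ → V →L[ℝ] V} {h : ℍ[ℝ] → ℍ[ℝ]}

theorem smul_smul_toSlice_symm (J : imUnits) (z w : ℂ) (A : V →L[ℝ] V) :
    (toSlice J).symm (z • w • toSlice J A) = A * leftMulL (emb J z * emb J w) := by
  rw [smul_smul, smul_toSlice, LinearIsometryEquiv.symm_apply_apply, emb_mul J.2]

variable (hK : IsSliceKernel α β ω Z K a b) (hω : 0 ≤ ω) (hθ : θ ≤ Real.pi) (hφ : φ ∈ Ioo ω θ)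
  (J : imUnits)
include hK hω hθ hφ

theorem integrand_eq_sum {ι : Type*} [Fintype ι] {hc : ι → ℂ → ℂ} {q : ι → ℍ[ℝ]}
    (hh : ∀ z ∈ csector θ, h (emb J z) = ∑ j, emb J (hc j z) * q j) {t : ℝ} (ht : t ≠ 0) :
    integrand K φ J h t = ∑ j, (toSlice J).symm (rayWeight φ t • hc j (ray φ t) •
      sliceOp J (a (ray φ t)) (b (ray φ t)) (toSlice J 1)) * leftMulL (q j) := by
  have hφ' : φ ∈ Ioo 0 Real.pi := ⟨hω.trans_lt hφ.1, hφ.2.trans_le hθ⟩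
  have hco : ray φ t ∈ coSector ω := ⟨ray_ne_zero ht, by rw [abs_arg_ray hφ' ht]; exact hφ.1⟩
  rw [integrand, path_eq, pathDeriv_eq J.2, hh _ (csector_ray hφ' hφ.2 ht), Finset.mul_sum]
  simp only [hK.apply J _ hco, smul_smul_toSlice_symm, mul_assoc, ← leftMulL_mul,
    ← Finset.mul_sum]
  congr 1
  ext v
  simp [Finset.mul_sum, Finset.sum_smul]

theorem pathIntegral_eq_sum {ι : Type*} [Fintype ι] {hc : ι → ℂ → ℂ} {q : ι → ℍ[ℝ]}
    (hh : ∀ z ∈ csector θ, h (emb J z) = ∑ j, emb J (hc j z) * q j)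
    (hi : ∀ j, CInt φ fun z => hc j z • sliceOp J (a z) (b z) (toSlice J 1)) :
    Converges K φ J h ∧ pathIntegral K φ J h = ∑ j, (toSlice J).symm
      (cint φ fun z => hc j z • sliceOp J (a z) (b z) (toSlice J 1)) * leftMulL (q j) := by
  set g : ι → ℝ → SliceSpace V J := fun j t => rayWeight φ t •
    hc j (ray φ t) • sliceOp J (a (ray φ t)) (b (ray φ t)) (toSlice J 1) with hg
  have hgi : ∀ j, Integrable (g j) := hi
  have hj : ∀ j, Integrable fun t => (toSlice J).symm (g j t) := fun j =>
    integrable_toSlice_symm (hgi j)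
  have hae : integrand K φ J h =ᵐ[volume]
      fun t => ∑ j, (toSlice J).symm (g j t) * leftMulL (q j) := by
    filter_upwards [ae_ne_zero_real] with t ht using integrand_eq_sum hK hω hθ hφ J hh ht
  have hgint : ∀ j, cint φ (fun z => hc j z • sliceOp J (a z) (b z) (toSlice J 1)) =
      ∫ t, g j t := fun j => rfl
  simp only [hgint]
  clear_value g
  have hm : ∀ j, Integrable fun t => (toSlice J).symm (g j t) * leftMulL (q j) := fun j =>
    (hj j).mul_const _
  have hsum : Integrable fun t => ∑ j, (toSlice J).symm (g j t) * leftMulL (q j) :=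
    integrable_sum hm
  have hint : Integrable (integrand K φ J h) := (integrable_congr hae).2 hsum
  refine ⟨hint, ?_⟩
  rw [pathIntegral, integral_congr_ae hae, integral_finsetSum _ fun j _ => hm j]
  refine Finset.sum_congr rfl fun j _ => ?_
  rw [integral_mul_const_of_integrable (hj j), integral_toSlice_symm]

theorem cInt_of_converges (hconv : Converges K φ J h) {k : ℂ → ℂ}
    (hk : ContinuousOn k (csector θ)) (hle : ∀ z ∈ csector θ, ‖k z‖ ≤ ‖h (emb J z)‖) :
    CInt φ fun z => k z • sliceOp J (a z) (b z) (toSlice J 1) := by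
  have hφ' : φ ∈ Ioo 0 Real.pi := ⟨hω.trans_lt hφ.1, hφ.2.trans_le hθ⟩
  have hco : ∀ t ≠ 0, ray φ t ∈ coSector ω := fun t ht =>
    ⟨ray_ne_zero ht, by rw [abs_arg_ray hφ' ht]; exact hφ.1⟩
  refine Integrable.mono hconv ?_ ?_
  · have hc : ContinuousOn (fun z => k z • sliceOp J (a z) (b z) (toSlice J 1))
        (csector θ ∩ coSector ω) :=
      (hk.mono inter_subset_left).smul
        (((hK.kernel J).diff.continuousOn.mono inter_subset_right).clm_apply continuousOn_const)
    exact (measurable_rayWeight φ).aestronglyMeasurable.smul (aestronglyMeasurable_comp_ray hc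
      fun t ht => ⟨csector_ray hφ' hφ.2 ht, hco t ht⟩)
  · filter_upwards [ae_ne_zero_real] with t ht
    have hz := csector_ray hφ' hφ.2 ht
    rw [integrand, norm_mul_leftMulL, path_eq, pathDeriv_eq J.2, norm_mul, norm_emb J.2,
      hK.apply J _ (hco t ht), norm_smul, norm_smul, LinearIsometryEquiv.norm_map]
    have := hle _ hz
    calc _ ≤ ‖rayWeight φ t‖ * (‖h (emb J (ray φ t))‖ * ‖K (emb J (ray φ t))‖) := by gcongr
      _ = _ := by ring

end

end Paths

section SliceFunctions

theorem isOpen_csector {θ : ℝ} (hθ : θ ∈ Icc 0 Real.pi) : IsOpen (csector θ) := by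
  have : csector θ = {z : ℂ | z ≠ 0} ∩ {z | Real.cos θ * ‖z‖ < z.re} := by
    ext z
    refine and_congr_right fun hz => ?_
    rw [← not_le, le_abs_arg_iff hθ hz, not_le]
    rfl
  rw [this]
  exact isOpen_ne.inter (isOpen_lt (by fun_prop) Complex.continuous_re)

theorem mem_reduced_iff {θ : ℝ} {p : ℝ × ℝ} :
    p ∈ reduced (sector θ) ↔ (⟨p.1, p.2⟩ : ℂ) ∈ csector θ :=
  ⟨fun h => (emb_mem_sector unit_one_mem).1 (h _ unit_one_mem),
    fun h _ hJ => (emb_mem_sector hJ).2 h⟩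

/-- The identification of `ℝ²` with `ℂ`. -/
def planeEquiv : (ℝ × ℝ) ≃L[ℝ] ℂ := Complex.equivRealProdCLM.symm

theorem planeEquiv_apply (p : ℝ × ℝ) : planeEquiv p = ⟨p.1, p.2⟩ := rfl

theorem reduced_eq (θ : ℝ) : reduced (sector θ) = planeEquiv ⁻¹' csector θ := by
  ext p; exact mem_reduced_iff

theorem isOpen_reduced {θ : ℝ} (hθ : θ ∈ Icc 0 Real.pi) : IsOpen (reduced (sector θ)) := by
  rw [reduced_eq]; exact (isOpen_csector hθ).preimage planeEquiv.continuous

/-- The values of a left slice hyperholomorphic function, in terms of holomorphic functions. -/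
structure IsSliceFun (θ : ℝ) {ι : Type*} [Fintype ι] (q : ι → ℍ[ℝ]) (h : ℍ[ℝ] → ℍ[ℝ])
    (hc : ι → ℂ → ℂ) : Prop where
  diff : ∀ j, DifferentiableOn ℂ (hc j) (csector θ)
  symm : ∀ j, IsConjSymm θ (hc j)
  apply : ∀ J ∈ imUnits, ∀ z ∈ csector θ, h (emb J z) = ∑ j, emb J (hc j z) * q j

/-- The values of an intrinsic function, in terms of a holomorphic function. -/
structure IsIntrinsicFun (θ : ℝ) (k : ℍ[ℝ] → ℍ[ℝ]) (k' : ℂ → ℂ) : Prop where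
  diff : DifferentiableOn ℂ k' (csector θ)
  symm : IsConjSymm θ k'
  apply : ∀ J ∈ imUnits, ∀ z ∈ csector θ, k (emb J z) = emb J (k' z)

theorem IsHolomorphicPair.differentiableOn {θ : ℝ} (hθ : θ ∈ Icc 0 Real.pi) {a b : ℝ × ℝ → ℍ[ℝ]}
    (h : IsHolomorphicPair (sector θ) a b) (ℓ : ℍ[ℝ] →L[ℝ] ℂ) :
    DifferentiableOn ℂ (fun z : ℂ => ℓ (a (z.re, z.im)) + Complex.I * ℓ (b (z.re, z.im)))
      (csector θ) := by
  intro z hz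
  have hp : planeEquiv.symm z ∈ reduced (sector θ) := mem_reduced_iff.2 hz
  have hnhds := (isOpen_reduced hθ).mem_nhds hp
  have ha := ((h.contDiff_fst.contDiffAt hnhds).differentiableAt one_ne_zero).hasFDerivAt
  have hb := ((h.contDiff_snd.contDiffAt hnhds).differentiableAt one_ne_zero).hasFDerivAt
  have hE := planeEquiv.symm.hasFDerivAt (x := z)
  have hA := ℓ.hasFDerivAt.comp z (ha.comp z hE)
  have hB := ℓ.hasFDerivAt.comp z (hb.comp z hE)
  have hF := hA.add (hB.const_mul Complex.I)
  refine DifferentiableAt.differentiableWithinAt ?_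
  have hF' : HasFDerivAt (fun z : ℂ => ℓ (a (z.re, z.im)) + Complex.I * ℓ (b (z.re, z.im))) _ z := hF
  refine differentiableAt_complex_iff_differentiableAt_real.2 ⟨hF'.differentiableAt, ?_⟩
  have e1 : planeEquiv.symm 1 = (1, 0) := rfl
  have e2 : planeEquiv.symm Complex.I = (0, 1) := rfl
  rw [hF'.fderiv]
  simp only [_root_.add_apply, _root_.smul_apply, ContinuousLinearMap.comp_apply,
    ContinuousLinearEquiv.coe_coe, e1, e2, h.cr_fst _ hp, h.cr_snd _ hp, map_neg, smul_eq_mul,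
    mul_add]
  rw [← mul_assoc, Complex.I_mul_I]
  ring

theorem SHL.exists_pair {θ : ℝ} {h : ℍ[ℝ] → ℍ[ℝ]} (hh : SHL (sector θ) h) :
    ∃ a b : ℝ × ℝ → ℍ[ℝ], IsHolomorphicPair (sector θ) a b ∧ ∀ J ∈ imUnits, ∀ z ∈ csector θ,
      h (emb J z) = a (z.re, z.im) + J * b (z.re, z.im) := by
  obtain ⟨a, b, hab, h⟩ := hh
  exact ⟨a, b, hab, fun J hJ z hz => h (z.re, z.im) (mem_reduced_iff.2 hz) J hJ⟩

theorem SHL.differentiableOn_sliceComp {θ : ℝ} (hθ : θ ∈ Icc 0 Real.pi) {h : ℍ[ℝ] → ℍ[ℝ]}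
    (hh : SHL (sector θ) h) {J : ℍ[ℝ]} (hJ : J ∈ imUnits) (j : Fin 4) :
    DifferentiableOn ℂ (sliceComp J h j) (csector θ) := by
  obtain ⟨a, b, hab, h⟩ := hh.exists_pair
  let ℓ : ℍ[ℝ] →ₗ[ℝ] ℂ := (1 / 2 : ℝ) • sliceCoord J ∘ₗ LinearMap.mulRight ℝ (star (unit j))
  refine (hab.differentiableOn hθ ℓ.toContinuousLinearMap).congr fun z hz => ?_
  have e : ∀ q, ℓ.toContinuousLinearMap q = (1 / 2 : ℝ) • sliceCoord J (q * star (unit j)) :=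
    fun q => rfl
  have hJI := sliceCoord_emb_mul hJ Complex.I (b (z.re, z.im) * star (unit j))
  rw [emb_I] at hJI
  rw [sliceComp, h J hJ z hz, e, e, add_mul, map_add, mul_assoc, hJI, smul_add, mul_smul_comm]

theorem SHL.exists_isSliceFun {θ : ℝ} (hθ : θ ∈ Icc 0 Real.pi) {h : ℍ[ℝ] → ℍ[ℝ]}
    (hh : SHL (sector θ) h) : ∃ hc : Fin 4 → ℂ → ℂ, IsSliceFun θ unit h hc ∧
      ∀ j, ∀ z ∈ csector θ, ‖hc j z‖ ≤ ‖h (emb (unit 1) z)‖ + ‖h (emb (-unit 1) z)‖ := by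
  obtain ⟨a, b, hab, h⟩ := hh.exists_pair
  let ℓ : Fin 4 → ℍ[ℝ] →ₗ[ℝ] ℂ := fun j =>
    { toFun := fun q => ((q * star (unit j)).re : ℂ)
      map_add' := fun p q => by simp [add_mul]
      map_smul' := fun r q => by simp; ring }
  have e : ∀ j q, (ℓ j).toContinuousLinearMap q = ((q * star (unit j)).re : ℂ) := fun j q => rfl
  refine ⟨fun j z => (ℓ j).toContinuousLinearMap (a (z.re, z.im)) +
    Complex.I * (ℓ j).toContinuousLinearMap (b (z.re, z.im)),
    ⟨fun j => hab.differentiableOn hθ _, fun j z hz => ?_, fun J hJ z hz => ?_⟩, fun j z hz => ?_⟩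
  · have hp : (z.re, z.im) ∈ reduced (sector θ) := mem_reduced_iff.2 hz
    have h1 := hab.even _ hp
    have h2 := hab.odd _ hp
    simp only [Complex.conj_re, Complex.conj_im, e] at h1 h2 ⊢
    rw [h1, h2]
    simp
    ring
  · simp only [e]
    have h1 : ∀ x y : ℝ, emb J (x + Complex.I * y) = (x : ℍ[ℝ]) + y • J := fun x y => by
      simp [emb]
    simp only [h1, add_mul, Finset.sum_add_distrib, Quaternion.coe_mul_eq_smul, sum_re_smul,
      smul_mul_assoc, ← mul_smul_comm, ← Finset.mul_sum]
    exact h J hJ z hz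
  · have h1 := h _ unit_one_mem z hz
    have h2 := h _ (neg_mem_imUnits unit_one_mem) z hz
    have n1 : ‖a (z.re, z.im)‖ ≤ (‖a (z.re, z.im) + unit 1 * b (z.re, z.im)‖ +
        ‖a (z.re, z.im) + -unit 1 * b (z.re, z.im)‖) / 2 := by
      have := norm_add_le (a (z.re, z.im) + unit 1 * b (z.re, z.im))
        (a (z.re, z.im) + -unit 1 * b (z.re, z.im))
      have e3 : a (z.re, z.im) + unit 1 * b (z.re, z.im) +
        (a (z.re, z.im) + -unit 1 * b (z.re, z.im)) = (2 : ℝ) • a (z.re, z.im) := by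
        rw [two_smul]; noncomm_ring
      rw [e3, norm_smul] at this
      norm_num at this ⊢
      linarith
    have n2 : ‖b (z.re, z.im)‖ ≤ (‖a (z.re, z.im) + unit 1 * b (z.re, z.im)‖ +
        ‖a (z.re, z.im) + -unit 1 * b (z.re, z.im)‖) / 2 := by
      have := norm_sub_le (a (z.re, z.im) + unit 1 * b (z.re, z.im))
        (a (z.re, z.im) + -unit 1 * b (z.re, z.im))
      have e3 : a (z.re, z.im) + unit 1 * b (z.re, z.im) -
        (a (z.re, z.im) + -unit 1 * b (z.re, z.im)) = (2 : ℝ) • (unit 1 * b (z.re, z.im)) := by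
        rw [two_smul]; noncomm_ring
      rw [e3, norm_smul, norm_mul, norm_unit] at this
      norm_num at this ⊢
      linarith
    have n3 : ∀ q : ℍ[ℝ], ‖((q * star (unit j)).re : ℂ)‖ ≤ ‖q‖ := fun q => by
      rw [Complex.norm_real, Real.norm_eq_abs]
      refine (abs_re_le_norm _).trans ?_
      rw [norm_mul, _root_.norm_star, norm_unit, mul_one]
    rw [h1, h2]
    refine (norm_add_le _ _).trans ?_
    rw [norm_mul, Complex.norm_I, one_mul, e, e]
    linarith [n3 (a (z.re, z.im)), n3 (b (z.re, z.im))]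

theorem Intrinsic.exists_isIntrinsicFun {θ : ℝ} (hθ : θ ∈ Icc 0 Real.pi) {k : ℍ[ℝ] → ℍ[ℝ]}
    (hk : Intrinsic (sector θ) k) : ∃ k', IsIntrinsicFun θ k k' := by
  obtain ⟨a, b, hab, hreal, h⟩ := hk
  let ℓ : ℍ[ℝ] →ₗ[ℝ] ℂ :=
    { toFun := fun q => (q.re : ℂ)
      map_add' := fun p q => by simp
      map_smul' := fun r q => by simp }
  have e : ∀ q, ℓ.toContinuousLinearMap q = (q.re : ℂ) := fun q => rfl
  refine ⟨fun z => ℓ.toContinuousLinearMap (a (z.re, z.im)) +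
    Complex.I * ℓ.toContinuousLinearMap (b (z.re, z.im)),
    hab.differentiableOn hθ _, fun z hz => ?_, fun J hJ z hz => ?_⟩
  · have hp : (z.re, z.im) ∈ reduced (sector θ) := mem_reduced_iff.2 hz
    have h1 := hab.even _ hp
    have h2 := hab.odd _ hp
    simp only [Complex.conj_re, Complex.conj_im, e] at h1 h2 ⊢
    rw [h1, h2]
    simp
  · have hp : (z.re, z.im) ∈ reduced (sector θ) := mem_reduced_iff.2 hz
    have h1 := h (z.re, z.im) hp J hJ
    obtain ⟨h2, h3⟩ := hreal _ hp
    have h4 : ∀ q : ℍ[ℝ], q.im = 0 → q = (q.re : ℍ[ℝ]) := fun q hq => by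
      conv_lhs => rw [← Quaternion.re_add_im q, hq, add_zero]
    have h5 : ∀ x y : ℝ, emb J (x + Complex.I * y) = (x : ℍ[ℝ]) + J * (y : ℍ[ℝ]) := fun x y => by
      simp [emb, Quaternion.mul_coe_eq_smul]
    simp only [e, h5]
    rw [← h4 _ h2, ← h4 _ h3]
    exact h1

theorem isHolomorphicPair_of_isConjSymm {θ : ℝ} (hθ : θ ∈ Icc 0 Real.pi) {ι : Type*} [Fintype ι]
    (q : ι → ℍ[ℝ]) {hc : ι → ℂ → ℂ} (hd : ∀ j, DifferentiableOn ℂ (hc j) (csector θ))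
    (hs : ∀ j, IsConjSymm θ (hc j)) :
    IsHolomorphicPair (sector θ) (fun p => ∑ j, (hc j (planeEquiv p)).re • q j)
      (fun p => ∑ j, (hc j (planeEquiv p)).im • q j) := by
  have hcd : ∀ j, ContDiffOn ℝ 1 (fun p => hc j (planeEquiv p)) (reduced (sector θ)) := fun j => by
    have h1 : ContDiffOn ℝ 1 (hc j) (csector θ) :=
      ((hd j).contDiffOn (isOpen_csector hθ)).restrict_scalars ℝ
    exact h1.comp planeEquiv.contDiff.contDiffOn fun p hp => mem_reduced_iff.1 hp
  have hder : ∀ j, ∀ p ∈ reduced (sector θ), ∃ d : ℂ, ∃ L : ℝ × ℝ →L[ℝ] ℂ,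
      HasFDerivAt (fun p => hc j (planeEquiv p)) L p ∧ L (1, 0) = d ∧
        L (0, 1) = Complex.I * d := fun j p hp => by
    have h1 := ((hd j).differentiableAt
      ((isOpen_csector hθ).mem_nhds (mem_reduced_iff.1 hp))).hasDerivAt
    have h2 := (h1.hasFDerivAt.restrictScalars ℝ).comp p (planeEquiv.hasFDerivAt (x := p))
    refine ⟨deriv (hc j) (planeEquiv p), _, h2, ?_, ?_⟩
    · have e1 : planeEquiv (1, 0) = 1 := rfl
      simp [e1, planeEquiv_apply]
    · have e1 : planeEquiv (0, 1) = Complex.I := rfl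
      simp [e1, planeEquiv_apply]
  have hfd : ∀ p ∈ reduced (sector θ), ∃ d : ι → ℂ, ∃ L : ι → ℝ × ℝ →L[ℝ] ℂ,
      HasFDerivAt (fun p => ∑ j, (hc j (planeEquiv p)).re • q j)
        (∑ j, (Complex.reCLM.comp (L j)).smulRight (q j)) p ∧
      HasFDerivAt (fun p => ∑ j, (hc j (planeEquiv p)).im • q j)
        (∑ j, (Complex.imCLM.comp (L j)).smulRight (q j)) p ∧
      ∀ j, L j (1, 0) = d j ∧ L j (0, 1) = Complex.I * d j := fun p hp => by
    choose d L hL h1 h2 using fun j => hder j p hp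
    refine ⟨d, L, .fun_sum fun j _ => ?_, .fun_sum fun j _ => ?_, fun j => ⟨h1 j, h2 j⟩⟩
    · exact (Complex.reCLM.hasFDerivAt.comp p (hL j)).smul_const (q j)
    · exact (Complex.imCLM.hasFDerivAt.comp p (hL j)).smul_const (q j)
  have hconj : ∀ p : ℝ × ℝ, planeEquiv (p.1, -p.2) = (starRingEnd ℂ) (planeEquiv p) :=
    fun p => rfl
  refine ⟨?_, ?_, fun p hp => ?_, fun p hp => ?_, fun p hp => ?_, fun p hp => ?_⟩
  · exact ContDiffOn.sum fun j _ => (Complex.reCLM.contDiff.comp_contDiffOn (hcd j)).smul contDiffOn_const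
  · exact ContDiffOn.sum fun j _ => (Complex.imCLM.contDiff.comp_contDiffOn (hcd j)).smul contDiffOn_const
  · simp only [hconj, hs _ _ (mem_reduced_iff.1 hp), planeEquiv_apply p, Complex.conj_re]
  · simp only [hconj, planeEquiv_apply p, hs _ _ (mem_reduced_iff.1 hp), Complex.conj_im, neg_smul,
      Finset.sum_neg_distrib]
  · obtain ⟨d, L, h1, h2, h3⟩ := hfd p hp
    rw [h1.fderiv, h2.fderiv]
    simp [_root_.sum_apply, h3]
  · obtain ⟨d, L, h1, h2, h3⟩ := hfd p hp
    rw [h1.fderiv, h2.fderiv]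
    simp [_root_.sum_apply, h3]

theorem IsSliceFun.shl {θ : ℝ} (hθ : θ ∈ Icc 0 Real.pi) {ι : Type*} [Fintype ι]
    {q : ι → ℍ[ℝ]} {h : ℍ[ℝ] → ℍ[ℝ]} {hc : ι → ℂ → ℂ} (hh : IsSliceFun θ q h hc) :
    SHL (sector θ) h := by
  refine ⟨_, _, isHolomorphicPair_of_isConjSymm hθ q hh.diff hh.symm, fun p hp J hJ => ?_⟩
  refine (hh.apply J hJ _ (mem_reduced_iff.1 hp)).trans ?_
  simp only [emb, add_mul, Finset.sum_add_distrib, Quaternion.coe_mul_eq_smul, smul_mul_assoc,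
    Finset.mul_sum, mul_smul_comm]
  rfl

theorem IsIntrinsicFun.intrinsic {θ : ℝ} (hθ : θ ∈ Icc 0 Real.pi) {k : ℍ[ℝ] → ℍ[ℝ]} {k' : ℂ → ℂ}
    (hk : IsIntrinsicFun θ k k') : Intrinsic (sector θ) k := by
  refine ⟨_, _, isHolomorphicPair_of_isConjSymm hθ (fun _ : Unit => 1) (hc := fun _ => k')
    (fun _ => hk.diff) (fun _ => hk.symm), fun p _ => ?_, fun p hp J hJ => ?_⟩
  · constructor <;> ext <;> simp
  · refine (hk.apply J hJ _ (mem_reduced_iff.1 hp)).trans ?_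
    simp only [Finset.univ_unique, Finset.sum_singleton, mul_one, emb,
      planeEquiv_apply, ← Quaternion.coe_mul_eq_smul, Quaternion.coe_commutes _ J]

theorem IsIntrinsicFun.mul {θ : ℝ} {ι : Type*} [Fintype ι] {q : ι → ℍ[ℝ]} {k h : ℍ[ℝ] → ℍ[ℝ]}
    {k' : ℂ → ℂ} {hc : ι → ℂ → ℂ} (hk : IsIntrinsicFun θ k k') (hh : IsSliceFun θ q h hc) :
    IsSliceFun θ q (k * h) (fun j z => k' z * hc j z) where
  diff j := hk.diff.mul (hh.diff j)
  symm j z hz := by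
    change k' _ * hc j _ = _
    rw [hk.symm z hz, hh.symm j z hz, ← map_mul]
  apply J hJ z hz := by
    rw [Pi.mul_apply, hk.apply J hJ z hz, hh.apply J hJ z hz, Finset.mul_sum]
    simp only [emb_mul hJ, mul_assoc]

theorem IsIntrinsicFun.isSliceFun {θ : ℝ} {k : ℍ[ℝ] → ℍ[ℝ]} {k' : ℂ → ℂ}
    (hk : IsIntrinsicFun θ k k') : IsSliceFun θ (fun _ : Unit => 1) k (fun _ => k') where
  diff _ := hk.diff
  symm _ := hk.symm
  apply J hJ z hz := by simp [hk.apply J hJ z hz]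

end SliceFunctions

section Apply

variable {M : Type*} [NormedAddCommGroup M] [NormedSpace ℂ M] {φ : ℝ} {k : ℂ → ℂ}
  {W : ℂ → M →L[ℂ] M}

theorem CInt.smul_apply (h : CInt φ fun z => k z • W z) (x : M) : CInt φ fun z => k z • W z x :=
  h.clm_comp (ContinuousLinearMap.apply ℂ M x)

theorem cint_smul_apply [CompleteSpace M] (h : CInt φ fun z => k z • W z) (x : M) :
    cint φ (fun z => k z • W z) x = cint φ fun z => k z • W z x :=
  (ContinuousLinearMap.cint_comp (ContinuousLinearMap.apply ℂ M x) h).symm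

end Apply

section Kernels

variable {V : Type*} [NormedAddCommGroup V] [NormedSpace ℝ V] [CompleteSpace V]
  [Module ℍ[ℝ] V] [Module ℍ[ℝ]ᵐᵒᵖ V] [SMulCommClass ℍ[ℝ] ℍ[ℝ]ᵐᵒᵖ V]
  [IsScalarTower ℝ ℍ[ℝ] V] [IsScalarTower ℝ ℍ[ℝ]ᵐᵒᵖ V]
  [NormSMulClass ℍ[ℝ] V] [NormSMulClass ℍ[ℝ]ᵐᵒᵖ V]

/-- The first component of a product of slice operators. -/
def mulFst (a b a' b' : ℂ → V →L[ℝ] V) (z : ℂ) : V →L[ℝ] V := a z * a' z - b z * b' z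

/-- The second component of a product of slice operators. -/
def mulSnd (a b a' b' : ℂ → V →L[ℝ] V) (z : ℂ) : V →L[ℝ] V := a z * b' z + b z * a' z

theorem sliceOp_mulFst_mulSnd (J : imUnits) (a b a' b' : ℂ → V →L[ℝ] V) (z : ℂ) :
    sliceOp J (mulFst a b a' b' z) (mulSnd a b a' b' z) =
      sliceOp J (a z) (b z) * sliceOp J (a' z) (b' z) :=
  (sliceOp_mul _ _ _ _).symm

namespace RightOp

variable (T : RightOp V) (D : Submodule ℍ[ℝ]ᵐᵒᵖ V)

/-- The first component of the kernel `Q_{c,s}^{-1}(T)`. -/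
def qinvA : ℂ → V →L[ℝ] V := mulFst (T.resA D) (T.resB D) (T.conj.resA D) (T.conj.resB D)

/-- The second component of the kernel `Q_{c,s}^{-1}(T)`. -/
def qinvB : ℂ → V →L[ℝ] V := mulSnd (T.resA D) (T.resB D) (T.conj.resA D) (T.conj.resB D)

/-- The first component of the kernel `S_L^{-1}(s,T) Q_{c,s}^{-1}(T)`. -/
def slqA : ℂ → V →L[ℝ] V := mulFst (T.resA D) (T.resB D) (T.qinvA D) (T.qinvB D)

/-- The second component of the kernel `S_L^{-1}(s,T) Q_{c,s}^{-1}(T)`. -/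
def slqB : ℂ → V →L[ℝ] V := mulSnd (T.resA D) (T.resB D) (T.qinvA D) (T.qinvB D)

/-- The first component of the square of the resolvent. -/
def sqA : ℂ → V →L[ℝ] V := mulFst (T.resA D) (T.resB D) (T.resA D) (T.resB D)

/-- The second component of the square of the resolvent. -/
def sqB : ℂ → V →L[ℝ] V := mulSnd (T.resA D) (T.resB D) (T.resA D) (T.resB D)

/-- The kernel `S_L^{-1}(s,T) Q_{c,s}^{-1}(T)`. -/
def slq (s : ℍ[ℝ]) : V →L[ℝ] V := T.SL D s * T.Qinv D s

/-- The slice extension of the square of the resolvent. -/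
def sq (s : ℍ[ℝ]) : V →L[ℝ] V := T.SL D s * (T.SL D s + T.conj.SL D s) - T.Qinv D s

variable {T D} {α β ω : ℝ} (hT : T.IsOfType D α β ω) (hω : ω ∈ Ioo 0 Real.pi) (hα : 0 ≤ α)
  (hβ : 0 ≤ β)
include hT hω hα hβ

theorem IsOfType.isSliceKernel_SL :
    IsSliceKernel α β ω (T.calcAlg D ω) (T.SL D) (T.resA D) (T.resB D) where
  evenOdd := isEvenOdd_res
  kernel J := (hT.isResolventPair hω J).kernel_fst ⟨hω.1.le, hω.2⟩ hα hβ
  apply J _ hz := sliceR_one (hT.isGood hω) (hT.coSector_subset hω) hz J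

theorem IsOfType.isSliceKernel_conj_SL :
    IsSliceKernel α β ω (T.calcAlg D ω) (T.conj.SL D) (T.conj.resA D) (T.conj.resB D) where
  evenOdd := isEvenOdd_conj_res
  kernel J := (hT.isResolventPair hω J).symm.kernel_fst ⟨hω.1.le, hω.2⟩ hα hβ
  apply J _ hz := sliceR_one (hT.isGood hω).conj
    (by rw [conj_regular]; exact hT.coSector_subset hω) hz J

theorem IsOfType.isSliceKernel_Qinv :
    IsSliceKernel α β ω (T.calcAlg D ω) (T.Qinv D) (T.qinvA D) (T.qinvB D) where
  evenOdd := isEvenOdd_res.mul isEvenOdd_conj_res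
  kernel J := by
    simp only [qinvA, qinvB, sliceOp_mulFst_mulSnd]
    exact (hT.isResolventPair hω J).kernel_mul ⟨hω.1.le, hω.2⟩ hα hβ
  apply J z hz := by
    rw [qinvA, qinvB, sliceOp_mulFst_mulSnd]
    exact sliceR_mul_one (hT.isGood hω) (hT.coSector_subset hω) hz J

theorem IsOfType.isSliceKernel_slq :
    IsSliceKernel α β ω (T.calcAlg D ω) (T.slq D) (T.slqA D) (T.slqB D) where
  evenOdd := isEvenOdd_res.mul (isEvenOdd_res.mul isEvenOdd_conj_res)
  kernel J := by
    simp only [slqA, slqB, qinvA, qinvB, sliceOp_mulFst_mulSnd]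
    exact (hT.isResolventPair hω J).kernel_sq_mul ⟨hω.1.le, hω.2⟩ hα hβ
  apply J z hz := by
    rw [slqA, slqB, sliceOp_mulFst_mulSnd, qinvA, qinvB, sliceOp_mulFst_mulSnd]
    exact sliceR_sq_mul_one (hT.isGood hω) (hT.coSector_subset hω) hz J

theorem IsOfType.isSliceKernel_sq :
    IsSliceKernel α β ω (T.calcAlg D ω) (T.sq D) (T.sqA D) (T.sqB D) where
  evenOdd := isEvenOdd_res.mul isEvenOdd_res
  kernel J := by
    simp only [sqA, sqB, sliceOp_mulFst_mulSnd]
    exact (hT.isResolventPair hω J).kernel_sq ⟨hω.1.le, hω.2⟩ hα hβ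
  apply J z hz := by
    rw [sqA, sqB, sliceOp_mulFst_mulSnd]
    exact sliceR_sq_one (hT.isGood hω) (hT.coSector_subset hω) hz J

end RightOp

section KernelCalculus

/-- The operator `(2π)⁻¹ ∫ K(s) ds_J h(s)`. -/
def kerCalc (K : ℍ[ℝ] → V →L[ℝ] V) (φ : ℝ) (J : ℍ[ℝ]) (h : ℍ[ℝ] → ℍ[ℝ]) : V →L[ℝ] V :=
  (1 / (2 * Real.pi)) • pathIntegral K φ J h

/-- The operator `(2π)⁻¹ ∫ k(s) K(s)`, for real components `a`, `b` of the kernel `K`. -/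
def pairCalc (φ : ℝ) (k : ℂ → ℂ) (a b : ℂ → V →L[ℝ] V) : V →L[ℝ] V :=
  (1 / (2 * Real.pi)) • pairInt φ k a b

variable {α β ω θ φ χ : ℝ} {Z : Subalgebra ℝ (V →L[ℝ] V)} {K : ℍ[ℝ] → V →L[ℝ] V}
  {a b : ℂ → V →L[ℝ] V} {k h : ℍ[ℝ] → ℍ[ℝ]} {k' : ℂ → ℂ}

theorem integrand_congr {h₁ h₂ : ℍ[ℝ] → ℍ[ℝ]} (hφ : φ ∈ Ioo 0 Real.pi) (hφθ : φ < θ)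
    {J : ℍ[ℝ]} (hJ : J ∈ imUnits) (h : EqOn h₁ h₂ (sector θ)) :
    integrand K φ J h₁ =ᵐ[volume] integrand K φ J h₂ := by
  filter_upwards [ae_ne_zero_real] with t ht
  rw [integrand, integrand, path_eq, h ((emb_mem_sector hJ).2 (csector_ray hφ hφθ ht))]

theorem pathIntegral_congr {h₁ h₂ : ℍ[ℝ] → ℍ[ℝ]} (hφ : φ ∈ Ioo 0 Real.pi) (hφθ : φ < θ)
    {J : ℍ[ℝ]} (hJ : J ∈ imUnits) (h : EqOn h₁ h₂ (sector θ)) :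
    pathIntegral K φ J h₁ = pathIntegral K φ J h₂ :=
  integral_congr_ae (integrand_congr hφ hφθ hJ h)

variable (hK : IsSliceKernel α β ω Z K a b) (hω : 0 ≤ ω) (hθ : θ ≤ Real.pi) (hφ : φ ∈ Ioo ω θ)
include hK hω hθ hφ

theorem IsSliceKernel.cInt_apply (hk : IsCGood α β θ k') (J : imUnits) (x : SliceSpace V J) :
    CInt φ fun z => k' z • sliceOp J (a z) (b z) x :=
  (hk.cInt (hK.kernel J) hω hθ hφ).smul_apply x

theorem IsSliceKernel.opCalc_toSlice (hk : IsCGood α β θ k') (hs : IsConjSymm θ k') (J : imUnits)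
    (A : V →L[ℝ] V) : opCalc (fun z => sliceOp J (a z) (b z)) φ k' (toSlice J A) =
      toSlice J (pairCalc φ k' a b * A) := by
  have h1 := (pairing hK.evenOdd hs hω hθ hφ (hK.cInt_apply hω hθ hφ hk J (toSlice J 1))).2 A
  have h2 := cint_smul_apply (hk.cInt (hK.kernel J) hω hθ hφ) (toSlice J A)
  have e : (2 * Real.pi : ℂ)⁻¹ = (((2 * Real.pi)⁻¹ : ℝ) : ℂ) := by push_cast; rfl
  rw [opCalc, _root_.smul_apply, h2, h1, pairCalc, smul_mul_assoc, map_smul, one_div, e,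
    Complex.coe_smul]

theorem IsSliceKernel.pairCalc_eq (hk : IsCGood α β θ k') (hs : IsConjSymm θ k')
    (hχ : χ ∈ Ioo ω θ) : pairCalc φ k' a b = pairCalc χ k' a b := by
  let J : imUnits := ⟨unit 1, unit_one_mem⟩
  have h1 := hK.opCalc_toSlice hω hθ hφ hk hs J 1
  rw [IsResolventPair.opCalc_eq (hK.kernel J) hk hω hθ hφ hχ,
    hK.opCalc_toSlice hω hθ hχ hk hs J 1, mul_one, mul_one] at h1
  exact ((toSlice J).injective h1).symm

theorem IsSliceKernel.converges {ι : Type*} [Fintype ι] {q : ι → ℍ[ℝ]} {hc : ι → ℂ → ℂ}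
    (hh : IsSliceFun θ q h hc) (hg : ∀ j, IsCGood α β θ (hc j)) (J : imUnits) :
    Converges K φ J h :=
  (pathIntegral_eq_sum hK hω hθ hφ J (hh.apply J J.2) fun j =>
    hK.cInt_apply hω hθ hφ (hg j) J _).1

theorem IsSliceKernel.kerCalc_eq_sum {ι : Type*} [Fintype ι] {q : ι → ℍ[ℝ]} {hc : ι → ℂ → ℂ}
    (hh : IsSliceFun θ q h hc)
    (J : imUnits) (hi : ∀ j, CInt φ fun z => hc j z • sliceOp J (a z) (b z) (toSlice J 1)) :
    kerCalc K φ J h = ∑ j, pairCalc φ (hc j) a b * leftMulL (q j) := by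
  rw [kerCalc, (pathIntegral_eq_sum hK hω hθ hφ J (hh.apply J J.2) hi).2, Finset.smul_sum]
  refine Finset.sum_congr rfl fun j _ => ?_
  rw [(pairing hK.evenOdd (hh.symm j) hω hθ hφ (hi j)).2,
    LinearIsometryEquiv.symm_apply_apply, mul_one, pairCalc, smul_mul_assoc]

theorem IsSliceKernel.kerCalc_eq_kerCalc {ι : Type*} [Fintype ι] {q : ι → ℍ[ℝ]} {hc : ι → ℂ → ℂ}
    (hh : IsSliceFun θ q h hc) (hg : ∀ j, IsCGood α β θ (hc j)) (J J' : imUnits)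
    (hχ : χ ∈ Ioo ω θ) : kerCalc K φ J h = kerCalc K χ J' h := by
  rw [hK.kerCalc_eq_sum hω hθ hφ hh J fun j => hK.cInt_apply hω hθ hφ (hg j) J _,
    hK.kerCalc_eq_sum hω hθ hχ hh J' fun j => hK.cInt_apply hω hθ hχ (hg j) J' _]
  refine Finset.sum_congr rfl fun j _ => ?_
  rw [hK.pairCalc_eq hω hθ hφ (hg j) (hh.symm j) hχ]

theorem IsSliceKernel.kerCalc_eq_pairCalc (hk : IsIntrinsicFun θ k k') (J : imUnits)
    (hc : Converges K φ J k) : kerCalc K φ J k = pairCalc φ k' a b := by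
  have := hK.kerCalc_eq_sum hω hθ hφ hk.isSliceFun J fun _ =>
    cInt_of_converges hK hω hθ hφ J hc hk.diff.continuousOn fun z hz => by
      rw [hk.apply J J.2 z hz, norm_emb J.2]
  simpa [leftMulL_one] using this

end KernelCalculus

end Kernels

section Decay

variable {α β θ : ℝ}

theorem Decays.mono {a b c d : ℝ} {h : ℍ[ℝ] → ℍ[ℝ]} (hd : Decays a b θ h) (h1 : c ≤ a)
    (h2 : b ≤ d) : Decays c d θ h := by
  obtain ⟨δ, hδ, C, hC, hb⟩ := hd
  exact ⟨δ, hδ, C, hC, fun s hs => (hb s hs).trans (mul_le_mul_of_nonneg_left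
    (twoPow_le_twoPow (norm_pos_iff.2 hs.1) (by linarith) (by linarith)) hC)⟩

theorem isCDecaying_of_le {h : ℍ[ℝ] → ℍ[ℝ]} (hd : Decays 1 1 θ h) {k : ℂ → ℂ}
    (hk : DifferentiableOn ℂ k (csector θ)) {J : ℍ[ℝ]} (hJ : J ∈ imUnits)
    (hle : ∀ z ∈ csector θ, ‖k z‖ ≤ ‖h (emb J z)‖) : IsCDecaying θ k := by
  obtain ⟨δ, hδ, C, hC, hb⟩ := hd
  refine ⟨hk, δ, hδ, C, hC, fun z hz => (hle z hz).trans ?_⟩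
  have := hb _ ((emb_mem_sector hJ).2 hz)
  rw [norm_emb hJ] at this
  simpa using this

theorem isCDecaying_sliceComp (hθ : θ ∈ Icc 0 Real.pi) {h : ℍ[ℝ] → ℍ[ℝ]}
    (hh : SHL (sector θ) h) (hd : Decays 1 1 θ h) {J : ℍ[ℝ]} (hJ : J ∈ imUnits) (j : Fin 4) :
    IsCDecaying θ (sliceComp J h j) :=
  isCDecaying_of_le hd (hh.differentiableOn_sliceComp hθ hJ j) hJ fun z _ =>
    norm_sliceComp_le hJ h j z

theorem IsCGood.mul {k h : ℂ → ℂ} (hk : IsCGood α β θ k) (hh : IsCDecaying θ h) :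
    IsCGood α β θ (fun z => k z * h z) := by
  obtain ⟨C', hC', hb'⟩ := hh.bounded
  obtain ⟨δ, hδ, C, hC, hb⟩ := hk.decay
  refine ⟨hk.diff.mul hh.diff, δ, hδ, C * C', by positivity, fun z hz => ?_⟩
  rw [norm_mul, mul_right_comm]
  exact mul_le_mul (hb z hz) (hb' z hz) (norm_nonneg _)
    (mul_nonneg hC (twoPow_nonneg (norm_nonneg _)))

end Decay

section ProductRule

variable {V : Type*} [NormedAddCommGroup V] [NormedSpace ℝ V] [CompleteSpace V]
  [Module ℍ[ℝ] V] [Module ℍ[ℝ]ᵐᵒᵖ V] [SMulCommClass ℍ[ℝ] ℍ[ℝ]ᵐᵒᵖ V]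
  [IsScalarTower ℝ ℍ[ℝ] V] [IsScalarTower ℝ ℍ[ℝ]ᵐᵒᵖ V]
  [NormSMulClass ℍ[ℝ] V] [NormSMulClass ℍ[ℝ]ᵐᵒᵖ V]

/-- The operator `(2π)⁻¹ ∑ yⱼ eⱼ`. -/
def sliceSum (J : imUnits) (y : Fin 4 → SliceSpace V J) : V →L[ℝ] V :=
  (1 / (2 * Real.pi)) • ∑ j, (toSlice J).symm (y j) * leftMulL (unit j)

theorem sliceSum_add (J : imUnits) (y y' : Fin 4 → SliceSpace V J) :
    sliceSum J (fun j => y j + y' j) = sliceSum J y + sliceSum J y' := by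
  simp only [sliceSum, map_add, add_mul, Finset.sum_add_distrib, smul_add]

theorem sliceSum_sub (J : imUnits) (y y' : Fin 4 → SliceSpace V J) :
    sliceSum J (fun j => y j - y' j) = sliceSum J y - sliceSum J y' := by
  simp only [sliceSum, map_sub, sub_mul, Finset.sum_sub_distrib, smul_sub]

variable {α β ω θ φ χ : ℝ} {Z : Subalgebra ℝ (V →L[ℝ] V)} {K : ℍ[ℝ] → V →L[ℝ] V}
  {a b : ℂ → V →L[ℝ] V} {k h : ℍ[ℝ] → ℍ[ℝ]} {k' : ℂ → ℂ}

section

variable (hK : IsSliceKernel α β ω Z K a b) (hω : 0 ≤ ω) (hθ : θ ≤ Real.pi) (hφ : φ ∈ Ioo ω θ)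
include hK hω hθ hφ

theorem IsSliceKernel.sliceSum_opCalc (hk : IsCGood α β θ k') (hs : IsConjSymm θ k') (J : imUnits)
    (y : Fin 4 → SliceSpace V J) :
    sliceSum J (fun j => opCalc (fun z => sliceOp J (a z) (b z)) φ k' (y j)) =
      pairCalc φ k' a b * sliceSum J y := by
  rw [sliceSum, sliceSum, mul_smul_comm, Finset.mul_sum]
  congr 1
  refine Finset.sum_congr rfl fun j _ => ?_
  conv_lhs => rw [← (toSlice J).apply_symm_apply (y j)]
  rw [hK.opCalc_toSlice hω hθ hφ hk hs, LinearIsometryEquiv.symm_apply_apply, mul_assoc]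

theorem IsSliceKernel.cInt_sliceComp (hh : SHL (sector θ) h) (J : imUnits)
    (hc : Converges K φ J h) (j : Fin 4) :
    CInt φ fun z => sliceComp J h j z • sliceOp J (a z) (b z) (toSlice J 1) :=
  cInt_of_converges hK hω hθ hφ J hc
    (hh.differentiableOn_sliceComp ⟨(hω.trans_lt hφ.1).le.trans hφ.2.le, hθ⟩ J.2 j).continuousOn
    fun z _ => norm_sliceComp_le J.2 h j z

theorem IsSliceKernel.kerCalc_eq_sliceSum (hh : SHL (sector θ) h) (J : imUnits)
    (hc : Converges K φ J h) : kerCalc K φ J h = sliceSum J fun j =>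
      cint φ fun z => sliceComp J h j z • sliceOp J (a z) (b z) (toSlice J 1) := by
  rw [kerCalc, (pathIntegral_eq_sum hK hω hθ hφ J (fun z _ => sum_sliceComp J.2 h z)
    (hK.cInt_sliceComp hω hθ hφ hh J hc)).2]
  rfl

theorem IsSliceKernel.kerCalc_mul_eq_sliceSum (hk : IsIntrinsicFun θ k k')
    (hk' : IsCGood α β θ k') (hh : SHL (sector θ) h) (hd : Decays 1 1 θ h) (J : imUnits) :
    kerCalc K φ J (k * h) = sliceSum J fun j =>
      cint φ fun z => (k' z * sliceComp J h j z) • sliceOp J (a z) (b z) (toSlice J 1) := by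
  have hθ' : θ ∈ Icc 0 Real.pi := ⟨(hω.trans_lt hφ.1).le.trans hφ.2.le, hθ⟩
  rw [kerCalc, (pathIntegral_eq_sum hK hω hθ hφ J (hc := fun j z => k' z * sliceComp J h j z)
    (q := unit) (fun z hz => ?_) fun j => ?_).2]
  · rfl
  · rw [Pi.mul_apply, hk.apply J J.2 z hz, sum_sliceComp J.2 h z, Finset.mul_sum]
    simp only [emb_mul J.2, mul_assoc]
  · exact hK.cInt_apply hω hθ hφ (hk'.mul (isCDecaying_sliceComp hθ' hh hd J.2 j)) J _

end

namespace RightOp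

variable {T : RightOp V} {D : Submodule ℍ[ℝ]ᵐᵒᵖ V} (hT : T.IsOfType D α β ω)
  (hω : ω ∈ Ioo 0 Real.pi) (hα : 1 / 3 ≤ α) (hβ : β ∈ Icc (0 : ℝ) 1) (hθ : θ ≤ Real.pi)
  (hφ : φ ∈ Ioo ω θ) (hχ : χ ∈ Ioo ω θ) (hk : IsIntrinsicFun θ k k') (hk' : IsCGood α β θ k')
  (hh : SHL (sector θ) h) (hd : Decays 1 1 θ h) (J : imUnits)

theorem sliceOp_qinv (J : imUnits) (z : ℂ) : sliceOp J (T.qinvA D z) (T.qinvB D z) =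
    T.sliceR D J z * T.conj.sliceR D J z := sliceOp_mulFst_mulSnd J _ _ _ _ z

theorem sliceOp_slq (J : imUnits) (z : ℂ) : sliceOp J (T.slqA D z) (T.slqB D z) =
    T.sliceR D J z * (T.sliceR D J z * T.conj.sliceR D J z) := by
  rw [← sliceOp_qinv]; exact sliceOp_mulFst_mulSnd J _ _ _ _ z

theorem sliceOp_sq (J : imUnits) (z : ℂ) : sliceOp J (T.sqA D z) (T.sqB D z) =
    T.sliceR D J z * T.sliceR D J z := sliceOp_mulFst_mulSnd J _ _ _ _ z

include hT hω hα hβ hθ hφ hχ hk hk' hh hd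

theorem kerCalc_SL_mul (hS : Converges (T.SL D) φ J h) :
    kerCalc (T.SL D) φ J (k * h) =
      pairCalc χ k' (T.resA D) (T.resB D) * kerCalc (T.SL D) φ J h := by
  have hα0 : 0 ≤ α := by linarith
  have kS := hT.isSliceKernel_SL hω hα0 hβ.1
  have hθ' : θ ∈ Icc 0 Real.pi := ⟨(hω.1.trans hφ.1).le.trans hφ.2.le, hθ⟩
  rw [kS.kerCalc_mul_eq_sliceSum hω.1.le hθ hφ hk hk' hh hd,
    kS.kerCalc_eq_sliceSum hω.1.le hθ hφ hh J hS,
    ← kS.sliceSum_opCalc hω.1.le hθ hχ hk' hk.symm]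
  congr 1
  funext j
  exact ((hT.isResolventPair hω J).opCalc_cint_fst hα hβ ⟨hω.1.le, hω.2⟩ hθ hφ hχ hk'
    (isCDecaying_sliceComp hθ' hh hd J.2 j) (kS.cInt_sliceComp hω.1.le hθ hφ hh J hS j)).symm

theorem kerCalc_Qinv_mul (hS : Converges (T.SL D) φ J h) (hQ : Converges (T.Qinv D) φ J h) :
    kerCalc (T.Qinv D) φ J (k * h) =
      pairCalc χ k' (T.qinvA D) (T.qinvB D) * kerCalc (T.SL D) φ J h +
      pairCalc χ k' (T.conj.resA D) (T.conj.resB D) * kerCalc (T.Qinv D) φ J h := by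
  have hα0 : 0 ≤ α := by linarith
  have kS := hT.isSliceKernel_SL hω hα0 hβ.1
  have kC := hT.isSliceKernel_conj_SL hω hα0 hβ.1
  have kQ := hT.isSliceKernel_Qinv hω hα0 hβ.1
  have hθ' : θ ∈ Icc 0 Real.pi := ⟨(hω.1.trans hφ.1).le.trans hφ.2.le, hθ⟩
  have h2 := kQ.cInt_sliceComp hω.1.le hθ hφ hh J hQ
  rw [kQ.kerCalc_mul_eq_sliceSum hω.1.le hθ hφ hk hk' hh hd,
    kS.kerCalc_eq_sliceSum hω.1.le hθ hφ hh J hS, kQ.kerCalc_eq_sliceSum hω.1.le hθ hφ hh J hQ,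
    ← kQ.sliceSum_opCalc hω.1.le hθ hχ hk' hk.symm, ← kC.sliceSum_opCalc hω.1.le hθ hχ hk' hk.symm,
    ← sliceSum_add]
  simp only [sliceOp_qinv] at h2 ⊢
  congr 1
  funext j
  exact ((hT.isResolventPair hω J).opCalc_cint_mul hα hβ ⟨hω.1.le, hω.2⟩ hθ hφ hχ hk'
    (isCDecaying_sliceComp hθ' hh hd J.2 j) (kS.cInt_sliceComp hω.1.le hθ hφ hh J hS j)
    (h2 j)).symm

theorem kerCalc_slq_mul (hS : Converges (T.SL D) φ J h) (hQ : Converges (T.Qinv D) φ J h)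
    (hF : Converges (T.slq D) φ J h) :
    kerCalc (T.slq D) φ J (k * h) =
      pairCalc χ k' (T.resA D) (T.resB D) * kerCalc (T.slq D) φ J h +
      pairCalc χ k' (T.qinvA D) (T.qinvB D) * kerCalc (T.Qinv D) φ J h +
      pairCalc χ k' (T.slqA D) (T.slqB D) * kerCalc (T.SL D) φ J h := by
  have hα0 : 0 ≤ α := by linarith
  have kS := hT.isSliceKernel_SL hω hα0 hβ.1
  have kQ := hT.isSliceKernel_Qinv hω hα0 hβ.1
  have kF := hT.isSliceKernel_slq hω hα0 hβ.1
  have hθ' : θ ∈ Icc 0 Real.pi := ⟨(hω.1.trans hφ.1).le.trans hφ.2.le, hθ⟩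
  have h2 := kQ.cInt_sliceComp hω.1.le hθ hφ hh J hQ
  have h3 := kF.cInt_sliceComp hω.1.le hθ hφ hh J hF
  rw [kF.kerCalc_mul_eq_sliceSum hω.1.le hθ hφ hk hk' hh hd,
    kS.kerCalc_eq_sliceSum hω.1.le hθ hφ hh J hS, kQ.kerCalc_eq_sliceSum hω.1.le hθ hφ hh J hQ,
    kF.kerCalc_eq_sliceSum hω.1.le hθ hφ hh J hF,
    ← kS.sliceSum_opCalc hω.1.le hθ hχ hk' hk.symm, ← kQ.sliceSum_opCalc hω.1.le hθ hχ hk' hk.symm,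
    ← kF.sliceSum_opCalc hω.1.le hθ hχ hk' hk.symm, ← sliceSum_add, ← sliceSum_add]
  simp only [sliceOp_qinv, sliceOp_slq] at h2 h3 ⊢
  congr 1
  funext j
  exact ((hT.isResolventPair hω J).opCalc_cint_sq_mul hα hβ ⟨hω.1.le, hω.2⟩ hθ hφ hχ hk'
    (isCDecaying_sliceComp hθ' hh hd J.2 j) (kS.cInt_sliceComp hω.1.le hθ hφ hh J hS j)
    (h2 j) (h3 j)).symm

theorem kerCalc_sq_mul (hS : Converges (T.SL D) φ J h) (hP : Converges (T.sq D) φ J h) :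
    kerCalc (T.sq D) φ J (k * h) =
      pairCalc χ k' (T.resA D) (T.resB D) * kerCalc (T.sq D) φ J h +
      pairCalc χ k' (T.sqA D) (T.sqB D) * kerCalc (T.SL D) φ J h := by
  have hα0 : 0 ≤ α := by linarith
  have kS := hT.isSliceKernel_SL hω hα0 hβ.1
  have kP := hT.isSliceKernel_sq hω hα0 hβ.1
  have hθ' : θ ∈ Icc 0 Real.pi := ⟨(hω.1.trans hφ.1).le.trans hφ.2.le, hθ⟩
  have h2 := kP.cInt_sliceComp hω.1.le hθ hφ hh J hP
  rw [kP.kerCalc_mul_eq_sliceSum hω.1.le hθ hφ hk hk' hh hd,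
    kS.kerCalc_eq_sliceSum hω.1.le hθ hφ hh J hS, kP.kerCalc_eq_sliceSum hω.1.le hθ hφ hh J hP,
    ← kS.sliceSum_opCalc hω.1.le hθ hχ hk' hk.symm, ← kP.sliceSum_opCalc hω.1.le hθ hχ hk' hk.symm,
    ← sliceSum_add]
  simp only [sliceOp_sq] at h2 ⊢
  congr 1
  funext j
  exact ((hT.isResolventPair hω J).opCalc_cint_sq hα hβ ⟨hω.1.le, hω.2⟩ hθ hφ hχ hk'
    (isCDecaying_sliceComp hθ' hh hd J.2 j) (kS.cInt_sliceComp hω.1.le hθ hφ hh J hS j)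
    (h2 j)).symm

theorem pairCalc_sub_mul_kerCalc_Qinv (hS : Converges (T.SL D) φ J h)
    (hC : Converges (T.conj.SL D) φ J h) (hQ : Converges (T.Qinv D) φ J h) :
    (pairCalc χ k' (T.resA D) (T.resB D) - pairCalc χ k' (T.conj.resA D) (T.conj.resB D)) *
        kerCalc (T.Qinv D) φ J h =
      pairCalc χ k' (T.qinvA D) (T.qinvB D) *
        (kerCalc (T.SL D) φ J h - kerCalc (T.conj.SL D) φ J h) := by
  have hα0 : 0 ≤ α := by linarith
  have kS := hT.isSliceKernel_SL hω hα0 hβ.1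
  have kC := hT.isSliceKernel_conj_SL hω hα0 hβ.1
  have kQ := hT.isSliceKernel_Qinv hω hα0 hβ.1
  have h2 := kQ.cInt_sliceComp hω.1.le hθ hφ hh J hQ
  rw [kS.kerCalc_eq_sliceSum hω.1.le hθ hφ hh J hS, kC.kerCalc_eq_sliceSum hω.1.le hθ hφ hh J hC,
    kQ.kerCalc_eq_sliceSum hω.1.le hθ hφ hh J hQ, ← sliceSum_sub,
    ← kQ.sliceSum_opCalc hω.1.le hθ hχ hk' hk.symm, sub_mul,
    ← kS.sliceSum_opCalc hω.1.le hθ hχ hk' hk.symm, ← kC.sliceSum_opCalc hω.1.le hθ hχ hk' hk.symm,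
    ← sliceSum_sub]
  simp only [sliceOp_qinv] at h2 ⊢
  congr 1
  funext j
  exact (hT.isResolventPair hω J).opCalc_sub_cint hβ ⟨hω.1.le, hω.2⟩ hθ hφ hχ hk' hα0
    (kS.cInt_sliceComp hω.1.le hθ hφ hh J hS j) (kC.cInt_sliceComp hω.1.le hθ hφ hh J hC j) (h2 j)

end RightOp

end ProductRule

/-- The values of the five functional calculi at a function: those of `S` for an operator and for
its conjugate, and the `Q`-, `P₂`- and `F`-functional calculi. -/
structure CalcData (A : Type*) where
  /-- the `S`-functional calculus -/
  S : A
  /-- the `S`-functional calculus of the conjugate operator -/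
  C : A
  /-- the `Q`-functional calculus -/
  Q : A
  /-- the `P₂`-functional calculus -/
  P : A
  /-- the `F`-functional calculus -/
  F : A

namespace CalcData

section Algebra

variable {R M : Type*} [Ring R] [AddCommGroup M] [Module R M]

/-- The product rules of the functional calculi. -/
def act (k : CalcData R) (h : CalcData M) : CalcData M where
  S := k.S • h.S
  C := k.C • h.C
  Q := k.Q • h.S + k.C • h.Q
  P := k.P • h.S + k.S • h.P + (k.S - k.C) • h.Q
  F := k.F • h.S - k.Q • h.Q + k.S • h.F

/-- The numerator of the `Q`-functional calculus of a quotient. -/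
def numQ (e : CalcData R) (h : CalcData M) : M := e.S • h.Q - e.Q • h.S

/-- The numerator of the `P₂`-functional calculus of a quotient. -/
def numP (e : CalcData R) (h : CalcData M) : M :=
  (e.S * e.C) • h.P - (e.C * e.P) • h.S + (e.S * e.Q) • h.C - (e.C * e.Q) • h.S

/-- The numerator of the `F`-functional calculus of a quotient. -/
def numF (e : CalcData R) (h : CalcData M) : M :=
  (e.S * e.C) • h.F - (e.C * e.F) • h.S + (e.S * e.Q) • h.Q - e.Q ^ 2 • h.S

/-- The relation between the `S`- and the `Q`-functional calculi of two functions. -/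
def Compatible (k : CalcData R) (h : CalcData M) : Prop :=
  (k.S - k.C) • h.Q = k.Q • (h.S - h.C)

end Algebra

theorem num_act {R M : Type*} [CommRing R] [AddCommGroup M] [Module R M] {k e : CalcData R}
    {h : CalcData M} (h1 : k.Compatible h) (h2 : k.Compatible e) :
    numQ (k.act e) (k.act h) = (k.S * k.C) • numQ e h ∧
    numP (k.act e) (k.act h) = (k.S ^ 2 * k.C) • numP e h ∧
    numF (k.act e) (k.act h) = (k.S ^ 2 * k.C) • numF e h := by
  obtain ⟨k1, k2, k3, k4, k5⟩ := k
  obtain ⟨e1, e2, e3, e4, e5⟩ := e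
  obtain ⟨H1, H2, H3, H4, H5⟩ := h
  simp only [Compatible, smul_eq_mul] at h1 h2
  simp only [numQ, numP, numF, act, smul_eq_mul]
  refine ⟨?_, ?_, ?_⟩
  · module
  · linear_combination (norm := module) (k1 * k2 * e1 * e2) • h1 - (k1 * k2 * e1) • (h2 • H2)
  · linear_combination (norm := module) (k1 * k2 * e3) • (h2 • H1) - (k1 * k2 * e1) • (h2 • H3)

end CalcData

section Quotients

variable {V : Type*} [NormedAddCommGroup V] [NormedSpace ℝ V]

theorem invMul_mul {c : V →L[ℝ] V} (hc : Function.Injective c) (A B : V →L[ℝ] V) :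
    invMul (c * A) (c * B) = invMul A B := by
  unfold invMul
  congr 1
  ext p
  simp only [LinearMap.mem_ker, LinearMap.sub_apply, LinearMap.comp_apply, sub_eq_zero]
  exact hc.eq_iff

namespace CalcData

/-- All values lie in a subalgebra. -/
def Mem {A : Type*} [Ring A] [Algebra ℝ A] (Z : Subalgebra ℝ A) (k : CalcData A) : Prop :=
  k.S ∈ Z ∧ k.C ∈ Z ∧ k.Q ∈ Z ∧ k.P ∈ Z ∧ k.F ∈ Z

theorem num_act_of_mem {A : Type*} [Ring A] [Algebra ℝ A] {Z : Subalgebra ℝ A}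
    (hZ : ∀ a ∈ Z, ∀ b ∈ Z, a * b = b * a) {k e h : CalcData A} (hk : k.Mem Z) (he : e.Mem Z)
    (h1 : k.Compatible h) (h2 : k.Compatible e) :
    numQ (k.act e) (k.act h) = (k.S * k.C) * numQ e h ∧
    numP (k.act e) (k.act h) = (k.S ^ 2 * k.C) * numP e h ∧
    numF (k.act e) (k.act h) = (k.S ^ 2 * k.C) * numF e h := by
  let : CommRing Z := { Subalgebra.toRing Z with
    mul_comm := fun x y => Subtype.ext (hZ x x.2 y y.2) }
  obtain ⟨hk1, hk2, hk3, hk4, hk5⟩ := hk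
  obtain ⟨he1, he2, he3, he4, he5⟩ := he
  let k' : CalcData Z := ⟨⟨k.S, hk1⟩, ⟨k.C, hk2⟩, ⟨k.Q, hk3⟩, ⟨k.P, hk4⟩, ⟨k.F, hk5⟩⟩
  let e' : CalcData Z := ⟨⟨e.S, he1⟩, ⟨e.C, he2⟩, ⟨e.Q, he3⟩, ⟨e.P, he4⟩, ⟨e.F, he5⟩⟩
  exact num_act (k := k') (e := e') (h := h) h1 (Subtype.ext h2)

/-- The `S`-functional calculus of a quotient. -/
def quotS (e h : CalcData (V →L[ℝ] V)) : V →ₗ.[ℝ] V := invMul e.S h.S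

/-- The `Q`-functional calculus of a quotient. -/
def quotQ (e h : CalcData (V →L[ℝ] V)) : V →ₗ.[ℝ] V := invMul (e.S * e.C) (numQ e h)

/-- The `P₂`-functional calculus of a quotient. -/
def quotP (e h : CalcData (V →L[ℝ] V)) : V →ₗ.[ℝ] V := invMul (e.S ^ 2 * e.C) (numP e h)

/-- The `F`-functional calculus of a quotient. -/
def quotF (e h : CalcData (V →L[ℝ] V)) : V →ₗ.[ℝ] V := invMul (e.S ^ 2 * e.C) (numF e h)

theorem quot_act {Z : Subalgebra ℝ (V →L[ℝ] V)} (hZ : ∀ a ∈ Z, ∀ b ∈ Z, a * b = b * a)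
    {k e h : CalcData (V →L[ℝ] V)} (hk : k.Mem Z) (he : e.Mem Z) (h1 : k.Compatible h)
    (h2 : k.Compatible e) (hS : Function.Injective k.S) (hC : Function.Injective k.C) :
    quotS (k.act e) (k.act h) = quotS e h ∧ quotQ (k.act e) (k.act h) = quotQ e h ∧
    quotP (k.act e) (k.act h) = quotP e h ∧ quotF (k.act e) (k.act h) = quotF e h := by
  obtain ⟨n1, n2, n3⟩ := num_act_of_mem hZ hk he h1 h2
  have hSC : Function.Injective (k.S * k.C : V →L[ℝ] V) := hS.comp hC
  have hSSC : Function.Injective (k.S ^ 2 * k.C : V →L[ℝ] V) := by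
    rw [pow_two]; exact (hS.comp hS).comp hC
  have c1 : k.C * e.S = e.S * k.C := hZ _ hk.2.1 _ he.1
  have c2 : k.S * e.S = e.S * k.S := hZ _ hk.1 _ he.1
  have d1 : (k.act e).S * (k.act e).C = k.S * k.C * (e.S * e.C) := by
    change k.S * e.S * (k.C * e.C) = _
    rw [mul_assoc, ← mul_assoc e.S, ← c1]
    simp only [mul_assoc]
  have d2 : (k.act e).S ^ 2 * (k.act e).C = k.S ^ 2 * k.C * (e.S ^ 2 * e.C) := by
    rw [pow_two, mul_assoc, d1]
    change k.S * e.S * _ = _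
    rw [mul_assoc, ← mul_assoc e.S, ← mul_assoc e.S, ← c2, mul_assoc k.S e.S, ← c1]
    simp only [pow_two, mul_assoc]
  refine ⟨invMul_mul hS _ _, ?_, ?_, ?_⟩
  · rw [quotQ, n1, d1, invMul_mul hSC, quotQ]
  · rw [quotP, n2, d2, invMul_mul hSSC, quotP]
  · rw [quotF, n3, d2, invMul_mul hSSC, quotF]

end CalcData

end Quotients

section SliceFun

variable {θ : ℝ} (hθ : θ ∈ Icc 0 Real.pi) {h : ℍ[ℝ] → ℍ[ℝ]} (hh : SHL (sector θ) h)
include hθ hh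

theorem SHL.exists_decaying {a b : ℝ} (hd : Decays a b θ h) :
    ∃ hc : Fin 4 → ℂ → ℂ, IsSliceFun θ unit h hc ∧ ∃ δ > 0, ∃ C ≥ 0, ∀ j, ∀ z ∈ csector θ,
      ‖hc j z‖ ≤ C * twoPow (a - 1 + δ) (b - 1 - δ) ‖z‖ := by
  obtain ⟨hc, hsl, hle⟩ := hh.exists_isSliceFun hθ
  obtain ⟨δ, hδ, C, hC, hb⟩ := hd
  refine ⟨hc, hsl, δ, hδ, 2 * C, by positivity, fun j z hz => (hle j z hz).trans ?_⟩
  have h1 := hb _ ((emb_mem_sector unit_one_mem).2 hz)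
  have h2 := hb _ ((emb_mem_sector (neg_mem_imUnits unit_one_mem)).2 hz)
  rw [norm_emb unit_one_mem] at h1
  rw [norm_emb (neg_mem_imUnits unit_one_mem)] at h2
  linarith

theorem SHL.exists_isCDecaying (hd : Decays 1 1 θ h) :
    ∃ hc : Fin 4 → ℂ → ℂ, IsSliceFun θ unit h hc ∧ ∀ j, IsCDecaying θ (hc j) := by
  obtain ⟨hc, hsl, δ, hδ, C, hC, hb⟩ := hh.exists_decaying hθ hd
  exact ⟨hc, hsl, fun j => ⟨hsl.diff j, δ, hδ, C, hC, fun z hz => by simpa using hb j z hz⟩⟩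

theorem SHL.exists_isCGood {α β : ℝ} (hd : Decays (3 * α) β θ h) :
    ∃ hc : Fin 4 → ℂ → ℂ, IsSliceFun θ unit h hc ∧ ∀ j, IsCGood α β θ (hc j) := by
  obtain ⟨hc, hsl, δ, hδ, C, hC, hb⟩ := hh.exists_decaying hθ hd
  exact ⟨hc, hsl, fun j => ⟨hsl.diff j, δ, hδ, C, hC, hb j⟩⟩

end SliceFun

section Values

variable {V : Type*} [NormedAddCommGroup V] [NormedSpace ℝ V] [CompleteSpace V]
  [Module ℍ[ℝ] V] [Module ℍ[ℝ]ᵐᵒᵖ V] [SMulCommClass ℍ[ℝ] ℍ[ℝ]ᵐᵒᵖ V]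
  [IsScalarTower ℝ ℍ[ℝ] V] [IsScalarTower ℝ ℍ[ℝ]ᵐᵒᵖ V]
  [NormSMulClass ℍ[ℝ] V] [NormSMulClass ℍ[ℝ]ᵐᵒᵖ V]

namespace RightOp

variable (T : RightOp V) (D : Submodule ℍ[ℝ]ᵐᵒᵖ V)

/-- The five functional calculi. -/
def calcData (φ : ℝ) (J : ℍ[ℝ]) (h : ℍ[ℝ] → ℍ[ℝ]) : CalcData (V →L[ℝ] V) where
  S := T.calcS D φ J h
  C := T.conj.calcS D φ J h
  Q := T.calcQ D φ J h
  P := T.calcP D φ J h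
  F := T.calcF D φ J h

variable {T D} {φ θ : ℝ} {J : ℍ[ℝ]} {h : ℍ[ℝ] → ℍ[ℝ]}

theorem calcQ_eq : T.calcQ D φ J h = (-2 : ℝ) • kerCalc (T.Qinv D) φ J h := by
  rw [calcQ, kerCalc, smul_smul]
  congr 1
  field_simp

theorem integrand_FL : integrand (T.FL D) φ J h = fun t => (-4 : ℝ) • integrand (T.slq D) φ J h t := by
  funext t
  rw [integrand, FL, smul_mul_assoc]
  rfl

theorem calcF_eq : T.calcF D φ J h = (-4 : ℝ) • kerCalc (T.slq D) φ J h := by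
  rw [calcF, kerCalc, pathIntegral, integrand_FL, integral_smul, smul_comm]
  rfl

theorem converges_FL : Converges (T.FL D) φ J h ↔ Converges (T.slq D) φ J h := by
  rw [Converges, integrand_FL]
  exact integrable_smul_iff (by norm_num : (-4 : ℝ) ≠ 0) _

theorem integrand_P2L : integrand (T.P2L D) φ J h =
    fun t => (2 : ℝ) • (integrand (T.sq D) φ J h t + integrand (T.Qinv D) φ J h t) := by
  funext t
  simp only [integrand]
  rw [← add_mul, sq, sub_add_cancel, P2L, smul_mul_assoc]

theorem converges_P2L (hQ : Converges (T.Qinv D) φ J h) :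
    Converges (T.P2L D) φ J h ↔ Converges (T.sq D) φ J h := by
  rw [Converges, integrand_P2L]
  refine (integrable_smul_iff (by norm_num : (2 : ℝ) ≠ 0) _).trans ?_
  exact integrable_add_iff_integrable_left hQ

theorem calcP_eq (hQ : Converges (T.Qinv D) φ J h) (hP : Converges (T.sq D) φ J h) :
    T.calcP D φ J h = (2 : ℝ) • kerCalc (T.sq D) φ J h + (2 : ℝ) • kerCalc (T.Qinv D) φ J h := by
  rw [calcP, kerCalc, kerCalc, pathIntegral, integrand_P2L, integral_smul, integral_add hP hQ,
    ← smul_add, ← smul_add, smul_comm]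
  rfl

theorem calcData_congr {h₁ h₂ : ℍ[ℝ] → ℍ[ℝ]} (hφ : φ ∈ Ioo 0 Real.pi) (hφθ : φ < θ)
    (hJ : J ∈ imUnits) (h : EqOn h₁ h₂ (sector θ)) :
    T.calcData D φ J h₁ = T.calcData D φ J h₂ := by
  simp only [calcData, calcS, calcQ, calcP, calcF, pathIntegral_congr hφ hφθ hJ h]

variable (T D) in
/-- The five functional calculi, for intrinsic functions. -/
def pairData (φ : ℝ) (k : ℂ → ℂ) : CalcData (V →L[ℝ] V) where
  S := pairCalc φ k (T.resA D) (T.resB D)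
  C := pairCalc φ k (T.conj.resA D) (T.conj.resB D)
  Q := (-2 : ℝ) • pairCalc φ k (T.qinvA D) (T.qinvB D)
  P := (2 : ℝ) • pairCalc φ k (T.sqA D) (T.sqB D) +
    (2 : ℝ) • pairCalc φ k (T.qinvA D) (T.qinvB D)
  F := (-4 : ℝ) • pairCalc φ k (T.slqA D) (T.slqB D)

variable {α β ω χ : ℝ} {k : ℍ[ℝ] → ℍ[ℝ]} {k' : ℂ → ℂ} (hT : T.IsOfType D α β ω)
  (hω : ω ∈ Ioo 0 Real.pi) (hα : 1 / 3 ≤ α) (hβ : β ∈ Icc (0 : ℝ) 1) (hθ : θ ≤ Real.pi)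
  (hφ : φ ∈ Ioo ω θ)
include hT hω hα hβ hθ hφ

theorem pairData_mem : (T.pairData D φ k').Mem (T.calcAlg D ω) := by
  have hφ' : φ ∈ Ioo ω Real.pi := ⟨hφ.1, hφ.2.trans_le hθ⟩
  have hα0 : 0 ≤ α := by linarith
  have mem : ∀ {K : ℍ[ℝ] → V →L[ℝ] V} {a b}, IsSliceKernel α β ω (T.calcAlg D ω) K a b →
      pairCalc φ k' a b ∈ T.calcAlg D ω := fun hK =>
    Subalgebra.smul_mem _ (pairInt_mem hK.evenOdd hω.1.le hφ' rfl) _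
  exact ⟨mem (hT.isSliceKernel_SL hω hα0 hβ.1), mem (hT.isSliceKernel_conj_SL hω hα0 hβ.1),
    Subalgebra.smul_mem _ (mem (hT.isSliceKernel_Qinv hω hα0 hβ.1)) _,
    add_mem (Subalgebra.smul_mem _ (mem (hT.isSliceKernel_sq hω hα0 hβ.1)) _)
      (Subalgebra.smul_mem _ (mem (hT.isSliceKernel_Qinv hω hα0 hβ.1)) _),
    Subalgebra.smul_mem _ (mem (hT.isSliceKernel_slq hω hα0 hβ.1)) _⟩

theorem calcData_eq_pairData (hk : IsIntrinsicFun θ k k') (hJ : J ∈ imUnits)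
    (hc : T.CalcDefined D φ J k) : T.calcData D φ J k = T.pairData D φ k' := by
  have hα0 : 0 ≤ α := by linarith
  have hP := (converges_P2L hc.convQ).1 hc.convP
  have key : ∀ {K : ℍ[ℝ] → V →L[ℝ] V} {a b}, IsSliceKernel α β ω (T.calcAlg D ω) K a b →
      Converges K φ J k → kerCalc K φ J k = pairCalc φ k' a b := fun hK hconv =>
    hK.kerCalc_eq_pairCalc hω.1.le hθ hφ hk ⟨J, hJ⟩ hconv
  have e1 : T.calcS D φ J k = _ := key (hT.isSliceKernel_SL hω hα0 hβ.1) hc.convS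
  have e2 : T.conj.calcS D φ J k = _ := key (hT.isSliceKernel_conj_SL hω hα0 hβ.1) hc.convS_conj
  rw [calcData, calcQ_eq, calcP_eq hc.convQ hP, calcF_eq, e1, e2,
    key (hT.isSliceKernel_Qinv hω hα0 hβ.1) hc.convQ, key (hT.isSliceKernel_sq hω hα0 hβ.1) hP,
    key (hT.isSliceKernel_slq hω hα0 hβ.1) (converges_FL.1 hc.convF), pairData]

theorem calcDefined_of_isCGood {ι : Type*} [Fintype ι] {q : ι → ℍ[ℝ]} {hc : ι → ℂ → ℂ}
    (hh : IsSliceFun θ q h hc) (hg : ∀ j, IsCGood α β θ (hc j)) (hJ : J ∈ imUnits) :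
    T.CalcDefined D φ J h := by
  have hα0 : 0 ≤ α := by linarith
  have key : ∀ {K : ℍ[ℝ] → V →L[ℝ] V} {a b}, IsSliceKernel α β ω (T.calcAlg D ω) K a b →
      Converges K φ J h := fun hK => hK.converges hω.1.le hθ hφ hh hg ⟨J, hJ⟩
  have hQ := key (hT.isSliceKernel_Qinv hω hα0 hβ.1)
  exact ⟨key (hT.isSliceKernel_SL hω hα0 hβ.1), key (hT.isSliceKernel_conj_SL hω hα0 hβ.1), hQ,
    (converges_P2L hQ).2 (key (hT.isSliceKernel_sq hω hα0 hβ.1)),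
    converges_FL.2 (key (hT.isSliceKernel_slq hω hα0 hβ.1))⟩

variable (hχ : χ ∈ Ioo ω θ)
include hχ

theorem calcData_eq_calcData {ι : Type*} [Fintype ι] {q : ι → ℍ[ℝ]} {hc : ι → ℂ → ℂ}
    (hh : IsSliceFun θ q h hc) (hg : ∀ j, IsCGood α β θ (hc j)) (hJ : J ∈ imUnits) {J' : ℍ[ℝ]}
    (hJ' : J' ∈ imUnits) : T.calcData D φ J h = T.calcData D χ J' h := by
  have hα0 : 0 ≤ α := by linarith
  have key : ∀ {K : ℍ[ℝ] → V →L[ℝ] V} {a b}, IsSliceKernel α β ω (T.calcAlg D ω) K a b →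
      kerCalc K φ J h = kerCalc K χ J' h := fun hK =>
    hK.kerCalc_eq_kerCalc hω.1.le hθ hφ hh hg ⟨J, hJ⟩ ⟨J', hJ'⟩ hχ
  have d := calcDefined_of_isCGood hT hω hα hβ hθ hφ hh hg hJ
  have d' := calcDefined_of_isCGood hT hω hα hβ hθ hχ hh hg hJ'
  have e1 : T.calcS D φ J h = T.calcS D χ J' h := key (hT.isSliceKernel_SL hω hα0 hβ.1)
  have e2 : T.conj.calcS D φ J h = T.conj.calcS D χ J' h :=
    key (hT.isSliceKernel_conj_SL hω hα0 hβ.1)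
  rw [calcData, calcData, e1, e2, calcQ_eq, calcP_eq d.convQ ((converges_P2L d.convQ).1 d.convP),
    calcF_eq, calcQ_eq, calcP_eq d'.convQ ((converges_P2L d'.convQ).1 d'.convP), calcF_eq,
    key (hT.isSliceKernel_Qinv hω hα0 hβ.1), key (hT.isSliceKernel_sq hω hα0 hβ.1),
    key (hT.isSliceKernel_slq hω hα0 hβ.1)]

variable (hk : IsIntrinsicFun θ k k') (hk' : IsCGood α β θ k') (hh : SHL (sector θ) h)
  (hd : Decays 1 1 θ h) (hJ : J ∈ imUnits) (hc : T.CalcDefined D φ J h)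
include hk hk' hh hd hJ hc

theorem compatible : (T.pairData D χ k').Compatible (T.calcData D φ J h) := by
  have := pairCalc_sub_mul_kerCalc_Qinv hT hω hα hβ hθ hφ hχ hk hk' hh hd ⟨J, hJ⟩ hc.convS
    hc.convS_conj hc.convQ
  simp only [CalcData.Compatible, pairData, calcData, calcQ_eq, smul_eq_mul, mul_smul_comm, this,
    smul_mul_assoc]
  rfl

theorem calcData_mul :
    T.calcData D φ J (k * h) = (T.pairData D χ k').act (T.calcData D φ J h) := by
  have hα0 : 0 ≤ α := by linarith
  have hP := (converges_P2L hc.convQ).1 hc.convP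
  have hF := converges_FL.1 hc.convF
  have hT' := hT.conj hω
  have rS : T.calcS D φ J (k * h) = _ * T.calcS D φ J h :=
    kerCalc_SL_mul hT hω hα hβ hθ hφ hχ hk hk' hh hd ⟨J, hJ⟩ hc.convS
  have rC : T.conj.calcS D φ J (k * h) = _ * T.conj.calcS D φ J h :=
    kerCalc_SL_mul hT' hω hα hβ hθ hφ hχ hk hk' hh hd ⟨J, hJ⟩ hc.convS_conj
  have rQ := kerCalc_Qinv_mul hT hω hα hβ hθ hφ hχ hk hk' hh hd ⟨J, hJ⟩ hc.convS hc.convQ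
  have rP := kerCalc_sq_mul hT hω hα hβ hθ hφ hχ hk hk' hh hd ⟨J, hJ⟩ hc.convS hP
  have rF := kerCalc_slq_mul hT hω hα hβ hθ hφ hχ hk hk' hh hd ⟨J, hJ⟩ hc.convS hc.convQ hF
  have eS : kerCalc (T.SL D) φ J h = T.calcS D φ J h := rfl
  have dQ : Converges (T.Qinv D) φ J (k * h) ∧ Converges (T.sq D) φ J (k * h) := by
    have hθ' : θ ∈ Icc 0 Real.pi := ⟨(hω.1.trans hφ.1).le.trans hφ.2.le, hθ⟩
    obtain ⟨hc, hsl, hdec⟩ := hh.exists_isCDecaying hθ' hd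
    have := calcDefined_of_isCGood hT hω hα hβ hθ hφ (hk.mul hsl) (fun j => hk'.mul (hdec j)) hJ
    exact ⟨this.convQ, (converges_P2L this.convQ).1 this.convP⟩
  simp only [calcData, CalcData.act, pairData, rS, rC, calcQ_eq, calcF_eq,
    calcP_eq hc.convQ hP, calcP_eq dQ.1 dQ.2, rQ, rP, rF, eS, smul_eq_mul]
  congr 1 <;> simp only [smul_add, add_mul, mul_add, sub_mul, smul_mul_assoc, mul_smul_comm] <;>
    module

end RightOp

end Values

section StandardRegularizer

/-- The functions `s^n (1 + s)^{-2n}`. -/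
def stdRegularizer (n : ℕ) (s : ℍ[ℝ]) : ℍ[ℝ] := s ^ n * ((1 + s) ^ (2 * n))⁻¹

theorem exists_eq_emb (s : ℍ[ℝ]) : ∃ J ∈ imUnits, ∃ z, s = emb J z := by
  rcases eq_or_ne s.im 0 with h | h
  · exact ⟨unit 1, unit_one_mem, s.re, by
      conv_lhs => rw [← Quaternion.re_add_im s, h, add_zero]
      simp [emb]⟩
  · have hn : ‖s.im‖ ≠ 0 := norm_ne_zero_iff.2 h
    refine ⟨‖s.im‖⁻¹ • s.im, ⟨by simp, by rw [norm_smul, norm_inv, norm_norm, inv_mul_cancel₀ hn]⟩,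
      ⟨s.re, ‖s.im‖⟩, ?_⟩
    rw [emb, smul_smul, mul_inv_cancel₀ hn, one_smul, Quaternion.re_add_im]

theorem emb_pow {J : ℍ[ℝ]} (hJ : J ∈ imUnits) (z : ℂ) (n : ℕ) : emb J (z ^ n) = emb J z ^ n := by
  induction n with
  | zero => rw [pow_zero, pow_zero, emb_one]
  | succ n ih => rw [pow_succ, pow_succ, emb_mul hJ, ih]

theorem emb_inv {J : ℍ[ℝ]} (hJ : J ∈ imUnits) (z : ℂ) : emb J z⁻¹ = (emb J z)⁻¹ := by
  rcases eq_or_ne z 0 with rfl | hz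
  · rw [inv_zero, emb_zero, inv_zero]
  · exact eq_inv_of_mul_eq_one_left (by rw [← emb_mul hJ, inv_mul_cancel₀ hz, emb_one])

variable {θ : ℝ} (n : ℕ)

theorem isIntrinsicFun_stdRegularizer (hθ : θ < Real.pi) :
    IsIntrinsicFun θ (stdRegularizer n) (stdReg n) where
  diff z hz := by
    have := one_add_ne_zero_of_arg hθ hz.2.le
    refine DifferentiableAt.differentiableWithinAt ?_
    unfold stdReg
    exact (by fun_prop : DifferentiableAt ℂ (fun z : ℂ => z ^ n) z).mul
      (DifferentiableAt.inv (by fun_prop) (pow_ne_zero _ this))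
  symm z _ := by simp [stdReg]
  apply J hJ z _ := by
    rw [stdRegularizer, stdReg, emb_mul hJ, emb_pow hJ, emb_inv hJ, emb_pow hJ, emb_add, emb_one]

theorem norm_stdReg_le (hθ : θ ∈ Ioo 0 Real.pi) :
    ∃ C ≥ 0, ∀ z ∈ csector θ, ‖stdReg n z‖ ≤ C * twoPow n (-n) ‖z‖ := by
  obtain ⟨c, hc, h⟩ := norm_mul_bounds hθ
  refine ⟨(c ^ (2 * n))⁻¹, by positivity, fun z hz => ?_⟩
  obtain ⟨h1, h2⟩ := h z hz.1 hz.2.le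
  have hz0 : 0 < ‖z‖ := norm_pos_iff.2 hz.1
  have h0 : 0 < ‖1 + z‖ := hc.trans_le h1
  rw [stdReg, norm_mul, norm_inv, norm_pow, norm_pow, mul_comm, twoPow]
  split_ifs with h3
  · rw [Real.rpow_natCast]
    gcongr
  · rw [Real.rpow_neg hz0.le, Real.rpow_natCast]
    calc (‖1 + z‖ ^ (2 * n))⁻¹ * ‖z‖ ^ n ≤ ((c * ‖z‖) ^ (2 * n))⁻¹ * ‖z‖ ^ n := by gcongr
      _ = _ := by
        rw [mul_pow, mul_inv, mul_assoc]
        congr 1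
        rw [two_mul, pow_add, mul_inv, inv_mul_cancel_right₀ (by positivity)]

theorem norm_stdRegularizer_le (hθ : θ ∈ Ioo 0 Real.pi) :
    ∃ C ≥ 0, ∀ s ∈ sector θ, ‖stdRegularizer n s‖ ≤ C * twoPow n (-n) ‖s‖ := by
  obtain ⟨C, hC, h⟩ := norm_stdReg_le n hθ
  refine ⟨C, hC, fun s hs => ?_⟩
  obtain ⟨J, hJ, z, rfl⟩ := exists_eq_emb s
  have hz := (emb_mem_sector hJ).1 hs
  rw [(isIntrinsicFun_stdRegularizer n hθ.2).apply J hJ z hz, norm_emb hJ, norm_emb hJ]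
  exact h z hz

variable {n}

theorem isCGood_stdReg {α β : ℝ} (hθ : θ ∈ Ioo 0 Real.pi) (h1 : 3 * α ≤ n) (h2 : 2 - β ≤ n) :
    IsCGood α β θ (stdReg n) := by
  obtain ⟨C, hC, h⟩ := norm_stdReg_le n hθ
  exact ⟨(isIntrinsicFun_stdRegularizer n hθ.2).diff, 1, one_pos, C, hC, fun z hz =>
    (h z hz).trans (mul_le_mul_of_nonneg_left (twoPow_le_twoPow (norm_pos_iff.2 hz.1)
      (by linarith) (by linarith)) hC)⟩

theorem decays_stdRegularizer {a b : ℝ} (hθ : θ ∈ Ioo 0 Real.pi) (h1 : a ≤ n) (h2 : 2 - b ≤ n) :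
    Decays a b θ (stdRegularizer n) := by
  obtain ⟨C, hC, h⟩ := norm_stdRegularizer_le n hθ
  exact ⟨1, one_pos, C, hC, fun s hs =>
    (h s hs).trans (mul_le_mul_of_nonneg_left (twoPow_le_twoPow (norm_pos_iff.2 hs.1)
      (by linarith) (by linarith)) hC)⟩

theorem decays_stdRegularizer_mul {a b κ C' : ℝ} (hθ : θ ∈ Ioo 0 Real.pi) (hκ : 0 < κ)
    (hC' : 0 ≤ C') {f : ℍ[ℝ] → ℍ[ℝ]}
    (hf : ∀ s ∈ sector θ, ‖f s‖ ≤ C' * (‖s‖ ^ κ + 1 / ‖s‖ ^ κ)) (h1 : a + κ ≤ n)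
    (h2 : 2 - b + κ ≤ n) : Decays a b θ (stdRegularizer n * f) := by
  obtain ⟨C, hC, h⟩ := norm_stdRegularizer_le n hθ
  refine ⟨1, one_pos, C * (2 * C'), by positivity, fun s hs => ?_⟩
  have hs0 : 0 < ‖s‖ := norm_pos_iff.2 hs.1
  have hpow : ‖s‖ ^ κ + 1 / ‖s‖ ^ κ ≤ 2 * twoPow (-κ) κ ‖s‖ := by
    rw [one_div, ← Real.rpow_neg hs0.le, twoPow]
    split_ifs with h3
    · have := Real.rpow_le_rpow_of_exponent_ge hs0 h3 (by linarith : -κ ≤ κ)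
      linarith
    · have := Real.rpow_le_rpow_of_exponent_le (not_le.1 h3).le (by linarith : -κ ≤ κ)
      linarith
  calc ‖(stdRegularizer n * f) s‖ = ‖stdRegularizer n s‖ * ‖f s‖ := norm_mul _ _
    _ ≤ (C * twoPow n (-n) ‖s‖) * (C' * (2 * twoPow (-κ) κ ‖s‖)) := by
      refine mul_le_mul (h s hs) ((hf s hs).trans (by gcongr)) (norm_nonneg _) ?_
      exact mul_nonneg hC (twoPow_nonneg hs0.le)
    _ = C * (2 * C') * (twoPow n (-n) ‖s‖ * twoPow (-κ) κ ‖s‖) := by ring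
    _ ≤ _ := by
      rw [twoPow_mul hs0]
      exact mul_le_mul_of_nonneg_left (twoPow_le_twoPow hs0 (by linarith) (by linarith))
        (by positivity)

end StandardRegularizer

section Injectivity

variable {V : Type*} [NormedAddCommGroup V] [NormedSpace ℝ V] [CompleteSpace V]
  [Module ℍ[ℝ] V] [Module ℍ[ℝ]ᵐᵒᵖ V] [SMulCommClass ℍ[ℝ] ℍ[ℝ]ᵐᵒᵖ V]
  [IsScalarTower ℝ ℍ[ℝ] V] [IsScalarTower ℝ ℍ[ℝ]ᵐᵒᵖ V]
  [NormSMulClass ℍ[ℝ] V] [NormSMulClass ℍ[ℝ]ᵐᵒᵖ V]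

theorem sliceOp_zero_pow (J : imUnits) (A : V →L[ℝ] V) (n : ℕ) :
    sliceOp J A 0 ^ n = sliceOp J (A ^ n) 0 := by
  induction n with
  | zero =>
    rw [pow_zero, pow_zero]
    refine sliceOp_ext fun Y => ?_
    rw [sliceOp_apply, one_mul, zero_mul, zero_mul, add_zero]
    rfl
  | succ n ih =>
    rw [pow_succ, ih, sliceOp_mul, pow_succ]
    simp only [zero_mul, mul_zero, sub_zero, add_zero]

theorem injective_pow {A : V →L[ℝ] V} (hA : Function.Injective A) (n : ℕ) :
    Function.Injective (A ^ n : V →L[ℝ] V) := by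
  induction n with
  | zero => exact fun x y h => h
  | succ n ih => rw [pow_succ]; exact ih.comp hA

namespace RightOp

variable {T : RightOp V} {D : Submodule ℍ[ℝ]ᵐᵒᵖ V} {α β ω θ φ : ℝ} {J : ℍ[ℝ]}
  (hT : T.IsOfType D α β ω) (hω : ω ∈ Ioo 0 Real.pi)
include hT hω

theorem neg_one_mem_resolventSet : (-1 : ℍ[ℝ]) ∈ T.resolventSet D := by
  have := (hT.coSector_subset hω) (IsResolventPair.neg_one_mem hω.2) (unit 1) unit_one_mem
  rwa [show emb (unit 1) (-1 : ℂ) = -1 by rw [emb_neg, emb_one]] at this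

theorem app_SL_neg_one (v : V) : T.app (T.SL D (-1) v) = -T.SL D (-1) v - v := by
  rw [app_SL hT.isKC hT.conj_isKC hT.admissible (neg_one_mem_resolventSet hT hω), neg_one_smul,
    map_neg]

theorem injective_SL_neg_one : Function.Injective (T.SL D (-1)) := by
  refine (injective_iff_map_eq_zero _).2 fun v hv => ?_
  have := app_SL_neg_one hT hω v
  rw [hv, app_zero, neg_zero, zero_sub] at this
  exact neg_eq_zero.1 this.symm

theorem injective_one_add_SL_neg_one (hinj : T.Inj) :
    Function.Injective (1 + T.SL D (-1) : V →L[ℝ] V) := by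
  refine (injective_iff_map_eq_zero _).2 fun v hv => ?_
  have h1 : v + T.SL D (-1) v = 0 := hv
  have h2 := app_SL_neg_one hT hω v
  rw [show -T.SL D (-1) v - v = -(v + T.SL D (-1) v) by abel, h1, neg_zero] at h2
  have h3 := hinj _ (SL_mem hT.conj_isKC hT.admissible (neg_one_mem_resolventSet hT hω) v) h2
  rwa [h3, add_zero] at h1

theorem sliceR_neg_one (J : imUnits) : T.sliceR D J (-1) = sliceOp J (T.SL D (-1)) 0 := by
  have hm := IsResolventPair.neg_one_mem hω.2
  have hB : T.resB D (-1) = 0 := by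
    have h1 := (isEvenOdd_res (T := T) (D := D) (ω := ω)).odd _ hm
    rw [map_neg, map_one] at h1
    have h2 : (2 : ℝ) • T.resB D (-1) = 0 := by
      rw [two_smul]; nth_rw 1 [h1]; exact neg_add_cancel _
    simpa using h2
  have h3 := sliceR_one (hT.isGood hω) (hT.coSector_subset hω) hm J
  rw [sliceR, hB, sliceOp_apply, zero_mul, zero_mul, add_zero, mul_one, emb_neg, emb_one] at h3
  rw [sliceR, hB, (toSlice J).injective h3]

variable (hα : 0 ≤ α) (hβ : β ∈ Ioc (0 : ℝ) 1) (hθ : θ < Real.pi) (hφ : φ ∈ Ioo ω θ) {n : ℕ}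
  (hn : 1 ≤ n) (h1 : 3 * α ≤ n) (h2 : 2 - β ≤ n)
include hα hβ hθ hφ hn h1 h2

theorem pairCalc_stdReg : pairCalc φ (stdReg n) (T.resA D) (T.resB D) =
    (1 + T.SL D (-1)) ^ n * (-T.SL D (-1)) ^ n := by
  let J : imUnits := ⟨unit 1, unit_one_mem⟩
  have hθ' : θ ∈ Ioo 0 Real.pi := ⟨(hω.1.trans hφ.1).trans hφ.2, hθ⟩
  have hk : IsCGood α β θ (stdReg n) := isCGood_stdReg hθ' h1 h2
  have e1 := (hT.isSliceKernel_SL hω hα hβ.1.le).opCalc_toSlice hω.1.le hθ.le hφ hk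
    (isIntrinsicFun_stdRegularizer n hθ).symm J 1
  have e2 := (hT.isResolventPair hω J).opCalc_stdReg hα hβ ⟨hω.1.le, hω.2⟩ hθ.le hφ hn h1 hk
  have e3 : (1 + sliceOp J (T.SL D (-1)) 0 : SliceSpace V J →L[ℂ] SliceSpace V J) =
      sliceOp J (1 + T.SL D (-1)) 0 := by
    have := sliceOp_add (J := J) (1 : V →L[ℝ] V) 0 (T.SL D (-1)) 0
    rw [add_zero] at this
    rw [← this]
    congr 1
    simpa using sliceOp_zero_pow J (1 : V →L[ℝ] V) 0
  have e4 : (-sliceOp J (T.SL D (-1)) 0 : SliceSpace V J →L[ℂ] SliceSpace V J) =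
      sliceOp J (-T.SL D (-1)) 0 := by
    refine sliceOp_ext fun Y => ?_
    rw [_root_.neg_apply, sliceOp_apply, sliceOp_apply, ← map_neg]
    simp
  rw [sliceR_neg_one hT hω, e3, e4, sliceOp_zero_pow, sliceOp_zero_pow, sliceOp_mul] at e2
  change opCalc (T.sliceR D J) φ (stdReg n) (toSlice J 1) = _ at e1
  rw [e2, sliceOp_apply] at e1
  simpa using ((toSlice J).injective e1).symm

theorem injective_pairCalc_stdReg (hinj : T.Inj) :
    Function.Injective (pairCalc φ (stdReg n) (T.resA D) (T.resB D)) := by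
  rw [pairCalc_stdReg hT hω hα hβ hθ hφ hn h1 h2]
  refine (injective_pow (injective_one_add_SL_neg_one hT hω hinj) n).comp (injective_pow ?_ n)
  exact neg_injective.comp (injective_SL_neg_one hT hω)

end RightOp

end Injectivity

theorem Decays.mul_left {a b θ : ℝ} {k h : ℍ[ℝ] → ℍ[ℝ]} (hk : Decays 1 1 θ k)
    (hh : Decays a b θ h) : Decays a b θ (k * h) := by
  obtain ⟨δ', hδ', C', hC', hb'⟩ := hk
  obtain ⟨δ, hδ, C, hC, hb⟩ := hh
  refine ⟨δ, hδ, C' * C, by positivity, fun s hs => ?_⟩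
  have hle : ‖k s‖ ≤ C' := (hb' s hs).trans (mul_le_of_le_one_right hC'
    (twoPow_le_one (norm_pos_iff.2 hs.1) (by linarith) (by linarith)))
  rw [Pi.mul_apply, norm_mul, mul_assoc]
  exact mul_le_mul hle (hb s hs) (norm_nonneg _) hC'

theorem IsIntrinsicFun.mul_isIntrinsicFun {θ : ℝ} {k h : ℍ[ℝ] → ℍ[ℝ]} {k' h' : ℂ → ℂ}
    (hk : IsIntrinsicFun θ k k') (hh : IsIntrinsicFun θ h h') :
    IsIntrinsicFun θ (k * h) (fun z => k' z * h' z) where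
  diff := hk.diff.mul hh.diff
  symm z hz := by
    change k' _ * h' _ = _
    rw [hk.symm z hz, hh.symm z hz, ← map_mul]
  apply J hJ z hz := by
    rw [Pi.mul_apply, hk.apply J hJ z hz, hh.apply J hJ z hz, emb_mul hJ]

theorem IsIntrinsicFun.comm {θ : ℝ} {k h : ℍ[ℝ] → ℍ[ℝ]} {k' h' : ℂ → ℂ}
    (hk : IsIntrinsicFun θ k k') (hh : IsIntrinsicFun θ h h') :
    EqOn (k * h) (h * k) (sector θ) := fun s hs => by
  obtain ⟨J, hJ, z, rfl⟩ := exists_eq_emb s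
  have hz := (emb_mem_sector hJ).1 hs
  rw [Pi.mul_apply, Pi.mul_apply, hk.apply J hJ z hz, hh.apply J hJ z hz, ← emb_mul hJ,
    ← emb_mul hJ, mul_comm]

theorem IsIntrinsicFun.isCDecaying {θ : ℝ} {k : ℍ[ℝ] → ℍ[ℝ]} {k' : ℂ → ℂ}
    (hk : IsIntrinsicFun θ k k') (hd : Decays 1 1 θ k) : IsCDecaying θ k' :=
  isCDecaying_of_le hd hk.diff unit_one_mem fun z hz => by
    rw [hk.apply _ unit_one_mem z hz, norm_emb unit_one_mem]

section Uniqueness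

variable {V : Type*} [NormedAddCommGroup V] [NormedSpace ℝ V] [CompleteSpace V]
  [Module ℍ[ℝ] V] [Module ℍ[ℝ]ᵐᵒᵖ V] [SMulCommClass ℍ[ℝ] ℍ[ℝ]ᵐᵒᵖ V]
  [IsScalarTower ℝ ℍ[ℝ] V] [IsScalarTower ℝ ℍ[ℝ]ᵐᵒᵖ V]
  [NormSMulClass ℍ[ℝ] V] [NormSMulClass ℍ[ℝ]ᵐᵒᵖ V]

/-- The four functional calculi of quotients agree. -/
def CalcData.SameQuot (e h e' h' : CalcData (V →L[ℝ] V)) : Prop :=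
  quotS e h = quotS e' h' ∧ quotQ e h = quotQ e' h' ∧ quotP e h = quotP e' h' ∧
    quotF e h = quotF e' h'

theorem CalcData.SameQuot.symm {e h e' h' : CalcData (V →L[ℝ] V)} (H : SameQuot e h e' h') :
    SameQuot e' h' e h := ⟨H.1.symm, H.2.1.symm, H.2.2.1.symm, H.2.2.2.symm⟩

theorem CalcData.SameQuot.trans {e h e' h' e'' h'' : CalcData (V →L[ℝ] V)}
    (H : SameQuot e h e' h') (H' : SameQuot e' h' e'' h'') : SameQuot e h e'' h'' :=
  ⟨H.1.trans H'.1, H.2.1.trans H'.2.1, H.2.2.1.trans H'.2.2.1, H.2.2.2.trans H'.2.2.2⟩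

namespace RightOp

variable {T : RightOp V} {D : Submodule ℍ[ℝ]ᵐᵒᵖ V} {α β ω θ φ χ : ℝ} {J J' : ℍ[ℝ]}
  {k e h f : ℍ[ℝ] → ℍ[ℝ]} {k' e' : ℂ → ℂ} (hT : T.IsOfType D α β ω) (hω : ω ∈ Ioo 0 Real.pi)
  (hα : 1 / 3 ≤ α)
include hT hω hα

section

variable (hβ : β ∈ Icc (0 : ℝ) 1) (hθ : θ ≤ Real.pi) (hφ : φ ∈ Ioo ω θ) (hχ : χ ∈ Ioo ω θ)
include hβ hθ hφ hχ

/-- Multiplication of numerator and denominator by an intrinsic function does not change the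
functional calculi of a quotient. -/
theorem sameQuot_mul (hk : IsIntrinsicFun θ k k') (hk' : IsCGood α β θ k')
    (hS : Function.Injective (T.pairData D χ k').S) (hC : Function.Injective (T.pairData D χ k').C)
    (he : IsIntrinsicFun θ e e') (hed : Decays 1 1 θ e) (hh : SHL (sector θ) h)
    (hhd : Decays 1 1 θ h) (hJ : J ∈ imUnits) (hce : T.CalcDefined D φ J e)
    (hch : T.CalcDefined D φ J h) :
    (T.calcData D φ J (k * e)).SameQuot (T.calcData D φ J (k * h)) (T.calcData D φ J e)
      (T.calcData D φ J h) := by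
  have hθ' : θ ∈ Icc 0 Real.pi := ⟨(hω.1.trans hφ.1).le.trans hφ.2.le, hθ⟩
  have hes := he.isSliceFun.shl hθ'
  rw [calcData_mul hT hω hα hβ hθ hφ hχ hk hk' hes hed hJ hce,
    calcData_mul hT hω hα hβ hθ hφ hχ hk hk' hh hhd hJ hch]
  refine CalcData.quot_act (Z := T.calcAlg D ω) (fun a ha b hb =>
    calcAlg_comm (hT.isGood hω) (hT.coSector_subset hω) ha hb) (pairData_mem hT hω hα hβ hθ hχ)
    ?_ (compatible hT hω hα hβ hθ hφ hχ hk hk' hh hhd hJ hch)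
    (compatible hT hω hα hβ hθ hφ hχ hk hk' hes hed hJ hce) hS hC
  rw [calcData_eq_pairData hT hω hα hβ hθ hφ he hJ hce]
  exact pairData_mem hT hω hα hβ hθ hφ

end

section

variable (hβ : β ∈ Ioc (0 : ℝ) (1 / 3)) (hθ : θ ∈ Ioo ω Real.pi)
include hβ hθ

theorem calcDefined (hφ : φ ∈ Ioo ω θ) (hJ : J ∈ imUnits) (hf : PsiL (3 * α) β θ f) :
    T.CalcDefined D φ J f := by
  obtain ⟨hc, hsl, hg⟩ := hf.1.exists_isCGood ⟨(hω.1.trans hθ.1).le, hθ.2.le⟩ hf.2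
  exact calcDefined_of_isCGood hT hω hα ⟨hβ.1.le, by linarith [hβ.2]⟩ hθ.2.le hφ hsl hg hJ

theorem exists_isRegularizer (hinj : T.Inj) (hinj_conj : T.conj.Inj) (hf : PolyGrowthL θ f) :
    ∃ N : ℕ, 1 ≤ N ∧ 3 * α ≤ N ∧ 2 - β ≤ N ∧ ∀ n ≥ N, ∀ φ ∈ Ioo ω θ, ∀ J ∈ imUnits,
      T.IsRegularizer D α β θ φ J f (stdRegularizer n) := by
  obtain ⟨hs, κ, hκ, C, hC, hb⟩ := hf
  have hθ0 : θ ∈ Ioo 0 Real.pi := ⟨hω.1.trans hθ.1, hθ.2⟩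
  have hθ' : θ ∈ Icc 0 Real.pi := ⟨hθ0.1.le, hθ0.2.le⟩
  have hβ1 : β ∈ Ioc (0 : ℝ) 1 := ⟨hβ.1, by linarith [hβ.2]⟩
  have hα0 : 0 ≤ α := by linarith
  have hN := Nat.le_ceil (3 * α + κ + 2)
  refine ⟨⌈3 * α + κ + 2⌉₊, ?_, by linarith, by linarith [hβ.1], fun n hn φ hφ J hJ => ?_⟩
  · rw [Nat.one_le_ceil_iff]; positivity
  have hn' : 3 * α + κ + 2 ≤ n := hN.trans (by exact_mod_cast hn)
  have hn1 : 1 ≤ n := by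
    have : (0 : ℝ) < n := by linarith
    exact_mod_cast this
  have hi := isIntrinsicFun_stdRegularizer n hθ.2
  have hd : ∀ b > 0, Decays (3 * α) b θ (stdRegularizer n) := fun b hb' =>
    decays_stdRegularizer hθ0 (by linarith) (by linarith)
  have hdf : ∀ b > 0, Decays (3 * α) b θ (stdRegularizer n * f) := fun b hb' =>
    decays_stdRegularizer_mul hθ0 hκ hC hb (by linarith) (by linarith)
  obtain ⟨hc, hsl, -⟩ := hs.exists_isSliceFun hθ'
  have hsf := (hi.mul hsl).shl hθ'
  have hdef : T.CalcDefined D φ J (stdRegularizer n) :=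
    calcDefined hT hω hα hβ hθ hφ hJ ⟨hi.isSliceFun.shl hθ', hd β hβ.1⟩
  have hdata := calcData_eq_pairData hT hω hα ⟨hβ1.1.le, hβ1.2⟩ hθ.2.le hφ hi hJ hdef
  have h3 : 0 < 3 * β := by linarith [hβ.1]
  refine ⟨⟨hi.intrinsic hθ', hd _ h3⟩, ⟨hsf, hdf _ h3⟩, hdef,
    calcDefined hT hω hα hβ hθ hφ hJ ⟨hsf, hdf β hβ.1⟩, ?_, ?_⟩
  · rw [show T.calcS D φ J (stdRegularizer n) = _ from congrArg CalcData.S hdata]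
    exact injective_pairCalc_stdReg hT hω hα0 hβ1 hθ.2 hφ hn1 (by linarith)
      (by linarith [hβ.1]) hinj
  · rw [show T.conj.calcS D φ J (stdRegularizer n) = _ from congrArg CalcData.C hdata]
    exact injective_pairCalc_stdReg (hT.conj hω) hω hα0 hβ1 hθ.2 hφ hn1 (by linarith)
      (by linarith [hβ.1]) hinj_conj

theorem exists_good_multiple {ε : ℍ[ℝ] → ℍ[ℝ]} {ε' : ℂ → ℂ} (hε : IsIntrinsicFun θ ε ε')
    (hε' : IsCGood α β θ ε') (hφ : φ ∈ Ioo ω θ) (hJ : J ∈ imUnits)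
    (hr : T.IsRegularizer D α β θ φ J f ε) (he : T.IsRegularizer D α β θ φ J f e) :
    ∃ k', IsIntrinsicFun θ (ε * e) k' ∧ IsCGood α β θ k' ∧
      Function.Injective (T.pairData D φ k').S ∧ Function.Injective (T.pairData D φ k').C ∧
      SHL (sector θ) (ε * (e * f)) ∧ Decays 1 1 θ (ε * e) ∧ Decays 1 1 θ (ε * (e * f)) ∧
      (∃ hc : Fin 4 → ℂ → ℂ, IsSliceFun θ unit (ε * (e * f)) hc ∧ ∀ j, IsCGood α β θ (hc j)) ∧
      (T.calcData D φ J (ε * e)).SameQuot (T.calcData D φ J (ε * (e * f)))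
        (T.calcData D φ J e) (T.calcData D φ J (e * f)) := by
  have hθ' : θ ∈ Icc 0 Real.pi := ⟨(hω.1.trans hθ.1).le, hθ.2.le⟩
  have hβ1 : β ∈ Icc (0 : ℝ) 1 := ⟨hβ.1.le, by linarith [hβ.2]⟩
  have hmono : ∀ {g}, Decays (3 * α) (3 * β) θ g → Decays 1 1 θ g := fun hg =>
    hg.mono (by linarith) (by linarith [hβ.2])
  obtain ⟨e', hi⟩ := he.psi.1.exists_isIntrinsicFun hθ'
  have hde := hmono he.psi.2
  have hdf := hmono he.psi_mul.2
  have hdε := hmono hr.psi.2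
  obtain ⟨hc, hsl, hdc⟩ := he.psi_mul.1.exists_isCDecaying hθ' hdf
  have hk := hε.mul_isIntrinsicFun hi
  have hk' := hε'.mul (hi.isCDecaying hde)
  have hslf := hε.mul hsl
  have hes := hi.isSliceFun.shl hθ'
  have hdata := calcData_eq_pairData hT hω hα hβ1 hθ.2.le hφ hε hJ hr.defined
  have hS : Function.Injective (T.pairData D φ ε').S := by rw [← hdata]; exact hr.inj
  have hC : Function.Injective (T.pairData D φ ε').C := by rw [← hdata]; exact hr.inj_conj
  have hmul := calcData_mul hT hω hα hβ1 hθ.2.le hφ hφ hε hε' hes hde hJ he.defined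
  rw [calcData_eq_pairData hT hω hα hβ1 hθ.2.le hφ hk hJ
    (calcDefined_of_isCGood hT hω hα hβ1 hθ.2.le hφ hk.isSliceFun (fun _ => hk') hJ)] at hmul
  refine ⟨_, hk, hk', ?_, ?_, hslf.shl hθ', hdε.mul_left hde, hdε.mul_left hdf,
    ⟨_, hslf, fun j => hε'.mul (hdc j)⟩, ?_⟩
  · rw [hmul]; exact hS.comp he.inj
  · rw [hmul]; exact hC.comp he.inj_conj
  · exact sameQuot_mul hT hω hα hβ1 hθ.2.le hφ hφ hε hε' hS hC hi hde he.psi_mul.1 hdf hJ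
      he.defined he.defined_mul

theorem sameQuot_of_isRegularizer (hinj : T.Inj) (hinj_conj : T.conj.Inj) (hf : PolyGrowthL θ f)
    {φ₁ φ₂ : ℝ} {J₁ J₂ : ℍ[ℝ]} (hφ₁ : φ₁ ∈ Ioo ω θ) (hJ₁ : J₁ ∈ imUnits) (hφ₂ : φ₂ ∈ Ioo ω θ)
    (hJ₂ : J₂ ∈ imUnits) {e₁ e₂ : ℍ[ℝ] → ℍ[ℝ]} (h₁ : T.IsRegularizer D α β θ φ₁ J₁ f e₁)
    (h₂ : T.IsRegularizer D α β θ φ₂ J₂ f e₂) :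
    (T.calcData D φ₁ J₁ e₁).SameQuot (T.calcData D φ₁ J₁ (e₁ * f))
      (T.calcData D φ₂ J₂ e₂) (T.calcData D φ₂ J₂ (e₂ * f)) := by
  have hβ1 : β ∈ Icc (0 : ℝ) 1 := ⟨hβ.1.le, by linarith [hβ.2]⟩
  obtain ⟨N, hN1, hN2, hN3, hN⟩ := exists_isRegularizer hT hω hα hβ hθ hinj hinj_conj hf
  have hε := isIntrinsicFun_stdRegularizer N hθ.2
  have hε' : IsCGood α β θ (stdReg N) := isCGood_stdReg ⟨hω.1.trans hθ.1, hθ.2⟩ hN2 hN3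
  obtain ⟨k₁, a1, b1, S1, C1, s1, d1, g1, ⟨c1, l1, m1⟩, q1⟩ :=
    exists_good_multiple hT hω hα hβ hθ hε hε' hφ₁ hJ₁ (hN N le_rfl φ₁ hφ₁ J₁ hJ₁) h₁
  obtain ⟨k₂, a2, b2, S2, C2, s2, d2, g2, ⟨c2, l2, m2⟩, q2⟩ :=
    exists_good_multiple hT hω hα hβ hθ hε hε' hφ₂ hJ₂ (hN N le_rfl φ₂ hφ₂ J₂ hJ₂) h₂
  rw [calcData_eq_calcData hT hω hα hβ1 hθ.2.le hφ₁ hφ₂ a1.isSliceFun (fun _ => b1) hJ₁ hJ₂,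
    calcData_eq_calcData hT hω hα hβ1 hθ.2.le hφ₁ hφ₂ l1 m1 hJ₁ hJ₂] at q1
  have r1 := sameQuot_mul hT hω hα hβ1 hθ.2.le hφ₂ hφ₂ a2 b2 S2 C2 a1 d1 s1 g1 hJ₂
    (calcDefined_of_isCGood hT hω hα hβ1 hθ.2.le hφ₂ a1.isSliceFun (fun _ => b1) hJ₂)
    (calcDefined_of_isCGood hT hω hα hβ1 hθ.2.le hφ₂ l1 m1 hJ₂)
  have r2 := sameQuot_mul hT hω hα hβ1 hθ.2.le hφ₂ hφ₁ a1 b1 S1 C1 a2 d2 s2 g2 hJ₂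
    (calcDefined_of_isCGood hT hω hα hβ1 hθ.2.le hφ₂ a2.isSliceFun (fun _ => b2) hJ₂)
    (calcDefined_of_isCGood hT hω hα hβ1 hθ.2.le hφ₂ l2 m2 hJ₂)
  have hφ₂' : φ₂ ∈ Ioo 0 Real.pi := ⟨hω.1.trans hφ₂.1, hφ₂.2.trans hθ.2⟩
  have hcomm := a2.comm a1
  have hcommf : EqOn (stdRegularizer N * e₂ * (stdRegularizer N * (e₁ * f)))
      (stdRegularizer N * e₁ * (stdRegularizer N * (e₂ * f))) (sector θ) := fun s hs => by
    have := congrArg (· * f s) (hcomm hs)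
    simpa only [Pi.mul_apply, mul_assoc] using this
  rw [calcData_congr hφ₂' hφ₂.2 hJ₂ hcomm, calcData_congr hφ₂' hφ₂.2 hJ₂ hcommf] at r1
  exact q1.symm.trans (r1.symm.trans (r2.trans q2))

end

end RightOp

end Uniqueness

end QuatCalculus

end

theorem mainTheorem1 {V : Type*} [NormedAddCommGroup V] [NormedSpace ℝ V] [CompleteSpace V]
    [Module ℍ[ℝ] V] [Module ℍ[ℝ]ᵐᵒᵖ V] [SMulCommClass ℍ[ℝ] ℍ[ℝ]ᵐᵒᵖ V]
    [IsScalarTower ℝ ℍ[ℝ] V] [IsScalarTower ℝ ℍ[ℝ]ᵐᵒᵖ V]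
    [NormSMulClass ℍ[ℝ] V] [NormSMulClass ℍ[ℝ]ᵐᵒᵖ V]
    (α β ω : ℝ) (hα : 1 / 3 ≤ α) (hβ : β ∈ Ioc (0 : ℝ) (1 / 3)) (hω : ω ∈ Ioo 0 Real.pi)
    (T : QuatCalculus.RightOp V) (D : Submodule ℍ[ℝ]ᵐᵒᵖ V) (hT : T.IsOfType D α β ω)
    (hinj : T.Inj) (hinj_conj : T.conj.Inj)
    (θ : ℝ) (hθ : θ ∈ Ioo ω Real.pi)
    (f : ℍ[ℝ] → ℍ[ℝ]) (hf : QuatCalculus.PolyGrowthL θ f) :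
    (∃ N : ℕ, ∀ n ≥ N, ∀ φ ∈ Ioo ω θ, ∀ J ∈ QuatCalculus.imUnits,
      T.IsRegularizer D α β θ φ J f (fun s => s ^ n * ((1 + s) ^ (2 * n))⁻¹)) ∧
    (∀ g : ℍ[ℝ] → ℍ[ℝ], QuatCalculus.PsiL (3 * α) β θ g →
      ∀ φ ∈ Ioo ω θ, ∀ J ∈ QuatCalculus.imUnits, T.CalcDefined D φ J g) ∧
    (∀ φ₁ ∈ Ioo ω θ, ∀ J₁ ∈ QuatCalculus.imUnits, ∀ φ₂ ∈ Ioo ω θ, ∀ J₂ ∈ QuatCalculus.imUnits,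
      ∀ e₁ e₂ : ℍ[ℝ] → ℍ[ℝ], T.IsRegularizer D α β θ φ₁ J₁ f e₁ →
        T.IsRegularizer D α β θ φ₂ J₂ f e₂ →
        T.hinfS D φ₁ J₁ f e₁ = T.hinfS D φ₂ J₂ f e₂ ∧
        T.hinfQ D φ₁ J₁ f e₁ = T.hinfQ D φ₂ J₂ f e₂ ∧
        T.hinfP D φ₁ J₁ f e₁ = T.hinfP D φ₂ J₂ f e₂ ∧
        T.hinfF D φ₁ J₁ f e₁ = T.hinfF D φ₂ J₂ f e₂) := by
  refine ⟨?_, fun g hg φ hφ J hJ =>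
    QuatCalculus.RightOp.calcDefined hT hω hα hβ hθ hφ hJ hg, ?_⟩
  · obtain ⟨N, -, -, -, hN⟩ :=
      QuatCalculus.RightOp.exists_isRegularizer hT hω hα hβ hθ hinj hinj_conj hf
    exact ⟨N, hN⟩
  · intro φ₁ hφ₁ J₁ hJ₁ φ₂ hφ₂ J₂ hJ₂ e₁ e₂ h₁ h₂
    exact QuatCalculus.RightOp.sameQuot_of_isRegularizer hT hω hα hβ hθ hinj hinj_conj hf hφ₁ hJ₁
      hφ₂ hJ₂ h₁ h₂
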